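/- Every non-empty (tame) link $L$ in real projective space $\mathbb{R}\mathrm{P}^3$ has a diagram $D$ whose all-A ribbon graph $\mathbb{A}_D$ has exactly one vertex. Here a diagram of a link in $\mathbb{R}\mathrm{P}^3$ is a disc $D^2$ with a collection of generically immersed arcs and closed curves, whose only multiple points are finitely many transversal double points in the interior of the disc, each with an over/under-crossing structure, and such that the end points of the arcs lie on $\partial D^2$ and form antipodal pairs. It is a diagram of $L$ if $L$ is ambient isotopic to a link that projects to it with this crossing structure, where $\mathbb{R}\mathrm{P}^3$ is regarded as a ball with antipodal boundary points identified and is projected to the equatorial disc. The ribbon graph $\mathbb{A}_D$ is obtained by replacing each crossing by its A-splicing: its vertices are discs bounded by the closed curves of the resulting all-A state (formed after antipodal points of $\partial D^2$ are identified), and it has one edge for each crossing, a disc attached to the two arcs of the splicing at that crossing. -/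

import Mathlib

open scoped LinearAlgebra.Projectivization

noncomputable section

namespace ProjLink

/-! ### Real projective 3-space, ambient isotopy -/

/-- Real projective 3-space: lines through the origin of `ℝ⁴`.  Homogeneous coordinates are
written `[x : y : w : z]`, in this order. -/
abbrev RP3 : Type := ℙ ℝ (Fin 4 → ℝ)

/-- The usual topology of `RP3`, as a quotient of `ℝ⁴ \ {0}`. -/
instance : TopologicalSpace RP3 :=
  TopologicalSpace.coinduced
    (fun v : {v : Fin 4 → ℝ // v ≠ 0} => Projectivization.mk ℝ v.1 v.2) inferInstance

/-- Two subsets of a space are ambient isotopic if an isotopy of the space (a jointly continuous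
family of homeomorphisms starting at the identity) ends at a homeomorphism that carries the first
onto the second. -/
def AmbientIsotopic {X : Type*} [TopologicalSpace X] (A B : Set X) : Prop :=
  ∃ Φ : unitInterval → X ≃ₜ X,
    Continuous (fun p : unitInterval × X => Φ p.1 p.2) ∧ Φ 0 = Homeomorph.refl X ∧ Φ 1 '' A = B

/-! ### Closed polygons in projective space -/

/-- A finite family of closed polygons (possibly crossing themselves or each other) in the
projective space of `ℝᵈ`.  The `i`-th polygon has `len i` edges; its `k`-th edge, `k < len i`, is
the image of the segment of `ℝᵈ` from `vert i k` to `vert i (k + 1)`, and the last vector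
`vert i (len i)` is plus or minus the first one, so that the polygon closes up in projective space.
Values `vert i k` with `len i < k` play no role. -/
structure PolygonSystem (d : ℕ) where
  num : ℕ
  len : Fin num → ℕ
  len_pos : ∀ i, 0 < len i
  vert : Fin num → ℕ → Fin d → ℝ
  closing : Fin num → ℤˣ
  closed : ∀ i, vert i (len i) = ((closing i : ℤ) : ℝ) • vert i 0
  nondegenerate : ∀ i, ∀ k < len i, LinearIndependent ℝ ![vert i k, vert i (k + 1)]

namespace PolygonSystem

variable {d : ℕ} (F : PolygonSystem d)

/-- The parametrization of the `i`-th polygon in homogeneous coordinates: on `[k, k + 1]` it runs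
affinely from `vert i k` to `vert i (k + 1)`. It is meant on `[0, len i]`. -/
def curve (i : Fin F.num) (x : ℝ) : Fin d → ℝ :=
  (1 - Int.fract x) • F.vert i ⌊x⌋₊ + Int.fract x • F.vert i (⌊x⌋₊ + 1)

/-- The direction vector of the edge that contains the parameter `x`. -/
def edgeVector (i : Fin F.num) (x : ℝ) : Fin d → ℝ :=
  F.vert i (⌊x⌋₊ + 1) - F.vert i ⌊x⌋₊

/-- The points of the abstract circles that are mapped by the polygons: each circle
`[0, len i] / (0 ~ len i)` is represented by the half-open interval `[0, len i)`. -/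
abbrev Point : Type := Σ i : Fin F.num, Set.Ico (0 : ℝ) (F.len i)

/-- Homogeneous coordinates of a point. -/
def coord (p : F.Point) : Fin d → ℝ := F.curve p.1 p.2

theorem coord_ne_zero (p : F.Point) : F.coord p ≠ 0 := by
  obtain ⟨i, x, hx0, hx1⟩ := p
  have hk : ⌊x⌋₊ < F.len i := (Nat.floor_lt hx0).2 hx1
  have h := LinearIndependent.pair_iff.1 (F.nondegenerate i _ hk)
  intro h0
  have h2 := h (1 - Int.fract x) (Int.fract x) h0
  have h3 := h2.1
  rw [h2.2] at h3
  norm_num at h3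

/-- The map from the abstract circles to projective space. -/
def toProj (p : F.Point) : ℙ ℝ (Fin d → ℝ) := Projectivization.mk ℝ (F.coord p) (F.coord_ne_zero p)

/-- The point `p` is mapped to a multiple point. -/
def IsMultiple (p : F.Point) : Prop := ∃ q, q ≠ p ∧ F.toProj q = F.toProj p

end PolygonSystem

/-- A subset of `RP3` is a polygonal link if it is a disjoint union of finitely many simple closed
polygons. -/
def IsPolygonalLink (L : Set RP3) : Prop :=
  ∃ F : PolygonSystem 4, Function.Injective F.toProj ∧ Set.range F.toProj = L

/-- A (tame) link in `RP3`: a subset that is ambient isotopic to a polygonal link. -/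
def IsLink (L : Set RP3) : Prop :=
  ∃ P : Set RP3, IsPolygonalLink P ∧ AmbientIsotopic P L

/-! ### Affine chart of the projective plane

The projective plane has homogeneous coordinates `[x : y : w]` and the line at infinity is `w = 0`.
Cutting the projective plane open along this line gives a closed disc with antipodal boundary points
identified; its interior is the affine plane with coordinates `(x / w, y / w)`. -/

namespace PolygonSystem

variable (F : PolygonSystem 3)

/-- The velocity in the affine plane of the moving point `(x / w, y / w)` (quotient rule). -/
def velocity (p : F.Point) : ℝ × ℝ :=
  let a := F.coord p
  let e := F.edgeVector p.1 p.2
  ((e 0 * a 2 - a 0 * e 2) / a 2 ^ 2, (e 1 * a 2 - a 1 * e 2) / a 2 ^ 2)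

end PolygonSystem

/-- The determinant of two plane vectors: positive if the second one is on the left of the first. -/
def det₂ (u v : ℝ × ℝ) : ℝ := u.1 * v.2 - u.2 * v.1

/-! ### Link diagrams -/

/-- A (polygonal) diagram of a link in `RP3`, recorded by its net: a family of closed polygons in
the projective plane with its line at infinity, which cross the line at infinity only in interior
points of edges, whose multiple points are finitely many transversal double points lying neither
at vertices nor on the line at infinity, together with the choice, at each double point, of the
strand that is the over-strand.  The arcs of the diagram in the disc are obtained by cutting the
projective plane open along the line at infinity. -/
structure Diagram where
  net : PolygonSystem 3
  vert_off_infinity : ∀ i, ∀ k ≤ net.len i, net.vert i k 2 ≠ 0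
  finite_multiple : {p | net.IsMultiple p}.Finite
  interior : ∀ p, net.IsMultiple p → Int.fract (p.2 : ℝ) ≠ 0 ∧ net.coord p 2 ≠ 0
  transversal : ∀ p q, p ≠ q → net.toProj p = net.toProj q →
    det₂ (net.velocity p) (net.velocity q) ≠ 0
  double : ∀ p q r, q ≠ p → r ≠ p → net.toProj q = net.toProj p → net.toProj r = net.toProj p →
    q = r
  /-- Only the values at preimages of double points matter. -/
  isOver : net.Point → Prop
  isOver_iff : ∀ p q, p ≠ q → net.toProj p = net.toProj q → (isOver p ↔ ¬ isOver q)

/-! ### Ribbon graphs -/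

/-- A ribbon graph, possibly non-orientable, in combinatorial form.  The flags are the end points
of the line segments in which vertex discs meet edge discs, i.e. the tips and tails of the marking
arrows of an arrow presentation.  They lie on the boundary circles of the vertex discs:
* `segment` exchanges the two ends of a line segment (of a marking arrow);
* `arc` exchanges the two ends of a component of what the line segments leave of the boundary
  circles of the vertex discs;
* `side` exchanges the two ends of each of the other two sides of an edge disc.
So an edge disc is a set of four flags `{f, segment f, side f, segment (side f)}`. `Isolated` is the
set of vertex discs that meet no edge. -/
structure RibbonGraph where
  Flag : Type
  Isolated : Type
  finite_flag : Finite Flag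
  finite_isolated : Finite Isolated
  arc : Flag → Flag
  segment : Flag → Flag
  side : Flag → Flag
  arc_arc : ∀ f, arc (arc f) = f
  segment_segment : ∀ f, segment (segment f) = f
  side_side : ∀ f, side (side f) = f
  arc_ne : ∀ f, arc f ≠ f
  segment_ne : ∀ f, segment f ≠ f
  side_ne : ∀ f, side f ≠ f
  segment_ne_side : ∀ f, segment f ≠ side f
  segment_side : ∀ f, segment (side f) = side (segment f)

/-- The vertices of a ribbon graph: the closed curves formed by the line segments and the
complementary arcs (the boundary circles of the vertex discs that meet an edge), and the isolated
vertices. -/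
def RibbonGraph.Vertex (G : RibbonGraph) : Type :=
  Quot (fun f g : G.Flag => g = G.arc f ∨ g = G.segment f) ⊕ G.Isolated

/-! ### The all-A ribbon graph of a diagram -/

namespace Diagram

variable (D : Diagram)

/-- The parameters on the `i`-th component at which it passes through a crossing. -/
abbrev PassageOn (i : Fin D.net.num) : Type :=
  {x : Set.Ico (0 : ℝ) (D.net.len i) // D.net.IsMultiple ⟨i, x⟩}

/-- The passages of strands through crossings; there are two of them at each crossing. -/
abbrev Passage : Type := Σ i : Fin D.net.num, D.PassageOn i

/-- The point of the abstract circles at which a passage happens. -/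
def pt (p : D.Passage) : D.net.Point := ⟨p.1, p.2.1⟩

theorem pt_injective : Function.Injective D.pt := by
  rintro ⟨i, x, hx⟩ ⟨j, y, hy⟩ h
  simp only [pt, Sigma.mk.injEq] at h
  obtain ⟨rfl, h⟩ := h
  obtain rfl := eq_of_heq h
  rfl

instance finite_passage : Finite D.Passage := by
  have : Finite {p | D.net.IsMultiple p} := D.finite_multiple
  exact Finite.of_injective
    (fun p : D.Passage => (⟨D.pt p, p.2.2⟩ : {p | D.net.IsMultiple p}))
    (fun p q h => D.pt_injective (congrArg Subtype.val h))

instance finite_passageOn (i : Fin D.net.num) : Finite (D.PassageOn i) :=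
  Finite.of_injective (fun x => (⟨i, x⟩ : D.Passage)) (fun x y h => by simpa using h)

instance fintype_passageOn (i : Fin D.net.num) : Fintype (D.PassageOn i) := Fintype.ofFinite _

/-- The next passage along the `i`-th component: the passages are listed by increasing parameter,
and the last one is followed by the first one. -/
def nextOn (i : Fin D.net.num) : Equiv.Perm (D.PassageOn i) :=
  ((monoEquivOfFin (D.PassageOn i) rfl).symm.toEquiv.trans (finRotate _)).trans
    (monoEquivOfFin (D.PassageOn i) rfl).toEquiv

/-- The next passage along the same component. -/
def next : Equiv.Perm D.Passage := Equiv.sigmaCongrRight D.nextOn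

theorem exists_partner (p : D.Passage) :
    ∃ q : D.Passage, q ≠ p ∧ D.net.toProj (D.pt q) = D.net.toProj (D.pt p) := by
  obtain ⟨⟨j, y⟩, hne, h⟩ := p.2.2
  refine ⟨⟨j, y, D.pt p, hne.symm, h.symm⟩, ?_, h⟩
  intro he
  exact hne (congrArg D.pt he)

/-- The other passage through the same crossing. -/
def partner (p : D.Passage) : D.Passage := (D.exists_partner p).choose

theorem partner_ne (p : D.Passage) : D.partner p ≠ p := (D.exists_partner p).choose_spec.1

theorem toProj_partner (p : D.Passage) :
    D.net.toProj (D.pt (D.partner p)) = D.net.toProj (D.pt p) := (D.exists_partner p).choose_spec.2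

theorem partner_partner (p : D.Passage) : D.partner (D.partner p) = p := by
  apply D.pt_injective
  apply D.double (D.pt (D.partner p))
  · exact fun h => D.partner_ne _ (D.pt_injective h)
  · exact fun h => D.partner_ne _ (D.pt_injective h.symm)
  · exact D.toProj_partner _
  · exact (D.toProj_partner p).symm

/-- A crossing, given by one of its passages, is positive if the under-strand crosses the
over-strand from right to left, the strands being directed by increasing parameter. -/
def Positive (p : D.Passage) : Prop :=
  (D.isOver (D.pt p) ∧ 0 < det₂ (D.net.velocity (D.pt p)) (D.net.velocity (D.pt (D.partner p)))) ∨
  (D.isOver (D.pt (D.partner p)) ∧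
    0 < det₂ (D.net.velocity (D.pt (D.partner p))) (D.net.velocity (D.pt p)))

theorem positive_partner (p : D.Passage) : D.Positive (D.partner p) ↔ D.Positive p := by
  simp only [Positive, partner_partner]
  exact or_comm

/-- The half-edges of the diagram at its crossings: `(p, true)` is the half-edge along which the
strand leaves the crossing at the passage `p`, and `(p, false)` the one along which it arrives. -/
abbrev HalfEdge : Type := D.Passage × Bool

/-- The other half of the same edge of the diagram (edges are followed in the net, through the
line at infinity). -/
def otherHalf : D.HalfEdge → D.HalfEdge
  | (p, true) => (D.next p, false)
  | (p, false) => (D.next.symm p, true)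

open Classical in
/-- The A-splicing at a crossing.  It joins the two regions that are swept when the over-strand is
turned counterclockwise until it meets the under-strand.  So at a positive crossing it connects each
arriving half-edge to the leaving half-edge of the other strand, and at a negative crossing it
connects the two arriving half-edges and the two leaving half-edges. -/
def spliceA (f : D.HalfEdge) : D.HalfEdge :=
  (D.partner f.1, if D.Positive f.1 then !f.2 else f.2)

open Classical in
/-- The B-splicing at a crossing: the other way of connecting the half-edges of different
strands. -/
def spliceB (f : D.HalfEdge) : D.HalfEdge :=
  (D.partner f.1, if D.Positive f.1 then f.2 else !f.2)

/-- The all-A ribbon graph of a diagram.  Its vertices are bounded by the closed curves of the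
all-A state, and it has one edge for each crossing, a disc that is attached to the two arcs of the
A-splicing at this crossing; the two other sides of the disc are then the arcs of the B-splicing.
A component without crossings is a closed curve of the state without marking arrows. -/
def allA : RibbonGraph where
  Flag := D.HalfEdge
  Isolated := {i : Fin D.net.num // IsEmpty (D.PassageOn i)}
  finite_flag := inferInstance
  finite_isolated := inferInstance
  arc := D.otherHalf
  segment := D.spliceA
  side := D.spliceB
  arc_arc := by rintro ⟨p, _ | _⟩ <;> simp [otherHalf]
  segment_segment := by
    rintro ⟨p, b⟩
    by_cases h : D.Positive p <;> simp [spliceA, partner_partner, positive_partner, h]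
  side_side := by
    rintro ⟨p, b⟩
    by_cases h : D.Positive p <;> simp [spliceB, partner_partner, positive_partner, h]
  arc_ne := by rintro ⟨p, _ | _⟩ <;> simp [otherHalf]
  segment_ne := fun f h => D.partner_ne f.1 (congrArg Prod.fst h)
  side_ne := fun f h => D.partner_ne f.1 (congrArg Prod.fst h)
  segment_ne_side := by
    rintro ⟨p, b⟩
    by_cases h : D.Positive p <;> simp [spliceA, spliceB, h]
  segment_side := by
    rintro ⟨p, b⟩
    by_cases h : D.Positive p <;> simp [spliceA, spliceB, positive_partner, h]

/-! ### The links that a diagram represents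

`RP3` is the ball with antipodal boundary points identified: the interior of the ball is the
affine part `w ≠ 0` with coordinates `(x / w, y / w, z / w)`, the equatorial disc is `z = 0`, both
poles give the point `[0 : 0 : 0 : 1]`, and the projection along the circles through the poles is
`[x : y : w : z] ↦ [x : y : w]`; the height is `z / w`. -/

/-- The points over the net, for given heights along the polygons. -/
def liftCoord (z : Fin D.net.num → ℝ → ℝ) (p : D.net.Point) : Fin 4 → ℝ :=
  ![D.net.coord p 0, D.net.coord p 1, D.net.coord p 2, z p.1 p.2]

theorem liftCoord_ne_zero (z : Fin D.net.num → ℝ → ℝ) (p : D.net.Point) :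
    D.liftCoord z p ≠ 0 := by
  intro h
  apply D.net.coord_ne_zero p
  funext k
  fin_cases k
  · exact congrFun h 0
  · exact congrFun h 1
  · exact congrFun h 2

/-- The map from the abstract circles to `RP3` for given heights. -/
def lift (z : Fin D.net.num → ℝ → ℝ) (p : D.net.Point) : RP3 :=
  Projectivization.mk ℝ (D.liftCoord z p) (D.liftCoord_ne_zero z p)

/-- Admissible heights: the function `z i` is the last homogeneous coordinate along the `i`-th
polygon; it is continuous, it closes up with the same sign as the other coordinates, and at each
crossing the over-strand is higher than the under-strand. -/
structure IsHeight (z : Fin D.net.num → ℝ → ℝ) : Prop where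
  continuousOn : ∀ i, ContinuousOn (z i) (Set.Icc 0 (D.net.len i))
  closed : ∀ i, z i (D.net.len i) = ((D.net.closing i : ℤ) : ℝ) * z i 0
  above : ∀ p q, p ≠ q → D.net.toProj p = D.net.toProj q → D.isOver p →
    z q.1 q.2 / D.net.coord q 2 < z p.1 p.2 / D.net.coord p 2

/-- `D` is a diagram of the link `L`: some curves that project to `D`, with its crossing
information, form a link that is ambient isotopic to `L`. -/
def IsDiagramOf (L : Set RP3) : Prop :=
  ∃ z : Fin D.net.num → ℝ → ℝ, D.IsHeight z ∧ AmbientIsotopic (Set.range (D.lift z)) L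

end Diagram

end ProjLink

end

/-! The state is made connected by Reidemeister II moves. Suppose two strands of a diagram lie on
different circles of the all-A state and are joined by a segment that meets the net nowhere else.
Push a finger of one strand along the segment and over the other strand. This creates two crossings
of opposite signs, and A-splicing both of them amounts to a surgery on one arc of each circle. Since
the arcs belong to different circles, the surgery fuses these circles, however the strands are
directed, and leaves the others alone. So the number of circles drops while the link stays the same
up to ambient isotopy, and induction ends at a single circle. Vertices are an image of circles
(`isColouring_vertexOf`), so one circle gives one vertex.

Combinatorics. Circles are not traced as cyclic words; they are classes of sides of points that no
colouring compatible with the state can separate (`stateSetoid`). A map out of the set of circles is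
then the same thing as a colouring, and `exists_merge` turns the tautological colouring of the new
diagram into one of the old diagram. The one topological input is that a circle cut at a point stays
connected (`eq_of_cut`), which is a parity count.

Geometry. In homogeneous coordinates the finger move displaces one vertex. Its isotopy is a vertical
shear that lifts a neighbourhood of the finger's base above the other strand, then a horizontal
shear supported above that strand (`exists_isHeight_diagram`); both come from
`ambientIsotopic_shear`. The segment is found on a generic line through two points of different
circles: on it, two consecutive points of the net have different circles
(`exists_fingerSite_of_line`). Such a line exists unless the whole net lies on one line; but then
the net has no crossings and a single component, hence a single circle.

A first diagram of a polygonal link comes from projection along a generic direction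
(`exists_isGeneric`), followed by a generic choice of the line at infinity. -/

noncomputable section

namespace ProjLink

/-! ### Topology of projective space -/

namespace RP3

/-- The quotient map from nonzero vectors to projective space. -/
def proj (v : {v : Fin 4 → ℝ // v ≠ 0}) : RP3 := Projectivization.mk ℝ v.1 v.2

theorem isQuotientMap_proj : Topology.IsQuotientMap proj :=
  ⟨by constructor; rfl, fun p => p.ind fun v hv => ⟨⟨v, hv⟩, rfl⟩⟩

theorem continuous_proj : Continuous proj := isQuotientMap_proj.continuous

/-- The unit sphere is compact and maps onto projective space. Compactness, with the Hausdorff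
property below, lets continuous bijections be inverted for free. -/
instance : CompactSpace RP3 := by
  have hS : IsCompact (Metric.sphere (0 : Fin 4 → ℝ) 1) := isCompact_sphere _ _
  have : CompactSpace (Metric.sphere (0 : Fin 4 → ℝ) 1) := isCompact_iff_compactSpace.1 hS
  have h0 : ∀ v : Metric.sphere (0 : Fin 4 → ℝ) 1, v.1 ≠ 0 := fun v =>
    ne_zero_of_mem_unit_sphere v
  let f : Metric.sphere (0 : Fin 4 → ℝ) 1 → RP3 := fun v => proj ⟨v.1, h0 v⟩
  have hf : Continuous f := continuous_proj.comp (by fun_prop)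
  have hs : Function.Surjective f := by
    intro p
    induction p using Projectivization.ind with
    | h v hv =>
      have hn : ‖v‖ ≠ 0 := norm_ne_zero_iff.2 hv
      refine ⟨⟨‖v‖⁻¹ • v, by simp [norm_smul, hn]⟩, ?_⟩
      exact (Projectivization.mk_eq_mk_iff' ℝ _ _ _ _).2 ⟨‖v‖⁻¹, rfl⟩
  refine ⟨?_⟩
  rw [← hs.range_eq]
  exact isCompact_range hf

/-- The orthogonal projection onto a line, as a matrix. -/
def projector : RP3 → Fin 4 → Fin 4 → ℝ :=
  Projectivization.lift (fun v i j => v.1 i * v.1 j / ∑ k, v.1 k ^ 2) (by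
    rintro ⟨a, ha⟩ ⟨b, hb⟩ t h
    have h' : a = t • b := h
    have ht : t ≠ 0 := by
      rintro rfl
      exact ha (by simpa using h')
    funext i j
    simp only [h', Pi.smul_apply, smul_eq_mul]
    have : ∑ k, (t * b k) ^ 2 = t ^ 2 * ∑ k, b k ^ 2 := by
      rw [Finset.mul_sum]
      exact Finset.sum_congr rfl fun k _ => by ring
    rw [this, show t * b i * (t * b j) = t ^ 2 * (b i * b j) by ring]
    exact mul_div_mul_left _ _ (pow_ne_zero 2 ht))

theorem sum_sq_pos {v : Fin 4 → ℝ} (hv : v ≠ 0) : 0 < ∑ k, v k ^ 2 := by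
  obtain ⟨i, hi⟩ := Function.ne_iff.1 hv
  exact Finset.sum_pos' (fun k _ => sq_nonneg _) ⟨i, Finset.mem_univ _, by
    have : v i ≠ 0 := hi
    positivity⟩

theorem continuous_projector : Continuous projector := by
  rw [isQuotientMap_proj.continuous_iff]
  refine continuous_pi fun i => continuous_pi fun j => ?_
  change Continuous fun v : {v : Fin 4 → ℝ // v ≠ 0} => v.1 i * v.1 j / ∑ k, v.1 k ^ 2
  have h : ∀ k, Continuous fun v : {v : Fin 4 → ℝ // v ≠ 0} => v.1 k := fun k =>
    (continuous_apply k).comp continuous_subtype_val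
  exact ((h i).mul (h j)).div (continuous_finsetSum _ fun k _ => (h k).pow 2)
    fun v => (sum_sq_pos v.2).ne'

/-- A nonzero row of the matrix of the projection is a multiple of `v`, so the matrix determines the
line. This embeds `RP3` continuously in a Hausdorff space. -/
theorem projector_injective : Function.Injective projector := by
  intro p q h
  induction p using Projectivization.ind with
  | h v hv =>
  induction q using Projectivization.ind with
  | h w hw =>
    obtain ⟨i, hi⟩ := Function.ne_iff.1 hv
    have hi' : v i ≠ 0 := hi
    have h1 := (sum_sq_pos hv).ne'
    have h2 := (sum_sq_pos hw).ne'
    have h3 : ∀ j, v i * v j / ∑ k, v k ^ 2 = w i * w j / ∑ k, w k ^ 2 := fun j =>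
      congrFun (congrFun h i) j
    refine (Projectivization.mk_eq_mk_iff' ℝ _ _ _ _).2
      ⟨w i * (∑ k, v k ^ 2) / (v i * ∑ k, w k ^ 2), ?_⟩
    funext j
    have h4 := h3 j
    rw [div_eq_div_iff h1 h2] at h4
    simp only [Pi.smul_apply, smul_eq_mul]
    rw [div_mul_eq_mul_div, div_eq_iff (mul_ne_zero hi' h2)]
    linarith

instance : T2Space RP3 := T2Space.of_injective_continuous projector_injective continuous_projector

end RP3

/-! ### Ambient isotopies -/

theorem AmbientIsotopic.trans {X : Type*} [TopologicalSpace X] {A B C : Set X}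
    (h₁ : AmbientIsotopic A B) (h₂ : AmbientIsotopic B C) : AmbientIsotopic A C := by
  obtain ⟨Φ, hΦ, hΦ0, rfl⟩ := h₁
  obtain ⟨Ψ, hΨ, hΨ0, rfl⟩ := h₂
  refine ⟨fun t => (Φ t).trans (Ψ t), ?_, ?_, ?_⟩
  · exact hΨ.comp (continuous_fst.prodMk hΦ)
  · simp [hΦ0, hΨ0]
    rfl
  · exact Set.image_comp (Ψ 1) (Φ 1) A

/-- Joint continuity of the inverse homeomorphisms is the point: `(t, x) ↦ (t, Φ t x)` is a
continuous bijection of a compact Hausdorff space, hence a homeomorphism. -/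
theorem AmbientIsotopic.symm {X : Type*} [TopologicalSpace X] [CompactSpace X] [T2Space X]
    {A B : Set X} (h : AmbientIsotopic A B) : AmbientIsotopic B A := by
  obtain ⟨Φ, hΦ, hΦ0, rfl⟩ := h
  let e : unitInterval × X ≃ unitInterval × X :=
    { toFun := fun p => (p.1, Φ p.1 p.2)
      invFun := fun p => (p.1, (Φ p.1).symm p.2)
      left_inv := fun p => by simp
      right_inv := fun p => by simp }
  have he : Continuous e := continuous_fst.prodMk hΦ
  let E := he.homeoOfEquivCompactToT2
  refine ⟨fun t => (Φ t).symm, ?_, ?_, ?_⟩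
  · exact continuous_snd.comp E.symm.continuous
  · simp only [hΦ0]
    rfl
  · exact (Φ 1).symm_image_image A

theorem AmbientIsotopic.nonempty {X : Type*} [TopologicalSpace X] {A B : Set X}
    (h : AmbientIsotopic A B) (hB : B.Nonempty) : A.Nonempty := by
  obtain ⟨Φ, -, -, rfl⟩ := h
  exact Set.image_nonempty.1 hB

/-- The ambient isotopy `V ↦ V + t g(V) u` of projective space. -/
theorem ambientIsotopic_shear {ι : Type*} (u : Fin 4 → ℝ) (g : (Fin 4 → ℝ) → ℝ)
    (hg : Continuous g) (hom : ∀ (c : ℝ) V, g (c • V) = c * g V) (hu : g u = 0)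
    (hmono : ∀ V, StrictMono fun s : ℝ => s + g (V + s • u))
    (P Q : ι → Fin 4 → ℝ) (hP : ∀ i, P i ≠ 0) (hQ : ∀ i, Q i ≠ 0)
    (hPQ : ∀ i, Q i = P i + g (P i) • u) :
    AmbientIsotopic (Set.range fun i => (Projectivization.mk ℝ (P i) (hP i) : RP3))
      (Set.range fun i => (Projectivization.mk ℝ (Q i) (hQ i) : RP3)) := by
  have hg0 : g 0 = 0 := by simpa using hom 0 0
  have hgu : ∀ c : ℝ, g (c • u) = 0 := fun c => by rw [hom, hu, mul_zero]
  -- The function is a convex combination of `s` and `s + g (V + s • u)`, so monotonicity at the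
  -- final time gives it at all times.
  have hmono' : ∀ t : unitInterval, ∀ V, StrictMono fun s : ℝ => s + t * g (V + s • u) := by
    intro t V s s' hs
    have h1 := hmono V hs
    simp only at h1 ⊢
    rcases t.2.2.lt_or_eq with ht | ht
    · nlinarith [mul_nonneg t.2.1 (sub_nonneg.2 h1.le), mul_pos (sub_pos.2 ht) (sub_pos.2 hs)]
    · rw [ht]; linarith
  let T : unitInterval → (Fin 4 → ℝ) → (Fin 4 → ℝ) := fun t V => V + ((t : ℝ) * g V) • u
  have hT : ∀ (t : unitInterval) (c : ℝ) V, T t (c • V) = c • T t V := by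
    intro t c V
    simp only [T, hom, smul_add, smul_smul]
    congr 2
    ring
  have hT0 : ∀ t V, V ≠ 0 → T t V ≠ 0 := by
    intro t V hV h
    have h1 : V = (-((t : ℝ) * g V)) • u := by
      rw [neg_smul]; exact eq_neg_of_add_eq_zero_left h
    have h2 : g V = 0 := by rw [h1]; exact hgu _
    rw [h2] at h1
    simp at h1
    exact hV h1
  have hTinj : ∀ t, Function.Injective (T t) := by
    intro t V W h
    have h1 : W = V + ((t : ℝ) * g V - t * g W) • u := by
      rw [sub_smul, ← add_sub_assoc]
      change W = T t V - _
      rw [h]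
      simp [T]
    set s := (t : ℝ) * g V - t * g W with hs
    have h2 : s = 0 := by
      apply (hmono' t V).injective
      simp only [zero_add, zero_smul, add_zero]
      rw [← h1]
      linarith
    rw [h2] at h1
    simpa using h1.symm
  -- A preimage `W + r • u` needs `r + t * g (W + r • u) = 0`. By homogeneity and `g u = 0`, the
  -- term `g (W + s • u)` is `o(s)`, so the intermediate value theorem applies.
  have hTsurj : ∀ t, Function.Surjective (T t) := by
    intro t W
    have hlim : ∀ e : Fin 4 → ℝ, Filter.Tendsto (fun s : ℝ => g (s⁻¹ • e + u)) Filter.atTop (nhds 0) := by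
      intro e
      have : Filter.Tendsto (fun s : ℝ => g (s⁻¹ • e + u)) Filter.atTop (nhds (g ((0:ℝ) • e + u))) :=
        (hg.tendsto _).comp ((tendsto_inv_atTop_zero.smul_const e).add_const u)
      simpa [hu] using this
    have hbd : ∀ e : Fin 4 → ℝ, ∀ᶠ s : ℝ in Filter.atTop, |g (e + s • u)| ≤ s := by
      intro e
      filter_upwards [(hlim e).eventually (Metric.ball_mem_nhds 0 one_pos),
        Filter.eventually_gt_atTop 0] with s h1 h2
      have : e + s • u = s • (s⁻¹ • e + u) := by
        rw [smul_add, smul_smul, mul_inv_cancel₀ h2.ne', one_smul]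
      rw [this, hom, abs_mul, abs_of_pos h2]
      simp only [dist_zero_right, Real.norm_eq_abs] at h1
      nlinarith
    obtain ⟨s, ⟨h1, h2⟩, h3⟩ := (((hbd W).and (hbd (-W))).and (Filter.eventually_gt_atTop 0)).exists
    have h2' : |g (W + (-s) • u)| ≤ s := by
      have : W + (-s) • u = (-1 : ℝ) • (-W + s • u) := by
        simp [smul_add]
      rw [this, hom, abs_mul]
      simpa using h2
    have ht0 : (0 : ℝ) ≤ t := t.2.1
    have ht1 : (t : ℝ) ≤ 1 := t.2.2
    have hc : Continuous fun s : ℝ => s + t * g (W + s • u) := by fun_prop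
    have hex := intermediate_value_Icc (show -s ≤ s by linarith) hc.continuousOn
    have hmem : (0 : ℝ) ∈ Set.Icc (-s + t * g (W + (-s) • u)) (s + t * g (W + s • u)) := by
      rw [abs_le] at h1 h2'
      constructor <;> nlinarith
    obtain ⟨r, -, hr⟩ := hex hmem
    refine ⟨W + r • u, ?_⟩
    simp only [T]
    simp only at hr
    rw [add_assoc, ← add_smul, hr]
    simp
  let φ : unitInterval → RP3 → RP3 := fun t =>
    Projectivization.lift (fun v => Projectivization.mk ℝ (T t v.1) (hT0 t _ v.2)) (by
      rintro ⟨a, ha⟩ ⟨b, hb⟩ c h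
      have h' : a = c • b := h
      refine (Projectivization.mk_eq_mk_iff' ℝ _ _ _ _).2 ⟨c, ?_⟩
      simp only [h', hT])
  have hφmk : ∀ t V hV, φ t (Projectivization.mk ℝ V hV) =
      Projectivization.mk ℝ (T t V) (hT0 t V hV) := fun t V hV => rfl
  have hφinj : ∀ t, Function.Injective (φ t) := by
    intro t p q h
    induction p using Projectivization.ind with
    | h v hv =>
    induction q using Projectivization.ind with
    | h w hw =>
      rw [hφmk, hφmk, Projectivization.mk_eq_mk_iff'] at h
      obtain ⟨c, hc⟩ := h
      rw [← hT] at hc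
      exact (Projectivization.mk_eq_mk_iff' ℝ _ _ _ _).2 ⟨c, hTinj t hc⟩
  have hφsurj : ∀ t, Function.Surjective (φ t) := by
    intro t p
    induction p using Projectivization.ind with
    | h w hw =>
      obtain ⟨v, rfl⟩ := hTsurj t w
      have hv : v ≠ 0 := by
        rintro rfl
        apply hw
        simp [T, hg0]
      exact ⟨Projectivization.mk ℝ v hv, rfl⟩
  -- The product of the quotient map with the interval is again a quotient map, so joint continuity
  -- may be tested on nonzero vectors.
  have hφc : Continuous fun p : unitInterval × RP3 => φ p.1 p.2 := by
    apply RP3.isQuotientMap_proj.continuous_lift_prod_right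
    have : Continuous fun p : unitInterval × {v : Fin 4 → ℝ // v ≠ 0} =>
        (⟨T p.1 p.2.1, hT0 _ _ p.2.2⟩ : {v : Fin 4 → ℝ // v ≠ 0}) := by
      apply Continuous.subtype_mk
      simp only [T]
      fun_prop
    exact RP3.continuous_proj.comp this
  let Φ : unitInterval → RP3 ≃ₜ RP3 := fun t =>
    Continuous.homeoOfEquivCompactToT2 (f := Equiv.ofBijective (φ t) ⟨hφinj t, hφsurj t⟩)
      (hφc.comp (continuous_const.prodMk continuous_id))
  have hΦ : ∀ t p, Φ t p = φ t p := fun t p => rfl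
  refine ⟨Φ, hφc, ?_, ?_⟩
  · ext p
    induction p using Projectivization.ind with
    | h v hv =>
      rw [hΦ, hφmk]
      simp [T]
  · rw [← Set.range_comp]
    congr 1
    funext i
    simp only [Function.comp, hΦ, hφmk]
    congr 1
    simp [T, hPQ]

/-- Only the points with `V c = 0` need care: there boundedness of `G` squeezes the product by `C *
|V c|`, so the default value of the quotient does no harm. -/
theorem continuous_homogenization {d : ℕ} (c : Fin d) (G : (Fin d → ℝ) → ℝ) (hG : Continuous G)
    {C : ℝ} (hC : ∀ x, |G x| ≤ C) :
    Continuous fun V : Fin d → ℝ => V c * G fun k => V k / V c := by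
  rw [continuous_iff_continuousAt]
  intro V
  have hp : ∀ k, ContinuousAt (fun V : Fin d → ℝ => V k) V := fun k =>
    (continuous_apply k).continuousAt
  by_cases hV : V c = 0
  · have h0 : ContinuousAt (fun V : Fin d → ℝ => C * |V c|) V :=
      continuousAt_const.mul (hp c).abs
    unfold ContinuousAt at h0 ⊢
    simp only [hV, abs_zero, mul_zero, zero_mul] at h0 ⊢
    refine squeeze_zero_norm (fun W => ?_) h0
    rw [Real.norm_eq_abs, abs_mul, mul_comm]
    exact mul_le_mul_of_nonneg_right (hC _) (abs_nonneg _)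
  · have h : ContinuousAt (fun V : Fin d → ℝ => fun k => V k / V c) V :=
      continuousAt_pi.2 fun k => (hp k).div (hp c) hV
    exact (hp c).mul (ContinuousAt.comp hG.continuousAt h)

theorem homogenization_smul {d : ℕ} (c : Fin d) (G : (Fin d → ℝ) → ℝ) (t : ℝ) (V : Fin d → ℝ) :
    ((t • V) c * G fun k => (t • V) k / (t • V) c) = t * (V c * G fun k => V k / V c) := by
  by_cases ht : t = 0
  · simp [ht]
  · simp only [Pi.smul_apply, smul_eq_mul, mul_div_mul_left _ _ ht, mul_assoc]

/-- The ambient isotopy of projective space that moves the points of the affine part `w ≠ 0` by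
`G` times the vector `u` and fixes the plane `w = 0`. -/
theorem ambientIsotopic_affineShear {ι : Type*} (u : Fin 4 → ℝ) (hu : u 2 = 0)
    (G : (Fin 4 → ℝ) → ℝ) (hG : Continuous G) (C : ℝ) (hC : ∀ x, |G x| ≤ C)
    (hmono : ∀ x, StrictMono fun s : ℝ => s + G (x + s • u))
    (P Q : ι → Fin 4 → ℝ) (hP : ∀ i, P i ≠ 0) (hQ : ∀ i, Q i ≠ 0)
    (hPQ : ∀ i, Q i = P i + (P i 2 * G fun k => P i k / P i 2) • u) :
    AmbientIsotopic (Set.range fun i => (Projectivization.mk ℝ (P i) (hP i) : RP3))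
      (Set.range fun i => (Projectivization.mk ℝ (Q i) (hQ i) : RP3)) := by
  refine ambientIsotopic_shear u (fun V => V 2 * G fun k => V k / V 2)
    (continuous_homogenization 2 G hG hC) (homogenization_smul 2 G) ?_ ?_ P Q hP hQ hPQ
  · simp [hu]
  · intro V
    -- On the plane at infinity nothing moves. Elsewhere one rescales by `V 2`; if it is negative,
    -- the order is reversed twice.
    by_cases hV : V 2 = 0
    · intro s s' hs
      simpa [hV, hu] using hs
    · have h3 : ∀ s : ℝ, (V + s • u) 2 = V 2 := fun s => by simp [hu]
      have h2 : ∀ s : ℝ, (fun k => (V + s • u) k / V 2) = (fun k => V k / V 2) + (s / V 2) • u := by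
        intro s
        funext k
        simp [add_div, mul_div_right_comm]
      intro s s' hs
      simp only [h3, h2]
      rcases lt_or_gt_of_ne hV with h | h
      · have := hmono (fun k => V k / V 2) (div_lt_div_of_neg_of_lt h hs)
        simp only at this
        have h4 := mul_lt_mul_of_neg_left this h
        rwa [mul_add, mul_add, mul_div_cancel₀ _ hV, mul_div_cancel₀ _ hV] at h4
      · have := hmono (fun k => V k / V 2) (div_lt_div_of_pos_right hs h)
        simp only at this
        have h4 := mul_lt_mul_of_pos_left this h
        rwa [mul_add, mul_add, mul_div_cancel₀ _ hV, mul_div_cancel₀ _ hV] at h4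

end ProjLink

end

noncomputable section

namespace ProjLink

namespace PolygonSystem

variable {d : ℕ} (F : PolygonSystem d)

/-! ### Parametrizations of polygons -/

/-- At the right end `curve` has already switched to the next edge, but with weight `0` on its far
vertex. So one formula serves the whole closed edge. -/
theorem curve_eq_of_mem_Icc {i : Fin F.num} {m : ℕ} {x : ℝ} (h : x ∈ Set.Icc (m : ℝ) (m + 1)) :
    F.curve i x = (m + 1 - x) • F.vert i m + (x - m) • F.vert i (m + 1) := by
  rcases h.2.lt_or_eq with h1 | h1
  · have hf : ⌊x⌋ = m := Int.floor_eq_iff.2 ⟨by exact_mod_cast h.1, by exact_mod_cast h1⟩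
    have hn : ⌊x⌋₊ = m := (Nat.floor_eq_iff ((Nat.cast_nonneg m).trans h.1)).2 ⟨h.1, h1⟩
    have hfr : Int.fract x = x - m := by rw [Int.fract, hf]; simp
    rw [curve, hfr, hn]
    congr 2
    ring
  · have hn : ⌊x⌋₊ = m + 1 := by
      rw [h1]
      exact_mod_cast Nat.floor_natCast (m + 1)
    have hfr : Int.fract x = 0 := by
      rw [h1]
      exact_mod_cast Int.fract_natCast (m + 1)
    rw [curve, hfr, hn, h1]
    simp

theorem curve_natCast (i : Fin F.num) (m : ℕ) : F.curve i m = F.vert i m := by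
  rw [F.curve_eq_of_mem_Icc (m := m) ⟨le_rfl, by linarith⟩]
  simp

theorem floor_mem_Icc {x : ℝ} (hx : 0 ≤ x) : x ∈ Set.Icc (⌊x⌋₊ : ℝ) (⌊x⌋₊ + 1) :=
  ⟨Nat.floor_le hx, (Nat.lt_floor_add_one x).le⟩

theorem curve_eq_vert_add (i : Fin F.num) (x : ℝ) :
    F.curve i x = F.vert i ⌊x⌋₊ + Int.fract x • F.edgeVector i x := by
  rw [curve, edgeVector, smul_sub, sub_smul, one_smul]
  abel

theorem continuousOn_curve (i : Fin F.num) (n : ℕ) :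
    ContinuousOn (F.curve i) (Set.Icc (0 : ℝ) n) := by
  induction n with
  | zero => simp
  | succ n ih =>
    have h1 : ContinuousOn (F.curve i) (Set.Icc (n : ℝ) (n + 1)) := by
      refine ContinuousOn.congr (f := fun x : ℝ =>
        (n + 1 - x) • F.vert i n + (x - n) • F.vert i (n + 1)) (by fun_prop) fun x hx =>
        F.curve_eq_of_mem_Icc hx
    have h2 := ih.union_of_isClosed h1 isClosed_Icc isClosed_Icc
    rw [Set.Icc_union_Icc_eq_Icc (Nat.cast_nonneg n) (by linarith)] at h2
    exact_mod_cast h2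

theorem toProj_eq_iff (p q : F.Point) :
    F.toProj p = F.toProj q ↔ ∃ c : ℝ, c ≠ 0 ∧ F.coord p = c • F.coord q := by
  rw [toProj, toProj, Projectivization.mk_eq_mk_iff']
  constructor
  · rintro ⟨c, hc⟩
    refine ⟨c, ?_, hc.symm⟩
    rintro rfl
    exact F.coord_ne_zero p (by simpa using hc.symm)
  · rintro ⟨c, -, hc⟩
    exact ⟨c, hc.symm⟩

theorem floor_lt_len (p : F.Point) : ⌊(p.2 : ℝ)⌋₊ < F.len p.1 :=
  (Nat.floor_lt p.2.2.1).2 p.2.2.2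

/-- The change of basis from the two end points of the edge to these two vectors has determinant `y
- x`. -/
theorem linearIndependent_curve {i : Fin F.num} {m : ℕ} (hm : m < F.len i) {x y : ℝ}
    (hx : x ∈ Set.Icc (m : ℝ) (m + 1)) (hy : y ∈ Set.Icc (m : ℝ) (m + 1)) (hxy : x ≠ y) :
    LinearIndependent ℝ ![F.curve i x, F.curve i y] := by
  have h := LinearIndependent.pair_iff.1 (F.nondegenerate i m hm)
  rw [LinearIndependent.pair_iff]
  intro s t hst
  rw [F.curve_eq_of_mem_Icc hx, F.curve_eq_of_mem_Icc hy] at hst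
  have h1 := h (s * (m + 1 - x) + t * (m + 1 - y)) (s * (x - m) + t * (y - m)) (by
    rw [← hst]
    module)
  have h2 : s * (y - x) = 0 := by linear_combination (y - m) * h1.1 - (m + 1 - y) * h1.2
  have h3 : t * (x - y) = 0 := by linear_combination (x - m) * h1.1 - (m + 1 - x) * h1.2
  exact ⟨(mul_eq_zero.1 h2).resolve_right (sub_ne_zero.2 hxy.symm),
    (mul_eq_zero.1 h3).resolve_right (sub_ne_zero.2 hxy)⟩

theorem eq_of_curve_eq_smul {i : Fin F.num} {m : ℕ} (hm : m < F.len i) {x y c : ℝ}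
    (hx : x ∈ Set.Icc (m : ℝ) (m + 1)) (hy : y ∈ Set.Icc (m : ℝ) (m + 1))
    (h : F.curve i x = c • F.curve i y) : x = y := by
  by_contra hxy
  have h1 := (LinearIndependent.pair_iff.1 (F.linearIndependent_curve hm hx hy hxy)) 1 (-c) (by
    rw [h]; module)
  exact one_ne_zero h1.1

theorem curve_len (i : Fin F.num) :
    F.curve i (F.len i) = ((F.closing i : ℤ) : ℝ) • F.curve i 0 := by
  have h0 := F.curve_natCast i 0
  rw [Nat.cast_zero] at h0
  rw [F.curve_natCast, h0, F.closed]

theorem closing_ne_zero (i : Fin F.num) : ((F.closing i : ℤ) : ℝ) ≠ 0 := by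
  exact_mod_cast (F.closing i).ne_zero

theorem linearIndependent_coord_edgeVector (p : F.Point) :
    LinearIndependent ℝ ![F.coord p, F.edgeVector p.1 p.2] := by
  have h := LinearIndependent.pair_iff.1 (F.nondegenerate p.1 _ (F.floor_lt_len p))
  rw [LinearIndependent.pair_iff]
  intro s t hst
  rw [coord, curve, edgeVector] at hst
  have h1 := h (s * (1 - Int.fract (p.2 : ℝ)) - t) (s * Int.fract (p.2 : ℝ) + t) (by
    rw [← hst]; module)
  have h2 : s = 0 := by linear_combination h1.1 + h1.2
  refine ⟨h2, ?_⟩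
  have := h1.2
  rw [h2] at this
  simpa using this

/-- The initial point of a polygon. -/
def basePoint (i : Fin F.num) : F.Point :=
  ⟨i, 0, le_rfl, by exact_mod_cast F.len_pos i⟩

/-! ### Images under linear maps -/

/-- The image of a polygon system under a linear map. -/
abbrev map {e : ℕ} (f : (Fin d → ℝ) →ₗ[ℝ] (Fin e → ℝ))
    (hf : ∀ i, ∀ k < F.len i, LinearIndependent ℝ ![f (F.vert i k), f (F.vert i (k + 1))]) :
    PolygonSystem e where
  num := F.num
  len := F.len
  len_pos := F.len_pos
  vert i k := f (F.vert i k)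
  closing := F.closing
  closed i := by rw [F.closed, map_smul]
  nondegenerate := hf

/-! ### Refinements -/

/-- Break points of a subdivision of the edges of a polygon system. -/
structure Refinement where
  len : Fin F.num → ℕ
  b : Fin F.num → ℕ → ℝ
  b_zero : ∀ i, b i 0 = 0
  b_len : ∀ i, b i (len i) = F.len i
  strictMono : ∀ i, StrictMono (b i)
  fine : ∀ i j, ∃ m : ℕ, (m : ℝ) ≤ b i j ∧ b i (j + 1) ≤ m + 1

namespace Refinement

variable {F} (R : F.Refinement)

theorem lt_len_of {i : Fin F.num} {j m : ℕ} (hj : j < R.len i) (hm : (m : ℝ) ≤ R.b i j) :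
    m < F.len i := by
  have h := R.strictMono i hj
  rw [R.b_len] at h
  exact_mod_cast hm.trans_lt h

/-- The subdivided polygons. -/
abbrev system : PolygonSystem d where
  num := F.num
  len := R.len
  len_pos i := by
    by_contra h
    have h0 : R.len i = 0 := by omega
    have h1 := R.b_len i
    rw [h0, R.b_zero] at h1
    have h2 : (0 : ℝ) < F.len i := by exact_mod_cast F.len_pos i
    exact h2.ne h1
  vert i j := F.curve i (R.b i j)
  closing := F.closing
  closed i := by rw [R.b_len, R.b_zero, F.curve_len]
  nondegenerate i j hj := by
    obtain ⟨m, h1, h2⟩ := R.fine i j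
    have h3 := R.strictMono i (Nat.lt_succ_self j)
    exact F.linearIndependent_curve (R.lt_len_of hj h1) ⟨h1, by linarith⟩ ⟨by linarith, h2⟩ h3.ne

/-- The parameter of the subdivided polygon in terms of the original one. -/
def param (i : Fin F.num) (x : ℝ) : ℝ :=
  R.b i ⌊x⌋₊ + Int.fract x * (R.b i (⌊x⌋₊ + 1) - R.b i ⌊x⌋₊)

theorem param_mem (i : Fin F.num) (x : ℝ) :
    R.param i x ∈ Set.Ico (R.b i ⌊x⌋₊) (R.b i (⌊x⌋₊ + 1)) := by
  have h1 := R.strictMono i (Nat.lt_succ_self ⌊x⌋₊)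
  have h2 := Int.fract_nonneg x
  have h3 := Int.fract_lt_one x
  simp only [param, Set.mem_Ico, Nat.succ_eq_add_one] at *
  constructor <;> nlinarith

theorem param_natCast (i : Fin F.num) (j : ℕ) : R.param i j = R.b i j := by
  simp [param]

/-- By `fine` each new edge lies inside one old edge, where the old curve is affine. -/
theorem curve_system (i : Fin F.num) (x : ℝ) :
    R.system.curve i x = F.curve i (R.param i x) := by
  obtain ⟨m, h1, h2⟩ := R.fine i ⌊x⌋₊
  have h3 := R.param_mem i x
  rw [F.curve_eq_of_mem_Icc (m := m) ⟨h1.trans h3.1, h3.2.le.trans h2⟩]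
  change (1 - Int.fract x) • F.curve i (R.b i ⌊x⌋₊) + Int.fract x • F.curve i (R.b i (⌊x⌋₊ + 1)) = _
  rw [F.curve_eq_of_mem_Icc (m := m) (x := R.b i ⌊x⌋₊) ⟨h1, h3.1.trans (h3.2.le.trans h2)⟩,
    F.curve_eq_of_mem_Icc (m := m) (x := R.b i (⌊x⌋₊ + 1)) ⟨h1.trans (h3.1.trans h3.2.le), h2⟩,
    param]
  module

/-- The factor is positive, so subdividing rescales velocities without changing the signs of
crossings. -/
theorem edgeVector_system (i : Fin F.num) (x : ℝ) :
    R.system.edgeVector i x =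
      (R.b i (⌊x⌋₊ + 1) - R.b i ⌊x⌋₊) • F.edgeVector i (R.param i x) := by
  obtain ⟨m, h1, h2⟩ := R.fine i ⌊x⌋₊
  have h3 := R.param_mem i x
  have hm : ⌊R.param i x⌋₊ = m :=
    (Nat.floor_eq_iff ((Nat.cast_nonneg m).trans (h1.trans h3.1))).2
      ⟨h1.trans h3.1, h3.2.trans_le h2⟩
  change F.curve i (R.b i (⌊x⌋₊ + 1)) - F.curve i (R.b i ⌊x⌋₊) = _ • F.edgeVector i _
  rw [edgeVector, hm]
  rw [F.curve_eq_of_mem_Icc (m := m) (x := R.b i ⌊x⌋₊) ⟨h1, h3.1.trans (h3.2.le.trans h2)⟩,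
    F.curve_eq_of_mem_Icc (m := m) (x := R.b i (⌊x⌋₊ + 1)) ⟨h1.trans (h3.1.trans h3.2.le), h2⟩]
  module

theorem param_strictMonoOn (i : Fin F.num) : StrictMonoOn (R.param i) (Set.Ici 0) := by
  intro x hx y hy hxy
  have hx' : (0 : ℝ) ≤ x := hx
  have hy' : (0 : ℝ) ≤ y := hy
  rcases (Nat.floor_mono hxy.le).lt_or_eq with h | h
  · exact (R.param_mem i x).2.trans_le
      (((R.strictMono i).monotone (Nat.succ_le_of_lt h)).trans (R.param_mem i y).1)
  · have h1 := R.strictMono i (Nat.lt_succ_self ⌊y⌋₊)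
    have hfx : Int.fract x = x - ⌊x⌋₊ := by
      rw [Int.fract, ← natCast_floor_eq_intCast_floor hx']
    have hfy : Int.fract y = y - ⌊y⌋₊ := by
      rw [Int.fract, ← natCast_floor_eq_intCast_floor hy']
    rw [param, param, hfx, hfy, h]
    simp only [Nat.succ_eq_add_one] at h1
    nlinarith

theorem param_zero (i : Fin F.num) : R.param i 0 = 0 := by
  simpa [R.b_zero] using R.param_natCast i 0

theorem param_len (i : Fin F.num) : R.param i (R.len i) = F.len i := by
  rw [R.param_natCast, R.b_len]

theorem param_mem_Ico {i : Fin F.num} {x : ℝ} (hx : x ∈ Set.Ico (0 : ℝ) (R.len i)) :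
    R.param i x ∈ Set.Ico (0 : ℝ) (F.len i) := by
  constructor
  · rw [← R.param_zero i]
    exact (R.param_strictMonoOn i).monotoneOn (Set.mem_Ici.2 le_rfl) hx.1 hx.1
  · rw [← R.param_len i]
    exact R.param_strictMonoOn i hx.1 (Set.mem_Ici.2 (Nat.cast_nonneg _)) hx.2

theorem exists_param {i : Fin F.num} {y : ℝ} (hy : y ∈ Set.Ico (0 : ℝ) (F.len i)) :
    ∃ x ∈ Set.Ico (0 : ℝ) (R.len i), R.param i x = y := by
  classical
  -- The new edge through `y` is the one that ends at the first break point beyond `y`.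
  have hex : ∃ j, y < R.b i j := ⟨R.len i, by rw [R.b_len]; exact hy.2⟩
  have h1 := Nat.find_spec hex
  have h0 : Nat.find hex ≠ 0 := by
    intro h
    rw [h, R.b_zero] at h1
    exact h1.not_ge hy.1
  obtain ⟨j, hj⟩ := Nat.exists_eq_succ_of_ne_zero h0
  have h2 : R.b i j ≤ y := not_lt.1 (Nat.find_min hex (by omega))
  rw [hj, Nat.succ_eq_add_one] at h1
  have h3 : 0 < R.b i (j + 1) - R.b i j := by linarith
  set t := (y - R.b i j) / (R.b i (j + 1) - R.b i j) with ht
  have ht0 : 0 ≤ t := div_nonneg (by linarith) h3.le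
  have ht1 : t < 1 := (div_lt_one h3).2 (by linarith)
  have hfl : ⌊(j : ℝ) + t⌋₊ = j := (Nat.floor_eq_iff (by positivity)).2 ⟨by linarith, by linarith⟩
  have hfr : Int.fract ((j : ℝ) + t) = t := by
    rw [Int.fract_natCast_add, Int.fract_eq_self.2 ⟨ht0, ht1⟩]
  have hlt : j < R.len i := by
    by_contra h
    have := (R.strictMono i).monotone (not_lt.1 h)
    rw [R.b_len] at this
    linarith [hy.2]
  have hlt' : (j : ℝ) + 1 ≤ R.len i := by exact_mod_cast hlt
  refine ⟨j + t, ⟨by positivity, by linarith⟩, ?_⟩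
  rw [param, hfl, hfr, ht, div_mul_cancel₀ _ h3.ne']
  ring

/-- The points of the subdivided polygons are the points of the original ones. -/
def point (p : R.system.Point) : F.Point := ⟨p.1, R.param p.1 p.2, R.param_mem_Ico p.2.2⟩

theorem point_injective : Function.Injective R.point := by
  rintro ⟨i, x, hx⟩ ⟨j, y, hy⟩ h
  obtain rfl : i = j := congrArg Sigma.fst h
  replace h := eq_of_heq (Sigma.mk.inj h).2
  have h1 := (R.param_strictMonoOn i).injOn hx.1 hy.1 (congrArg Subtype.val h)
  subst h1
  rfl

theorem point_surjective : Function.Surjective R.point := by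
  rintro ⟨i, y, hy⟩
  obtain ⟨x, hx, rfl⟩ := R.exists_param hy
  exact ⟨⟨i, x, hx⟩, rfl⟩

theorem coord_system (p : R.system.Point) : R.system.coord p = F.coord (R.point p) :=
  R.curve_system _ _

theorem toProj_system (p : R.system.Point) : R.system.toProj p = F.toProj (R.point p) := by
  simp only [toProj, coord_system]

theorem isMultiple_system (p : R.system.Point) :
    R.system.IsMultiple p ↔ F.IsMultiple (R.point p) := by
  constructor
  · rintro ⟨q, hq, h⟩
    refine ⟨R.point q, R.point_injective.ne hq, ?_⟩
    rwa [← toProj_system, ← toProj_system]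
  · rintro ⟨q, hq, h⟩
    obtain ⟨q, rfl⟩ := R.point_surjective q
    refine ⟨q, fun h => hq (congrArg R.point h), ?_⟩
    rwa [toProj_system, toProj_system]

end Refinement

end PolygonSystem

end ProjLink

end

noncomputable section

namespace ProjLink

/-! ### Cyclic successors -/

/-- The cyclic successor in a finite linear order. -/
def cyclicSucc (α : Type*) [Fintype α] [LinearOrder α] : Equiv.Perm α :=
  ((monoEquivOfFin α rfl).symm.toEquiv.trans (finRotate _)).trans (monoEquivOfFin α rfl).toEquiv

/-- `y` is the cyclic successor of a position between the elements that satisfy the predicate `P`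
(the later elements) and the other ones. -/
def IsCyclicSucc {α : Type*} [LinearOrder α] (P : α → Prop) (y : α) : Prop :=
  (P y ∧ ∀ z, P z → y ≤ z) ∨ ((∀ z, ¬ P z) ∧ ∀ z, y ≤ z)

/-- Because of uniqueness, the next passage, defined by rotating an enumeration, can be identified
from order relations alone. -/
theorem IsCyclicSucc.unique {α : Type*} [LinearOrder α] {P : α → Prop} {y z : α}
    (hy : IsCyclicSucc P y) (hz : IsCyclicSucc P z) : y = z := by
  rcases hy with ⟨h1, h2⟩ | ⟨h1, h2⟩ <;> rcases hz with ⟨h3, h4⟩ | ⟨h3, h4⟩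
  · exact le_antisymm (h2 _ h3) (h4 _ h1)
  · exact absurd h1 (h3 _)
  · exact absurd h3 (h1 _)
  · exact le_antisymm (h2 _) (h4 _)

theorem exists_isCyclicSucc {α : Type*} [LinearOrder α] [Finite α] [Nonempty α] (P : α → Prop) :
    ∃ y, IsCyclicSucc P y := by
  by_cases h : ∃ z, P z
  · obtain ⟨y, hy, hy'⟩ := Set.exists_min_image {z | P z} id (Set.toFinite _) h
    exact ⟨y, Or.inl ⟨hy, fun z hz => hy' z hz⟩⟩
  · obtain ⟨y, -, hy'⟩ := Set.exists_min_image (Set.univ : Set α) id (Set.toFinite _) Set.univ_nonempty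
    exact ⟨y, Or.inr ⟨fun z hz => h ⟨z, hz⟩, fun z => hy' z (Set.mem_univ z)⟩⟩

theorem isCyclicSucc_cyclicSucc {α : Type*} [Fintype α] [LinearOrder α] (x : α) :
    IsCyclicSucc (fun z => x < z) (cyclicSucc α x) := by
  have key : ∀ (k : ℕ) (e : Fin k ≃o α), IsCyclicSucc (fun z => x < z)
      (e (finRotate k (e.symm x))) := by
    intro k e
    obtain ⟨j, rfl⟩ := e.surjective x
    rw [e.symm_apply_apply]
    cases k with
    | zero => exact j.elim0
    | succ k =>
      by_cases hj : j = Fin.last k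
      · subst hj
        right
        refine ⟨fun z => ?_, fun z => ?_⟩
        · rw [not_lt, ← e.apply_symm_apply z, e.le_iff_le]
          exact Fin.le_last _
        · rw [finRotate_last, ← e.apply_symm_apply z, e.le_iff_le]
          exact Fin.zero_le _
      · have hj' : (j : ℕ) < k := by
          have := Fin.val_lt_last hj
          simpa using this
        have hr : ((finRotate (k + 1) j : Fin (k + 1)) : ℕ) = j + 1 :=
          coe_finRotate_of_ne_last hj
        left
        refine ⟨?_, fun z hz => ?_⟩
        · change e j < e _
          rw [e.lt_iff_lt, Fin.lt_def, hr]
          omega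
        · rw [← e.apply_symm_apply z, e.lt_iff_lt, Fin.lt_def] at hz
          rw [← e.apply_symm_apply z, e.le_iff_le, Fin.le_def, hr]
          omega
  exact key _ (monoEquivOfFin α rfl)

/-! ### Colourings of states

The abstract circles `[0, len i] / (0 ~ len i)` are cut at the passages through crossings. A state
colouring gives a colour to the two sides (just before: `false`, just after: `true`) of every point;
it is constant between crossings and compatible with the A-splicings. -/

/-- The points of a family of abstract circles. -/
abbrev CirclePoint {n : ℕ} (len : Fin n → ℕ) : Type := Σ i : Fin n, Set.Ico (0 : ℝ) (len i)

variable {n : ℕ} {len : Fin n → ℕ} {K : Type*}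

/-- The colouring is constant along intervals that contain no point of `N`. -/
structure EdgeRule (N : Set (CirclePoint len)) (h : CirclePoint len × Bool → K) : Prop where
  between : ∀ i (x y : Set.Ico (0 : ℝ) (len i)), x < y →
    (∀ z, x < z → z < y → (⟨i, z⟩ : CirclePoint len) ∉ N) → h (⟨i, x⟩, true) = h (⟨i, y⟩, false)
  last : ∀ i (x o : Set.Ico (0 : ℝ) (len i)), (o : ℝ) = 0 →
    (∀ z, x < z → (⟨i, z⟩ : CirclePoint len) ∉ N) → h (⟨i, x⟩, true) = h (⟨i, o⟩, false)

/-- The colouring is compatible with the A-splicings: `X p q` means that `p` and `q` are the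
passages through a crossing, and `pos` gives the sign of the crossing. -/
structure CrossRule (X pos : CirclePoint len → CirclePoint len → Prop)
    (h : CirclePoint len × Bool → K) : Prop where
  positive : ∀ p q, X p q → pos p q → ∀ b, h (p, b) = h (q, !b)
  negative : ∀ p q, X p q → ¬ pos p q → ∀ b, h (p, b) = h (q, b)

/-- The passages through crossings. -/
def passages (X : CirclePoint len → CirclePoint len → Prop) : Set (CirclePoint len) :=
  {p | ∃ q, X p q}

/-- State colourings. -/
structure IsColouring (X pos : CirclePoint len → CirclePoint len → Prop)
    (h : CirclePoint len × Bool → K) : Prop where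
  edge : EdgeRule (passages X) h
  regular : ∀ p, p ∉ passages X → h (p, false) = h (p, true)
  cross : CrossRule X pos h

theorem EdgeRule.comp {N : Set (CirclePoint len)} {h : CirclePoint len × Bool → K}
    (hh : EdgeRule N h) {K' : Type*} (f : K → K') : EdgeRule N (f ∘ h) :=
  ⟨fun i x y hxy hN => congrArg f (hh.between i x y hxy hN),
    fun i x o ho hN => congrArg f (hh.last i x o ho hN)⟩

theorem CrossRule.comp {X pos : CirclePoint len → CirclePoint len → Prop}
    {h : CirclePoint len × Bool → K}
    (hh : CrossRule X pos h) {K' : Type*} (f : K → K') : CrossRule X pos (f ∘ h) :=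
  ⟨fun p q hX hp b => congrArg f (hh.positive p q hX hp b),
    fun p q hX hp b => congrArg f (hh.negative p q hX hp b)⟩

theorem IsColouring.comp {X pos : CirclePoint len → CirclePoint len → Prop}
    {h : CirclePoint len × Bool → K}
    (hh : IsColouring X pos h) {K' : Type*} (f : K → K') : IsColouring X pos (f ∘ h) :=
  ⟨hh.edge.comp f, fun p hp => congrArg f (hh.regular p hp), hh.cross.comp f⟩

theorem EdgeRule.mono {N N' : Set (CirclePoint len)} {h : CirclePoint len × Bool → K}
    (hh : EdgeRule N h) (hN : N ⊆ N') : EdgeRule N' h :=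
  ⟨fun i x y hxy h' => hh.between i x y hxy fun z h1 h2 h3 => h' z h1 h2 (hN h3),
    fun i x o ho h' => hh.last i x o ho fun z h1 h3 => h' z h1 (hN h3)⟩

/-- An interval that contains `p` splits at `p` into two intervals on which the rule is known; the
agreement of the two sides of `p` glues them. -/
theorem EdgeRule.of_insert {N : Set (CirclePoint len)} {h : CirclePoint len × Bool → K}
    {p : CirclePoint len} (hh : EdgeRule (insert p N) h) (hp : h (p, false) = h (p, true)) :
    EdgeRule N h := by
  obtain ⟨j, w⟩ := p
  constructor
  · intro i x y hxy hN
    by_cases hw : ∃ e : j = i, x < e ▸ w ∧ e ▸ w < y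
    · obtain ⟨rfl, h1, h2⟩ := hw
      have h3 := hh.between j x w h1 fun z h4 h5 h6 => by
        rcases h6 with h6 | h6
        · have := eq_of_heq (Sigma.mk.inj h6).2
          exact h5.ne this
        · exact hN z h4 (h5.trans h2) h6
      have h4 := hh.between j w y h2 fun z h4 h5 h6 => by
        rcases h6 with h6 | h6
        · have := eq_of_heq (Sigma.mk.inj h6).2
          exact h4.ne this.symm
        · exact hN z (h1.trans h4) h5 h6
      rw [h3, hp, h4]
    · refine hh.between i x y hxy fun z h4 h5 h6 => ?_
      rcases h6 with h6 | h6
      · obtain rfl : i = j := congrArg Sigma.fst h6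
        obtain rfl := eq_of_heq (Sigma.mk.inj h6).2
        exact hw ⟨rfl, h4, h5⟩
      · exact hN z h4 h5 h6
  · intro i x o ho hN
    by_cases hw : ∃ e : j = i, x < e ▸ w
    · obtain ⟨rfl, h1⟩ := hw
      have h3 := hh.between j x w h1 fun z h4 h5 h6 => by
        rcases h6 with h6 | h6
        · have := eq_of_heq (Sigma.mk.inj h6).2
          exact h5.ne this
        · exact hN z h4 h6
      have h4 := hh.last j w o ho fun z h4 h6 => by
        rcases h6 with h6 | h6
        · have := eq_of_heq (Sigma.mk.inj h6).2
          exact h4.ne this.symm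
        · exact hN z (h1.trans h4) h6
      rw [h3, hp, h4]
    · refine hh.last i x o ho fun z h4 h6 => ?_
      rcases h6 with h6 | h6
      · obtain rfl : i = j := congrArg Sigma.fst h6
        obtain rfl := eq_of_heq (Sigma.mk.inj h6).2
        exact hw ⟨rfl, h4⟩
      · exact hN z h4 h6

/-! ### State circles -/

section StateCircle

variable (X pos : CirclePoint len → CirclePoint len → Prop)

/-- Two sides of points lie on the same state circle if all colourings agree on them. -/
def stateSetoid : Setoid (CirclePoint len × Bool) where
  r f g := ∀ h : CirclePoint len × Bool → Prop, IsColouring X pos h → h f = h g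
  iseqv := ⟨fun _ _ _ => rfl, fun H h hh => (H h hh).symm, fun H H' h hh => (H h hh).trans (H' h hh)⟩

/-- The circles of the all-A state. -/
def StateCircle : Type := Quotient (stateSetoid X pos)

/-- The state circle of a side of a point. -/
def circleOf (f : CirclePoint len × Bool) : StateCircle X pos := Quotient.mk (stateSetoid X pos) f

theorem circleOf_surjective : Function.Surjective (circleOf X pos) := Quotient.exists_rep

theorem isColouring_circleOf : IsColouring X pos (circleOf X pos) where
  edge :=
    ⟨fun i x y hxy hN => Quotient.sound fun _ hh => hh.edge.between i x y hxy hN,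
      fun i x o ho hN => Quotient.sound fun _ hh => hh.edge.last i x o ho hN⟩
  regular p hp := Quotient.sound fun _ hh => hh.regular p hp
  cross :=
    ⟨fun p q hX hp b => Quotient.sound fun _ hh => hh.cross.positive p q hX hp b,
      fun p q hX hp b => Quotient.sound fun _ hh => hh.cross.negative p q hX hp b⟩

variable {X pos}

/-- Two-valued colourings suffice in `stateSetoid`: a colouring with arbitrary values is composed
with the predicate of being equal to `h g`. -/
theorem IsColouring.eq_of_circleOf_eq {h : CirclePoint len × Bool → K} (hh : IsColouring X pos h)
    {f g : CirclePoint len × Bool} (hfg : circleOf X pos f = circleOf X pos g) : h f = h g := by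
  have h1 := Quotient.exact hfg (fun f => h f = h g) (hh.comp fun k => k = h g)
  exact h1.mpr rfl

/-- The map on state circles that is induced by a colouring. -/
def IsColouring.lift {h : CirclePoint len × Bool → K} (hh : IsColouring X pos h) :
    StateCircle X pos → K :=
  Quotient.lift h fun _ _ hfg => hh.eq_of_circleOf_eq (Quotient.sound hfg)

theorem IsColouring.lift_circleOf {h : CirclePoint len × Bool → K} (hh : IsColouring X pos h)
    (f : CirclePoint len × Bool) : hh.lift (circleOf X pos f) = h f := rfl

/-- Every side of a point can be moved back to the nearest passage or base point. The base points
are added so that a preceding marked point always exists. Finiteness makes the count of circles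
usable for induction. -/
theorem finite_stateCircle (hlen : ∀ i, 0 < len i) (hX : (passages X).Finite) :
    Finite (StateCircle X pos) := by
  classical
  let o : Fin n → CirclePoint len := fun i => ⟨i, 0, le_rfl, by exact_mod_cast hlen i⟩
  let M : Set (CirclePoint len) := passages X ∪ Set.range o
  have hM : M.Finite := hX.union (Set.finite_range o)
  have : Finite M := hM
  refine Finite.of_surjective (fun m : M × Bool => circleOf X pos (m.1.1, m.2)) ?_
  have hcol := isColouring_circleOf X pos
  have key : ∀ p : CirclePoint len, ∃ m : M × Bool,
      circleOf X pos (m.1.1, m.2) = circleOf X pos (p, false) := by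
    rintro ⟨i, x⟩
    by_cases hx : (⟨i, x⟩ : CirclePoint len) ∈ M
    · exact ⟨(⟨_, hx⟩, false), rfl⟩
    · have hfin : {z | (⟨i, z⟩ : CirclePoint len) ∈ M ∧ z < x}.Finite := by
        refine (hM.preimage (f := fun z => (⟨i, z⟩ : CirclePoint len)) ?_).subset fun z hz => hz.1
        intro z _ w _ h
        exact eq_of_heq (Sigma.mk.inj h).2
      have hne : {z | (⟨i, z⟩ : CirclePoint len) ∈ M ∧ z < x}.Nonempty := by
        refine ⟨(o i).2, Or.inr ⟨i, rfl⟩, ?_⟩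
        refine lt_of_le_of_ne x.2.1 fun h => hx (Or.inr ⟨i, ?_⟩)
        have : (o i).2 = x := h
        rw [← this]
      obtain ⟨m, ⟨hm, hmx⟩, hmax⟩ := Set.exists_max_image _ id hfin hne
      refine ⟨(⟨_, hm⟩, true), hcol.edge.between i m x hmx fun z h1 h2 h3 => ?_⟩
      exact h1.not_ge (hmax z ⟨Or.inl h3, h2⟩)
  intro c
  obtain ⟨⟨p, b⟩, rfl⟩ := circleOf_surjective X pos c
  cases b with
  | false => exact key p
  | true =>
    by_cases hp : p ∈ passages X
    · exact ⟨(⟨p, Or.inl hp⟩, true), rfl⟩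
    · rw [← hcol.regular p hp]
      exact key p

end StateCircle

/-! ### Cutting a state circle -/

/-- The axioms satisfied by the crossings of a diagram. -/
structure IsCrossingData (X pos : CirclePoint len → CirclePoint len → Prop) : Prop where
  symm : ∀ p q, X p q → X q p
  irrefl : ∀ p, ¬ X p p
  unique : ∀ p q r, X p q → X p r → q = r
  pos_symm : ∀ p q, pos p q ↔ pos q p
  finite : (passages X).Finite
  zero : ∀ p : CirclePoint len, (p.2 : ℝ) = 0 → p ∉ passages X

/-- A circle that is cut at one point is still connected. -/
theorem IsCrossingData.eq_of_cut {X pos : CirclePoint len → CirclePoint len → Prop}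
    (hX : IsCrossingData X pos) (hlen : ∀ i, 0 < len i) {h : CirclePoint len × Bool → K}
    {a : CirclePoint len} (ha : a ∉ passages X)
    (hedge : EdgeRule (insert a (passages X)) h)
    (hreg : ∀ p, p ∉ passages X → p ≠ a → h (p, false) = h (p, true))
    (hcross : CrossRule X pos h) : h (a, false) = h (a, true) := by
  classical
  by_contra hne
  let o : Fin n → CirclePoint len := fun i => ⟨i, 0, le_rfl, by exact_mod_cast hlen i⟩
  -- The colouring can only change at these finitely many points; the base points ensure that every
  -- component carries one.
  let M : Set (CirclePoint len) := insert a (passages X) ∪ Set.range o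
  have hM : M.Finite := (hX.finite.insert a).union (Set.finite_range o)
  let MI : Fin n → Type := fun i => {x : Set.Ico (0 : ℝ) (len i) // (⟨i, x⟩ : CirclePoint len) ∈ M}
  have hfinI : ∀ i, Finite (MI i) := by
    intro i
    have : Finite M := hM
    refine Finite.of_injective (fun x : MI i => (⟨⟨i, x.1⟩, x.2⟩ : M)) fun x y hxy => ?_
    have h1 : (⟨i, x.1⟩ : CirclePoint len) = ⟨i, y.1⟩ := congrArg Subtype.val hxy
    exact Subtype.ext (eq_of_heq (Sigma.mk.inj h1).2)
  let _ : ∀ i, Fintype (MI i) := fun i => Fintype.ofFinite _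
  let val : (Σ i, MI i) → CirclePoint len := fun m => ⟨m.1, m.2.1⟩
  have hvalinj : Function.Injective val := by
    rintro ⟨i, x, hx⟩ ⟨j, y, hy⟩ h
    obtain rfl : i = j := congrArg Sigma.fst h
    obtain rfl := eq_of_heq (Sigma.mk.inj h).2
    rfl
  have hval : ∀ p ∈ M, ∃ m, val m = p := fun p hp => ⟨⟨p.1, p.2, hp⟩, rfl⟩
  let σ : Equiv.Perm (Σ i, MI i) := Equiv.sigmaCongrRight fun i => cyclicSucc (MI i)
  have hσ : ∀ m, h (val m, true) = h (val (σ m), false) := by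
    rintro ⟨i, x⟩
    change h (⟨i, x.1⟩, true) = h (⟨i, (cyclicSucc (MI i) x).1⟩, false)
    rcases isCyclicSucc_cyclicSucc x with ⟨h1, h2⟩ | ⟨h1, h2⟩
    · refine hedge.between i _ _ h1 fun z h3 h4 h5 => ?_
      exact h4.not_ge (h2 ⟨z, Or.inl h5⟩ h3)
    · refine hedge.last i _ _ ?_ fun z h3 h5 => h1 ⟨z, Or.inl h5⟩ h3
      have h3 := h2 ⟨(o i).2, Or.inr ⟨i, rfl⟩⟩
      exact le_antisymm h3 (cyclicSucc (MI i) x).1.2.1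
  -- Parity argument: count the sides with the colour of `(a, false)`. Pairing them along the
  -- intervals between marked points shows that their number is even.
  let φ : (Σ i, MI i) × Bool → ZMod 2 := fun f => if h (val f.1, f.2) = h (a, false) then 1 else 0
  have hsum : ∑ f, φ f = 0 := by
    rw [Fintype.sum_prod_type]
    simp only [Fintype.sum_bool]
    rw [Finset.sum_add_distrib]
    have h1 : ∑ m, φ (m, true) = ∑ m, φ (m, false) := by
      rw [← Equiv.sum_comp σ fun m => φ (m, false)]
      exact Finset.sum_congr rfl fun m _ => by simp only [φ, hσ]
    rw [h1]
    exact CharTwo.add_self_eq_zero _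
  obtain ⟨a', ha'⟩ := hval a (Or.inl (Or.inl rfl))
  have hpart : ∀ m, val m ∈ passages X → ∃ m', X (val m) (val m') := by
    rintro m ⟨q, hq⟩
    obtain ⟨m', rfl⟩ := hval q (Or.inl (Or.inr ⟨_, hX.symm _ _ hq⟩))
    exact ⟨m', hq⟩
  choose! π hπ using hpart
  have hπmem : ∀ m, val m ∈ passages X → val (π m) ∈ passages X := fun m hm =>
    ⟨_, hX.symm _ _ (hπ m hm)⟩
  have hππ : ∀ m, val m ∈ passages X → π (π m) = m := fun m hm =>
    hvalinj (hX.unique _ _ _ (hπ _ (hπmem m hm)) (hX.symm _ _ (hπ m hm)))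
  -- The other pairing follows the splicings at crossings and passes from one side to the other at
  -- regular points. It preserves `φ` away from `a`, so the two sides of `a` must contribute an even
  -- number as well; different colours would contribute exactly one.
  let τ : (Σ i, MI i) × Bool → (Σ i, MI i) × Bool := fun f =>
    if val f.1 ∈ passages X then (π f.1, if pos (val f.1) (val (π f.1)) then !f.2 else f.2)
    else (f.1, !f.2)
  have hττ : ∀ f, τ (τ f) = f := by
    rintro ⟨m, b⟩
    by_cases hm : val m ∈ passages X
    · have h1 := hπmem m hm
      by_cases hp : pos (val m) (val (π m))
      · have hp' := (hX.pos_symm _ _).1 hp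
        simp [τ, hm, h1, hp, hππ m hm, hp']
      · have hp' : ¬ pos (val (π m)) (val m) := fun h => hp ((hX.pos_symm _ _).1 h)
        simp [τ, hm, h1, hp, hππ m hm, hp']
    · simp [τ, hm]
  have hτne : ∀ f, τ f ≠ f := by
    rintro ⟨m, b⟩ h
    by_cases hm : val m ∈ passages X
    · simp only [τ, hm, if_true] at h
      have h1 : π m = m := congrArg Prod.fst h
      have h2 := hπ m hm
      rw [h1] at h2
      exact hX.irrefl _ h2
    · simp [τ, hm] at h
  have hτφ : ∀ f, f.1 ≠ a' → φ (τ f) = φ f := by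
    rintro ⟨m, b⟩ hma
    have : h (val (τ (m, b)).1, (τ (m, b)).2) = h (val m, b) := by
      by_cases hm : val m ∈ passages X
      · by_cases hp : pos (val m) (val (π m))
        · simp only [τ, hm, hp, if_true]
          exact (hcross.positive _ _ (hπ m hm) hp b).symm
        · simp only [τ, hm, hp, if_true, if_false]
          exact (hcross.negative _ _ (hπ m hm) hp b).symm
      · have h1 := hreg _ hm fun h => hma (hvalinj (h.trans ha'.symm))
        simp only [τ, hm, if_false]
        cases b
        · exact h1.symm
        · exact h1
    simp only [φ, this]
  have hτa : ∀ f, (τ f).1 = a' → f.1 = a' := by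
    rintro ⟨m, b⟩ h
    by_cases hm : val m ∈ passages X
    · simp only [τ, hm, if_true] at h
      have h1 := hπmem m hm
      rw [h, ha'] at h1
      exact absurd h1 ha
    · simpa [τ, hm] using h
  have hsum' : ∑ f with f.1 ≠ a', φ f = 0 := by
    refine Finset.sum_involution (fun f _ => τ f) ?_ ?_ ?_ ?_
    · intro f hf
      rw [hτφ f (Finset.mem_filter.1 hf).2]
      exact CharTwo.add_self_eq_zero _
    · intro f _ _
      exact hτne f
    · intro f hf
      refine Finset.mem_filter.2 ⟨Finset.mem_univ _, fun h => ?_⟩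
      exact (Finset.mem_filter.1 hf).2 (hτa f h)
    · intro f _
      exact hττ f
  have hsum'' : ∑ f with f.1 = a', φ f = 1 := by
    have h1 : (Finset.univ.filter fun f : (Σ i, MI i) × Bool => f.1 = a') =
        {(a', false), (a', true)} := by
      ext ⟨m, b⟩
      cases b <;> simp
    rw [h1, Finset.sum_pair (by simp)]
    simp only [φ, ha', if_true]
    rw [if_neg fun h => hne h.symm, add_zero]
  have := Finset.sum_filter_add_sum_filter_not Finset.univ
    (fun f : (Σ i, MI i) × Bool => f.1 = a') φ
  rw [hsum, hsum'', hsum'] at this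
  simp at this

end ProjLink

end

noncomputable section

namespace ProjLink

/-! ### Merging two state circles -/

variable {n : ℕ} {len : Fin n → ℕ} {K K' : Type*}

theorem EdgeRule.prodMk {N : Set (CirclePoint len)} {h : CirclePoint len × Bool → K}
    {h' : CirclePoint len × Bool → K'} (hh : EdgeRule N h) (hh' : EdgeRule N h') :
    EdgeRule N fun f => (h f, h' f) :=
  ⟨fun i x y hxy hN => Prod.ext (hh.between i x y hxy hN) (hh'.between i x y hxy hN),
    fun i x o ho hN => Prod.ext (hh.last i x o ho hN) (hh'.last i x o ho hN)⟩

theorem CrossRule.prodMk {X pos : CirclePoint len → CirclePoint len → Prop}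
    {h : CirclePoint len × Bool → K} {h' : CirclePoint len × Bool → K'} (hh : CrossRule X pos h)
    (hh' : CrossRule X pos h') : CrossRule X pos fun f => (h f, h' f) :=
  ⟨fun p q hX hp b => Prod.ext (hh.positive p q hX hp b) (hh'.positive p q hX hp b),
    fun p q hX hp b => Prod.ext (hh.negative p q hX hp b) (hh'.negative p q hX hp b)⟩

/-- A colouring can be made constant on the two halves of an interval, with the values that it has
outside at the end points of the interval. -/
theorem EdgeRule.exists_snap {N : Set (CirclePoint len)} {h : CirclePoint len × Bool → K}
    (hh : EdgeRule N h) {i : Fin n} {x₁ a x₂ : Set.Ico (0 : ℝ) (len i)} (h₁ : x₁ < a) (h₂ : a < x₂)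
    (hx₁ : (⟨i, x₁⟩ : CirclePoint len) ∈ N) (hx₂ : (⟨i, x₂⟩ : CirclePoint len) ∈ N) :
    ∃ k : CirclePoint len × Bool → K, EdgeRule (insert (⟨i, a⟩ : CirclePoint len) N) k ∧
      (∀ p b, (∀ z, x₁ ≤ z → z ≤ x₂ → p ≠ ⟨i, z⟩) → k (p, b) = h (p, b)) ∧
      (∀ z, x₁ ≤ z → z ≤ x₂ → z ≠ a → k (⟨i, z⟩, false) = k (⟨i, z⟩, true)) ∧
      k (⟨i, a⟩, false) = h (⟨i, x₁⟩, false) ∧ k (⟨i, a⟩, true) = h (⟨i, x₂⟩, true) := by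
  classical
  -- The side before `a` belongs to the left half and the side after `a` to the right half; a jump
  -- of colour can thus only occur at `a`.
  let k : CirclePoint len × Bool → K := fun f =>
    if ∃ z, f.1 = ⟨i, z⟩ ∧ x₁ ≤ z ∧ (z < a ∨ z = a ∧ f.2 = false) then h (⟨i, x₁⟩, false)
    else if ∃ z, f.1 = ⟨i, z⟩ ∧ z ≤ x₂ ∧ (a < z ∨ z = a ∧ f.2 = true) then h (⟨i, x₂⟩, true)
    else h f
  have inj : ∀ {z w : Set.Ico (0 : ℝ) (len i)},
      (⟨i, z⟩ : CirclePoint len) = ⟨i, w⟩ → z = w := fun h => eq_of_heq (Sigma.mk.inj h).2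
  have kL : ∀ z b, x₁ ≤ z → (z < a ∨ z = a ∧ b = false) → k (⟨i, z⟩, b) = h (⟨i, x₁⟩, false) :=
    fun z b h1 h2 => if_pos ⟨z, rfl, h1, h2⟩
  have kR : ∀ z b, z ≤ x₂ → (a < z ∨ z = a ∧ b = true) → k (⟨i, z⟩, b) = h (⟨i, x₂⟩, true) := by
    intro z b h1 h2
    have h3 : ¬ ∃ w, (⟨i, z⟩ : CirclePoint len) = ⟨i, w⟩ ∧ x₁ ≤ w ∧ (w < a ∨ w = a ∧ b = false) := by
      rintro ⟨w, hw, -, h3⟩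
      obtain rfl := inj hw
      rcases h2 with h2 | ⟨h2, h4⟩ <;> rcases h3 with h3 | ⟨h3, h5⟩
      · exact lt_asymm h2 h3
      · exact h2.ne h3.symm
      · exact h3.ne h2
      · rw [h4] at h5; exact Bool.noConfusion h5
    exact (if_neg h3).trans (if_pos ⟨z, rfl, h1, h2⟩)
  have kO : ∀ p b, (∀ z, x₁ ≤ z → z ≤ x₂ → p ≠ ⟨i, z⟩) → k (p, b) = h (p, b) := by
    intro p b hp
    refine (if_neg ?_).trans (if_neg ?_)
    · rintro ⟨z, hz, h1, h2⟩
      refine hp z h1 ?_ hz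
      rcases h2 with h2 | ⟨h2, -⟩
      · exact (h2.trans h₂).le
      · exact h2.le.trans h₂.le
    · rintro ⟨z, hz, h1, h2⟩
      refine hp z ?_ h1 hz
      rcases h2 with h2 | ⟨h2, -⟩
      · exact (h₁.trans h2).le
      · exact h₁.le.trans h2.ge
  have kO' : ∀ z b, z < x₁ ∨ x₂ < z → k (⟨i, z⟩, b) = h (⟨i, z⟩, b) := by
    intro z b hz
    refine kO _ _ fun w h1 h2 h3 => ?_
    obtain rfl := inj h3
    rcases hz with hz | hz
    · exact hz.not_ge h1
    · exact hz.not_ge h2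
  have kne : ∀ j z b, j ≠ i → k (⟨j, z⟩, b) = h (⟨j, z⟩, b) := by
    intro j z b hj
    exact kO _ _ fun w _ _ h3 => hj (congrArg Sigma.fst h3)
  refine ⟨k, ⟨?_, ?_⟩, kO, ?_, kL a false h₁.le (Or.inr ⟨rfl, rfl⟩), kR a true h₂.le (Or.inr ⟨rfl, rfl⟩)⟩
  · intro j x y hxy hN
    have hN' : ∀ z, x < z → z < y → (⟨j, z⟩ : CirclePoint len) ∉ N := fun z h3 h4 h5 =>
      hN z h3 h4 (Or.inr h5)
    by_cases hj : j = i
    · subst hj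
      have hxa : ¬ (x < a ∧ a < y) := fun hc => hN a hc.1 hc.2 (Or.inl rfl)
      have hx1 : ¬ (x < x₁ ∧ x₁ < y) := fun hc => hN' x₁ hc.1 hc.2 hx₁
      have hx2 : ¬ (x < x₂ ∧ x₂ < y) := fun hc => hN' x₂ hc.1 hc.2 hx₂
      rcases lt_or_ge x x₁ with h3 | h3
      · rw [kO' x true (Or.inl h3), hh.between _ x y hxy hN']
        have h4 : y ≤ x₁ := not_lt.1 fun h => hx1 ⟨h3, h⟩
        rcases h4.lt_or_eq with h4 | rfl
        · rw [kO' y _ (Or.inl h4)]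
        · exact (kL y false le_rfl (Or.inl h₁)).symm
      · rcases lt_or_ge x a with h4 | h4
        · have h5 : y ≤ a := not_lt.1 fun h => hxa ⟨h4, h⟩
          rw [kL x true h3 (Or.inl h4), kL y false (h3.trans hxy.le)]
          rcases h5.lt_or_eq with h5 | h5
          · exact Or.inl h5
          · exact Or.inr ⟨h5, rfl⟩
        · have h4' : a < x ∨ x = a ∧ true = true := by
            rcases h4.lt_or_eq with h5 | h5
            · exact Or.inl h5
            · exact Or.inr ⟨h5.symm, rfl⟩
          rcases lt_trichotomy x x₂ with h5 | h5 | h5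
          · have h6 : y ≤ x₂ := not_lt.1 fun h => hx2 ⟨h5, h⟩
            rw [kR x true h5.le h4', kR y false h6 (Or.inl (h4.trans_lt hxy))]
          · rw [kR x true h5.le h4', kO' y false (Or.inr (h5 ▸ hxy)), ← h5]
            exact hh.between _ x y hxy hN'
          · rw [kO' x true (Or.inr h5), kO' y false (Or.inr (h5.trans hxy))]
            exact hh.between _ x y hxy hN'
    · rw [kne j x _ hj, kne j y _ hj]
      exact hh.between j x y hxy hN'
  · intro j x o ho hN
    have hN' : ∀ z, x < z → (⟨j, z⟩ : CirclePoint len) ∉ N := fun z h3 h5 =>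
      hN z h3 (Or.inr h5)
    by_cases hj : j = i
    · subst hj
      have hx2 : x₂ ≤ x := not_lt.1 fun h => hN' x₂ h hx₂
      have h3 : k (⟨j, o⟩, false) = h (⟨j, o⟩, false) := by
        have hox : o ≤ x₁ := by
          change (o : ℝ) ≤ x₁
          rw [ho]
          exact x₁.2.1
        rcases hox.lt_or_eq with h4 | rfl
        · exact kO' o _ (Or.inl h4)
        · exact kL o false le_rfl (Or.inl h₁)
      have h4 : k (⟨j, x⟩, true) = h (⟨j, x⟩, true) := by
        rcases hx2.lt_or_eq with h4 | rfl
        · exact kO' x _ (Or.inr h4)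
        · exact kR _ true le_rfl (Or.inl h₂)
      rw [h3, h4]
      exact hh.last j x o ho hN'
    · rw [kne j x _ hj, kne j o _ hj]
      exact hh.last j x o ho hN'
  · intro z h1 h2 h3
    rcases lt_or_gt_of_ne h3 with h4 | h4
    · rw [kL z _ h1 (Or.inl h4), kL z _ h1 (Or.inl h4)]
    · rw [kR z _ h2 (Or.inl h4), kR z _ h2 (Or.inl h4)]

/-- If a colouring obeys all rules except at the points `a` and `b`, which lie on different state
circles, then it obeys the rule at `a` as well. -/
theorem IsCrossingData.regular_of_ne {X pos : CirclePoint len → CirclePoint len → Prop}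
    (hX : IsCrossingData X pos) (hlen : ∀ i, 0 < len i) {k : CirclePoint len × Bool → K}
    {a b : CirclePoint len} (ha : a ∉ passages X) (hb : b ∉ passages X)
    (hab : circleOf X pos (a, false) ≠ circleOf X pos (b, false))
    (hedge : EdgeRule (insert b (insert a (passages X))) k)
    (hreg : ∀ p, p ∉ passages X → p ≠ a → p ≠ b → k (p, false) = k (p, true))
    (hcross : CrossRule X pos k) : k (a, false) = k (a, true) := by
  classical
  have hc := isColouring_circleOf X pos
  -- Forgetting the colour outside the state circle of `a` hides the possible jump at `b`, which
  -- lies on another circle. What is left is a colouring cut only at `a`, the situation of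
  -- `eq_of_cut`.
  let F : StateCircle X pos × K → Option K := fun c =>
    if c.1 = circleOf X pos (a, false) then some c.2 else none
  let h : CirclePoint len × Bool → Option K := fun f => F (circleOf X pos f, k f)
  have h1 : h (b, false) = h (b, true) := by
    have h2 : ∀ s, h (b, s) = none := by
      intro s
      refine if_neg fun h3 => hab ?_
      cases s
      · exact h3.symm
      · rw [← h3]
        exact (hc.regular b hb).symm
    rw [h2, h2]
  have hE : EdgeRule (insert a (passages X)) h := by
    have := ((hc.edge.mono (N' := insert b (insert a (passages X)))
      ((Set.subset_insert _ _).trans (Set.subset_insert _ _))).prodMk hedge).comp F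
    exact EdgeRule.of_insert (h := h) this h1
  have h2 := hX.eq_of_cut hlen ha hE (fun p hp hpa => by
    by_cases hpb : p = b
    · rw [hpb]; exact h1
    · change F (_, _) = F (_, _)
      rw [hc.regular p hp, hreg p hp hpa hpb]) ((hc.cross.prodMk hcross).comp F)
  have h3 : h (a, false) = some (k (a, false)) := if_pos rfl
  have h4 : h (a, true) = some (k (a, true)) := if_pos (hc.regular a ha).symm
  rw [h3, h4] at h2
  exact Option.some.inj h2

/-- If two new crossings of opposite signs are introduced between two strands that belong to
different state circles, then these two state circles merge. -/
theorem IsCrossingData.exists_merge {X₁ pos₁ X₂ pos₂ : CirclePoint len → CirclePoint len → Prop}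
    (hX : IsCrossingData X₁ pos₁) (hlen : ∀ i, 0 < len i) {i j : Fin n}
    {x₁ a x₂ : Set.Ico (0 : ℝ) (len i)} {y₁ b y₂ : Set.Ico (0 : ℝ) (len j)}
    (hx₁ : x₁ < a) (hx₂ : a < x₂) (hy₁ : y₁ < b) (hy₂ : b < y₂)
    (hJa : ∀ z, x₁ ≤ z → z ≤ x₂ → (⟨i, z⟩ : CirclePoint len) ∉ passages X₁)
    (hJb : ∀ z, y₁ ≤ z → z ≤ y₂ → (⟨j, z⟩ : CirclePoint len) ∉ passages X₁)
    (hdisj : ∀ z w, x₁ ≤ z → z ≤ x₂ → y₁ ≤ w → w ≤ y₂ → (⟨i, z⟩ : CirclePoint len) ≠ ⟨j, w⟩)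
    (hpass : ∀ p ∈ passages X₂, p ∈ passages X₁ ∨ p = ⟨i, x₁⟩ ∨ p = ⟨i, x₂⟩ ∨ p = ⟨j, y₁⟩ ∨
      p = ⟨j, y₂⟩)
    (hold : ∀ p q, X₁ p q → X₂ p q ∧ (pos₂ p q ↔ pos₁ p q))
    {w₁ w₂ : CirclePoint len}
    (hw : (w₁ = ⟨j, y₁⟩ ∧ w₂ = ⟨j, y₂⟩) ∨ (w₁ = ⟨j, y₂⟩ ∧ w₂ = ⟨j, y₁⟩))
    (hXw₁ : X₂ ⟨i, x₁⟩ w₁) (hXw₂ : X₂ ⟨i, x₂⟩ w₂) (hsymm : ∀ p q, X₂ p q → X₂ q p)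
    (hsign : pos₂ ⟨i, x₁⟩ w₁ ↔ ¬ pos₂ ⟨i, x₂⟩ w₂)
    (hab : circleOf X₁ pos₁ (⟨i, a⟩, false) ≠ circleOf X₁ pos₁ (⟨j, b⟩, false)) :
    ∃ f : StateCircle X₁ pos₁ → StateCircle X₂ pos₂,
      Function.Surjective f ∧ ¬ Function.Injective f := by
  have hc := isColouring_circleOf X₂ pos₂
  set h := circleOf X₂ pos₂ with hh
  have hpy : (⟨j, y₁⟩ : CirclePoint len) ∈ passages X₂ ∧ (⟨j, y₂⟩ : CirclePoint len) ∈ passages X₂ := by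
    rcases hw with ⟨rfl, rfl⟩ | ⟨rfl, rfl⟩
    · exact ⟨⟨_, hsymm _ _ hXw₁⟩, ⟨_, hsymm _ _ hXw₂⟩⟩
    · exact ⟨⟨_, hsymm _ _ hXw₂⟩, ⟨_, hsymm _ _ hXw₁⟩⟩
  have injx : ∀ {l : Fin n} {z w : Set.Ico (0 : ℝ) (len l)},
      (⟨l, z⟩ : CirclePoint len) = ⟨l, w⟩ → z = w := fun h => eq_of_heq (Sigma.mk.inj h).2
  -- the interiors of the two intervals contain no passages
  have hIa : ∀ z, x₁ < z → z < x₂ → (⟨i, z⟩ : CirclePoint len) ∉ passages X₂ := by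
    intro z h1 h2 h3
    rcases hpass _ h3 with h4 | h4 | h4 | h4 | h4
    · exact hJa z h1.le h2.le h4
    · exact h1.ne (injx h4).symm
    · exact h2.ne (injx h4)
    · exact hdisj z y₁ h1.le h2.le le_rfl (hy₁.trans hy₂).le h4
    · exact hdisj z y₂ h1.le h2.le (hy₁.trans hy₂).le le_rfl h4
  have hIb : ∀ z, y₁ < z → z < y₂ → (⟨j, z⟩ : CirclePoint len) ∉ passages X₂ := by
    intro z h1 h2 h3
    rcases hpass _ h3 with h4 | h4 | h4 | h4 | h4
    · exact hJb z h1.le h2.le h4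
    · exact hdisj x₁ z le_rfl (hx₁.trans hx₂).le h1.le h2.le h4.symm
    · exact hdisj x₂ z (hx₁.trans hx₂).le le_rfl h1.le h2.le h4.symm
    · exact h1.ne (injx h4).symm
    · exact h2.ne (injx h4)
  -- The new crossings are undone in the colouring: each half of the two intervals receives the
  -- colour found just outside it. The result obeys the rules of the old state except possibly at
  -- `a` and `b`.
  obtain ⟨k₁, hk₁E, hk₁o, hk₁r, hk₁f, hk₁t⟩ :=
    hc.edge.exists_snap hx₁ hx₂ ⟨_, hXw₁⟩ ⟨_, hXw₂⟩
  obtain ⟨k, hkE, hko, hkr, hkf, hkt⟩ :=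
    hk₁E.exists_snap hy₁ hy₂ (Or.inr hpy.1) (Or.inr hpy.2)
  have hka : ∀ z s, x₁ ≤ z → z ≤ x₂ → k (⟨i, z⟩, s) = k₁ (⟨i, z⟩, s) := fun z s h1 h2 =>
    hko _ _ fun w h3 h4 => hdisj z w h1 h2 h3 h4
  have hk1b : ∀ z s, y₁ ≤ z → z ≤ y₂ → k₁ (⟨j, z⟩, s) = h (⟨j, z⟩, s) := fun z s h1 h2 =>
    hk₁o _ _ fun w h3 h4 => (hdisj w z h3 h4 h1 h2).symm
  have hkaf : k (⟨i, a⟩, false) = h (⟨i, x₁⟩, false) := by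
    rw [hka a _ hx₁.le hx₂.le, hk₁f]
  have hkat : k (⟨i, a⟩, true) = h (⟨i, x₂⟩, true) := by
    rw [hka a _ hx₁.le hx₂.le, hk₁t]
  have hkbf : k (⟨j, b⟩, false) = h (⟨j, y₁⟩, false) := by
    rw [hkf, hk1b _ _ le_rfl (hy₁.trans hy₂).le]
  have hkbt : k (⟨j, b⟩, true) = h (⟨j, y₂⟩, true) := by
    rw [hkt, hk1b _ _ (hy₁.trans hy₂).le le_rfl]
  have hkout : ∀ p s, (∀ z, x₁ ≤ z → z ≤ x₂ → p ≠ ⟨i, z⟩) → (∀ z, y₁ ≤ z → z ≤ y₂ → p ≠ ⟨j, z⟩) →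
      k (p, s) = h (p, s) := fun p s h1 h2 => by rw [hko p s h2, hk₁o p s h1]
  have hkpass : ∀ p s, p ∈ passages X₁ → k (p, s) = h (p, s) := by
    intro p s hp
    refine hkout p s (fun z h1 h2 h3 => ?_) (fun z h1 h2 h3 => ?_)
    · exact hJa z h1 h2 (h3 ▸ hp)
    · exact hJb z h1 h2 (h3 ▸ hp)
  have hkreg : ∀ p, p ∉ passages X₁ → p ≠ ⟨i, a⟩ → p ≠ ⟨j, b⟩ → k (p, false) = k (p, true) := by
    intro p hp hpa hpb
    by_cases h1 : ∃ z, x₁ ≤ z ∧ z ≤ x₂ ∧ p = ⟨i, z⟩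
    · obtain ⟨z, h1, h2, rfl⟩ := h1
      rw [hka z _ h1 h2, hka z _ h1 h2]
      exact hk₁r z h1 h2 fun h => hpa (by rw [h])
    · by_cases h2 : ∃ z, y₁ ≤ z ∧ z ≤ y₂ ∧ p = ⟨j, z⟩
      · obtain ⟨z, h2, h3, rfl⟩ := h2
        exact hkr z h2 h3 fun h => hpb (by rw [h])
      · push Not at h1 h2
        rw [hkout p _ h1 h2, hkout p _ h1 h2]
        refine hc.regular p fun h3 => ?_
        have hx12 := (hx₁.trans hx₂).le
        have hy12 := (hy₁.trans hy₂).le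
        rcases hpass p h3 with h4 | h4 | h4 | h4 | h4
        · exact hp h4
        · exact h1 _ le_rfl hx12 h4
        · exact h1 _ hx12 le_rfl h4
        · exact h2 _ le_rfl hy12 h4
        · exact h2 _ hy12 le_rfl h4
  have hkcross : CrossRule X₁ pos₁ k := by
    constructor
    · intro p q hpq hp s
      rw [hkpass p s ⟨q, hpq⟩, hkpass q _ ⟨p, hX.symm _ _ hpq⟩]
      exact hc.cross.positive p q (hold p q hpq).1 ((hold p q hpq).2.2 hp) s
    · intro p q hpq hp s
      rw [hkpass p s ⟨q, hpq⟩, hkpass q _ ⟨p, hX.symm _ _ hpq⟩]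
      exact hc.cross.negative p q (hold p q hpq).1 (fun h => hp ((hold p q hpq).2.1 h)) s
  have haX : (⟨i, a⟩ : CirclePoint len) ∉ passages X₁ := hJa a hx₁.le hx₂.le
  have hbX : (⟨j, b⟩ : CirclePoint len) ∉ passages X₁ := hJb b hy₁.le hy₂.le
  -- The four new passages are admitted as cuts at first, and then removed one by one because `k`
  -- does not jump there.
  have hkE' : EdgeRule (insert (⟨j, b⟩ : CirclePoint len) (insert ⟨i, a⟩ (passages X₁))) k := by
    have hx12 := (hx₁.trans hx₂).le
    have hy12 := (hy₁.trans hy₂).le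
    have e1 : EdgeRule (insert ⟨i, x₁⟩ (insert ⟨i, x₂⟩ (insert ⟨j, y₁⟩ (insert ⟨j, y₂⟩
        (insert (⟨j, b⟩ : CirclePoint len) (insert ⟨i, a⟩ (passages X₁))))))) k := by
      refine hkE.mono fun p hp => ?_
      simp only [Set.mem_insert_iff] at hp ⊢
      rcases hp with h1 | h1 | h1
      · tauto
      · tauto
      · have := hpass p h1
        tauto
    have r1 : ∀ z, x₁ ≤ z → z ≤ x₂ → z ≠ a → k (⟨i, z⟩, false) = k (⟨i, z⟩, true) := by
      intro z h1 h2 h3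
      exact hkreg _ (hJa z h1 h2) (fun h => h3 (injx h))
        (hdisj z b h1 h2 hy₁.le hy₂.le)
    have r2 : ∀ z, y₁ ≤ z → z ≤ y₂ → z ≠ b → k (⟨j, z⟩, false) = k (⟨j, z⟩, true) := by
      intro z h1 h2 h3
      exact hkreg _ (hJb z h1 h2) (hdisj a z hx₁.le hx₂.le h1 h2).symm (fun h => h3 (injx h))
    exact (((e1.of_insert (r1 _ le_rfl hx12 hx₁.ne)).of_insert (r1 _ hx12 le_rfl hx₂.ne')).of_insert
      (r2 _ le_rfl hy12 hy₁.ne)).of_insert (r2 _ hy12 le_rfl hy₂.ne')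
  -- This is where the hypothesis of different circles enters: it rules out jumps at `a` and `b`, so
  -- the outer ends of each interval have equal colours in the new state.
  have hka_reg : k (⟨i, a⟩, false) = k (⟨i, a⟩, true) :=
    hX.regular_of_ne hlen haX hbX hab hkE' hkreg hkcross
  have hkb_reg : k (⟨j, b⟩, false) = k (⟨j, b⟩, true) :=
    hX.regular_of_ne hlen hbX haX hab.symm (by rwa [Set.insert_comm])
      (fun p h1 h2 h3 => hkreg p h1 h3 h2) hkcross
  have hcol : IsColouring X₁ pos₁ k := by
    refine ⟨(hkE'.of_insert hkb_reg).of_insert hka_reg, fun p hp => ?_, hkcross⟩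
    by_cases h1 : p = ⟨i, a⟩
    · rw [h1]; exact hka_reg
    · by_cases h2 : p = ⟨j, b⟩
      · rw [h2]; exact hkb_reg
      · exact hkreg p hp h1 h2
  -- the colours near the two new crossings
  have e1 : h (⟨i, x₁⟩, true) = h (⟨i, x₂⟩, false) := hc.edge.between i _ _ (hx₁.trans hx₂) hIa
  have e2 : h (⟨j, y₁⟩, true) = h (⟨j, y₂⟩, false) := hc.edge.between j _ _ (hy₁.trans hy₂) hIb
  rw [hkaf, hkat] at hka_reg
  rw [hkbf, hkbt] at hkb_reg
  -- One splicing swaps the sides and the other keeps them. Together with the two equalities just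
  -- obtained and the two edges between the crossings, this identifies all eight sides at the new
  -- crossings.
  obtain ⟨c1, c2, c3, c4, c5⟩ : h (⟨i, x₁⟩, true) = h (⟨i, x₁⟩, false) ∧
      h (⟨i, x₂⟩, false) = h (⟨i, x₁⟩, false) ∧ h (⟨j, y₁⟩, true) = h (⟨i, x₁⟩, false) ∧
      h (⟨j, y₁⟩, false) = h (⟨i, x₁⟩, false) ∧ h (⟨j, y₂⟩, true) = h (⟨i, x₁⟩, false) := by
    by_cases hp : pos₂ ⟨i, x₁⟩ w₁
    · have s1 := hc.cross.positive _ _ hXw₁ hp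
      have s2 := hc.cross.negative _ _ hXw₂ (hsign.1 hp)
      have s1f := s1 false
      have s1t := s1 true
      have s2f := s2 false
      have s2t := s2 true
      simp only [Bool.not_false, Bool.not_true] at s1f s1t
      rcases hw with ⟨rfl, rfl⟩ | ⟨rfl, rfl⟩ <;> grind
    · have hp2 : pos₂ ⟨i, x₂⟩ w₂ := by
        by_contra h2
        exact hp (hsign.2 h2)
      have s1 := hc.cross.negative _ _ hXw₁ hp
      have s2 := hc.cross.positive _ _ hXw₂ hp2
      have s1f := s1 false
      have s1t := s1 true
      have s2f := s2 false
      have s2t := s2 true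
      simp only [Bool.not_false, Bool.not_true] at s2f s2t
      rcases hw with ⟨rfl, rfl⟩ | ⟨rfl, rfl⟩ <;> grind
  refine ⟨hcol.lift, ?_, ?_⟩
  · intro c
    obtain ⟨⟨p, s⟩, rfl⟩ := circleOf_surjective X₂ pos₂ c
    -- All colours inside the two intervals coincide with that of the merged circle, which the
    -- circle of `a` attains; outside them `k` agrees with `h`.
    have hκ : ∀ {p s}, h (p, s) = h (⟨i, x₁⟩, false) → ∃ c, hcol.lift c = h (p, s) := fun {p s} hp =>
      ⟨circleOf X₁ pos₁ (⟨i, a⟩, false), by rw [hcol.lift_circleOf, hkaf, hp]⟩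
    by_cases h1 : ∃ z, x₁ ≤ z ∧ z ≤ x₂ ∧ p = ⟨i, z⟩
    · obtain ⟨z, h1, h2, rfl⟩ := h1
      apply hκ
      rcases h1.lt_or_eq with h1 | rfl
      · rcases h2.lt_or_eq with h2 | rfl
        · have h3 := hc.regular _ (hIa z h1 h2)
          have h4 := hc.edge.between i _ _ h1 fun w h5 h6 => hIa w h5 (h6.trans h2)
          cases s
          · rw [← h4, c1]
          · rw [← h3, ← h4, c1]
        · cases s
          · exact c2
          · exact hka_reg.symm
      · cases s
        · rfl
        · exact c1
    · by_cases h2 : ∃ z, y₁ ≤ z ∧ z ≤ y₂ ∧ p = ⟨j, z⟩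
      · obtain ⟨z, h7, h8, rfl⟩ := h2
        apply hκ
        rcases h7.lt_or_eq with h1 | rfl
        · rcases h8.lt_or_eq with h2 | rfl
          · have h3 := hc.regular _ (hIb z h1 h2)
            have h4 := hc.edge.between j _ _ h1 fun w h5 h6 => hIb w h5 (h6.trans h2)
            cases s
            · rw [← h4, c3]
            · rw [← h3, ← h4, c3]
          · cases s
            · rw [← e2, c3]
            · exact c5
        · cases s
          · exact c4
          · exact c3
      · push Not at h1 h2
        exact ⟨circleOf X₁ pos₁ (p, s), by rw [hcol.lift_circleOf, hkout p s h1 h2]⟩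
  · intro hinj
    apply hab
    apply hinj
    rw [hcol.lift_circleOf, hcol.lift_circleOf, hkaf, hkbf, c4]

end ProjLink

end

noncomputable section

namespace ProjLink

namespace Diagram

variable (D : Diagram)

/-! ### State circles of a diagram and vertices of its all-A ribbon graph -/

/-- Two different points are mapped to the same crossing. -/
def Crosses (p q : D.net.Point) : Prop := p ≠ q ∧ D.net.toProj p = D.net.toProj q

/-- The crossing of the strands at `p` and `q` is positive. -/
def PositivePair (p q : D.net.Point) : Prop :=
  (D.isOver p ∧ 0 < det₂ (D.net.velocity p) (D.net.velocity q)) ∨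
  (D.isOver q ∧ 0 < det₂ (D.net.velocity q) (D.net.velocity p))

/-- The circles of the all-A state of a diagram. -/
abbrev Circle : Type := StateCircle D.Crosses D.PositivePair

theorem mem_passages {p : D.net.Point} : p ∈ passages D.Crosses ↔ D.net.IsMultiple p := by
  constructor
  · rintro ⟨q, h1, h2⟩
    exact ⟨q, h1.symm, h2.symm⟩
  · rintro ⟨q, h1, h2⟩
    exact ⟨q, h1.symm, h2.symm⟩

theorem isCrossingData : IsCrossingData D.Crosses D.PositivePair where
  symm p q h := ⟨h.1.symm, h.2.symm⟩
  irrefl p h := h.1 rfl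
  unique p q r h h' := D.double p q r h.1.symm h'.1.symm h.2.symm h'.2.symm
  pos_symm p q := or_comm
  finite := D.finite_multiple.subset fun _ hp => D.mem_passages.1 hp
  zero p hp h := by
    refine (D.interior p (D.mem_passages.1 h)).1 ?_
    rw [hp, Int.fract_zero]

instance : Finite D.Circle := finite_stateCircle D.net.len_pos D.isCrossingData.finite

/-- The first passage after the parameter `x`. -/
def succPassage (i : Fin D.net.num) (h : Nonempty (D.PassageOn i)) (x : Set.Ico (0 : ℝ) (D.net.len i)) :
    D.PassageOn i :=
  (exists_isCyclicSucc fun z : D.PassageOn i => x < z.1).choose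

theorem isCyclicSucc_succPassage (i : Fin D.net.num) (h : Nonempty (D.PassageOn i))
    (x : Set.Ico (0 : ℝ) (D.net.len i)) :
    IsCyclicSucc (fun z : D.PassageOn i => x < z.1) (D.succPassage i h x) :=
  (exists_isCyclicSucc fun z : D.PassageOn i => x < z.1).choose_spec

theorem next_eq {i : Fin D.net.num} (h : Nonempty (D.PassageOn i)) (x : D.PassageOn i) :
    D.next ⟨i, x⟩ = ⟨i, D.succPassage i h x.1⟩ := by
  have h1 : D.nextOn i x = D.succPassage i h x.1 :=
    (isCyclicSucc_cyclicSucc x).unique (D.isCyclicSucc_succPassage i h x.1)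
  rw [← h1]
  rfl

/-- The vertex with a given flag. -/
def vertexOfFlag (f : D.HalfEdge) : D.allA.Vertex := Sum.inl (Quot.mk _ f)

theorem vertexOfFlag_otherHalf (f : D.HalfEdge) :
    D.vertexOfFlag (D.otherHalf f) = D.vertexOfFlag f :=
  congrArg Sum.inl (Quot.sound (r := fun f g : D.allA.Flag => g = D.allA.arc f ∨ g = D.allA.segment f)
    (a := f) (b := D.otherHalf f) (Or.inl rfl)).symm

theorem vertexOfFlag_spliceA (f : D.HalfEdge) :
    D.vertexOfFlag (D.spliceA f) = D.vertexOfFlag f :=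
  congrArg Sum.inl (Quot.sound (r := fun f g : D.allA.Flag => g = D.allA.arc f ∨ g = D.allA.segment f)
    (a := f) (b := D.spliceA f) (Or.inr rfl)).symm

/-- The vertex bounded by a component without crossings. -/
def isolatedVertex (i : Fin D.net.num) (h : IsEmpty (D.PassageOn i)) : D.allA.Vertex :=
  Sum.inr ⟨i, h⟩

open Classical in
/-- The vertex after a point. -/
def vertexAfter (p : D.net.Point) : D.allA.Vertex :=
  if h : Nonempty (D.PassageOn p.1) then D.vertexOfFlag (⟨p.1, D.succPassage p.1 h p.2⟩, false)
  else D.isolatedVertex p.1 (not_nonempty_iff.1 h)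

theorem vertexAfter_of_nonempty {i : Fin D.net.num} (h : Nonempty (D.PassageOn i))
    (x : Set.Ico (0 : ℝ) (D.net.len i)) :
    D.vertexAfter ⟨i, x⟩ = D.vertexOfFlag (⟨i, D.succPassage i h x⟩, false) := dif_pos h

theorem vertexAfter_of_not_nonempty {i : Fin D.net.num} (h : ¬ Nonempty (D.PassageOn i))
    (x : Set.Ico (0 : ℝ) (D.net.len i)) :
    D.vertexAfter ⟨i, x⟩ = D.isolatedVertex i (not_nonempty_iff.1 h) := dif_neg h

open Classical in
/-- The vertex whose boundary passes through a side of a point. -/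
def vertexOf (f : D.net.Point × Bool) : D.allA.Vertex :=
  if h : D.net.IsMultiple f.1 then D.vertexOfFlag (⟨f.1.1, f.1.2, h⟩, f.2) else D.vertexAfter f.1

theorem vertexOf_passage (p : D.Passage) (b : Bool) :
    D.vertexOf (D.pt p, b) = D.vertexOfFlag (p, b) := dif_pos p.2.2

theorem vertexOf_of_not_isMultiple {p : D.net.Point} (hp : ¬ D.net.IsMultiple p) (b : Bool) :
    D.vertexOf (p, b) = D.vertexAfter p := dif_neg hp

/-- At a crossing, the arc of the ribbon graph leads from the leaving flag to the arriving flag of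
the next passage. So points on and off crossings can be treated uniformly. -/
theorem vertexOf_true (p : D.net.Point) : D.vertexOf (p, true) = D.vertexAfter p := by
  by_cases h : D.net.IsMultiple p
  · have hne : Nonempty (D.PassageOn p.1) := ⟨⟨p.2, h⟩⟩
    have h1 := D.vertexOfFlag_otherHalf (⟨p.1, p.2, h⟩, true)
    rw [D.vertexAfter_of_nonempty hne]
    refine (D.vertexOf_passage ⟨p.1, p.2, h⟩ true).trans (h1.symm.trans ?_)
    simp only [otherHalf]
    rw [D.next_eq hne]
  · exact dif_neg h

/-- The arcs of the ribbon graph give the edge rules and its marking segments the crossing rules.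
Being a colouring, `vertexOf` factors through the state circles; isolated vertices are covered by
components without passages. -/
theorem isColouring_vertexOf : IsColouring D.Crosses D.PositivePair D.vertexOf := by
  refine ⟨⟨?_, ?_⟩, ?_, ⟨?_, ?_⟩⟩
  · intro i x y hxy hN
    rw [vertexOf_true]
    by_cases hy : D.net.IsMultiple ⟨i, y⟩
    · have hne : Nonempty (D.PassageOn i) := ⟨⟨y, hy⟩⟩
      rw [D.vertexAfter_of_nonempty hne]
      refine Eq.trans ?_ (D.vertexOf_passage ⟨i, y, hy⟩ false).symm
      congr 3
      refine (D.isCyclicSucc_succPassage i hne x).unique (Or.inl ⟨hxy, fun z hz => ?_⟩)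
      exact not_lt.1 fun h => hN z.1 hz h (D.mem_passages.2 z.2)
    · rw [D.vertexOf_of_not_isMultiple hy]
      by_cases hne : Nonempty (D.PassageOn i)
      · rw [D.vertexAfter_of_nonempty hne, D.vertexAfter_of_nonempty hne]
        congr 3
        have h1 : (fun z : D.PassageOn i => x < z.1) = fun z : D.PassageOn i => y < z.1 := by
          funext z
          refine propext ⟨fun h => ?_, fun h => hxy.trans h⟩
          refine lt_of_le_of_ne (not_lt.1 fun h' => hN z.1 h h' (D.mem_passages.2 z.2)) ?_
          rintro rfl
          exact hy z.2
        have h2 := D.isCyclicSucc_succPassage i hne x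
        rw [h1] at h2
        exact h2.unique (D.isCyclicSucc_succPassage i hne y)
      · rw [D.vertexAfter_of_not_nonempty hne, D.vertexAfter_of_not_nonempty hne]
  · intro i x o ho hN
    have h0 : ¬ D.net.IsMultiple ⟨i, o⟩ := fun h => D.isCrossingData.zero _ ho (D.mem_passages.2 h)
    rw [vertexOf_true, D.vertexOf_of_not_isMultiple h0]
    by_cases hne : Nonempty (D.PassageOn i)
    · rw [D.vertexAfter_of_nonempty hne, D.vertexAfter_of_nonempty hne]
      congr 3
      refine (D.isCyclicSucc_succPassage i hne x).unique (Or.inr ⟨fun z hz => ?_, fun z => ?_⟩)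
      · exact hN z.1 hz (D.mem_passages.2 z.2)
      · rcases D.isCyclicSucc_succPassage i hne o with ⟨-, h2⟩ | ⟨-, h2⟩
        · refine h2 z (lt_of_le_of_ne ?_ ?_)
          · change (o : ℝ) ≤ z.1
            rw [ho]
            exact z.1.2.1
          · rintro rfl
            exact h0 z.2
        · exact h2 z
    · rw [D.vertexAfter_of_not_nonempty hne, D.vertexAfter_of_not_nonempty hne]
  · intro p hp
    rw [vertexOf_true]
    exact D.vertexOf_of_not_isMultiple (fun h => hp (D.mem_passages.2 h)) _
  all_goals
    intro p q hpq hpos b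
    have hp : D.net.IsMultiple p := D.mem_passages.1 ⟨q, hpq⟩
    have hq : D.net.IsMultiple q := D.mem_passages.1 ⟨p, D.isCrossingData.symm _ _ hpq⟩
    let p' : D.Passage := ⟨p.1, p.2, hp⟩
    let q' : D.Passage := ⟨q.1, q.2, hq⟩
    have hpart : D.partner p' = q' := by
      apply D.pt_injective
      refine D.double p _ _ ?_ hpq.1.symm (D.toProj_partner p') hpq.2.symm
      exact fun h => D.partner_ne p' (D.pt_injective h)
    have hpos' : D.Positive p' ↔ D.PositivePair p q := by
      rw [Positive, hpart]
      exact Iff.rfl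
    have h1 : D.vertexOf (p, b) = D.vertexOfFlag (p', b) := D.vertexOf_passage p' b
    have h2 : ∀ b, D.vertexOf (q, b) = D.vertexOfFlag (q', b) := fun b => D.vertexOf_passage q' b
    rw [h1, h2, ← D.vertexOfFlag_spliceA, spliceA, hpart]
    simp [hpos', hpos]

theorem vertexOf_surjective : Function.Surjective D.vertexOf := by
  rintro (f | ⟨i, hi⟩)
  · induction f using Quot.ind with
    | mk f => exact ⟨(D.pt f.1, f.2), D.vertexOf_passage f.1 f.2⟩
  · refine ⟨(D.net.basePoint i, true), ?_⟩
    rw [vertexOf_true]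
    exact dif_neg (not_nonempty_iff.2 hi)

theorem card_vertex_eq_one (h : Subsingleton D.Circle) (hne : Nonempty D.net.Point) :
    Nat.card D.allA.Vertex = 1 := by
  rw [Nat.card_eq_one_iff_unique]
  obtain ⟨p⟩ := hne
  refine ⟨⟨fun v w => ?_⟩, ⟨D.vertexOf (p, true)⟩⟩
  obtain ⟨f, rfl⟩ := D.vertexOf_surjective v
  obtain ⟨g, rfl⟩ := D.vertexOf_surjective w
  exact D.isColouring_vertexOf.eq_of_circleOf_eq (Subsingleton.elim _ _)

end Diagram

end ProjLink

end

noncomputable section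

namespace ProjLink

/-! ### Transport of colourings -/

section Transport

variable {n : ℕ} {len len' : Fin n → ℕ} {K : Type*}

/-- Order isomorphisms of the parameter intervals act on points. -/
def mapPoint (e : ∀ i, Set.Ico (0 : ℝ) (len' i) ≃o Set.Ico (0 : ℝ) (len i)) (p : CirclePoint len') :
    CirclePoint len := ⟨p.1, e p.1 p.2⟩

/-- Colourings depend only on the order along each component and on the crossing data, so they pull
back under reparametrization. -/
theorem IsColouring.comp_mapPoint {X pos : CirclePoint len → CirclePoint len → Prop}
    {X' pos' : CirclePoint len' → CirclePoint len' → Prop} {h : CirclePoint len × Bool → K}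
    (hh : IsColouring X pos h) (e : ∀ i, Set.Ico (0 : ℝ) (len' i) ≃o Set.Ico (0 : ℝ) (len i))
    (hX : ∀ p q, X' p q ↔ X (mapPoint e p) (mapPoint e q))
    (hpos : ∀ p q, X' p q → (pos' p q ↔ pos (mapPoint e p) (mapPoint e q))) :
    IsColouring X' pos' fun f => h (mapPoint e f.1, f.2) := by
  have hpass : ∀ i z, (⟨i, z⟩ : CirclePoint len) ∈ passages X →
      (⟨i, (e i).symm z⟩ : CirclePoint len') ∈ passages X' := by
    rintro i z ⟨⟨j, w⟩, hq⟩
    refine ⟨⟨j, (e j).symm w⟩, (hX _ _).2 ?_⟩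
    simpa [mapPoint] using hq
  have h0 : ∀ i (o : Set.Ico (0 : ℝ) (len' i)), (o : ℝ) = 0 → (e i o : ℝ) = 0 := by
    intro i o ho
    have hb : ∀ w, o ≤ w := by
      intro w
      change (o : ℝ) ≤ w
      rw [ho]
      exact w.2.1
    let w : Set.Ico (0 : ℝ) (len i) := ⟨0, le_rfl, (e i o).2.1.trans_lt (e i o).2.2⟩
    have h1 : e i o ≤ w := by
      have := (e i).monotone (hb ((e i).symm w))
      rwa [(e i).apply_symm_apply] at this
    exact le_antisymm h1 (e i o).2.1
  refine ⟨⟨?_, ?_⟩, ?_, ⟨?_, ?_⟩⟩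
  · intro i x y hxy hN
    refine hh.edge.between i _ _ ((e i).strictMono hxy) fun z h1 h2 h3 => ?_
    refine hN ((e i).symm z) ?_ ?_ (hpass i z h3)
    · rwa [(e i).lt_symm_apply]
    · rwa [(e i).symm_apply_lt]
  · intro i x o ho hN
    refine hh.edge.last i _ _ (h0 i o ho) fun z h1 h3 => ?_
    refine hN ((e i).symm z) ?_ (hpass i z h3)
    rwa [(e i).lt_symm_apply]
  · intro p hp
    refine hh.regular _ fun h => hp ?_
    have := hpass _ _ h
    rwa [(e p.1).symm_apply_apply] at this
  · intro p q hpq hp b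
    exact hh.cross.positive _ _ ((hX p q).1 hpq) ((hpos p q hpq).1 hp) b
  · intro p q hpq hp b
    exact hh.cross.negative _ _ ((hX p q).1 hpq) (fun h => hp ((hpos p q hpq).2 h)) b

end Transport

/-! ### Refined diagrams -/

theorem det₂_smul_smul (a b : ℝ) (u v : ℝ × ℝ) : det₂ (a • u) (b • v) = a * b * det₂ u v := by
  simp only [det₂, Prod.smul_fst, Prod.smul_snd, smul_eq_mul]
  ring

namespace PolygonSystem.Refinement

theorem param_eq_of_mem_Icc {d : ℕ} {F : PolygonSystem d} (R : F.Refinement) {i : Fin F.num} {m : ℕ}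
    {x : ℝ} (h : x ∈ Set.Icc (m : ℝ) (m + 1)) :
    R.param i x = (m + 1 - x) * R.b i m + (x - m) * R.b i (m + 1) := by
  rcases h.2.lt_or_eq with h1 | h1
  · have hn : ⌊x⌋₊ = m := (Nat.floor_eq_iff ((Nat.cast_nonneg m).trans h.1)).2 ⟨h.1, h1⟩
    have hfr : Int.fract x = x - m := by
      rw [Int.fract, ← natCast_floor_eq_intCast_floor ((Nat.cast_nonneg m).trans h.1), hn]
    rw [param, hfr, hn]
    ring
  · have h2 := R.param_natCast i (m + 1)
    push_cast at h2
    rw [h1, h2]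
    ring

theorem continuousOn_param {d : ℕ} {F : PolygonSystem d} (R : F.Refinement) (i : Fin F.num) (n : ℕ) :
    ContinuousOn (R.param i) (Set.Icc (0 : ℝ) n) := by
  induction n with
  | zero => simp
  | succ n ih =>
    have h1 : ContinuousOn (R.param i) (Set.Icc (n : ℝ) (n + 1)) := by
      refine ContinuousOn.congr (f := fun x : ℝ =>
        (n + 1 - x) * R.b i n + (x - n) * R.b i (n + 1)) (by fun_prop) fun x hx =>
        R.param_eq_of_mem_Icc hx
    have h2 := ih.union_of_isClosed h1 isClosed_Icc isClosed_Icc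
    rw [Set.Icc_union_Icc_eq_Icc (Nat.cast_nonneg n) (by linarith)] at h2
    exact_mod_cast h2

variable {F : PolygonSystem 3} (R : F.Refinement)

/-- The parameter as an order isomorphism. -/
def paramIso (i : Fin F.num) : Set.Ico (0 : ℝ) (R.len i) ≃o Set.Ico (0 : ℝ) (F.len i) :=
  StrictMono.orderIsoOfSurjective (fun x => ⟨R.param i x, R.param_mem_Ico x.2⟩)
    (fun x y hxy => R.param_strictMonoOn i x.2.1 y.2.1 hxy)
    (fun y => by
      obtain ⟨x, hx, h⟩ := R.exists_param y.2
      exact ⟨⟨x, hx⟩, Subtype.ext h⟩)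

theorem exists_velocity_system (p : R.system.Point) :
    ∃ c : ℝ, 0 < c ∧ R.system.velocity p = c • F.velocity (R.point p) := by
  refine ⟨_, sub_pos.2 (R.strictMono p.1 (Nat.lt_succ_self ⌊(p.2 : ℝ)⌋₊)), ?_⟩
  have h : R.system.edgeVector p.1 p.2 =
      (R.b p.1 (⌊(p.2 : ℝ)⌋₊ + 1) - R.b p.1 ⌊(p.2 : ℝ)⌋₊) • F.edgeVector p.1 (R.param p.1 p.2) :=
    R.edgeVector_system _ _
  simp only [velocity]
  rw [h, R.coord_system]
  simp only [Pi.smul_apply, smul_eq_mul, Nat.succ_eq_add_one, point]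
  ext
  · simp only [Prod.smul_fst, smul_eq_mul]; ring
  · simp only [Prod.smul_snd, smul_eq_mul]; ring

end PolygonSystem.Refinement

namespace Diagram

variable (D : Diagram)

/-- The new vertices of a refinement are neither multiple points nor at infinity. -/
structure IsAdmissible (R : D.net.Refinement) : Prop where
  off_infinity : ∀ i, ∀ j ≤ R.len i, D.net.curve i (R.b i j) 2 ≠ 0
  not_isMultiple : ∀ (p : D.net.Point) (j : ℕ), (p.2 : ℝ) = R.b p.1 j → ¬ D.net.IsMultiple p

variable {D}

/-- A diagram with additional vertices. -/
abbrev refine (R : D.net.Refinement) (hR : D.IsAdmissible R) : Diagram where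
  net := R.system
  vert_off_infinity := hR.off_infinity
  finite_multiple := by
    refine (D.finite_multiple.preimage (f := R.point) R.point_injective.injOn).subset fun p hp => ?_
    exact (R.isMultiple_system p).1 hp
  interior p hp := by
    have hp' := (R.isMultiple_system p).1 hp
    refine ⟨fun h => ?_, ?_⟩
    · refine hR.not_isMultiple (R.point p) ⌊(p.2 : ℝ)⌋₊ ?_ hp'
      change R.param p.1 p.2 = _
      rw [PolygonSystem.Refinement.param, h, zero_mul, add_zero]
      rfl
    · rw [R.coord_system]
      exact (D.interior _ hp').2
  transversal p q hpq h := by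
    obtain ⟨c, hc, h1⟩ := R.exists_velocity_system p
    obtain ⟨c', hc', h2⟩ := R.exists_velocity_system q
    rw [h1, h2, det₂_smul_smul]
    rw [R.toProj_system, R.toProj_system] at h
    exact mul_ne_zero (mul_pos hc hc').ne' (D.transversal _ _ (R.point_injective.ne hpq) h)
  double p q r h1 h2 h3 h4 := by
    rw [R.toProj_system, R.toProj_system] at h3 h4
    exact R.point_injective (D.double _ _ _ (R.point_injective.ne h1) (R.point_injective.ne h2) h3 h4)
  isOver p := D.isOver (R.point p)
  isOver_iff p q hpq h := by
    rw [R.toProj_system, R.toProj_system] at h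
    exact D.isOver_iff _ _ (R.point_injective.ne hpq) h

section

variable {R : D.net.Refinement} (hR : D.IsAdmissible R)

theorem refine_crosses (p q : (refine R hR).net.Point) :
    (refine R hR).Crosses p q ↔ D.Crosses (R.point p) (R.point q) := by
  rw [Crosses, Crosses, R.point_injective.ne_iff, ← R.toProj_system, ← R.toProj_system]

theorem refine_positivePair (p q : (refine R hR).net.Point) :
    (refine R hR).PositivePair p q ↔ D.PositivePair (R.point p) (R.point q) := by
  obtain ⟨c, hc, h1⟩ := R.exists_velocity_system p
  obtain ⟨c', hc', h2⟩ := R.exists_velocity_system q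
  rw [PositivePair, PositivePair]
  change (D.isOver (R.point p) ∧ 0 < det₂ (R.system.velocity p) (R.system.velocity q)) ∨
    (D.isOver (R.point q) ∧ 0 < det₂ (R.system.velocity q) (R.system.velocity p)) ↔ _
  rw [h1, h2, det₂_smul_smul, det₂_smul_smul, mul_pos_iff_of_pos_left (mul_pos hc hc'),
    mul_pos_iff_of_pos_left (mul_pos hc' hc)]

/-- The circles of `D` pull back to a colouring of the subdivided diagram, which still separates
what was separated before. -/
theorem circleOf_refine_ne {f g : (refine R hR).net.Point × Bool}
    (h : circleOf D.Crosses D.PositivePair (R.point f.1, f.2) ≠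
      circleOf D.Crosses D.PositivePair (R.point g.1, g.2)) :
    circleOf (refine R hR).Crosses (refine R hR).PositivePair f ≠
      circleOf (refine R hR).Crosses (refine R hR).PositivePair g := by
  intro hfg
  have hcol : IsColouring (refine R hR).Crosses (refine R hR).PositivePair _ :=
    (isColouring_circleOf D.Crosses D.PositivePair).comp_mapPoint (len' := R.len) R.paramIso
      (refine_crosses hR) fun p q _ => refine_positivePair hR p q
  exact h (hcol.eq_of_circleOf_eq hfg)

/-- The inverse reparametrization pulls the circles of the subdivision back to a surjective
colouring of `D`. Only this inequality is needed for the descent. -/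
theorem card_circle_refine_le : Nat.card (refine R hR).Circle ≤ Nat.card D.Circle := by
  have hpp : ∀ p : D.net.Point, R.point (mapPoint (fun i => (R.paramIso i).symm) p) = p := by
    rintro ⟨i, x⟩
    have := (R.paramIso i).apply_symm_apply x
    change (⟨i, R.paramIso i ((R.paramIso i).symm x)⟩ : D.net.Point) = _
    rw [this]
  have hcol : IsColouring D.Crosses D.PositivePair _ :=
    (isColouring_circleOf (refine R hR).Crosses (refine R hR).PositivePair).comp_mapPoint
      (len' := D.net.len) (fun i => (R.paramIso i).symm)
      (fun p q => by rw [refine_crosses hR, hpp, hpp]) fun p q _ => by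
        rw [refine_positivePair hR, hpp, hpp]
  refine Nat.card_le_card_of_surjective hcol.lift fun c => ?_
  obtain ⟨⟨⟨i, x⟩, b⟩, rfl⟩ := circleOf_surjective _ _ c
  refine ⟨circleOf _ _ (R.point ⟨i, x⟩, b), ?_⟩
  rw [hcol.lift_circleOf]
  congr 2
  exact congrArg (Sigma.mk i) ((R.paramIso i).symm_apply_apply x)

theorem isHeight_refine {z : Fin D.net.num → ℝ → ℝ} (hz : D.IsHeight z) :
    (refine R hR).IsHeight fun i x => z i (R.param i x) where
  continuousOn i := by
    refine (hz.continuousOn i).comp (R.continuousOn_param i (R.len i)) fun x hx => ?_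
    rcases hx.2.lt_or_eq with h | h
    · exact Set.Ico_subset_Icc_self (R.param_mem_Ico ⟨hx.1, h⟩)
    · rw [h, R.param_len]
      exact ⟨Nat.cast_nonneg _, le_rfl⟩
  closed i := by
    change z i (R.param i (R.len i)) = _ * z i (R.param i 0)
    rw [R.param_len, R.param_zero]
    exact hz.closed i
  above p q hpq h ho := by
    have h' := h
    rw [R.toProj_system, R.toProj_system] at h'
    have := hz.above (R.point p) (R.point q) (R.point_injective.ne hpq) h' ho
    rw [← R.coord_system, ← R.coord_system] at this
    exact this

theorem range_lift_refine (z : Fin D.net.num → ℝ → ℝ) :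
    Set.range ((refine R hR).lift fun i x => z i (R.param i x)) = Set.range (D.lift z) := by
  have h : ∀ p, (refine R hR).lift (fun i x => z i (R.param i x)) p = D.lift z (R.point p) := by
    intro p
    have : (refine R hR).liftCoord (fun i x => z i (R.param i x)) p = D.liftCoord z (R.point p) := by
      simp only [liftCoord]
      rw [R.coord_system]
      rfl
    simp only [lift, this]
  rw [← R.point_surjective.range_comp (D.lift z)]
  congr 1
  funext p
  exact h p

end

end Diagram

end ProjLink

end

noncomputable section

namespace ProjLink

/-! ### Linear functionals in homogeneous coordinates of the plane -/

/-- The value of the linear functional with coefficients `l`. -/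
def ev (l V : Fin 3 → ℝ) : ℝ := l 0 * V 0 + l 1 * V 1 + l 2 * V 2

theorem ev_add (l V W : Fin 3 → ℝ) : ev l (V + W) = ev l V + ev l W := by
  simp only [ev, Pi.add_apply]; ring

theorem ev_sub (l V W : Fin 3 → ℝ) : ev l (V - W) = ev l V - ev l W := by
  simp only [ev, Pi.sub_apply]; ring

theorem ev_smul (l : Fin 3 → ℝ) (c : ℝ) (V : Fin 3 → ℝ) : ev l (c • V) = c * ev l V := by
  simp only [ev, Pi.smul_apply, smul_eq_mul]; ring

theorem continuous_ev (l : Fin 3 → ℝ) : Continuous (ev l) := by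
  have h : ∀ k : Fin 3, Continuous fun V : Fin 3 → ℝ => V k := fun k => continuous_apply k
  exact ((continuous_const.mul (h 0)).add (continuous_const.mul (h 1))).add
    (continuous_const.mul (h 2))

/-- This is the quotient rule for the affine function `ev l / w` along the moving point. -/
theorem PolygonSystem.ev_velocity (F : PolygonSystem 3) (l : Fin 3 → ℝ) (p : F.Point) :
    l 0 * (F.velocity p).1 + l 1 * (F.velocity p).2 =
      (ev l (F.edgeVector p.1 p.2) * F.coord p 2 - ev l (F.coord p) * F.edgeVector p.1 p.2 2) /
        F.coord p 2 ^ 2 := by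
  simp only [velocity, ev]
  ring

/-- The determinant condition says that `S`, `T` and the weight `w` are linear coordinates on `ℝ³`,
equivalently that `S / w` and `T / w` are affine coordinates of the plane. -/
theorem vec_eq_zero_of_ev {S T : Fin 3 → ℝ} (hδ : S 0 * T 1 - S 1 * T 0 ≠ 0) {V : Fin 3 → ℝ}
    (hS : ev S V = 0) (hT : ev T V = 0) (hw : V 2 = 0) : V = 0 := by
  simp only [ev, hw, mul_zero, add_zero] at hS hT
  have h0 : (S 0 * T 1 - S 1 * T 0) * V 0 = 0 := by linear_combination T 1 * hS - S 1 * hT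
  have h1 : (S 0 * T 1 - S 1 * T 0) * V 1 = 0 := by linear_combination S 0 * hT - T 0 * hS
  funext k
  fin_cases k
  · exact (mul_eq_zero.1 h0).resolve_left hδ
  · exact (mul_eq_zero.1 h1).resolve_left hδ
  · exact hw

/-- The projective coordinate on a segment, compared with the affine parameter. -/
theorem tent_aux {α β wl wm tl : ℝ} (hα : 0 ≤ α) (hβ : 0 ≤ β) (h1 : α + β = 1) (hw : 0 < wl * wm)
    (ht : tl * wm < 0) :
    0 < (α * wl + β * wm) * wm ∧ tl / wl < 0 ∧ α * tl / (α * wl + β * wm) ≤ 0 ∧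
      (0 < α → α * tl / (α * wl + β * wm) < 0) ∧
      tl / wl ≤ α * tl / (α * wl + β * wm) ∧
      1 - α * tl / (α * wl + β * wm) / (tl / wl) = β * wm / (α * wl + β * wm) ∧
      β * wm / (α * wl + β * wm) ≤ 1 := by
  have hwm : wm ≠ 0 := by rintro rfl; simp at hw
  have hwl : wl ≠ 0 := by rintro rfl; simp at hw
  have htl : tl ≠ 0 := by rintro rfl; simp at ht
  have hm2 : 0 < wm ^ 2 := by positivity
  have hw0 : 0 < (α * wl + β * wm) * wm := by
    rcases hα.lt_or_eq with h | h
    · nlinarith [mul_pos h hw, mul_nonneg hβ hm2.le]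
    · have : β = 1 := by linarith
      rw [← h, this]
      nlinarith
  have hW : α * wl + β * wm ≠ 0 := by
    intro h; rw [h] at hw0; simp at hw0
  have q1 : tl / wl < 0 := by
    have : tl / wl = tl * wm / (wl * wm) := by field_simp
    rw [this]
    exact div_neg_of_neg_of_pos ht hw
  have q2 : α * tl / (α * wl + β * wm) = α * (tl * wm) / ((α * wl + β * wm) * wm) := by
    field_simp
  have q3 : 1 - α * tl / (α * wl + β * wm) / (tl / wl) = β * wm / (α * wl + β * wm) := by
    field_simp
    ring
  have q4 : β * wm / (α * wl + β * wm) = β * wm ^ 2 / ((α * wl + β * wm) * wm) := by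
    field_simp
  have q5 : 0 ≤ β * wm / (α * wl + β * wm) := by
    rw [q4]; positivity
  refine ⟨hw0, q1, ?_, ?_, ?_, q3, ?_⟩
  · rw [q2]
    exact div_nonpos_of_nonpos_of_nonneg (mul_nonpos_of_nonneg_of_nonpos hα ht.le) hw0.le
  · intro h
    rw [q2]
    exact div_neg_of_neg_of_pos (mul_neg_of_pos_of_neg h ht) hw0
  · have h2 : α * tl / (α * wl + β * wm) / (tl / wl) ≤ 1 := by linarith
    rw [div_le_one_of_neg q1] at h2
    exact h2
  · rw [q4, div_le_one hw0]
    nlinarith [mul_nonneg hα hw.le]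

/-! ### The finger move on the net -/

/-- The data for pushing a finger of a strand of a diagram across another strand. In the affine
coordinates `s = S / w` and `r = T / w`, the part of the net between the vertices `l` and `l + 2`
of the component `i₀` is an interval of the line `s = 0`, its vertex `l + 1` is the origin, and the
other strand passes through the point `(1, 0)`. -/
structure FingerData (D : Diagram) where
  S : Fin 3 → ℝ
  T : Fin 3 → ℝ
  det_ne : S 0 * T 1 - S 1 * T 0 ≠ 0
  i₀ : Fin D.net.num
  l : ℕ
  l_lt : l + 1 < D.net.len i₀
  S_left : ev S (D.net.vert i₀ l) = 0
  S_mid : ev S (D.net.vert i₀ (l + 1)) = 0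
  S_right : ev S (D.net.vert i₀ (l + 2)) = 0
  T_mid : ev T (D.net.vert i₀ (l + 1)) = 0
  w_left : 0 < D.net.vert i₀ l 2 * D.net.vert i₀ (l + 1) 2
  w_right : 0 < D.net.vert i₀ (l + 2) 2 * D.net.vert i₀ (l + 1) 2
  T_left : ev T (D.net.vert i₀ l) * D.net.vert i₀ (l + 1) 2 < 0
  T_right : 0 < ev T (D.net.vert i₀ (l + 2)) * D.net.vert i₀ (l + 1) 2
  i₁ : Fin D.net.num
  m : ℕ
  m_lt : m < D.net.len i₁
  yl : ℝ
  yb : ℝ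
  yr : ℝ
  m_lt_yl : (m : ℝ) < yl
  yl_lt : yl < yb
  lt_yr : yb < yr
  yr_lt : yr < m + 1
  κ : ℝ
  S_strand : ∀ y ∈ Set.Icc yl yr,
    ev S (D.net.curve i₁ y) = κ * ev T (D.net.curve i₁ y) + D.net.curve i₁ y 2
  T_yb : ev T (D.net.curve i₁ yb) = 0
  T_edge : ev T (D.net.vert i₁ (m + 1) - D.net.vert i₁ m) ≠ 0
  w_strand : ∀ y ∈ Set.Icc yl yr, 0 < D.net.curve i₁ y 2 * D.net.curve i₁ yb 2
  half_lt : ∀ y ∈ Set.Icc yl yr, 1 / 2 < ev S (D.net.curve i₁ y) / D.net.curve i₁ y 2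
  κ_left : 0 < (D.net.vert i₀ l 2 + κ * ev T (D.net.vert i₀ l)) * D.net.vert i₀ (l + 1) 2
  κ_right : 0 < (D.net.vert i₀ (l + 2) 2 + κ * ev T (D.net.vert i₀ (l + 2))) *
    D.net.vert i₀ (l + 1) 2
  η : ℝ
  η_pos : 0 < η
  box : ∀ p : D.net.Point, D.net.coord p 2 ≠ 0 →
    -η ≤ ev S (D.net.coord p) / D.net.coord p 2 → ev S (D.net.coord p) / D.net.coord p 2 ≤ 1 + η →
    ev T (D.net.vert i₀ l) / D.net.vert i₀ l 2 ≤ ev T (D.net.coord p) / D.net.coord p 2 →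
    ev T (D.net.coord p) / D.net.coord p 2 ≤ ev T (D.net.vert i₀ (l + 2)) / D.net.vert i₀ (l + 2) 2 →
    (p.1 = i₀ ∧ (p.2 : ℝ) ∈ Set.Icc (l : ℝ) (l + 2)) ∨ (p.1 = i₁ ∧ (p.2 : ℝ) ∈ Set.Ioo yl yr)
  cross : ∀ r, ev T (D.net.vert i₀ l) / D.net.vert i₀ l 2 ≤ r →
    r ≤ ev T (D.net.vert i₀ (l + 2)) / D.net.vert i₀ (l + 2) 2 →
    ∃ y ∈ Set.Ioo yl yr, ev T (D.net.curve i₁ y) = r * D.net.curve i₁ y 2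
  base_regular : ∀ p : D.net.Point, p.1 = i₀ → (p.2 : ℝ) ∈ Set.Icc (l : ℝ) (l + 2) →
    ¬ D.net.IsMultiple p
  strand_regular : ∀ p : D.net.Point, p.1 = i₁ → (p.2 : ℝ) ∈ Set.Icc yl yr → ¬ D.net.IsMultiple p

namespace FingerData

variable {D : Diagram} (Γ : FingerData D)

/-- The direction of the finger. -/
def dir : Fin 3 → ℝ :=
  ![Γ.T 1 / (Γ.S 0 * Γ.T 1 - Γ.S 1 * Γ.T 0), -Γ.T 0 / (Γ.S 0 * Γ.T 1 - Γ.S 1 * Γ.T 0), 0]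

theorem dir_two : Γ.dir 2 = 0 := rfl

theorem ev_S_dir : ev Γ.S Γ.dir = 1 := by
  have := Γ.det_ne
  simp only [ev, dir, Matrix.cons_val_zero, Matrix.cons_val_one, Matrix.cons_val_two,
    Matrix.tail_cons, Matrix.head_cons]
  simp
  field_simp
  ring

theorem ev_T_dir : ev Γ.T Γ.dir = 0 := by
  have := Γ.det_ne
  simp only [ev, dir]
  simp
  field_simp
  ring

/-- The position of the tip of the finger. -/
def M : ℝ := 1 + Γ.η / 2

theorem one_lt_M : 1 < Γ.M := by
  have := Γ.η_pos
  rw [M]; linarith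

/-- The weight of the tip of the finger. -/
def wm : ℝ := D.net.vert Γ.i₀ (Γ.l + 1) 2

theorem wm_ne : Γ.wm ≠ 0 := by
  intro h
  have := Γ.w_left
  rw [wm] at h
  rw [h] at this
  simp at this

/-- The piecewise linear function that is `1` at the tip and `0` at the other vertices. -/
def hat (i : Fin D.net.num) (x : ℝ) : ℝ := if i = Γ.i₀ then max 0 (1 - |x - (Γ.l + 1)|) else 0

theorem hat_left {x : ℝ} (h : x ∈ Set.Icc (Γ.l : ℝ) (Γ.l + 1)) : Γ.hat Γ.i₀ x = x - Γ.l := by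
  rw [hat, if_pos rfl, abs_of_nonpos (by linarith [h.2]), max_eq_right (by linarith [h.1])]
  ring

theorem hat_right {x : ℝ} (h : x ∈ Set.Icc (Γ.l + 1 : ℝ) (Γ.l + 2)) :
    Γ.hat Γ.i₀ x = Γ.l + 2 - x := by
  rw [hat, if_pos rfl, abs_of_nonneg (by linarith [h.1]), max_eq_right (by linarith [h.2])]
  ring

theorem hat_eq_zero {i : Fin D.net.num} {x : ℝ}
    (h : i = Γ.i₀ → x ≤ Γ.l ∨ (Γ.l : ℝ) + 2 ≤ x) : Γ.hat i x = 0 := by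
  by_cases hi : i = Γ.i₀
  · rw [hat, if_pos hi]
    apply max_eq_left
    rcases h hi with h1 | h1
    · rw [abs_of_nonpos (by linarith)]; linarith
    · rw [abs_of_nonneg (by linarith)]; linarith
  · rw [hat, if_neg hi]

/-- The break points of `hat` are integers, so displacing the vertices displaces whole edges by the
interpolated amount; this is what `curve_net` uses. -/
theorem hat_affine (i : Fin D.net.num) {k : ℕ} {x : ℝ} (h : x ∈ Set.Icc (k : ℝ) (k + 1)) :
    Γ.hat i x = (k + 1 - x) * Γ.hat i k + (x - k) * Γ.hat i ((k + 1 : ℕ) : ℝ) := by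
  by_cases hi : i = Γ.i₀
  · subst hi
    push_cast
    rcases lt_trichotomy k Γ.l with h1 | h1 | h1
    · have h2 : (k : ℝ) + 1 ≤ Γ.l := by exact_mod_cast h1
      rw [Γ.hat_eq_zero fun _ => Or.inl (h.2.trans h2), Γ.hat_eq_zero fun _ => Or.inl (by linarith),
        Γ.hat_eq_zero fun _ => Or.inl h2]
      ring
    · subst h1
      rw [Γ.hat_left h, Γ.hat_left ⟨le_rfl, by linarith⟩, Γ.hat_left ⟨by linarith, le_rfl⟩]
      ring
    · rcases (Nat.succ_le_of_lt h1).lt_or_eq with h2 | h2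
      · have h3 : (Γ.l : ℝ) + 2 ≤ k := by exact_mod_cast h2
        rw [Γ.hat_eq_zero fun _ => Or.inr (h3.trans h.1), Γ.hat_eq_zero fun _ => Or.inr h3,
          Γ.hat_eq_zero fun _ => Or.inr (by linarith)]
        ring
      · have h3 : (k : ℝ) = Γ.l + 1 := by rw [← h2]; push_cast; ring
        rw [h3] at h ⊢
        have h4 : x ∈ Set.Icc (Γ.l + 1 : ℝ) (Γ.l + 2) := ⟨h.1, by linarith [h.2]⟩
        rw [Γ.hat_right h4, Γ.hat_right ⟨le_rfl, by linarith⟩,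
          Γ.hat_right ⟨by linarith, by linarith⟩]
        ring
  · simp [hat, hi]

theorem hat_natCast (i : Fin D.net.num) (k : ℕ) :
    Γ.hat i k = if i = Γ.i₀ ∧ k = Γ.l + 1 then 1 else 0 := by
  by_cases hi : i = Γ.i₀
  · subst hi
    rcases lt_trichotomy k (Γ.l + 1) with h1 | h1 | h1
    · rw [if_neg (by omega)]
      exact Γ.hat_eq_zero fun _ => Or.inl (by exact_mod_cast Nat.lt_succ_iff.1 h1)
    · rw [if_pos ⟨rfl, h1⟩, h1, Γ.hat_left (by push_cast; constructor <;> linarith)]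
      push_cast
      ring
    · rw [if_neg (by omega)]
      exact Γ.hat_eq_zero fun _ => Or.inr (by exact_mod_cast h1)
  · simp [hat, hi]

/-- The net after the finger move. -/
abbrev net : PolygonSystem 3 where
  num := D.net.num
  len := D.net.len
  len_pos := D.net.len_pos
  vert i k := D.net.vert i k + (Γ.hat i k * (Γ.wm * Γ.M)) • Γ.dir
  closing := D.net.closing
  closed i := by
    have hl := Γ.l_lt
    -- The index `l + 1` of the tip lies strictly between `0` and the length, so closing up is not
    -- disturbed.
    have h1 : Γ.hat i (D.net.len i) = 0 := by
      rw [hat_natCast, if_neg]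
      rintro ⟨rfl, h⟩
      omega
    have h2 : Γ.hat i ((0 : ℕ) : ℝ) = 0 := by
      rw [hat_natCast, if_neg]
      rintro ⟨-, h⟩
      omega
    rw [h1, h2, zero_mul, zero_smul, add_zero, add_zero, D.net.closed]
  nondegenerate i k hk := by
    have hM := Γ.one_lt_M
    have hc : Γ.wm * Γ.M ≠ 0 := mul_ne_zero Γ.wm_ne (by linarith)
    have hnd := LinearIndependent.pair_iff.1 (D.net.nondegenerate i k hk)
    rw [hat_natCast, hat_natCast]
    by_cases hi : i = Γ.i₀
    · subst hi
      by_cases h1 : k = Γ.l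
      · subst h1
        simp only [true_and, if_neg (show ¬ Γ.l = Γ.l + 1 by omega), if_true, zero_mul, zero_smul,
          add_zero, one_mul]
        rw [LinearIndependent.pair_iff]
        intro s t hst
        -- On the two modified edges, `S` vanishes at the base vertex and not at the tip. This kills
        -- the coefficient of the tip, and the old independence does the rest.
        have h2 := congrArg (ev Γ.S) hst
        simp only [ev_add, ev_smul, Γ.S_left, Γ.S_mid, Γ.ev_S_dir] at h2
        have h3 : t = 0 := by
          have h4 : ev Γ.S 0 = 0 := by simp [ev]
          rw [h4] at h2
          have : t * (Γ.wm * Γ.M) = 0 := by linarith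
          exact (mul_eq_zero.1 this).resolve_right hc
        subst h3
        exact hnd s 0 (by simpa using hst)
      · by_cases h2 : k = Γ.l + 1
        · subst h2
          simp only [true_and, if_neg (show ¬ Γ.l + 1 + 1 = Γ.l + 1 by omega), if_true, zero_mul,
            zero_smul, add_zero, one_mul]
          rw [LinearIndependent.pair_iff]
          intro s t hst
          have h2 := congrArg (ev Γ.S) hst
          have hr := Γ.S_right
          simp only [ev_add, ev_smul, hr, Γ.S_mid, Γ.ev_S_dir] at h2
          have h3 : s = 0 := by
            have h4 : ev Γ.S 0 = 0 := by simp [ev]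
            rw [h4] at h2
            have : s * (Γ.wm * Γ.M) = 0 := by linarith
            exact (mul_eq_zero.1 this).resolve_right hc
          subst h3
          exact hnd 0 t (by simpa using hst)
        · simp only [true_and, if_neg h2, if_neg (show ¬ k + 1 = Γ.l + 1 by omega), zero_mul,
            zero_smul, add_zero]
          exact D.net.nondegenerate _ k hk
    · simp only [hi, false_and, if_false, zero_mul, zero_smul, add_zero]
      exact D.net.nondegenerate _ k hk

theorem curve_net (i : Fin D.net.num) {x : ℝ} (hx : 0 ≤ x) :
    Γ.net.curve i x = D.net.curve i x + (Γ.hat i x * (Γ.wm * Γ.M)) • Γ.dir := by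
  have h := PolygonSystem.floor_mem_Icc hx
  rw [D.net.curve_eq_of_mem_Icc h, Γ.net.curve_eq_of_mem_Icc h, Γ.hat_affine i h]
  module

theorem coord_net (p : D.net.Point) :
    Γ.net.coord p = D.net.coord p + (Γ.hat p.1 p.2 * (Γ.wm * Γ.M)) • Γ.dir :=
  Γ.curve_net p.1 p.2.2.1

theorem coord_net_two (p : D.net.Point) : Γ.net.coord p 2 = D.net.coord p 2 := by
  rw [coord_net, Pi.add_apply, Pi.smul_apply, Γ.dir_two]
  simp

theorem ev_T_coord_net (p : D.net.Point) : ev Γ.T (Γ.net.coord p) = ev Γ.T (D.net.coord p) := by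
  rw [coord_net, ev_add, ev_smul, Γ.ev_T_dir]
  simp

theorem ev_S_coord_net (p : D.net.Point) : ev Γ.S (Γ.net.coord p) =
    ev Γ.S (D.net.coord p) + Γ.hat p.1 p.2 * (Γ.wm * Γ.M) := by
  rw [coord_net, ev_add, ev_smul, Γ.ev_S_dir, mul_one]

/-- The end points of the base of the finger. -/
def rl : ℝ := ev Γ.T (D.net.vert Γ.i₀ Γ.l) / D.net.vert Γ.i₀ Γ.l 2

/-- The end points of the base of the finger. -/
def rr : ℝ := ev Γ.T (D.net.vert Γ.i₀ (Γ.l + 2)) / D.net.vert Γ.i₀ (Γ.l + 2) 2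

theorem rl_neg : Γ.rl < 0 :=
  (tent_aux zero_le_one le_rfl (add_zero 1) Γ.w_left Γ.T_left).2.1

theorem rr_pos : 0 < Γ.rr := by
  have h := (tent_aux (tl := -ev Γ.T (D.net.vert Γ.i₀ (Γ.l + 2))) zero_le_one le_rfl (add_zero 1)
    Γ.w_right (by linarith [Γ.T_right])).2.1
  rw [neg_div] at h
  rw [rr]
  linarith

/-- The piecewise linear function of `r` that describes the finger. -/
def tent (r : ℝ) : ℝ := max 0 (min (1 - r / Γ.rl) (1 - r / Γ.rr))

theorem tent_nonneg (r : ℝ) : 0 ≤ Γ.tent r := le_max_left _ _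

theorem tent_le_one (r : ℝ) : Γ.tent r ≤ 1 := by
  refine max_le zero_le_one ?_
  rcases le_total r 0 with h | h
  · refine (min_le_left _ _).trans ?_
    have := div_nonneg_of_nonpos h Γ.rl_neg.le
    linarith
  · refine (min_le_right _ _).trans ?_
    have := div_nonneg h Γ.rr_pos.le
    linarith

theorem tent_eq_zero {r : ℝ} (h : r ≤ Γ.rl ∨ Γ.rr ≤ r) : Γ.tent r = 0 := by
  apply max_eq_left
  rcases h with h | h
  · refine (min_le_left _ _).trans ?_
    have := (one_le_div_of_neg Γ.rl_neg).2 h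
    linarith
  · refine (min_le_right _ _).trans ?_
    have := (one_le_div Γ.rr_pos).2 h
    linarith

theorem tent_of_nonpos {r : ℝ} (h : r ≤ 0) (h' : Γ.rl ≤ r) : Γ.tent r = 1 - r / Γ.rl := by
  have h1 : r / Γ.rl ≤ 1 := (div_le_one_of_neg Γ.rl_neg).2 h'
  have h2 : 0 ≤ r / Γ.rl := div_nonneg_of_nonpos h Γ.rl_neg.le
  have h3 : r / Γ.rr ≤ 0 := div_nonpos_of_nonpos_of_nonneg h Γ.rr_pos.le
  rw [tent, min_eq_left (by linarith), max_eq_right (by linarith)]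

theorem tent_of_nonneg {r : ℝ} (h : 0 ≤ r) (h' : r ≤ Γ.rr) : Γ.tent r = 1 - r / Γ.rr := by
  have h1 : r / Γ.rr ≤ 1 := (div_le_one Γ.rr_pos).2 h'
  have h2 : 0 ≤ r / Γ.rr := div_nonneg h Γ.rr_pos.le
  have h3 : r / Γ.rl ≤ 0 := div_nonpos_of_nonneg_of_nonpos h Γ.rl_neg.le
  rw [tent, min_eq_right (by linarith), max_eq_right (by linarith)]

/-- The coordinates of the points of the base. -/
theorem base_coord {x : ℝ} (hx : x ∈ Set.Icc (Γ.l : ℝ) (Γ.l + 2)) :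
    ev Γ.S (D.net.curve Γ.i₀ x) = 0 ∧ 0 < D.net.curve Γ.i₀ x 2 * Γ.wm ∧
    Γ.rl ≤ ev Γ.T (D.net.curve Γ.i₀ x) / D.net.curve Γ.i₀ x 2 ∧
    ev Γ.T (D.net.curve Γ.i₀ x) / D.net.curve Γ.i₀ x 2 ≤ Γ.rr ∧
    Γ.tent (ev Γ.T (D.net.curve Γ.i₀ x) / D.net.curve Γ.i₀ x 2) =
      Γ.hat Γ.i₀ x * Γ.wm / D.net.curve Γ.i₀ x 2 ∧
    (x < Γ.l + 1 → ev Γ.T (D.net.curve Γ.i₀ x) / D.net.curve Γ.i₀ x 2 < 0) ∧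
    (Γ.l + 1 < x → 0 < ev Γ.T (D.net.curve Γ.i₀ x) / D.net.curve Γ.i₀ x 2) := by
  rcases le_total x (Γ.l + 1) with h | h
  · have hx' : x ∈ Set.Icc (Γ.l : ℝ) (Γ.l + 1) := ⟨hx.1, h⟩
    obtain ⟨t1, t2, t3, t3', t4, t5, t6⟩ := tent_aux (α := Γ.l + 1 - x) (β := x - Γ.l)
      (by linarith) (by linarith [hx.1]) (by ring) Γ.w_left Γ.T_left
    rw [Γ.hat_left hx', D.net.curve_eq_of_mem_Icc hx']
    simp only [ev_add, ev_smul, Γ.S_left, Γ.S_mid, Γ.T_mid, Pi.add_apply, Pi.smul_apply,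
      smul_eq_mul, mul_zero, add_zero]
    refine ⟨trivial, t1, t4, t3.trans Γ.rr_pos.le, ?_, fun h1 => t3' (by linarith), fun h1 => ?_⟩
    · rw [Γ.tent_of_nonpos t3 t4]
      exact t5
    · linarith
  · have hx' : x ∈ Set.Icc ((Γ.l + 1 : ℕ) : ℝ) ((Γ.l + 1 : ℕ) + 1) := by
      push_cast
      exact ⟨h, by linarith [hx.2]⟩
    obtain ⟨t1, t2, t3, t3', t4, t5, t6⟩ := tent_aux (α := x - (Γ.l + 1)) (β := Γ.l + 2 - x)
      (tl := -ev Γ.T (D.net.vert Γ.i₀ (Γ.l + 2)))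
      (by linarith) (by linarith [hx.2]) (by ring) Γ.w_right (by linarith [Γ.T_right])
    have hr := Γ.S_right
    rw [Γ.hat_right ⟨h, hx.2⟩, D.net.curve_eq_of_mem_Icc hx']
    simp only [ev_add, ev_smul, hr, Γ.S_mid, Γ.T_mid, Pi.add_apply, Pi.smul_apply,
      smul_eq_mul, mul_zero, zero_add]
    push_cast
    have e1 : (Γ.l + 1 + 1 - x : ℝ) = Γ.l + 2 - x := by ring
    rw [e1, add_comm ((Γ.l + 2 - x : ℝ) * _)]
    simp only [mul_neg, neg_div] at t3 t3' t4 t5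
    rw [div_neg, neg_neg] at t5
    have t3'' : 0 ≤ (x - (Γ.l + 1)) * ev Γ.T (D.net.vert Γ.i₀ (Γ.l + 2)) /
        ((x - (Γ.l + 1)) * D.net.vert Γ.i₀ (Γ.l + 2) 2 +
          (Γ.l + 2 - x) * D.net.vert Γ.i₀ (Γ.l + 1) 2) := by linarith
    have t4' : (x - (Γ.l + 1)) * ev Γ.T (D.net.vert Γ.i₀ (Γ.l + 2)) /
        ((x - (Γ.l + 1)) * D.net.vert Γ.i₀ (Γ.l + 2) 2 +
          (Γ.l + 2 - x) * D.net.vert Γ.i₀ (Γ.l + 1) 2) ≤ Γ.rr := by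
      rw [rr]; linarith
    refine ⟨trivial, t1, Γ.rl_neg.le.trans t3'', t4', ?_, fun h1 => ?_, fun h1 => ?_⟩
    · rw [Γ.tent_of_nonneg t3'' t4']
      exact t5
    · linarith
    · have := t3' (by linarith)
      linarith

end FingerData

end ProjLink

end

/-! ### Intersections of the finger with the net -/

noncomputable section

namespace ProjLink

namespace FingerData

variable {D : Diagram} (Γ : FingerData D)

/-- The point is on the finger. -/
def InFinger (p : D.net.Point) : Prop := p.1 = Γ.i₀ ∧ (p.2 : ℝ) ∈ Set.Ioo (Γ.l : ℝ) (Γ.l + 2)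

/-- The point is on the strand that the finger crosses. -/
def InStrand (p : D.net.Point) : Prop := p.1 = Γ.i₁ ∧ (p.2 : ℝ) ∈ Set.Ioo Γ.yl Γ.yr

theorem coord_net_of_not_inFinger {p : D.net.Point} (hp : ¬ Γ.InFinger p) :
    Γ.net.coord p = D.net.coord p := by
  rw [coord_net, Γ.hat_eq_zero, zero_mul, zero_smul, add_zero]
  intro hi
  by_contra h
  push Not at h
  exact hp ⟨hi, h⟩

theorem wm_sq_pos : 0 < Γ.wm ^ 2 := by
  have := Γ.wm_ne
  positivity

theorem base_point {p : D.net.Point} (hi : p.1 = Γ.i₀)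
    (hx : (p.2 : ℝ) ∈ Set.Icc (Γ.l : ℝ) (Γ.l + 2)) :
    ev Γ.S (D.net.coord p) = 0 ∧ 0 < D.net.coord p 2 * Γ.wm ∧
    Γ.rl ≤ ev Γ.T (D.net.coord p) / D.net.coord p 2 ∧
    ev Γ.T (D.net.coord p) / D.net.coord p 2 ≤ Γ.rr ∧
    Γ.tent (ev Γ.T (D.net.coord p) / D.net.coord p 2) =
      Γ.hat p.1 p.2 * Γ.wm / D.net.coord p 2 ∧
    ((p.2 : ℝ) < Γ.l + 1 → ev Γ.T (D.net.coord p) / D.net.coord p 2 < 0) ∧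
    (Γ.l + 1 < (p.2 : ℝ) → 0 < ev Γ.T (D.net.coord p) / D.net.coord p 2) := by
  obtain ⟨i, x⟩ := p
  obtain rfl : i = Γ.i₀ := hi
  exact Γ.base_coord hx

theorem hat_pos {p : D.net.Point} (hp : Γ.InFinger p) : 0 < Γ.hat p.1 p.2 := by
  obtain ⟨i, x⟩ := p
  obtain ⟨hi, hx⟩ := hp
  obtain rfl : i = Γ.i₀ := hi
  rcases le_total (x : ℝ) (Γ.l + 1) with h | h
  · have := Γ.hat_left ⟨hx.1.le, h⟩
    simp only at this ⊢
    rw [this]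
    linarith [hx.1]
  · have := Γ.hat_right ⟨h, hx.2.le⟩
    simp only at this ⊢
    rw [this]
    linarith [hx.2]

theorem ne_zero_of_mul_wm_pos {w : ℝ} (h : 0 < w * Γ.wm) : w ≠ 0 := by
  rintro rfl
  simp at h

/-- The coordinates of the points of the finger. -/
theorem finger_coord {p : D.net.Point} (hp : Γ.InFinger p) :
    0 < D.net.coord p 2 * Γ.wm ∧ 0 < ev Γ.S (Γ.net.coord p) / Γ.net.coord p 2 ∧
    ev Γ.S (Γ.net.coord p) / Γ.net.coord p 2 ≤ Γ.M ∧
    Γ.rl ≤ ev Γ.T (Γ.net.coord p) / Γ.net.coord p 2 ∧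
    ev Γ.T (Γ.net.coord p) / Γ.net.coord p 2 ≤ Γ.rr := by
  obtain ⟨h1, h2, h3, h4, h5, -, -⟩ := Γ.base_point hp.1 (Set.Ioo_subset_Icc_self hp.2)
  have hM := Γ.one_lt_M
  have hw := Γ.ne_zero_of_mul_wm_pos h2
  have e : ev Γ.S (Γ.net.coord p) / Γ.net.coord p 2 =
      Γ.M * Γ.tent (ev Γ.T (D.net.coord p) / D.net.coord p 2) := by
    rw [ev_S_coord_net, coord_net_two, h1, h5]
    ring
  refine ⟨h2, ?_, ?_, ?_, ?_⟩
  · rw [e, h5]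
    have h6 : Γ.hat p.1 p.2 * Γ.wm / D.net.coord p 2 =
        Γ.hat p.1 p.2 * Γ.wm ^ 2 / (D.net.coord p 2 * Γ.wm) := by
      have := Γ.wm_ne
      field_simp
    rw [h6]
    exact mul_pos (by linarith) (div_pos (mul_pos (Γ.hat_pos hp) Γ.wm_sq_pos) h2)
  · rw [e]
    exact mul_le_of_le_one_right (by linarith) (Γ.tent_le_one _)
  · rw [ev_T_coord_net, coord_net_two]; exact h3
  · rw [ev_T_coord_net, coord_net_two]; exact h4

/-- The coordinate `S / w` is `0` on the base and exceeds `1 / 2` on the strand. The two may lie on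
the same component, but they are disjoint. -/
theorem not_base_of_strand {p : D.net.Point} (hi : p.1 = Γ.i₁)
    (hx : (p.2 : ℝ) ∈ Set.Icc Γ.yl Γ.yr) :
    ¬ (p.1 = Γ.i₀ ∧ (p.2 : ℝ) ∈ Set.Icc (Γ.l : ℝ) (Γ.l + 2)) := by
  rintro ⟨h1, h2⟩
  have h3 := (Γ.base_point h1 h2).1
  obtain ⟨i, x⟩ := p
  obtain rfl : i = Γ.i₁ := hi
  have h4 := Γ.half_lt x hx
  change ev Γ.S (D.net.curve Γ.i₁ x) = 0 at h3
  rw [h3, zero_div] at h4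
  linarith

theorem InStrand.not_inFinger {p : D.net.Point} (hp : Γ.InStrand p) : ¬ Γ.InFinger p :=
  fun h => Γ.not_base_of_strand hp.1 (Set.Ioo_subset_Icc_self hp.2)
    ⟨h.1, Set.Ioo_subset_Icc_self h.2⟩

theorem ratio_eq {l V W : Fin 3 → ℝ} {c : ℝ} (hc : c ≠ 0) (h : V = c • W) :
    ev l V / V 2 = ev l W / W 2 := by
  rw [h, ev_smul, Pi.smul_apply, smul_eq_mul, mul_div_mul_left _ _ hc]

/-- The finger stays in the box, where the old net consists of base and strand only; the base is
excluded because `S / w` is positive on the open finger. -/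
theorem inStrand_of_toProj_eq {p q : D.net.Point} (hp : Γ.InFinger p) (hq : ¬ Γ.InFinger q)
    (h : Γ.net.toProj p = Γ.net.toProj q) : Γ.InStrand q := by
  obtain ⟨c, hc, h1⟩ := (Γ.net.toProj_eq_iff p q).1 h
  obtain ⟨h2, h3, h4, h5, h6⟩ := Γ.finger_coord hp
  rw [ratio_eq hc h1] at h3 h4 h5 h6
  rw [Γ.coord_net_of_not_inFinger hq] at h1 h3 h4 h5 h6
  have hw : D.net.coord q 2 ≠ 0 := by
    intro h0
    rw [← Γ.coord_net_two, h1, Pi.smul_apply, h0, smul_zero, zero_mul] at h2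
    exact lt_irrefl _ h2
  have hη := Γ.η_pos
  rcases Γ.box q hw (by linarith) (by rw [M] at h4; linarith) h5 h6 with h7 | h7
  · rw [(Γ.base_point h7.1 h7.2).1, zero_div] at h3
    exact absurd h3 (lt_irrefl _)
  · exact h7

/-- The linear functional that vanishes on the strand. -/
def L : Fin 3 → ℝ :=
  ![Γ.S 0 - Γ.κ * Γ.T 0, Γ.S 1 - Γ.κ * Γ.T 1, Γ.S 2 - Γ.κ * Γ.T 2 - 1]

theorem ev_L (V : Fin 3 → ℝ) : ev Γ.L V = ev Γ.S V - Γ.κ * ev Γ.T V - V 2 := by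
  simp only [ev, L]
  simp
  ring

theorem L_strand {p : D.net.Point} (hp : Γ.InStrand p) : ev Γ.L (D.net.coord p) = 0 := by
  obtain ⟨i, x⟩ := p
  obtain ⟨hi, hx⟩ := hp
  obtain rfl : i = Γ.i₁ := hi
  have := Γ.S_strand x (Set.Ioo_subset_Icc_self hx)
  rw [ev_L]
  change ev Γ.S (D.net.curve Γ.i₁ x) - Γ.κ * ev Γ.T (D.net.curve Γ.i₁ x) - D.net.curve Γ.i₁ x 2 = 0
  rw [this]
  ring

theorem L_eq_zero_of_toProj_eq {p q : D.net.Point} (hp : Γ.InFinger p) (hq : ¬ Γ.InFinger q)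
    (h : Γ.net.toProj p = Γ.net.toProj q) : ev Γ.L (Γ.net.coord p) = 0 := by
  obtain ⟨c, -, h1⟩ := (Γ.net.toProj_eq_iff p q).1 h
  rw [h1, ev_smul, Γ.coord_net_of_not_inFinger hq,
    Γ.L_strand (Γ.inStrand_of_toProj_eq hp hq h), mul_zero]

theorem point_ext {d : ℕ} {F : PolygonSystem d} {p q : F.Point} (h1 : p.1 = q.1)
    (h2 : (p.2 : ℝ) = q.2) : p = q := by
  obtain ⟨i, x⟩ := p
  obtain ⟨j, y⟩ := q
  obtain rfl : i = j := h1
  obtain rfl : x = y := Subtype.ext h2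
  rfl

/-- The push preserves `T / w`, which is negative before the tip and positive after it. So
coinciding points lie on the same edge of the finger, and an edge is injective. -/
theorem eq_of_inFinger {p q : D.net.Point} (hp : Γ.InFinger p) (hq : Γ.InFinger q)
    (h : Γ.net.toProj p = Γ.net.toProj q) : p = q := by
  obtain ⟨c, hc, h1⟩ := (Γ.net.toProj_eq_iff p q).1 h
  have hr := ratio_eq (l := Γ.T) hc h1
  rw [ev_T_coord_net, ev_T_coord_net, coord_net_two, coord_net_two] at hr
  obtain ⟨-, -, -, -, -, hpl, hpr⟩ := Γ.base_point hp.1 (Set.Ioo_subset_Icc_self hp.2)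
  obtain ⟨-, -, -, -, -, hql, hqr⟩ := Γ.base_point hq.1 (Set.Ioo_subset_Icc_self hq.2)
  rw [hr] at hpl hpr
  obtain ⟨hp1, hp2⟩ := hp
  obtain ⟨hq1, hq2⟩ := hq
  refine point_ext (hp1.trans hq1.symm) ?_
  obtain ⟨i, x⟩ := p
  obtain ⟨j, y⟩ := q
  obtain rfl : i = Γ.i₀ := hp1
  obtain rfl : j = Γ.i₀ := hq1
  have hl := Γ.l_lt
  have h1' : Γ.net.curve Γ.i₀ x = c • Γ.net.curve Γ.i₀ y := h1
  simp only at hpl hpr hql hqr hp2 hq2 ⊢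
  by_cases hx : (x : ℝ) ≤ Γ.l + 1
  · have hy : (y : ℝ) ≤ Γ.l + 1 := by
      by_contra h2
      have h3 := hqr (not_le.1 h2)
      rcases hx.lt_or_eq with h4 | h4
      · exact lt_asymm (hpl h4) h3
      · have h5 : ev Γ.T (D.net.curve Γ.i₀ x) = 0 := by
          have := D.net.curve_natCast Γ.i₀ (Γ.l + 1)
          push_cast at this
          rw [h4, this, Γ.T_mid]
        have h6 : ev Γ.T (D.net.curve Γ.i₀ x) / D.net.curve Γ.i₀ x 2 =
          ev Γ.T (D.net.curve Γ.i₀ y) / D.net.curve Γ.i₀ y 2 := hr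
        rw [h5, zero_div] at h6
        have h3' : 0 < ev Γ.T (D.net.curve Γ.i₀ y) / D.net.curve Γ.i₀ y 2 := h3
        rw [← h6] at h3'
        exact lt_irrefl _ h3'
    exact Γ.net.eq_of_curve_eq_smul (m := Γ.l) (show Γ.l < D.net.len Γ.i₀ by omega)
      ⟨hp2.1.le, hx⟩ ⟨hq2.1.le, hy⟩ h1'
  · have hx' := not_le.1 hx
    have hy : Γ.l + 1 < (y : ℝ) := by
      by_contra h2
      have h3 := hpr hx'
      rcases (not_lt.1 h2).lt_or_eq with h4 | h4
      · exact lt_asymm (hql h4) h3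
      · have h5 : ev Γ.T (D.net.curve Γ.i₀ y) = 0 := by
          have := D.net.curve_natCast Γ.i₀ (Γ.l + 1)
          push_cast at this
          rw [h4, this, Γ.T_mid]
        have h3' : 0 < ev Γ.T (D.net.curve Γ.i₀ y) / D.net.curve Γ.i₀ y 2 := h3
        rw [h5, zero_div] at h3'
        exact lt_irrefl _ h3'
    refine Γ.net.eq_of_curve_eq_smul (m := Γ.l + 1) hl ?_ ?_ h1'
    · push_cast; exact ⟨hx'.le, by linarith [hp2.2]⟩
    · push_cast; exact ⟨hy.le, by linarith [hq2.2]⟩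

/-- `L` interpolates between its values at the end of the base and at the tip. By `κ_left` and `1 <
M`, these have opposite signs after multiplication by `wm`, so this edge meets the line of the
strand exactly once. -/
theorem L_curve_left {x : ℝ} (hx : x ∈ Set.Icc (Γ.l : ℝ) (Γ.l + 1)) :
    ev Γ.L (Γ.net.curve Γ.i₀ x) = (x - Γ.l) * (Γ.wm * (Γ.M - 1)) -
      (Γ.l + 1 - x) * (D.net.vert Γ.i₀ Γ.l 2 + Γ.κ * ev Γ.T (D.net.vert Γ.i₀ Γ.l)) := by
  rw [Γ.curve_net _ ((Nat.cast_nonneg _).trans hx.1), Γ.hat_left hx, D.net.curve_eq_of_mem_Icc hx,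
    ev_L]
  simp only [ev_add, ev_smul, Γ.S_left, Γ.S_mid, Γ.T_mid, Γ.ev_S_dir, Γ.ev_T_dir, Pi.add_apply,
    Pi.smul_apply, smul_eq_mul, Γ.dir_two]
  rw [wm]
  ring

theorem L_curve_right {x : ℝ} (hx : x ∈ Set.Icc (Γ.l + 1 : ℝ) (Γ.l + 2)) :
    ev Γ.L (Γ.net.curve Γ.i₀ x) = (Γ.l + 2 - x) * (Γ.wm * (Γ.M - 1)) -
      (x - (Γ.l + 1)) *
        (D.net.vert Γ.i₀ (Γ.l + 2) 2 + Γ.κ * ev Γ.T (D.net.vert Γ.i₀ (Γ.l + 2))) := by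
  have hx' : x ∈ Set.Icc ((Γ.l + 1 : ℕ) : ℝ) ((Γ.l + 1 : ℕ) + 1) := by
    push_cast
    exact ⟨hx.1, by linarith [hx.2]⟩
  have hr := Γ.S_right
  rw [Γ.curve_net _ ((Nat.cast_nonneg _).trans hx'.1), Γ.hat_right hx,
    D.net.curve_eq_of_mem_Icc hx', ev_L]
  simp only [ev_add, ev_smul, hr, Γ.S_mid, Γ.T_mid, Γ.ev_S_dir, Γ.ev_T_dir, Pi.add_apply,
    Pi.smul_apply, smul_eq_mul, Γ.dir_two]
  rw [wm]
  push_cast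
  ring

theorem wm_M_pos : 0 < Γ.wm * (Γ.M - 1) * Γ.wm := by
  have := Γ.wm_sq_pos
  have := Γ.one_lt_M
  nlinarith

/-- The first edge of the finger crosses the line of the strand outwards and the second one returns.
This contrast, up to positive factors, produces the opposite crossing signs. -/
theorem ev_L_edgeVector_left {x : ℝ} (hx : x ∈ Set.Ico (Γ.l : ℝ) (Γ.l + 1)) :
    0 < ev Γ.L (Γ.net.edgeVector Γ.i₀ x) * Γ.wm := by
  have hf : ⌊x⌋₊ = Γ.l := (Nat.floor_eq_iff ((Nat.cast_nonneg _).trans hx.1)).2 hx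
  have h0 := Γ.L_curve_left (x := Γ.l) ⟨le_rfl, by linarith⟩
  have h1 := Γ.L_curve_left (x := (Γ.l : ℝ) + 1) ⟨by linarith, le_rfl⟩
  rw [Γ.net.curve_natCast] at h0
  have e : ((Γ.l : ℝ) + 1) = ((Γ.l + 1 : ℕ) : ℝ) := by push_cast; ring
  rw [e, Γ.net.curve_natCast] at h1
  rw [PolygonSystem.edgeVector, hf, ev_sub, h0, h1]
  push_cast
  have h2 := Γ.κ_left
  have h3 := Γ.wm_M_pos
  change 0 < _ * Γ.wm at h2
  nlinarith

theorem ev_L_edgeVector_right {x : ℝ} (hx : x ∈ Set.Ico (Γ.l + 1 : ℝ) (Γ.l + 2)) :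
    ev Γ.L (Γ.net.edgeVector Γ.i₀ x) * Γ.wm < 0 := by
  have hf : ⌊x⌋₊ = Γ.l + 1 := by
    refine (Nat.floor_eq_iff ((by positivity : (0 : ℝ) ≤ Γ.l + 1).trans hx.1)).2 ?_
    push_cast
    exact ⟨hx.1, by linarith [hx.2]⟩
  have h0 := Γ.L_curve_right (x := (Γ.l : ℝ) + 1) ⟨le_rfl, by linarith⟩
  have h1 := Γ.L_curve_right (x := (Γ.l : ℝ) + 2) ⟨by linarith, le_rfl⟩
  have e : ((Γ.l : ℝ) + 1) = ((Γ.l + 1 : ℕ) : ℝ) := by push_cast; ring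
  have e' : ((Γ.l : ℝ) + 2) = ((Γ.l + 2 : ℕ) : ℝ) := by push_cast; ring
  rw [e, Γ.net.curve_natCast] at h0
  rw [e', Γ.net.curve_natCast] at h1
  have h1' : ev Γ.L (Γ.net.vert Γ.i₀ (Γ.l + 1 + 1)) = _ := h1
  rw [PolygonSystem.edgeVector, hf, ev_sub, h0, h1']
  push_cast
  have h2 := Γ.κ_right
  have h3 := Γ.wm_M_pos
  change 0 < _ * Γ.wm at h2
  nlinarith

/-- This is the zero of the affine function with values `-A` at `0` and `B` at `1`. -/
theorem exists_zero {A B : ℝ} (hA : 0 < A) (hB : 0 < B) :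
    ∃ t, 0 < t ∧ t < 1 ∧ t * B = (1 - t) * A := by
  refine ⟨A / (A + B), by positivity, (div_lt_one (by positivity)).2 (by linarith), ?_⟩
  field_simp
  ring

/-- The two points of the finger that lie on the line of the strand. -/
theorem exists_L_eq_zero : ∃ p₁ p₂ : D.net.Point,
    (p₁.1 = Γ.i₀ ∧ (p₁.2 : ℝ) ∈ Set.Ioo (Γ.l : ℝ) (Γ.l + 1) ∧ ev Γ.L (Γ.net.coord p₁) = 0) ∧
    (p₂.1 = Γ.i₀ ∧ (p₂.2 : ℝ) ∈ Set.Ioo (Γ.l + 1 : ℝ) (Γ.l + 2) ∧ ev Γ.L (Γ.net.coord p₂) = 0) ∧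
    ∀ p, Γ.InFinger p → ev Γ.L (Γ.net.coord p) = 0 → p = p₁ ∨ p = p₂ := by
  have hM := Γ.wm_M_pos
  have hwm := Γ.wm_ne
  obtain ⟨t, ht0, ht1, ht⟩ := exists_zero Γ.κ_left hM
  obtain ⟨s, hs0, hs1, hs⟩ := exists_zero Γ.κ_right hM
  have hlen : (Γ.l : ℝ) + 2 ≤ D.net.len Γ.i₀ := by exact_mod_cast Γ.l_lt
  have hl0 : (0 : ℝ) ≤ Γ.l := Nat.cast_nonneg _
  refine ⟨⟨Γ.i₀, Γ.l + t, by linarith, by linarith⟩, ⟨Γ.i₀, Γ.l + 2 - s, by linarith, by linarith⟩,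
    ⟨rfl, ⟨by simp only; linarith, by simp only; linarith⟩, ?_⟩,
    ⟨rfl, ⟨by simp only; linarith, by simp only; linarith⟩, ?_⟩, ?_⟩
  · refine (Γ.L_curve_left (x := Γ.l + t) ⟨by linarith, by linarith⟩).trans ?_
    change t * (Γ.wm * (Γ.M - 1) * Γ.wm) = (1 - t) * (_ * Γ.wm) at ht
    refine mul_right_cancel₀ hwm ?_
    rw [zero_mul]
    linear_combination ht
  · refine (Γ.L_curve_right (x := Γ.l + 2 - s) ⟨by linarith, by linarith⟩).trans ?_
    change s * (Γ.wm * (Γ.M - 1) * Γ.wm) = (1 - s) * (_ * Γ.wm) at hs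
    refine mul_right_cancel₀ hwm ?_
    rw [zero_mul]
    linear_combination hs
  · rintro ⟨i, x⟩ ⟨hi, hx⟩ hL
    obtain rfl : i = Γ.i₀ := hi
    change ev Γ.L (Γ.net.curve Γ.i₀ x) = 0 at hL
    simp only at hx
    rcases le_total (x : ℝ) (Γ.l + 1) with h | h
    · left
      refine point_ext rfl ?_
      simp only
      rw [Γ.L_curve_left ⟨hx.1.le, h⟩] at hL
      have h2 := Γ.κ_left
      change 0 < _ * Γ.wm at h2
      change t * (Γ.wm * (Γ.M - 1) * Γ.wm) = (1 - t) * (_ * Γ.wm) at ht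
      have h3 := add_pos h2 hM
      have : ((x : ℝ) - (Γ.l + t)) * ((D.net.vert Γ.i₀ Γ.l 2 +
        Γ.κ * ev Γ.T (D.net.vert Γ.i₀ Γ.l)) * Γ.wm + Γ.wm * (Γ.M - 1) * Γ.wm) = 0 := by
        linear_combination Γ.wm * hL - ht
      have := (mul_eq_zero.1 this).resolve_right h3.ne'
      linarith
    · right
      refine point_ext rfl ?_
      simp only
      rw [Γ.L_curve_right ⟨h, hx.2.le⟩] at hL
      have h2 := Γ.κ_right
      change 0 < _ * Γ.wm at h2
      change s * (Γ.wm * (Γ.M - 1) * Γ.wm) = (1 - s) * (_ * Γ.wm) at hs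
      have h3 := add_pos h2 hM
      have : ((x : ℝ) - (Γ.l + 2 - s)) * ((D.net.vert Γ.i₀ (Γ.l + 2) 2 +
        Γ.κ * ev Γ.T (D.net.vert Γ.i₀ (Γ.l + 2))) * Γ.wm + Γ.wm * (Γ.M - 1) * Γ.wm) = 0 := by
        linear_combination -Γ.wm * hL + hs
      have := (mul_eq_zero.1 this).resolve_right h3.ne'
      linarith

theorem yl_nonneg : 0 ≤ Γ.yl := (Nat.cast_nonneg _).trans Γ.m_lt_yl.le

theorem strand_lt_len {y : ℝ} (hy : y ≤ Γ.yr) : y < D.net.len Γ.i₁ := by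
  have h1 : (Γ.m : ℝ) + 1 ≤ D.net.len Γ.i₁ := by exact_mod_cast Γ.m_lt
  linarith [Γ.yr_lt]

/-- The field `cross` supplies a point of the strand with the same `T / w`. On the line of the
strand `T / w` determines `S / w`, so the two points agree. -/
theorem exists_strand_point {p : D.net.Point} (hp : Γ.InFinger p)
    (hL : ev Γ.L (Γ.net.coord p) = 0) :
    ∃ q, Γ.InStrand q ∧ Γ.net.toProj p = Γ.net.toProj q := by
  obtain ⟨h2, -, -, h5, h6⟩ := Γ.finger_coord hp
  obtain ⟨y, hy, hyr⟩ := Γ.cross _ h5 h6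
  let q : D.net.Point := ⟨Γ.i₁, y, Γ.yl_nonneg.trans hy.1.le, Γ.strand_lt_len hy.2.le⟩
  have hq : Γ.InStrand q := ⟨rfl, hy⟩
  refine ⟨q, hq, ?_⟩
  have hwq : D.net.curve Γ.i₁ y 2 ≠ 0 := by
    intro h0
    have := Γ.w_strand y (Set.Ioo_subset_Icc_self hy)
    rw [h0, zero_mul] at this
    exact lt_irrefl _ this
  have hwp : Γ.net.coord p 2 ≠ 0 := by
    rw [coord_net_two]
    exact Γ.ne_zero_of_mul_wm_pos h2
  rw [Γ.net.toProj_eq_iff]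
  refine ⟨Γ.net.coord p 2 / D.net.curve Γ.i₁ y 2, div_ne_zero hwp hwq, ?_⟩
  rw [Γ.coord_net_of_not_inFinger (InStrand.not_inFinger Γ hq), ← sub_eq_zero]
  have hT : ev Γ.T (Γ.net.coord p) =
      Γ.net.coord p 2 / D.net.curve Γ.i₁ y 2 * ev Γ.T (D.net.curve Γ.i₁ y) := by
    rw [hyr]
    field_simp
  have hS : ev Γ.S (Γ.net.coord p) =
      Γ.net.coord p 2 / D.net.curve Γ.i₁ y 2 * ev Γ.S (D.net.curve Γ.i₁ y) := by
    rw [Γ.S_strand y (Set.Ioo_subset_Icc_self hy)]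
    rw [ev_L] at hL
    have : ev Γ.S (Γ.net.coord p) = Γ.κ * ev Γ.T (Γ.net.coord p) + Γ.net.coord p 2 := by linarith
    rw [this, hT]
    field_simp
  refine vec_eq_zero_of_ev Γ.det_ne ?_ ?_ ?_
  · rw [ev_sub, ev_smul, hS]
    exact sub_self _
  · rw [ev_sub, ev_smul, hT]
    exact sub_self _
  · change Γ.net.coord p 2 - Γ.net.coord p 2 / D.net.curve Γ.i₁ y 2 * D.net.curve Γ.i₁ y 2 = 0
    field_simp
    ring

theorem strand_mem_edge {y : ℝ} (hy : y ∈ Set.Icc Γ.yl Γ.yr) : y ∈ Set.Icc (Γ.m : ℝ) (Γ.m + 1) :=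
  ⟨Γ.m_lt_yl.le.trans hy.1, hy.2.trans Γ.yr_lt.le⟩

theorem eq_of_inStrand {q q' : D.net.Point} (hq : Γ.InStrand q) (hq' : Γ.InStrand q')
    (h : Γ.net.toProj q = Γ.net.toProj q') : q = q' := by
  obtain ⟨c, -, h1⟩ := (Γ.net.toProj_eq_iff q q').1 h
  rw [Γ.coord_net_of_not_inFinger (InStrand.not_inFinger Γ hq),
    Γ.coord_net_of_not_inFinger (InStrand.not_inFinger Γ hq')] at h1
  refine point_ext (hq.1.trans hq'.1.symm) ?_
  obtain ⟨i, x⟩ := q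
  obtain ⟨j, y⟩ := q'
  obtain ⟨hi, hx⟩ := hq
  obtain ⟨hj, hy⟩ := hq'
  obtain rfl : i = Γ.i₁ := hi
  obtain rfl : j = Γ.i₁ := hj
  exact D.net.eq_of_curve_eq_smul Γ.m_lt (Γ.strand_mem_edge (Set.Ioo_subset_Icc_self hx))
    (Γ.strand_mem_edge (Set.Ioo_subset_Icc_self hy)) h1

/-- The velocity is unchanged away from the finger. -/
theorem velocity_net {p : D.net.Point}
    (hp : ¬ (p.1 = Γ.i₀ ∧ (p.2 : ℝ) ∈ Set.Icc (Γ.l : ℝ) (Γ.l + 2))) :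
    Γ.net.velocity p = D.net.velocity p := by
  have h1 : Γ.net.coord p = D.net.coord p :=
    Γ.coord_net_of_not_inFinger fun h => hp ⟨h.1, Set.Ioo_subset_Icc_self h.2⟩
  have h2 : Γ.net.edgeVector p.1 p.2 = D.net.edgeVector p.1 p.2 := by
    have hfl := PolygonSystem.floor_mem_Icc p.2.2.1
    have key : ∀ k : ℕ, k = ⌊(p.2 : ℝ)⌋₊ ∨ k = ⌊(p.2 : ℝ)⌋₊ + 1 → Γ.hat p.1 k = 0 := by
      intro k hk
      rw [hat_natCast, if_neg]
      rintro ⟨hi, hkl⟩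
      refine hp ⟨hi, ?_⟩
      have hlt := Nat.lt_floor_add_one (p.2 : ℝ)
      rcases hk with hk | hk
      · have e : (⌊(p.2 : ℝ)⌋₊ : ℝ) = Γ.l + 1 := by rw [← hk, hkl]; push_cast; ring
        rw [e] at hfl hlt
        exact ⟨by linarith [hfl.1], by linarith⟩
      · have e : (⌊(p.2 : ℝ)⌋₊ : ℝ) = Γ.l := by
          have : ⌊(p.2 : ℝ)⌋₊ = Γ.l := by omega
          rw [this]
        rw [e] at hfl hlt
        exact ⟨hfl.1, by linarith⟩
    have k1 := key _ (Or.inl rfl)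
    have k2 := key _ (Or.inr rfl)
    simp only [PolygonSystem.edgeVector, k1, k2, zero_mul, zero_smul, add_zero]
  simp only [PolygonSystem.velocity]
  rw [h1, h2]

/-- The velocity of the strand. -/
theorem strand_velocity {q : D.net.Point} (hq : Γ.InStrand q) (v : ℝ × ℝ) :
    det₂ v (D.net.velocity q) =
      ev Γ.T (D.net.vert Γ.i₁ (Γ.m + 1) - D.net.vert Γ.i₁ Γ.m) * D.net.curve Γ.i₁ Γ.yb 2 /
        D.net.coord q 2 ^ 2 / (Γ.S 0 * Γ.T 1 - Γ.S 1 * Γ.T 0) * (Γ.L 0 * v.1 + Γ.L 1 * v.2) := by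
  have hLc := Γ.L_strand hq
  have hT := D.net.ev_velocity Γ.T q
  have hL := D.net.ev_velocity Γ.L q
  obtain ⟨i, y⟩ := q
  obtain ⟨hi, hy⟩ := hq
  obtain rfl : i = Γ.i₁ := hi
  simp only at hy
  have hy' := Γ.strand_mem_edge (Set.Ioo_subset_Icc_self hy)
  have hyb := Γ.strand_mem_edge ⟨Γ.yl_lt.le, Γ.lt_yr.le⟩
  have hyl := Γ.strand_mem_edge ⟨le_rfl, (Γ.yl_lt.trans Γ.lt_yr).le⟩
  have hyr := Γ.strand_mem_edge ⟨(Γ.yl_lt.trans Γ.lt_yr).le, le_rfl⟩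
  have hf : ⌊(y : ℝ)⌋₊ = Γ.m :=
    (Nat.floor_eq_iff y.2.1).2 ⟨hy'.1, hy.2.trans Γ.yr_lt⟩
  have hE : D.net.edgeVector Γ.i₁ y = D.net.vert Γ.i₁ (Γ.m + 1) - D.net.vert Γ.i₁ Γ.m := by
    rw [PolygonSystem.edgeVector, hf]
  set E := D.net.vert Γ.i₁ (Γ.m + 1) - D.net.vert Γ.i₁ Γ.m with hEdef
  have hc : ∀ {x : ℝ}, x ∈ Set.Icc (Γ.m : ℝ) (Γ.m + 1) →
      D.net.curve Γ.i₁ x = D.net.curve Γ.i₁ Γ.yb + (x - Γ.yb) • E := by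
    intro x hx
    rw [D.net.curve_eq_of_mem_Icc hx, D.net.curve_eq_of_mem_Icc hyb, hEdef]
    module
  -- `L` vanishes at two different points of the strand, hence along its direction.
  have hLE : ev Γ.L E = 0 := by
    have h1 := Γ.S_strand Γ.yl ⟨le_rfl, (Γ.yl_lt.trans Γ.lt_yr).le⟩
    have h2 := Γ.S_strand Γ.yb ⟨Γ.yl_lt.le, Γ.lt_yr.le⟩
    have h3 : ev Γ.L (D.net.curve Γ.i₁ Γ.yl) = 0 := by rw [ev_L, h1]; ring
    have h4 : ev Γ.L (D.net.curve Γ.i₁ Γ.yb) = 0 := by rw [ev_L, h2]; ring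
    rw [hc hyl, ev_add, ev_smul, h4, zero_add] at h3
    exact (mul_eq_zero.1 h3).resolve_left (sub_ne_zero.2 Γ.yl_lt.ne)
  have hcoord : D.net.coord ⟨Γ.i₁, y⟩ = D.net.curve Γ.i₁ Γ.yb + ((y : ℝ) - Γ.yb) • E := hc hy'
  change Γ.T 0 * _ + Γ.T 1 * _ = (ev Γ.T (D.net.edgeVector Γ.i₁ y) * _ -
    _ * D.net.edgeVector Γ.i₁ y 2) / _ at hT
  change Γ.L 0 * _ + Γ.L 1 * _ = (ev Γ.L (D.net.edgeVector Γ.i₁ y) * _ -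
    _ * D.net.edgeVector Γ.i₁ y 2) / _ at hL
  rw [hE] at hT hL
  rw [hLE, hLc, zero_mul, zero_mul, sub_zero, zero_div] at hL
  have hnum : ev Γ.T E * D.net.coord ⟨Γ.i₁, y⟩ 2 - ev Γ.T (D.net.coord ⟨Γ.i₁, y⟩) * E 2 =
      ev Γ.T E * D.net.curve Γ.i₁ Γ.yb 2 := by
    rw [hcoord, ev_add, ev_smul, Γ.T_yb]
    simp only [Pi.add_apply, Pi.smul_apply, smul_eq_mul]
    ring
  rw [hnum] at hT
  rw [← hT]
  -- `L` is `S - κ T - w`, and neither a multiple of `T` nor `w` contributes to this minor. As `L`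
  -- vanishes on the velocity of the strand, that velocity is determined by its value under `T`.
  have hδ : Γ.L 0 * Γ.T 1 - Γ.L 1 * Γ.T 0 = Γ.S 0 * Γ.T 1 - Γ.S 1 * Γ.T 0 := by
    simp only [L]
    simp
    ring
  have hδ' := Γ.det_ne
  rw [div_mul_eq_mul_div, eq_div_iff hδ', ← hδ]
  simp only [det₂]
  linear_combination -(v.1 * Γ.T 0 + v.2 * Γ.T 1) * hL

theorem T_strand {q : D.net.Point} (hq : Γ.InStrand q) :
    ev Γ.T (D.net.coord q) = ((q.2 : ℝ) - Γ.yb) *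
      ev Γ.T (D.net.vert Γ.i₁ (Γ.m + 1) - D.net.vert Γ.i₁ Γ.m) := by
  obtain ⟨i, y⟩ := q
  obtain ⟨hi, hy⟩ := hq
  obtain rfl : i = Γ.i₁ := hi
  have hy' := Γ.strand_mem_edge (Set.Ioo_subset_Icc_self hy)
  have hyb := Γ.strand_mem_edge ⟨Γ.yl_lt.le, Γ.lt_yr.le⟩
  have h := Γ.T_yb
  change ev Γ.T (D.net.curve Γ.i₁ y) = _
  rw [D.net.curve_eq_of_mem_Icc hyb, ev_add, ev_smul, ev_smul] at h
  rw [D.net.curve_eq_of_mem_Icc hy', ev_add, ev_smul, ev_smul, ev_sub]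
  simp only
  linear_combination h

/-- The two crossings of the finger with the strand. -/
theorem exists_crossings : ∃ p₁ p₂ q₁ q₂ : D.net.Point,
    (p₁.1 = Γ.i₀ ∧ (p₁.2 : ℝ) ∈ Set.Ioo (Γ.l : ℝ) (Γ.l + 1)) ∧
    (p₂.1 = Γ.i₀ ∧ (p₂.2 : ℝ) ∈ Set.Ioo (Γ.l + 1 : ℝ) (Γ.l + 2)) ∧
    Γ.InStrand q₁ ∧ Γ.InStrand q₂ ∧
    Γ.net.toProj p₁ = Γ.net.toProj q₁ ∧ Γ.net.toProj p₂ = Γ.net.toProj q₂ ∧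
    (∀ p q, Γ.InFinger p → p ≠ q → Γ.net.toProj p = Γ.net.toProj q →
      (p = p₁ ∧ q = q₁) ∨ (p = p₂ ∧ q = q₂)) ∧
    det₂ (Γ.net.velocity p₁) (Γ.net.velocity q₁) * det₂ (Γ.net.velocity p₂) (Γ.net.velocity q₂) < 0 ∧
    (((q₁.2 : ℝ) < Γ.yb ∧ Γ.yb < q₂.2) ∨ ((q₂.2 : ℝ) < Γ.yb ∧ Γ.yb < q₁.2)) := by
  obtain ⟨p₁, p₂, ⟨h1i, h1x, h1L⟩, ⟨h2i, h2x, h2L⟩, huniq⟩ := Γ.exists_L_eq_zero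
  have h1f : Γ.InFinger p₁ := ⟨h1i, h1x.1, by linarith [h1x.2]⟩
  have h2f : Γ.InFinger p₂ := ⟨h2i, by linarith [h2x.1], h2x.2⟩
  obtain ⟨q₁, hq₁, h1⟩ := Γ.exists_strand_point h1f h1L
  obtain ⟨q₂, hq₂, h2⟩ := Γ.exists_strand_point h2f h2L
  have hwpos : ∀ {q}, Γ.InStrand q → 0 < D.net.coord q 2 * D.net.curve Γ.i₁ Γ.yb 2 := by
    rintro ⟨i, y⟩ ⟨hi, hy⟩
    obtain rfl : i = Γ.i₁ := hi
    exact Γ.w_strand y (Set.Ioo_subset_Icc_self hy)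
  have hTE := Γ.T_edge
  set TE := ev Γ.T (D.net.vert Γ.i₁ (Γ.m + 1) - D.net.vert Γ.i₁ Γ.m) with hTEdef
  set wb := D.net.curve Γ.i₁ Γ.yb 2 with hwb
  refine ⟨p₁, p₂, q₁, q₂, ⟨h1i, h1x⟩, ⟨h2i, h2x⟩, hq₁, hq₂, h1, h2, ?_, ?_, ?_⟩
  · intro p q hp hpq h
    have hq : ¬ Γ.InFinger q := fun hq => hpq (Γ.eq_of_inFinger hp hq h)
    have hqs := Γ.inStrand_of_toProj_eq hp hq h
    rcases huniq p hp (Γ.L_eq_zero_of_toProj_eq hp hq h) with rfl | rfl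
    · exact Or.inl ⟨rfl, Γ.eq_of_inStrand hqs hq₁ (h.symm.trans h1)⟩
    · exact Or.inr ⟨rfl, Γ.eq_of_inStrand hqs hq₂ (h.symm.trans h2)⟩
  · have hv : ∀ {q}, Γ.InStrand q → Γ.net.velocity q = D.net.velocity q := fun {q} hq =>
      Γ.velocity_net (Γ.not_base_of_strand hq.1 (Set.Ioo_subset_Icc_self hq.2))
    rw [hv hq₁, hv hq₂, Γ.strand_velocity hq₁, Γ.strand_velocity hq₂, ← hTEdef, ← hwb,
      Γ.net.ev_velocity Γ.L p₁, Γ.net.ev_velocity Γ.L p₂, h1L, h2L, Γ.coord_net_two, Γ.coord_net_two]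
    have a1 := (Γ.finger_coord h1f).1
    have a2 := (Γ.finger_coord h2f).1
    have b1 := hwpos hq₁
    have b2 := hwpos hq₂
    have c1 : 0 < ev Γ.L (Γ.net.edgeVector p₁.1 p₁.2) * Γ.wm := by
      have := Γ.ev_L_edgeVector_left ⟨h1x.1.le, h1x.2⟩
      rwa [← h1i] at this
    have c2 : ev Γ.L (Γ.net.edgeVector p₂.1 p₂.2) * Γ.wm < 0 := by
      have := Γ.ev_L_edgeVector_right ⟨h2x.1.le, h2x.2⟩
      rwa [← h2i] at this
    set e1 := ev Γ.L (Γ.net.edgeVector p₁.1 p₁.2)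
    set e2 := ev Γ.L (Γ.net.edgeVector p₂.1 p₂.2)
    set w1 := D.net.coord p₁ 2
    set w2 := D.net.coord p₂ 2
    set v1 := D.net.coord q₁ 2
    set v2 := D.net.coord q₂ 2
    have hw1 : w1 ≠ 0 := by rintro h; rw [h] at a1; simp at a1
    have hw2 : w2 ≠ 0 := by rintro h; rw [h] at a2; simp at a2
    have hv1 : v1 ≠ 0 := by rintro h; rw [h] at b1; simp at b1
    have hv2 : v2 ≠ 0 := by rintro h; rw [h] at b2; simp at b2
    have hwb0 : wb ≠ 0 := by rintro h; rw [h] at b1; simp at b1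
    have hwm := Γ.wm_ne
    have hδ := Γ.det_ne
    -- Everything that depends on conventions for representatives is collected in squares or
    -- products known to be positive. The sign left over is that of `e1 * e2`, negative because the
    -- finger goes out and comes back.
    have hkey : TE * wb / v1 ^ 2 / (Γ.S 0 * Γ.T 1 - Γ.S 1 * Γ.T 0) *
        ((e1 * w1 - 0 * Γ.net.edgeVector p₁.1 p₁.2 2) / w1 ^ 2) *
        (TE * wb / v2 ^ 2 / (Γ.S 0 * Γ.T 1 - Γ.S 1 * Γ.T 0) *
          ((e2 * w2 - 0 * Γ.net.edgeVector p₂.1 p₂.2 2) / w2 ^ 2)) =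
        (TE * wb / (v1 * v2 * (Γ.S 0 * Γ.T 1 - Γ.S 1 * Γ.T 0) * w1 * w2 * Γ.wm ^ 2)) ^ 2 *
          ((w1 * Γ.wm) * (w2 * Γ.wm)) * ((e1 * Γ.wm) * (e2 * Γ.wm)) := by
      field_simp
      ring
    rw [hkey]
    refine mul_neg_of_pos_of_neg (mul_pos ?_ (mul_pos a1 a2)) (mul_neg_of_pos_of_neg c1 c2)
    positivity
  -- The strand points inherit `T / w` from the finger points, negative at the first crossing and
  -- positive at the second. Along the strand `T` changes sign at `yb`, so `yb` separates the
  -- parameters.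
  · have hr1 : ev Γ.T (D.net.coord q₁) / D.net.coord q₁ 2 < 0 := by
      obtain ⟨c, hc, h3⟩ := (Γ.net.toProj_eq_iff _ _).1 h1
      have h4 := ratio_eq (l := Γ.T) hc h3
      rw [ev_T_coord_net, ev_T_coord_net, coord_net_two, coord_net_two] at h4
      rw [← h4]
      exact (Γ.base_point h1i ⟨h1x.1.le, by linarith [h1x.2]⟩).2.2.2.2.2.1 h1x.2
    have hr2 : 0 < ev Γ.T (D.net.coord q₂) / D.net.coord q₂ 2 := by
      obtain ⟨c, hc, h3⟩ := (Γ.net.toProj_eq_iff _ _).1 h2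
      have h4 := ratio_eq (l := Γ.T) hc h3
      rw [ev_T_coord_net, ev_T_coord_net, coord_net_two, coord_net_two] at h4
      rw [← h4]
      exact (Γ.base_point h2i ⟨by linarith [h2x.1], h2x.2.le⟩).2.2.2.2.2.2 h2x.1
    rw [Γ.T_strand hq₁, ← hTEdef] at hr1
    rw [Γ.T_strand hq₂, ← hTEdef] at hr2
    have b1 := hwpos hq₁
    have b2 := hwpos hq₂
    set v1 := D.net.coord q₁ 2
    set v2 := D.net.coord q₂ 2
    have hv1 : v1 ≠ 0 := by rintro h; rw [h] at b1; simp at b1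
    have hv2 : v2 ≠ 0 := by rintro h; rw [h] at b2; simp at b2
    have hwb0 : wb ≠ 0 := by rintro h; rw [h] at b1; simp at b1
    have g1 : ((q₁.2 : ℝ) - Γ.yb) * (TE * wb) < 0 := by
      have : ((q₁.2 : ℝ) - Γ.yb) * (TE * wb) = ((q₁.2 : ℝ) - Γ.yb) * TE / v1 * (v1 * wb) := by
        field_simp
      rw [this]
      exact mul_neg_of_neg_of_pos hr1 b1
    have g2 : 0 < ((q₂.2 : ℝ) - Γ.yb) * (TE * wb) := by
      have : ((q₂.2 : ℝ) - Γ.yb) * (TE * wb) = ((q₂.2 : ℝ) - Γ.yb) * TE / v2 * (v2 * wb) := by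
        field_simp
      rw [this]
      exact mul_pos hr2 b2
    rcases lt_or_gt_of_ne (mul_ne_zero hTE hwb0) with h | h
    · right
      exact ⟨by nlinarith, by nlinarith⟩
    · left
      exact ⟨by nlinarith, by nlinarith⟩

end FingerData

end ProjLink

end

noncomputable section

namespace ProjLink

theorem fract_ne_zero_of_mem_Ioo {x : ℝ} {k : ℕ} (h : x ∈ Set.Ioo (k : ℝ) (k + 1)) :
    Int.fract x ≠ 0 := by
  have h1 : ⌊x⌋ = (k : ℤ) := Int.floor_eq_iff.2 ⟨by exact_mod_cast h.1.le, by exact_mod_cast h.2⟩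
  rw [Int.fract, h1]
  have := h.1
  push_cast
  linarith

theorem det₂_swap (u v : ℝ × ℝ) : det₂ v u = -det₂ u v := by
  simp only [det₂]; ring

namespace FingerData

variable {D : Diagram} (Γ : FingerData D)

/-! ### The crossings of the finger -/

/-- The first passage of the finger over the strand. -/
def p₁ : D.net.Point := Γ.exists_crossings.choose

/-- The second passage of the finger over the strand. -/
def p₂ : D.net.Point := Γ.exists_crossings.choose_spec.choose

/-- The passage of the strand under `p₁`. -/
def q₁ : D.net.Point := Γ.exists_crossings.choose_spec.choose_spec.choose

/-- The passage of the strand under `p₂`. -/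
def q₂ : D.net.Point := Γ.exists_crossings.choose_spec.choose_spec.choose_spec.choose

theorem crossings_spec :
    (Γ.p₁.1 = Γ.i₀ ∧ (Γ.p₁.2 : ℝ) ∈ Set.Ioo (Γ.l : ℝ) (Γ.l + 1)) ∧
    (Γ.p₂.1 = Γ.i₀ ∧ (Γ.p₂.2 : ℝ) ∈ Set.Ioo (Γ.l + 1 : ℝ) (Γ.l + 2)) ∧
    Γ.InStrand Γ.q₁ ∧ Γ.InStrand Γ.q₂ ∧
    Γ.net.toProj Γ.p₁ = Γ.net.toProj Γ.q₁ ∧ Γ.net.toProj Γ.p₂ = Γ.net.toProj Γ.q₂ ∧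
    (∀ p q, Γ.InFinger p → p ≠ q → Γ.net.toProj p = Γ.net.toProj q →
      (p = Γ.p₁ ∧ q = Γ.q₁) ∨ (p = Γ.p₂ ∧ q = Γ.q₂)) ∧
    det₂ (Γ.net.velocity Γ.p₁) (Γ.net.velocity Γ.q₁) *
      det₂ (Γ.net.velocity Γ.p₂) (Γ.net.velocity Γ.q₂) < 0 ∧
    (((Γ.q₁.2 : ℝ) < Γ.yb ∧ Γ.yb < Γ.q₂.2) ∨ ((Γ.q₂.2 : ℝ) < Γ.yb ∧ Γ.yb < Γ.q₁.2)) :=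
  Γ.exists_crossings.choose_spec.choose_spec.choose_spec.choose_spec

/-- The point `p` is a passage of the finger over the strand at `q`. -/
def Over (p q : D.net.Point) : Prop := (p = Γ.p₁ ∧ q = Γ.q₁) ∨ (p = Γ.p₂ ∧ q = Γ.q₂)

variable {Γ}

theorem Over.inFinger {p q : D.net.Point} (h : Γ.Over p q) : Γ.InFinger p := by
  obtain ⟨⟨h1, h2⟩, ⟨h3, h4⟩, -⟩ := Γ.crossings_spec
  rcases h with ⟨rfl, -⟩ | ⟨rfl, -⟩
  · exact ⟨h1, h2.1, by linarith [h2.2]⟩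
  · exact ⟨h3, by linarith [h4.1], h4.2⟩

theorem Over.inStrand {p q : D.net.Point} (h : Γ.Over p q) : Γ.InStrand q := by
  obtain ⟨-, -, h1, h2, -⟩ := Γ.crossings_spec
  rcases h with ⟨-, rfl⟩ | ⟨-, rfl⟩
  · exact h1
  · exact h2

theorem Over.toProj_eq {p q : D.net.Point} (h : Γ.Over p q) :
    Γ.net.toProj p = Γ.net.toProj q := by
  obtain ⟨-, -, -, -, h1, h2, -⟩ := Γ.crossings_spec
  rcases h with ⟨rfl, rfl⟩ | ⟨rfl, rfl⟩
  · exact h1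
  · exact h2

theorem Over.ne {p q : D.net.Point} (h : Γ.Over p q) : p ≠ q := by
  intro h'
  exact InStrand.not_inFinger Γ h.inStrand (h' ▸ h.inFinger)

theorem p₁_ne_p₂ : Γ.p₁ ≠ Γ.p₂ := by
  obtain ⟨⟨-, h1⟩, ⟨-, h2⟩, -⟩ := Γ.crossings_spec
  intro h
  rw [h] at h1
  linarith [h1.2, h2.1]

theorem q₁_ne_q₂ : Γ.q₁ ≠ Γ.q₂ := by
  obtain ⟨-, -, -, -, -, -, -, -, h1⟩ := Γ.crossings_spec
  intro h
  rw [h] at h1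
  rcases h1 with h1 | h1 <;> linarith [h1.1, h1.2]

theorem Over.right_unique {p q q' : D.net.Point} (h : Γ.Over p q) (h' : Γ.Over p q') : q = q' := by
  rcases h with ⟨rfl, rfl⟩ | ⟨rfl, rfl⟩ <;> rcases h' with ⟨h1, rfl⟩ | ⟨h1, rfl⟩
  · rfl
  · exact absurd h1 p₁_ne_p₂
  · exact absurd h1.symm p₁_ne_p₂
  · rfl

theorem Over.left_unique {p p' q : D.net.Point} (h : Γ.Over p q) (h' : Γ.Over p' q) : p = p' := by
  rcases h with ⟨rfl, rfl⟩ | ⟨rfl, rfl⟩ <;> rcases h' with ⟨rfl, h1⟩ | ⟨rfl, h1⟩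
  · rfl
  · exact absurd h1 q₁_ne_q₂
  · exact absurd h1.symm q₁_ne_q₂
  · rfl

theorem InFinger.not_isMultiple {p : D.net.Point} (h : Γ.InFinger p) : ¬ D.net.IsMultiple p :=
  Γ.base_regular p h.1 (Set.Ioo_subset_Icc_self h.2)

theorem InStrand.not_isMultiple {p : D.net.Point} (h : Γ.InStrand p) : ¬ D.net.IsMultiple p :=
  Γ.strand_regular p h.1 (Set.Ioo_subset_Icc_self h.2)

theorem not_inFinger_of_crosses {p q : D.net.Point} (h : D.Crosses p q) : ¬ Γ.InFinger p :=
  fun hp => hp.not_isMultiple ⟨q, h.1.symm, h.2.symm⟩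

theorem crosses_symm {p q : D.net.Point} (h : D.Crosses p q) : D.Crosses q p := ⟨h.1.symm, h.2.symm⟩

variable (Γ)

theorem toProj_net_iff {p q : D.net.Point} (hp : ¬ Γ.InFinger p) (hq : ¬ Γ.InFinger q) :
    Γ.net.toProj p = Γ.net.toProj q ↔ D.net.toProj p = D.net.toProj q := by
  rw [Γ.net.toProj_eq_iff, D.net.toProj_eq_iff, Γ.coord_net_of_not_inFinger hp,
    Γ.coord_net_of_not_inFinger hq]

/-- The crossings of the new net. -/
theorem net_crosses_iff (p q : D.net.Point) : (p ≠ q ∧ Γ.net.toProj p = Γ.net.toProj q) ↔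
    D.Crosses p q ∨ Γ.Over p q ∨ Γ.Over q p := by
  constructor
  · rintro ⟨h1, h2⟩
    have hu := Γ.crossings_spec.2.2.2.2.2.2.1
    by_cases hp : Γ.InFinger p
    · exact Or.inr (Or.inl (hu p q hp h1 h2))
    · by_cases hq : Γ.InFinger q
      · exact Or.inr (Or.inr (hu q p hq h1.symm h2.symm))
      · exact Or.inl ⟨h1, (Γ.toProj_net_iff hp hq).1 h2⟩
  · rintro (h | h | h)
    · exact ⟨h.1, (Γ.toProj_net_iff (not_inFinger_of_crosses h)
        (not_inFinger_of_crosses (crosses_symm h))).2 h.2⟩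
    · exact ⟨h.ne, h.toProj_eq⟩
    · exact ⟨h.ne.symm, h.toProj_eq.symm⟩

theorem net_isMultiple_iff (p : D.net.Point) : Γ.net.IsMultiple p ↔
    D.net.IsMultiple p ∨ (∃ q, Γ.Over p q) ∨ ∃ q, Γ.Over q p := by
  constructor
  · rintro ⟨q, h1, h2⟩
    rcases (Γ.net_crosses_iff p q).1 ⟨h1.symm, h2.symm⟩ with h | h | h
    · exact Or.inl ⟨q, h1, h.2.symm⟩
    · exact Or.inr (Or.inl ⟨q, h⟩)
    · exact Or.inr (Or.inr ⟨q, h⟩)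
  · have key : ∀ q, D.Crosses p q ∨ Γ.Over p q ∨ Γ.Over q p → Γ.net.IsMultiple p := by
      intro q h
      obtain ⟨h1, h2⟩ := (Γ.net_crosses_iff p q).2 h
      exact ⟨q, h1.symm, h2.symm⟩
    rintro (⟨q, h1, h2⟩ | ⟨q, h⟩ | ⟨q, h⟩)
    · exact key q (Or.inl ⟨h1.symm, h2.symm⟩)
    · exact key q (Or.inr (Or.inl h))
    · exact key q (Or.inr (Or.inr h))

theorem velocity_net_of_crosses {p q : D.net.Point} (h : D.Crosses p q) :
    Γ.net.velocity p = D.net.velocity p :=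
  Γ.velocity_net fun hp => Γ.base_regular p hp.1 hp.2 ⟨q, h.1.symm, h.2.symm⟩

theorem Over.det_ne {p q : D.net.Point} (h : Γ.Over p q) :
    det₂ (Γ.net.velocity p) (Γ.net.velocity q) ≠ 0 := by
  have h1 := Γ.crossings_spec.2.2.2.2.2.2.2.1
  rcases h with ⟨rfl, rfl⟩ | ⟨rfl, rfl⟩
  · exact left_ne_zero_of_mul h1.ne
  · exact right_ne_zero_of_mul h1.ne

/-- The point `p` is on the finger at a new crossing. -/
def IsTop (p : D.net.Point) : Prop := ∃ q, Γ.Over p q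

/-- The point `p` is on the strand at a new crossing. -/
def IsBottom (p : D.net.Point) : Prop := ∃ q, Γ.Over q p

/-- The diagram after the finger move: the finger passes over the strand. -/
abbrev diagram : Diagram where
  net := Γ.net
  vert_off_infinity i k hk := by
    change (D.net.vert i k + (Γ.hat i k * (Γ.wm * Γ.M)) • Γ.dir) 2 ≠ 0
    rw [Pi.add_apply, Pi.smul_apply, Γ.dir_two, smul_zero, add_zero]
    exact D.vert_off_infinity i k hk
  finite_multiple := by
    refine (D.finite_multiple.union (Set.toFinite {Γ.p₁, Γ.p₂, Γ.q₁, Γ.q₂})).subset fun p hp => ?_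
    rcases (Γ.net_isMultiple_iff p).1 hp with h | ⟨q, ⟨rfl, -⟩ | ⟨rfl, -⟩⟩ | ⟨q, ⟨-, rfl⟩ | ⟨-, rfl⟩⟩
    · exact Or.inl h
    all_goals simp
  interior p hp := by
    rw [Γ.coord_net_two]
    rcases (Γ.net_isMultiple_iff p).1 hp with h | ⟨q, h⟩ | ⟨q, h⟩
    · exact D.interior p h
    · refine ⟨?_, Γ.ne_zero_of_mul_wm_pos (Γ.finger_coord h.inFinger).1⟩
      obtain ⟨⟨-, h1⟩, ⟨-, h2⟩, -⟩ := Γ.crossings_spec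
      rcases h with ⟨rfl, -⟩ | ⟨rfl, -⟩
      · exact fract_ne_zero_of_mem_Ioo h1
      · refine fract_ne_zero_of_mem_Ioo (k := Γ.l + 1) ?_
        push_cast
        exact ⟨h2.1, by linarith [h2.2]⟩
    · obtain ⟨h1, h2⟩ := h.inStrand
      refine ⟨fract_ne_zero_of_mem_Ioo (k := Γ.m)
        ⟨Γ.m_lt_yl.trans h2.1, h2.2.trans Γ.yr_lt⟩, fun h0 => ?_⟩
      have h3 := Γ.w_strand _ (Set.Ioo_subset_Icc_self h2)
      rw [← h1] at h3
      change 0 < D.net.coord p 2 * _ at h3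
      rw [h0, zero_mul] at h3
      exact lt_irrefl _ h3
  transversal p q hpq h := by
    rcases (Γ.net_crosses_iff p q).1 ⟨hpq, h⟩ with h | h | h
    · rw [Γ.velocity_net_of_crosses h, Γ.velocity_net_of_crosses (crosses_symm h)]
      exact D.transversal p q h.1 h.2
    · exact h.det_ne
    · rw [det₂_swap]
      exact neg_ne_zero.2 h.det_ne
  double p q r hq hr hqp hrp := by
    -- Old crossings cannot share a point with new ones, since base and strand are regular. New
    -- crossings cannot share a point with each other, since finger and strand are disjoint and the
    -- pairing is injective.
    have hm : ∀ {p q}, D.Crosses p q → D.net.IsMultiple p := fun h => ⟨_, h.1.symm, h.2.symm⟩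
    rcases (Γ.net_crosses_iff p q).1 ⟨hq.symm, hqp.symm⟩ with h | h | h <;>
      rcases (Γ.net_crosses_iff p r).1 ⟨hr.symm, hrp.symm⟩ with h' | h' | h'
    · exact D.double p q r hq hr h.2.symm h'.2.symm
    · exact absurd (hm h) h'.inFinger.not_isMultiple
    · exact absurd (hm h) h'.inStrand.not_isMultiple
    · exact absurd (hm h') h.inFinger.not_isMultiple
    · exact h.right_unique h'
    · exact absurd h.inFinger (InStrand.not_inFinger Γ h'.inStrand)
    · exact absurd (hm h') h.inStrand.not_isMultiple
    · exact absurd h'.inFinger (InStrand.not_inFinger Γ h.inStrand)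
    · exact h.left_unique h'
  -- The old value at a strand point is arbitrary, as that point was regular, and has to be
  -- overridden.
  isOver p := Γ.IsTop p ∨ (¬ Γ.IsBottom p ∧ D.isOver p)
  isOver_iff p q hpq h := by
    have hT : ∀ {p q}, D.Crosses p q → ¬ Γ.IsTop p := fun h ⟨_, h'⟩ =>
      h'.inFinger.not_isMultiple ⟨_, h.1.symm, h.2.symm⟩
    have hB : ∀ {p q}, D.Crosses p q → ¬ Γ.IsBottom p := fun h ⟨_, h'⟩ =>
      h'.inStrand.not_isMultiple ⟨_, h.1.symm, h.2.symm⟩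
    have hTB : ∀ {p q}, Γ.Over p q → ¬ Γ.IsTop q := fun h ⟨_, h'⟩ =>
      InStrand.not_inFinger Γ h.inStrand h'.inFinger
    rcases (Γ.net_crosses_iff p q).1 ⟨hpq, h⟩ with h | h | h
    · simp only [hT h, hB h, hT (crosses_symm h), hB (crosses_symm h), false_or, not_false_iff,
        true_and]
      exact D.isOver_iff p q h.1 h.2
    · have h1 : Γ.IsTop p := ⟨q, h⟩
      have h2 : Γ.IsBottom q := ⟨p, h⟩
      simp only [h1, h2, hTB h, true_or, false_or, not_true_eq_false, false_and, not_false_iff]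
    · have h1 : Γ.IsTop q := ⟨p, h⟩
      have h2 : Γ.IsBottom p := ⟨q, h⟩
      simp only [h1, h2, hTB h, true_or, false_or, not_true_eq_false, false_and]

theorem diagram_isOver_of_crosses {p q : D.net.Point} (h : D.Crosses p q) :
    Γ.diagram.isOver p ↔ D.isOver p := by
  have hT : ¬ Γ.IsTop p := fun ⟨_, h'⟩ =>
    h'.inFinger.not_isMultiple ⟨_, h.1.symm, h.2.symm⟩
  have hB : ¬ Γ.IsBottom p := fun ⟨_, h'⟩ =>
    h'.inStrand.not_isMultiple ⟨_, h.1.symm, h.2.symm⟩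
  change (Γ.IsTop p ∨ (¬ Γ.IsBottom p ∧ D.isOver p)) ↔ _
  simp only [hT, hB, false_or, not_false_iff, true_and]

theorem diagram_positivePair_of_crosses {p q : D.net.Point} (h : D.Crosses p q) :
    Γ.diagram.PositivePair p q ↔ D.PositivePair p q := by
  have h' := crosses_symm h
  rw [Diagram.PositivePair, Diagram.PositivePair, Γ.diagram_isOver_of_crosses h,
    Γ.diagram_isOver_of_crosses h']
  change _ ∧ 0 < det₂ (Γ.net.velocity p) (Γ.net.velocity q) ∨
    _ ∧ 0 < det₂ (Γ.net.velocity q) (Γ.net.velocity p) ↔ _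
  rw [Γ.velocity_net_of_crosses h, Γ.velocity_net_of_crosses h']

theorem Over.positivePair_iff {p q : D.net.Point} (h : Γ.Over p q) :
    Γ.diagram.PositivePair p q ↔ 0 < det₂ (Γ.net.velocity p) (Γ.net.velocity q) := by
  have h1 : Γ.diagram.isOver p := Or.inl ⟨q, h⟩
  have h2 : ¬ Γ.diagram.isOver q := (Γ.diagram.isOver_iff p q h.ne h.toProj_eq).1 h1
  exact ⟨fun h' => h'.elim And.right fun h'' => absurd h''.1 h2, fun h' => Or.inl ⟨h1, h'⟩⟩

/-- The tip of the finger. -/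
def tip : D.net.Point :=
  ⟨Γ.i₀, Γ.l + 1, by positivity, by exact_mod_cast Γ.l_lt⟩

/-- The point of the strand in front of the finger. -/
def target : D.net.Point :=
  ⟨Γ.i₁, Γ.yb, Γ.yl_nonneg.trans Γ.yl_lt.le, Γ.strand_lt_len Γ.lt_yr.le⟩

theorem diagram_crosses_iff (p q : D.net.Point) :
    Γ.diagram.Crosses p q ↔ D.Crosses p q ∨ Γ.Over p q ∨ Γ.Over q p := Γ.net_crosses_iff p q

/-- The finger move merges two state circles. -/
theorem card_circle_lt (hne : circleOf D.Crosses D.PositivePair (Γ.tip, false) ≠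
    circleOf D.Crosses D.PositivePair (Γ.target, false)) :
    Nat.card Γ.diagram.Circle < Nat.card D.Circle := by
  obtain ⟨⟨h1i, h1x⟩, ⟨h2i, h2x⟩, hq₁, hq₂, -, -, -, hdet, hside⟩ := Γ.crossings_spec
  have o₁ : Γ.Over Γ.p₁ Γ.q₁ := Or.inl ⟨rfl, rfl⟩
  have o₂ : Γ.Over Γ.p₂ Γ.q₂ := Or.inr ⟨rfl, rfl⟩
  have s₁ := o₁.positivePair_iff
  have s₂ := o₂.positivePair_iff
  have hover : ∀ {p q}, Γ.Over p q → (p = Γ.p₁ ∧ q = Γ.q₁) ∨ (p = Γ.p₂ ∧ q = Γ.q₂) := fun h => h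
  have hdet1 := o₁.det_ne
  revert s₁ s₂
  -- Freeing the chosen points allows their component indices to be substituted, so that their
  -- parameters can be compared within one interval.
  generalize hP₁ : Γ.p₁ = P₁ at *
  generalize hP₂ : Γ.p₂ = P₂ at *
  generalize hQ₁ : Γ.q₁ = Q₁ at *
  generalize hQ₂ : Γ.q₂ = Q₂ at *
  intro s₁ s₂
  obtain ⟨i, x₁⟩ := P₁
  obtain rfl : i = Γ.i₀ := h1i
  obtain ⟨i, x₂⟩ := P₂
  obtain rfl : i = Γ.i₀ := h2i
  obtain ⟨i, y₁⟩ := Q₁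
  obtain ⟨i', y₂⟩ := Q₂
  obtain ⟨hi, hy₁⟩ := hq₁
  obtain ⟨hi', hy₂⟩ := hq₂
  obtain rfl : i = Γ.i₁ := hi
  obtain rfl : i' = Γ.i₁ := hi'
  simp only at h1x h2x hy₁ hy₂ hside
  have hnp : ∀ p : D.net.Point, ¬ D.net.IsMultiple p → p ∉ passages D.Crosses :=
    fun p h h' => h (D.mem_passages.1 h')
  -- Which crossing the strand meets first depends on its direction, so its two passages are renamed
  -- by increasing parameter.
  obtain ⟨ya, yz, haz, ha, hz, hya, hyz⟩ : ∃ ya yz : Set.Ico (0 : ℝ) (D.net.len Γ.i₁),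
      ((y₁ = ya ∧ y₂ = yz) ∨ (y₁ = yz ∧ y₂ = ya)) ∧ (ya : ℝ) < Γ.yb ∧ Γ.yb < (yz : ℝ) ∧
      Γ.yl < ya ∧ (yz : ℝ) < Γ.yr := by
    rcases hside with h | h
    · exact ⟨y₁, y₂, Or.inl ⟨rfl, rfl⟩, h.1, h.2, hy₁.1, hy₂.2⟩
    · exact ⟨y₂, y₁, Or.inr ⟨rfl, rfl⟩, h.1, h.2, hy₂.1, hy₁.2⟩
  obtain ⟨f, hf, hf'⟩ := D.isCrossingData.exists_merge (X₂ := Γ.diagram.Crosses)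
    (pos₂ := Γ.diagram.PositivePair) D.net.len_pos (i := Γ.i₀) (j := Γ.i₁)
    (x₁ := x₁) (a := Γ.tip.2) (x₂ := x₂) (y₁ := ya) (b := Γ.target.2) (y₂ := yz)
    (w₁ := ⟨Γ.i₁, y₁⟩) (w₂ := ⟨Γ.i₁, y₂⟩) h1x.2 h2x.1 ha hz
    (fun z h1 h2 => hnp _ (Γ.base_regular _ rfl
      ⟨h1x.1.le.trans h1, le_trans (Subtype.coe_le_coe.2 h2) h2x.2.le⟩))
    (fun z h1 h2 => hnp _ (Γ.strand_regular _ rfl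
      ⟨hya.le.trans h1, le_trans (Subtype.coe_le_coe.2 h2) hyz.le⟩))
    (fun z w h1 h2 h3 h4 h5 => by
      refine Γ.not_base_of_strand (p := ⟨Γ.i₁, w⟩) rfl
        ⟨hya.le.trans h3, le_trans (Subtype.coe_le_coe.2 h4) hyz.le⟩ ?_
      rw [← h5]
      exact ⟨rfl, h1x.1.le.trans h1, le_trans (Subtype.coe_le_coe.2 h2) h2x.2.le⟩)
    (by
      rintro p ⟨q, h⟩
      rcases (Γ.diagram_crosses_iff p q).1 h with h | h | h
      · exact Or.inl ⟨q, h⟩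
      · rcases hover h with ⟨rfl, -⟩ | ⟨rfl, -⟩
        · exact Or.inr (Or.inl rfl)
        · exact Or.inr (Or.inr (Or.inl rfl))
      · rcases hover h with ⟨-, rfl⟩ | ⟨-, rfl⟩ <;> rcases haz with ⟨rfl, rfl⟩ | ⟨rfl, rfl⟩
        · exact Or.inr (Or.inr (Or.inr (Or.inl rfl)))
        · exact Or.inr (Or.inr (Or.inr (Or.inr rfl)))
        · exact Or.inr (Or.inr (Or.inr (Or.inr rfl)))
        · exact Or.inr (Or.inr (Or.inr (Or.inl rfl))))
    (fun p q h => ⟨(Γ.diagram_crosses_iff p q).2 (Or.inl h),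
      Γ.diagram_positivePair_of_crosses h⟩)
    (by
      rcases haz with ⟨rfl, rfl⟩ | ⟨rfl, rfl⟩
      · exact Or.inl ⟨rfl, rfl⟩
      · exact Or.inr ⟨rfl, rfl⟩)
    ((Γ.diagram_crosses_iff _ _).2 (Or.inr (Or.inl o₁)))
    ((Γ.diagram_crosses_iff _ _).2 (Or.inr (Or.inl o₂)))
    Γ.diagram.isCrossingData.symm
    (by
      -- The finger is over at both crossings, so the signs are those of the two determinants, whose
      -- product is negative.
      rw [s₁, s₂, not_lt]
      constructor
      · intro h; by_contra h'
        exact lt_asymm hdet (mul_pos h (not_le.1 h'))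
      · intro h
        rcases lt_or_gt_of_ne hdet1 with h' | h'
        · exact absurd hdet (not_lt.2 (mul_nonneg_of_nonpos_of_nonpos h'.le h))
        · exact h')
    hne
  have : Finite D.Circle := inferInstance
  have := Fintype.ofFinite D.Circle
  have : Finite Γ.diagram.Circle := inferInstance
  have := Fintype.ofFinite Γ.diagram.Circle
  rw [Nat.card_eq_fintype_card, Nat.card_eq_fintype_card]
  exact Fintype.card_lt_of_surjective_not_injective f hf hf'

end FingerData

end ProjLink

end

/-! ### The finger move as an ambient isotopy -/

noncomputable section

namespace ProjLink

namespace Diagram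

variable {D : Diagram}

/-- Changing the heights by a function of the point of the affine plane. -/
theorem IsHeight.add {z : Fin D.net.num → ℝ → ℝ} (hz : D.IsHeight z) (G : (Fin 3 → ℝ) → ℝ)
    (hG : Continuous G) {C : ℝ} (hC : ∀ x, |G x| ≤ C) :
    D.IsHeight fun i x => z i x + D.net.curve i x 2 *
      G fun k => D.net.curve i x k / D.net.curve i x 2 where
  continuousOn i := (hz.continuousOn i).add
    ((continuous_homogenization 2 G hG hC).comp_continuousOn
      (D.net.continuousOn_curve i (D.net.len i)))
  closed i := by
    rw [hz.closed, D.net.curve_len, homogenization_smul]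
    ring
  above p q hpq h ho := by
    have h1 := hz.above p q hpq h ho
    obtain ⟨c, hc, hcoord⟩ := (D.net.toProj_eq_iff p q).1 h
    have hw := (D.interior p ⟨q, hpq.symm, h.symm⟩).2
    have hw' := (D.interior q ⟨p, hpq, h⟩).2
    have e : ∀ r : D.net.Point, D.net.coord r 2 ≠ 0 → (z r.1 r.2 + D.net.coord r 2 *
        G fun k => D.net.coord r k / D.net.coord r 2) / D.net.coord r 2 =
        z r.1 r.2 / D.net.coord r 2 + G fun k => D.net.coord r k / D.net.coord r 2 := by
      intro r hr
      field_simp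
    refine ((e q hw').trans_lt ?_).trans_eq (e p hw).symm
    -- Both strands at a crossing lie over the same affine point, so their heights change by the
    -- same amount.
    have e2 : (fun k => D.net.coord p k / D.net.coord p 2) =
        fun k => D.net.coord q k / D.net.coord q 2 := by
      funext k
      rw [hcoord, Pi.smul_apply, Pi.smul_apply, smul_eq_mul, smul_eq_mul,
        mul_div_mul_left _ _ hc]
    rw [e2]
    linarith

/-- The displacement is vertical and independent of the height, so on each vertical line the shear
is a translation. -/
theorem ambientIsotopic_lift_add (z : Fin D.net.num → ℝ → ℝ) (G : (Fin 3 → ℝ) → ℝ)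
    (hG : Continuous G) {C : ℝ} (hC : ∀ x, |G x| ≤ C) :
    AmbientIsotopic (Set.range (D.lift z)) (Set.range (D.lift fun i x => z i x +
      D.net.curve i x 2 * G fun k => D.net.curve i x k / D.net.curve i x 2)) := by
  refine ambientIsotopic_affineShear ![0, 0, 0, 1] rfl (fun V => G ![V 0, V 1, V 2])
    (hG.comp ?_) C (fun x => hC _) ?_ (D.liftCoord z) _ (D.liftCoord_ne_zero z)
    (D.liftCoord_ne_zero _) ?_
  · refine continuous_pi fun k => ?_
    fin_cases k <;> exact continuous_apply _
  · intro x s t hst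
    have h : ∀ s : ℝ, (![(x + s • (![0, 0, 0, 1] : Fin 4 → ℝ)) 0,
        (x + s • (![0, 0, 0, 1] : Fin 4 → ℝ)) 1, (x + s • (![0, 0, 0, 1] : Fin 4 → ℝ)) 2] :
          Fin 3 → ℝ) = ![x 0, x 1, x 2] := by
      intro s
      funext k
      fin_cases k <;> simp
    simp only [h]
    linarith
  · intro p
    have h : (![D.liftCoord z p 0 / D.liftCoord z p 2, D.liftCoord z p 1 / D.liftCoord z p 2,
        D.liftCoord z p 2 / D.liftCoord z p 2] : Fin 3 → ℝ) =
        fun k => D.net.coord p k / D.net.coord p 2 := by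
      funext k
      fin_cases k <;> rfl
    rw [h]
    funext k
    fin_cases k
    · simp [liftCoord]
    · simp [liftCoord]
    · simp [liftCoord]
    · simp [liftCoord]
      rfl

end Diagram

namespace FingerData

variable {D : Diagram} (Γ : FingerData D)

theorem continuous_tent : Continuous Γ.tent := by
  unfold tent
  fun_prop

/-- The cut-off function of the finger move in the direction of the finger. -/
def cutoff (s : ℝ) : ℝ := max 0 (min (1 + s / Γ.η) (1 - s / (1 + Γ.η)))

theorem continuous_cutoff : Continuous Γ.cutoff := by
  unfold cutoff
  fun_prop

theorem cutoff_zero : Γ.cutoff 0 = 1 := by simp [cutoff]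

theorem cutoff_nonneg (s : ℝ) : 0 ≤ Γ.cutoff s := le_max_left _ _

theorem cutoff_le_one (s : ℝ) : Γ.cutoff s ≤ 1 := by
  have hη := Γ.η_pos
  refine max_le zero_le_one ?_
  rcases le_total s 0 with h | h
  · refine (min_le_left _ _).trans ?_
    have := div_nonpos_of_nonpos_of_nonneg h hη.le
    linarith
  · refine (min_le_right _ _).trans ?_
    have : 0 ≤ s / (1 + Γ.η) := div_nonneg h (by linarith)
    linarith

theorem cutoff_eq_zero {s : ℝ} (h : s < -Γ.η ∨ 1 + Γ.η < s) : Γ.cutoff s = 0 := by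
  have hη := Γ.η_pos
  apply max_eq_left
  rcases h with h | h
  · refine (min_le_left _ _).trans ?_
    have : s / Γ.η ≤ -1 := by rw [div_le_iff₀ hη]; linarith
    linarith
  · refine (min_le_right _ _).trans ?_
    have : 1 ≤ s / (1 + Γ.η) := by rw [le_div_iff₀ (by linarith)]; linarith
    linarith

/-- The cut-off falls with slope at most `1 / (1 + η)`; its steeper rise on the left is harmless for
monotonicity. -/
theorem cutoff_le {a b : ℝ} (h : a ≤ b) : Γ.cutoff a ≤ Γ.cutoff b + (b - a) / (1 + Γ.η) := by
  have hη := Γ.η_pos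
  have h1 : 0 ≤ (b - a) / (1 + Γ.η) := div_nonneg (by linarith) (by linarith)
  have h2 : a / Γ.η ≤ b / Γ.η := by gcongr
  refine max_le (add_nonneg (Γ.cutoff_nonneg b) h1) ?_
  have h3 : min (1 + a / Γ.η) (1 - a / (1 + Γ.η)) ≤
      min (1 + b / Γ.η) (1 - b / (1 + Γ.η)) + (b - a) / (1 + Γ.η) := by
    rw [← min_add_add_right]
    refine min_le_min (by linarith) (le_of_eq ?_)
    ring
  exact h3.trans (by gcongr; exact le_max_right _ _)

/-- The displacement of the finger move. -/
def push (C : ℝ) (x : Fin 4 → ℝ) : ℝ :=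
  Γ.M * Γ.tent (ev Γ.T ![x 0, x 1, x 2]) * max 0 (min 1 (x 3 - C)) *
    Γ.cutoff (ev Γ.S ![x 0, x 1, x 2])

theorem continuous_push (C : ℝ) : Continuous (Γ.push C) := by
  have h : Continuous fun x : Fin 4 → ℝ => (![x 0, x 1, x 2] : Fin 3 → ℝ) := by
    refine continuous_pi fun k => ?_
    fin_cases k <;> exact continuous_apply _
  unfold push
  have h1 := Γ.continuous_tent.comp ((continuous_ev Γ.T).comp h)
  have h2 := Γ.continuous_cutoff.comp ((continuous_ev Γ.S).comp h)
  have h3 : Continuous fun x : Fin 4 → ℝ => max 0 (min 1 (x 3 - C)) := by fun_prop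
  exact ((continuous_const.mul h1).mul h3).mul h2

theorem amplitude_mem (C r ζ : ℝ) :
    Γ.M * Γ.tent r * max 0 (min 1 (ζ - C)) ∈ Set.Icc 0 Γ.M := by
  have hM := Γ.one_lt_M
  have h1 := Γ.tent_nonneg r
  have h2 := Γ.tent_le_one r
  have h3 : 0 ≤ max 0 (min 1 (ζ - C)) := le_max_left _ _
  have h4 : max 0 (min 1 (ζ - C)) ≤ 1 := max_le zero_le_one (min_le_left _ _)
  refine ⟨by positivity, ?_⟩
  calc Γ.M * Γ.tent r * max 0 (min 1 (ζ - C)) ≤ Γ.M * 1 * 1 := by gcongr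
    _ = Γ.M := by ring

theorem abs_push_le (C : ℝ) (x : Fin 4 → ℝ) : |Γ.push C x| ≤ Γ.M := by
  obtain ⟨h1, h2⟩ := Γ.amplitude_mem C (ev Γ.T ![x 0, x 1, x 2]) (x 3)
  rw [push, abs_of_nonneg (mul_nonneg h1 (Γ.cutoff_nonneg _))]
  exact (mul_le_of_le_one_right h1 (Γ.cutoff_le_one _)).trans h2

/-- The direction of the finger in homogeneous coordinates of projective space. -/
def dir₄ : Fin 4 → ℝ := ![Γ.dir 0, Γ.dir 1, 0, 0]

/-- Along the direction of the finger only `cutoff` varies. The amplitude is at most `M = 1 + η /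
2`, which is less than `1 + η`, so the push never overtakes itself. This is the reason for the value
of `M`. -/
theorem strictMono_push (C : ℝ) (x : Fin 4 → ℝ) :
    StrictMono fun s : ℝ => s + Γ.push C (x + s • Γ.dir₄) := by
  intro s t hst
  have hη := Γ.η_pos
  have hv : ∀ s : ℝ, (![(x + s • Γ.dir₄) 0, (x + s • Γ.dir₄) 1, (x + s • Γ.dir₄) 2] : Fin 3 → ℝ) =
      ![x 0, x 1, x 2] + s • Γ.dir := by
    intro s
    funext k
    fin_cases k <;> simp [dir₄]
    exact Or.inr Γ.dir_two
  have h3 : ∀ s : ℝ, (x + s • Γ.dir₄) 3 = x 3 := by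
    intro s
    simp [dir₄]
  simp only [push, hv, h3, ev_add, ev_smul, Γ.ev_S_dir, Γ.ev_T_dir, mul_zero, add_zero, mul_one]
  obtain ⟨h1, h2⟩ := Γ.amplitude_mem C (ev Γ.T ![x 0, x 1, x 2]) (x 3)
  set A := Γ.M * Γ.tent (ev Γ.T ![x 0, x 1, x 2]) * max 0 (min 1 (x 3 - C))
  set σ := ev Γ.S ![x 0, x 1, x 2]
  have h4 := Γ.cutoff_le (show σ + s ≤ σ + t by linarith)
  have e : σ + t - (σ + s) = t - s := by ring
  rw [e] at h4
  have h5 : A * Γ.cutoff (σ + s) ≤ A * Γ.cutoff (σ + t) + A * ((t - s) / (1 + Γ.η)) := by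
    rw [← mul_add]
    exact mul_le_mul_of_nonneg_left h4 h1
  have h6 : A * ((t - s) / (1 + Γ.η)) < t - s := by
    rw [mul_div_assoc', div_lt_iff₀ (by linarith), mul_comm]
    refine mul_lt_mul_of_pos_left (h2.trans_lt ?_) (by linarith)
    rw [M]
    linarith
  linarith

/-- Both pieces are compact and avoid the line at infinity, so their affine heights are continuous
and bounded. -/
theorem exists_height_bounds {z : Fin D.net.num → ℝ → ℝ} (hz : D.IsHeight z) :
    ∃ c C : ℝ, (∀ x ∈ Set.Icc (Γ.l : ℝ) (Γ.l + 2), c ≤ z Γ.i₀ x / D.net.curve Γ.i₀ x 2) ∧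
      ∀ y ∈ Set.Icc Γ.yl Γ.yr, z Γ.i₁ y / D.net.curve Γ.i₁ y 2 ≤ C := by
  have hcont : ∀ i, ContinuousOn (fun x => D.net.curve i x 2) (Set.Icc 0 (D.net.len i)) := fun i =>
    (continuous_apply 2).comp_continuousOn (D.net.continuousOn_curve i (D.net.len i))
  have hlen : (Γ.l : ℝ) + 2 ≤ D.net.len Γ.i₀ := by exact_mod_cast Γ.l_lt
  have s₁ : Set.Icc (Γ.l : ℝ) (Γ.l + 2) ⊆ Set.Icc 0 (D.net.len Γ.i₀) :=
    Set.Icc_subset_Icc (Nat.cast_nonneg _) hlen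
  have s₂ : Set.Icc Γ.yl Γ.yr ⊆ Set.Icc 0 (D.net.len Γ.i₁) :=
    Set.Icc_subset_Icc Γ.yl_nonneg (Γ.strand_lt_len le_rfl).le
  have c₁ : ContinuousOn (fun x => z Γ.i₀ x / D.net.curve Γ.i₀ x 2) (Set.Icc (Γ.l : ℝ) (Γ.l + 2)) :=
    ((hz.continuousOn _).mono s₁).div ((hcont _).mono s₁) fun x hx =>
      Γ.ne_zero_of_mul_wm_pos (Γ.base_coord hx).2.1
  have c₂ : ContinuousOn (fun x => z Γ.i₁ x / D.net.curve Γ.i₁ x 2) (Set.Icc Γ.yl Γ.yr) :=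
    ((hz.continuousOn _).mono s₂).div ((hcont _).mono s₂) fun x hx h0 => by
      have := Γ.w_strand x hx
      rw [h0, zero_mul] at this
      exact lt_irrefl _ this
  obtain ⟨c, hc⟩ := isCompact_Icc.bddBelow_image c₁
  obtain ⟨C, hC⟩ := isCompact_Icc.bddAbove_image c₂
  exact ⟨c, C, fun x hx => hc ⟨x, hx, rfl⟩, fun y hy => hC ⟨y, hy, rfl⟩⟩

/-- The finger move does not change the link. -/
theorem exists_isHeight_diagram {z : Fin D.net.num → ℝ → ℝ} (hz : D.IsHeight z) :
    ∃ z' : Fin Γ.diagram.net.num → ℝ → ℝ, Γ.diagram.IsHeight z' ∧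
      AmbientIsotopic (Set.range (D.lift z)) (Set.range (Γ.diagram.lift z')) := by
  obtain ⟨c, C, hc, hC⟩ := Γ.exists_height_bounds hz
  -- First isotopy: lift by a ridge of height `H` along `S / w = 0` that dies out at `S / w = 1 /
  -- 2`. The base ends up at height at least `C + 1`, and the strand, where `S / w > 1 / 2`, stays
  -- at height at most `C`.
  let H : ℝ := |C + 1 - c|
  let G : (Fin 3 → ℝ) → ℝ := fun x => H * max 0 (1 - 2 * |ev Γ.S x|)
  have hGc : Continuous G := by
    have := continuous_ev Γ.S
    fun_prop
  have hGb : ∀ x, |G x| ≤ H := by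
    intro x
    have h1 : 0 ≤ max 0 (1 - 2 * |ev Γ.S x|) := le_max_left _ _
    have h2 : max 0 (1 - 2 * |ev Γ.S x|) ≤ 1 :=
      max_le zero_le_one (by linarith [abs_nonneg (ev Γ.S x)])
    have h3 : 0 ≤ H := abs_nonneg _
    rw [abs_of_nonneg (mul_nonneg h3 h1)]
    exact mul_le_of_le_one_right h3 h2
  set z' : Fin D.net.num → ℝ → ℝ := fun i x => z i x + D.net.curve i x 2 *
    G fun k => D.net.curve i x k / D.net.curve i x 2 with hz'
  have hh : D.IsHeight z' := hz.add G hGc hGb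
  have hiso₁ := D.ambientIsotopic_lift_add z G hGc hGb
  have hev : ∀ (l V : Fin 3 → ℝ) (w : ℝ), ev l (fun k => V k / w) = ev l V / w := by
    intro l V w
    simp only [ev]
    ring
  have hbase : ∀ p : D.net.Point, p.1 = Γ.i₀ → (p.2 : ℝ) ∈ Set.Icc (Γ.l : ℝ) (Γ.l + 2) →
      C + 1 ≤ z' p.1 p.2 / D.net.coord p 2 := by
    rintro ⟨i, x⟩ hi hx
    obtain rfl : i = Γ.i₀ := hi
    obtain ⟨h1, h2, -⟩ := Γ.base_coord hx
    have hw := Γ.ne_zero_of_mul_wm_pos h2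
    change _ ≤ (z Γ.i₀ x + D.net.curve Γ.i₀ x 2 * (H * max 0 (1 - 2 * |ev Γ.S _|))) /
      D.net.curve Γ.i₀ x 2
    rw [hev, h1, zero_div, abs_zero, mul_zero, sub_zero, max_eq_right zero_le_one, mul_one,
      add_div, mul_div_cancel_left₀ _ hw]
    have h3 := hc x hx
    have h4 : C + 1 - c ≤ H := le_abs_self _
    linarith
  have hstrand : ∀ p : D.net.Point, p.1 = Γ.i₁ → (p.2 : ℝ) ∈ Set.Icc Γ.yl Γ.yr →
      z' p.1 p.2 / D.net.coord p 2 ≤ C := by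
    rintro ⟨i, y⟩ hi hy
    obtain rfl : i = Γ.i₁ := hi
    have h1 := Γ.half_lt y hy
    change (z Γ.i₁ y + D.net.curve Γ.i₁ y 2 * (H * max 0 (1 - 2 * |ev Γ.S _|))) /
      D.net.curve Γ.i₁ y 2 ≤ C
    rw [hev, max_eq_left (by linarith [le_abs_self (ev Γ.S (D.net.curve Γ.i₁ y) /
      D.net.curve Γ.i₁ y 2)]), mul_zero, mul_zero, add_zero]
    exact hC y hy
  refine ⟨z', ⟨hh.continuousOn, hh.closed, ?_⟩, hiso₁.trans ?_⟩
  · intro p q hpq h ho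
    change z' q.1 q.2 / Γ.net.coord q 2 < z' p.1 p.2 / Γ.net.coord p 2
    rw [Γ.coord_net_two, Γ.coord_net_two]
    rcases (Γ.net_crosses_iff p q).1 ⟨hpq, h⟩ with h' | h' | h'
    · exact hh.above p q h'.1 h'.2 ((Γ.diagram_isOver_of_crosses h').1 ho)
    · have h1 := hbase p h'.inFinger.1 (Set.Ioo_subset_Icc_self h'.inFinger.2)
      have h2 := hstrand q h'.inStrand.1 (Set.Ioo_subset_Icc_self h'.inStrand.2)
      linarith
    · exfalso
      have h1 : Γ.diagram.isOver q := Or.inl ⟨p, h'⟩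
      exact (Γ.diagram.isOver_iff p q hpq h).1 ho h1
  · refine ambientIsotopic_affineShear Γ.dir₄ rfl (Γ.push C) (Γ.continuous_push C) Γ.M
      (Γ.abs_push_le C) (Γ.strictMono_push C) (D.liftCoord z') _ (D.liftCoord_ne_zero z')
      (Γ.diagram.liftCoord_ne_zero z') ?_
    intro p
    have hv : (![D.liftCoord z' p 0 / D.liftCoord z' p 2, D.liftCoord z' p 1 / D.liftCoord z' p 2,
        D.liftCoord z' p 2 / D.liftCoord z' p 2] : Fin 3 → ℝ) =
        fun k => D.net.coord p k / D.net.coord p 2 := by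
      funext k
      fin_cases k <;> rfl
    -- Second isotopy: it must move precisely the base, by the displacement of the vertices. On the
    -- base the height and cut-off factors are `1` and `tent` reproduces `hat`. On the strand the
    -- height factor vanishes, and elsewhere `box` forces `tent` or `cutoff` to vanish, or the point
    -- is at infinity.
    have key : Γ.hat p.1 p.2 * (Γ.wm * Γ.M) = D.liftCoord z' p 2 *
        Γ.push C fun k => D.liftCoord z' p k / D.liftCoord z' p 2 := by
      rw [push, hv, hev, hev]
      change _ = D.net.coord p 2 * (Γ.M * Γ.tent (ev Γ.T (D.net.coord p) / D.net.coord p 2) *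
        max 0 (min 1 (z' p.1 p.2 / D.net.coord p 2 - C)) *
          Γ.cutoff (ev Γ.S (D.net.coord p) / D.net.coord p 2))
      by_cases hb : p.1 = Γ.i₀ ∧ (p.2 : ℝ) ∈ Set.Icc (Γ.l : ℝ) (Γ.l + 2)
      · obtain ⟨h1, h2, -, -, h5, -, -⟩ := Γ.base_point hb.1 hb.2
        have hw := Γ.ne_zero_of_mul_wm_pos h2
        have h3 := hbase p hb.1 hb.2
        rw [h1, zero_div, Γ.cutoff_zero, h5, min_eq_left (by linarith), max_eq_right zero_le_one]
        field_simp
      · have h0 : Γ.hat p.1 p.2 = 0 := by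
          refine Γ.hat_eq_zero fun hi => ?_
          by_contra h
          push Not at h
          exact hb ⟨hi, h.1.le, h.2.le⟩
        rw [h0, zero_mul]
        by_cases hw : D.net.coord p 2 = 0
        · rw [hw, zero_mul]
        by_cases hr : ev Γ.T (D.net.coord p) / D.net.coord p 2 ≤ Γ.rl ∨
            Γ.rr ≤ ev Γ.T (D.net.coord p) / D.net.coord p 2
        · rw [Γ.tent_eq_zero hr]
          ring
        by_cases hs : ev Γ.S (D.net.coord p) / D.net.coord p 2 < -Γ.η ∨
            1 + Γ.η < ev Γ.S (D.net.coord p) / D.net.coord p 2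
        · rw [Γ.cutoff_eq_zero hs]
          ring
        push Not at hr hs
        rcases Γ.box p hw hs.1 hs.2 hr.1.le hr.2.le with h | h
        · exact absurd h hb
        · have h3 := hstrand p h.1 (Set.Ioo_subset_Icc_self h.2)
          rw [max_eq_left ((min_le_right _ _).trans (by linarith))]
          ring
    rw [← key]
    have hc := Γ.coord_net p
    funext k
    fin_cases k
    · exact congrFun hc 0
    · exact congrFun hc 1
    · refine (congrFun hc 2).trans ?_
      simp [Γ.dir_two, dir₄, Diagram.liftCoord]
    · simp [Diagram.liftCoord, dir₄]

end FingerData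

end ProjLink

end

/-! ### Subdividing the base of the finger -/

noncomputable section

namespace ProjLink

/-- The data for a finger move before the base of the finger is made a pair of edges. -/
structure FingerSite (D : Diagram) where
  S : Fin 3 → ℝ
  T : Fin 3 → ℝ
  det_ne : S 0 * T 1 - S 1 * T 0 ≠ 0
  i₀ : Fin D.net.num
  k : ℕ
  k_lt : k < D.net.len i₀
  xl : ℝ
  xa : ℝ
  xr : ℝ
  k_lt_xl : (k : ℝ) < xl
  xl_lt : xl < xa
  lt_xr : xa < xr
  xr_lt : xr < k + 1
  S_base : ∀ x ∈ Set.Icc (k : ℝ) (k + 1), ev S (D.net.curve i₀ x) = 0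
  T_mid : ev T (D.net.curve i₀ xa) = 0
  w_left : 0 < D.net.curve i₀ xl 2 * D.net.curve i₀ xa 2
  w_right : 0 < D.net.curve i₀ xr 2 * D.net.curve i₀ xa 2
  T_left : ev T (D.net.curve i₀ xl) * D.net.curve i₀ xa 2 < 0
  T_right : 0 < ev T (D.net.curve i₀ xr) * D.net.curve i₀ xa 2
  i₁ : Fin D.net.num
  m : ℕ
  m_lt : m < D.net.len i₁
  yl : ℝ
  yb : ℝ
  yr : ℝ
  m_lt_yl : (m : ℝ) < yl
  yl_lt : yl < yb
  lt_yr : yb < yr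
  yr_lt : yr < m + 1
  κ : ℝ
  S_strand : ∀ y ∈ Set.Icc yl yr,
    ev S (D.net.curve i₁ y) = κ * ev T (D.net.curve i₁ y) + D.net.curve i₁ y 2
  T_yb : ev T (D.net.curve i₁ yb) = 0
  T_edge : ev T (D.net.vert i₁ (m + 1) - D.net.vert i₁ m) ≠ 0
  w_strand : ∀ y ∈ Set.Icc yl yr, 0 < D.net.curve i₁ y 2 * D.net.curve i₁ yb 2
  half_lt : ∀ y ∈ Set.Icc yl yr, 1 / 2 < ev S (D.net.curve i₁ y) / D.net.curve i₁ y 2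
  κ_left : 0 < (D.net.curve i₀ xl 2 + κ * ev T (D.net.curve i₀ xl)) * D.net.curve i₀ xa 2
  κ_right : 0 < (D.net.curve i₀ xr 2 + κ * ev T (D.net.curve i₀ xr)) * D.net.curve i₀ xa 2
  η : ℝ
  η_pos : 0 < η
  box : ∀ p : D.net.Point, D.net.coord p 2 ≠ 0 →
    -η ≤ ev S (D.net.coord p) / D.net.coord p 2 → ev S (D.net.coord p) / D.net.coord p 2 ≤ 1 + η →
    ev T (D.net.curve i₀ xl) / D.net.curve i₀ xl 2 ≤ ev T (D.net.coord p) / D.net.coord p 2 →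
    ev T (D.net.coord p) / D.net.coord p 2 ≤ ev T (D.net.curve i₀ xr) / D.net.curve i₀ xr 2 →
    (p.1 = i₀ ∧ (p.2 : ℝ) ∈ Set.Icc xl xr) ∨ (p.1 = i₁ ∧ (p.2 : ℝ) ∈ Set.Ioo yl yr)
  cross : ∀ r, ev T (D.net.curve i₀ xl) / D.net.curve i₀ xl 2 ≤ r →
    r ≤ ev T (D.net.curve i₀ xr) / D.net.curve i₀ xr 2 →
    ∃ y ∈ Set.Ioo yl yr, ev T (D.net.curve i₁ y) = r * D.net.curve i₁ y 2
  base_regular : ∀ p : D.net.Point, p.1 = i₀ → (p.2 : ℝ) ∈ Set.Icc xl xr → ¬ D.net.IsMultiple p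
  strand_regular : ∀ p : D.net.Point, p.1 = i₁ → (p.2 : ℝ) ∈ Set.Icc yl yr → ¬ D.net.IsMultiple p

namespace FingerSite

variable {D : Diagram} (Γ : FingerSite D)

/-- The subdivision that makes the base of the finger a pair of edges. -/
def breaks (i : Fin D.net.num) (j : ℕ) : ℝ :=
  if i = Γ.i₀ then
    if j ≤ Γ.k then j else if j = Γ.k + 1 then Γ.xl else if j = Γ.k + 2 then Γ.xa else
      if j = Γ.k + 3 then Γ.xr else (j : ℝ) - 3
  else j

theorem breaks_of_ne {i : Fin D.net.num} (h : i ≠ Γ.i₀) (j : ℕ) : Γ.breaks i j = j := if_neg h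

theorem breaks_of_le {j : ℕ} (h : j ≤ Γ.k) : Γ.breaks Γ.i₀ j = j := by
  rw [breaks, if_pos rfl, if_pos h]

theorem breaks_left : Γ.breaks Γ.i₀ (Γ.k + 1) = Γ.xl := by
  rw [breaks, if_pos rfl, if_neg (by omega), if_pos rfl]

theorem breaks_mid : Γ.breaks Γ.i₀ (Γ.k + 2) = Γ.xa := by
  rw [breaks, if_pos rfl, if_neg (by omega), if_neg (by omega), if_pos rfl]

theorem breaks_right : Γ.breaks Γ.i₀ (Γ.k + 3) = Γ.xr := by
  rw [breaks, if_pos rfl, if_neg (by omega), if_neg (by omega), if_neg (by omega), if_pos rfl]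

theorem breaks_of_lt {j : ℕ} (h : Γ.k < j) : Γ.breaks Γ.i₀ (j + 3) = j := by
  rw [breaks, if_pos rfl, if_neg (by omega), if_neg (by omega), if_neg (by omega),
    if_neg (by omega)]
  push_cast
  ring

theorem breaks_cases (j : ℕ) : j ≤ Γ.k ∨ j = Γ.k + 1 ∨ j = Γ.k + 2 ∨ j = Γ.k + 3 ∨
    ∃ j', Γ.k < j' ∧ j = j' + 3 := by
  by_cases h : j ≤ Γ.k + 3
  · omega
  · exact Or.inr (Or.inr (Or.inr (Or.inr ⟨j - 3, by omega, by omega⟩)))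

theorem breaks_step (i : Fin D.net.num) (j : ℕ) : Γ.breaks i j < Γ.breaks i (j + 1) ∧
    ∃ m : ℕ, (m : ℝ) ≤ Γ.breaks i j ∧ Γ.breaks i (j + 1) ≤ m + 1 := by
  by_cases hi : i = Γ.i₀
  · subst hi
    have h1 := Γ.k_lt_xl
    have h2 := Γ.xl_lt
    have h3 := Γ.lt_xr
    have h4 := Γ.xr_lt
    rcases Γ.breaks_cases j with h | rfl | rfl | rfl | ⟨j', h, rfl⟩
    · rw [Γ.breaks_of_le h]
      rcases h.lt_or_eq with h' | rfl
      · rw [Γ.breaks_of_le h']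
        exact ⟨by push_cast; linarith, j, le_rfl, by push_cast; linarith⟩
      · rw [Γ.breaks_left]
        exact ⟨h1, Γ.k, le_rfl, by linarith⟩
    · rw [Γ.breaks_left, Γ.breaks_mid]
      exact ⟨h2, Γ.k, by linarith, by linarith⟩
    · rw [Γ.breaks_mid, Γ.breaks_right]
      exact ⟨h3, Γ.k, by linarith, by linarith⟩
    · rw [Γ.breaks_right, show Γ.k + 3 + 1 = (Γ.k + 1) + 3 by ring,
        Γ.breaks_of_lt (Nat.lt_succ_self _)]
      push_cast
      exact ⟨h4, Γ.k, by linarith, le_rfl⟩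
    · rw [Γ.breaks_of_lt h, show j' + 3 + 1 = (j' + 1) + 3 by ring, Γ.breaks_of_lt (by omega)]
      push_cast
      exact ⟨by linarith, j', le_rfl, le_rfl⟩
  · rw [Γ.breaks_of_ne hi, Γ.breaks_of_ne hi]
    push_cast
    exact ⟨by linarith, j, le_rfl, le_rfl⟩

/-- The subdivision that makes the base of the finger a pair of edges. -/
abbrev refinement : D.net.Refinement where
  len i := if i = Γ.i₀ then D.net.len i + 3 else D.net.len i
  b := Γ.breaks
  b_zero i := by
    by_cases hi : i = Γ.i₀
    · subst hi
      simp [Γ.breaks_of_le (Nat.zero_le _)]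
    · simp [Γ.breaks_of_ne hi]
  b_len i := by
    by_cases hi : i = Γ.i₀
    · subst hi
      rw [if_pos rfl, Γ.breaks_of_lt Γ.k_lt]
    · rw [if_neg hi, Γ.breaks_of_ne hi]
  strictMono i := strictMono_nat_of_lt_succ fun j => (Γ.breaks_step i j).1
  fine i j := (Γ.breaks_step i j).2

theorem mul_pos_ne_left {a b : ℝ} (h : 0 < a * b) : a ≠ 0 := by
  rintro rfl
  simp at h

theorem isAdmissible : D.IsAdmissible Γ.refinement where
  off_infinity i j hj := by
    change D.net.curve i (Γ.breaks i j) 2 ≠ 0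
    change j ≤ (if i = Γ.i₀ then D.net.len i + 3 else D.net.len i) at hj
    by_cases hi : i = Γ.i₀
    · subst hi
      rw [if_pos rfl] at hj
      have hk := Γ.k_lt
      rcases Γ.breaks_cases j with h | rfl | rfl | rfl | ⟨j', h, rfl⟩
      · rw [Γ.breaks_of_le h, D.net.curve_natCast]
        exact D.vert_off_infinity _ _ (by omega)
      · rw [Γ.breaks_left]
        exact mul_pos_ne_left Γ.w_left
      · rw [Γ.breaks_mid]
        exact mul_pos_ne_left ((mul_comm _ _).trans_gt Γ.w_left)
      · rw [Γ.breaks_right]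
        exact mul_pos_ne_left Γ.w_right
      · rw [Γ.breaks_of_lt h, D.net.curve_natCast]
        exact D.vert_off_infinity _ _ (by omega)
    · rw [if_neg hi] at hj
      rw [Γ.breaks_of_ne hi, D.net.curve_natCast]
      exact D.vert_off_infinity _ _ hj
  not_isMultiple p j hj := by
    have hnat : ∀ n : ℕ, (p.2 : ℝ) = n → ¬ D.net.IsMultiple p := by
      intro n hn h
      refine (D.interior p h).1 ?_
      rw [hn, Int.fract_natCast]
    change (p.2 : ℝ) = Γ.breaks p.1 j at hj
    by_cases hi : p.1 = Γ.i₀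
    · replace hj : (p.2 : ℝ) = Γ.breaks Γ.i₀ j := hj.trans (by rw [hi])
      have h2 := Γ.xl_lt
      have h3 := Γ.lt_xr
      have hreg : Γ.breaks Γ.i₀ j ∈ Set.Icc Γ.xl Γ.xr → ¬ D.net.IsMultiple p := fun h =>
        Γ.base_regular p hi (hj ▸ h)
      rcases Γ.breaks_cases j with h | rfl | rfl | rfl | ⟨j', h, rfl⟩
      · rw [Γ.breaks_of_le h] at hj
        exact hnat _ hj
      · rw [Γ.breaks_left] at hreg
        exact hreg ⟨le_rfl, by linarith⟩
      · rw [Γ.breaks_mid] at hreg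
        exact hreg ⟨h2.le, h3.le⟩
      · rw [Γ.breaks_right] at hreg
        exact hreg ⟨by linarith, le_rfl⟩
      · rw [Γ.breaks_of_lt h] at hj
        exact hnat _ hj
    · rw [Γ.breaks_of_ne hi] at hj
      exact hnat _ hj

theorem vert_left : Γ.refinement.system.vert Γ.i₀ (Γ.k + 1) = D.net.curve Γ.i₀ Γ.xl :=
  congrArg (D.net.curve Γ.i₀) Γ.breaks_left

theorem vert_mid : Γ.refinement.system.vert Γ.i₀ (Γ.k + 1 + 1) = D.net.curve Γ.i₀ Γ.xa :=
  congrArg (D.net.curve Γ.i₀) Γ.breaks_mid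

theorem vert_right : Γ.refinement.system.vert Γ.i₀ (Γ.k + 1 + 2) = D.net.curve Γ.i₀ Γ.xr :=
  congrArg (D.net.curve Γ.i₀) Γ.breaks_right

/-- The shift of the indices of the strand. -/
def shift : ℕ := if Γ.i₁ = Γ.i₀ ∧ Γ.k < Γ.m then 3 else 0

theorem breaks_shift : Γ.breaks Γ.i₁ (Γ.m + Γ.shift) = Γ.m ∧
    Γ.breaks Γ.i₁ (Γ.m + Γ.shift + 1) = Γ.m + 1 := by
  by_cases hi : Γ.i₁ = Γ.i₀
  · have hmk : Γ.m ≠ Γ.k := by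
      intro h
      have h1 := Γ.m_lt_yl
      have h2 := Γ.yl_lt
      have h3 := Γ.lt_yr
      have h4 := Γ.yr_lt
      have h5 := Γ.half_lt Γ.yb ⟨h2.le, h3.le⟩
      rw [hi, Γ.S_base Γ.yb (by rw [← h]; exact ⟨by linarith, by linarith⟩), zero_div] at h5
      linarith
    by_cases hlt : Γ.k < Γ.m
    · rw [shift, if_pos ⟨hi, hlt⟩, hi, Γ.breaks_of_lt hlt, show Γ.m + 3 + 1 = Γ.m + 1 + 3 by ring,
        Γ.breaks_of_lt (by omega)]
      push_cast
      exact ⟨rfl, rfl⟩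
    · rw [shift, if_neg (fun h => hlt h.2), hi, add_zero, Γ.breaks_of_le (by omega),
        Γ.breaks_of_le (by omega)]
      push_cast
      exact ⟨rfl, rfl⟩
  · rw [shift, if_neg (fun h => hi h.1), Γ.breaks_of_ne hi, Γ.breaks_of_ne hi]
    push_cast
    exact ⟨by ring, by ring⟩

theorem param_shift {y : ℝ} (hy : y ∈ Set.Icc (Γ.m : ℝ) (Γ.m + 1)) :
    Γ.refinement.param Γ.i₁ (y + Γ.shift) = y := by
  rw [Γ.refinement.param_eq_of_mem_Icc (m := Γ.m + Γ.shift)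
    (by push_cast; exact ⟨by linarith [hy.1], by linarith [hy.2]⟩)]
  change _ * Γ.breaks _ _ + _ * Γ.breaks _ _ = _
  rw [Γ.breaks_shift.1, Γ.breaks_shift.2]
  push_cast
  ring

theorem curve_shift {y : ℝ} (hy : y ∈ Set.Icc (Γ.m : ℝ) (Γ.m + 1)) :
    Γ.refinement.system.curve Γ.i₁ (y + Γ.shift) = D.net.curve Γ.i₁ y := by
  rw [Γ.refinement.curve_system, Γ.param_shift hy]

theorem strand_mem {y : ℝ} (hy : y ∈ Set.Icc Γ.yl Γ.yr) : y ∈ Set.Icc (Γ.m : ℝ) (Γ.m + 1) :=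
  ⟨Γ.m_lt_yl.le.trans hy.1, hy.2.trans Γ.yr_lt.le⟩

theorem exists_shift {y : ℝ} (hy : y ∈ Set.Icc (Γ.yl + Γ.shift) (Γ.yr + Γ.shift)) :
    ∃ y' ∈ Set.Icc Γ.yl Γ.yr, y = y' + Γ.shift :=
  ⟨y - Γ.shift, ⟨by linarith [hy.1], by linarith [hy.2]⟩, by ring⟩

/-- The subdivided diagram. -/
abbrev diagram : Diagram := D.refine Γ.refinement Γ.isAdmissible

theorem param_left : Γ.refinement.param Γ.i₀ ((Γ.k + 1 : ℕ) : ℝ) = Γ.xl := by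
  rw [Γ.refinement.param_natCast]; exact Γ.breaks_left

theorem param_right : Γ.refinement.param Γ.i₀ (((Γ.k + 1 : ℕ) : ℝ) + 2) = Γ.xr := by
  have h := Γ.refinement.param_natCast Γ.i₀ (Γ.k + 3)
  push_cast at h ⊢
  rw [show (Γ.k + 1 + 2 : ℝ) = Γ.k + 3 by ring, h]
  exact Γ.breaks_right

theorem base_iff (p : Γ.diagram.net.Point) (hi : p.1 = Γ.i₀) :
    (p.2 : ℝ) ∈ Set.Icc ((Γ.k + 1 : ℕ) : ℝ) (((Γ.k + 1 : ℕ) : ℝ) + 2) ↔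
      Γ.refinement.param p.1 p.2 ∈ Set.Icc Γ.xl Γ.xr := by
  obtain ⟨i, x⟩ := p
  obtain rfl : i = Γ.i₀ := hi
  have hm := Γ.refinement.param_strictMonoOn Γ.i₀
  have h0 : (0 : ℝ) ≤ ((Γ.k + 1 : ℕ) : ℝ) := Nat.cast_nonneg _
  have h1 : (0 : ℝ) ≤ ((Γ.k + 1 : ℕ) : ℝ) + 2 := by linarith
  have hl := hm.le_iff_le (a := ((Γ.k + 1 : ℕ) : ℝ)) (b := (x : ℝ)) h0 x.2.1
  have hr := hm.le_iff_le (a := (x : ℝ)) (b := ((Γ.k + 1 : ℕ) : ℝ) + 2) x.2.1 h1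
  rw [Γ.param_left] at hl
  rw [Γ.param_right] at hr
  exact and_congr hl.symm hr.symm

theorem yl_mem : Γ.yl ∈ Set.Icc (Γ.m : ℝ) (Γ.m + 1) :=
  Γ.strand_mem ⟨le_rfl, (Γ.yl_lt.trans Γ.lt_yr).le⟩

theorem yr_mem : Γ.yr ∈ Set.Icc (Γ.m : ℝ) (Γ.m + 1) :=
  Γ.strand_mem ⟨(Γ.yl_lt.trans Γ.lt_yr).le, le_rfl⟩

theorem yb_mem : Γ.yb ∈ Set.Icc (Γ.m : ℝ) (Γ.m + 1) := Γ.strand_mem ⟨Γ.yl_lt.le, Γ.lt_yr.le⟩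

theorem shift_nonneg {y : ℝ} (hy : y ∈ Set.Icc (Γ.m : ℝ) (Γ.m + 1)) : 0 ≤ y + Γ.shift :=
  add_nonneg ((Nat.cast_nonneg _).trans hy.1) (Nat.cast_nonneg _)

theorem strand_iff (p : Γ.diagram.net.Point) (hi : p.1 = Γ.i₁) :
    (Γ.yl + Γ.shift ≤ (p.2 : ℝ) ↔ Γ.yl ≤ Γ.refinement.param p.1 p.2) ∧
    ((p.2 : ℝ) ≤ Γ.yr + Γ.shift ↔ Γ.refinement.param p.1 p.2 ≤ Γ.yr) ∧
    (Γ.yl + Γ.shift < (p.2 : ℝ) ↔ Γ.yl < Γ.refinement.param p.1 p.2) ∧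
    ((p.2 : ℝ) < Γ.yr + Γ.shift ↔ Γ.refinement.param p.1 p.2 < Γ.yr) := by
  obtain ⟨i, x⟩ := p
  obtain rfl : i = Γ.i₁ := hi
  have hm := Γ.refinement.param_strictMonoOn Γ.i₁
  have h0 := Γ.shift_nonneg Γ.yl_mem
  have h1 := Γ.shift_nonneg Γ.yr_mem
  have a1 := hm.le_iff_le h0 x.2.1
  have a2 := hm.le_iff_le x.2.1 h1
  have a3 := hm.lt_iff_lt h0 x.2.1
  have a4 := hm.lt_iff_lt x.2.1 h1
  rw [Γ.param_shift Γ.yl_mem] at a1 a3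
  rw [Γ.param_shift Γ.yr_mem] at a2 a4
  exact ⟨a1.symm, a2.symm, a3.symm, a4.symm⟩

/-- The data for the finger move on the subdivided diagram. -/
abbrev fingerData : FingerData Γ.diagram where
  S := Γ.S
  T := Γ.T
  det_ne := Γ.det_ne
  i₀ := Γ.i₀
  l := Γ.k + 1
  l_lt := by
    change Γ.k + 1 + 1 < if Γ.i₀ = Γ.i₀ then D.net.len Γ.i₀ + 3 else D.net.len Γ.i₀
    rw [if_pos rfl]
    have := Γ.k_lt
    omega
  S_left := by
    rw [Γ.vert_left]
    exact Γ.S_base _ ⟨Γ.k_lt_xl.le, by linarith [Γ.xl_lt, Γ.lt_xr, Γ.xr_lt]⟩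
  S_mid := by
    rw [Γ.vert_mid]
    exact Γ.S_base _ ⟨by linarith [Γ.k_lt_xl, Γ.xl_lt], by linarith [Γ.lt_xr, Γ.xr_lt]⟩
  S_right := by
    rw [Γ.vert_right]
    exact Γ.S_base _ ⟨by linarith [Γ.k_lt_xl, Γ.xl_lt, Γ.lt_xr], Γ.xr_lt.le⟩
  T_mid := by rw [Γ.vert_mid]; exact Γ.T_mid
  w_left := by rw [Γ.vert_left, Γ.vert_mid]; exact Γ.w_left
  w_right := by rw [Γ.vert_right, Γ.vert_mid]; exact Γ.w_right
  T_left := by rw [Γ.vert_left, Γ.vert_mid]; exact Γ.T_left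
  T_right := by rw [Γ.vert_right, Γ.vert_mid]; exact Γ.T_right
  i₁ := Γ.i₁
  m := Γ.m + Γ.shift
  m_lt := by
    change Γ.m + (if Γ.i₁ = Γ.i₀ ∧ Γ.k < Γ.m then 3 else 0) <
      if Γ.i₁ = Γ.i₀ then D.net.len Γ.i₁ + 3 else D.net.len Γ.i₁
    have := Γ.m_lt
    split_ifs <;> omega
  yl := Γ.yl + Γ.shift
  yb := Γ.yb + Γ.shift
  yr := Γ.yr + Γ.shift
  m_lt_yl := by push_cast; linarith [Γ.m_lt_yl]
  yl_lt := by linarith [Γ.yl_lt]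
  lt_yr := by linarith [Γ.lt_yr]
  yr_lt := by push_cast; linarith [Γ.yr_lt]
  κ := Γ.κ
  S_strand y hy := by
    obtain ⟨y', hy', rfl⟩ := Γ.exists_shift hy
    rw [Γ.curve_shift (Γ.strand_mem hy')]
    exact Γ.S_strand y' hy'
  T_yb := by
    rw [Γ.curve_shift Γ.yb_mem]
    exact Γ.T_yb
  T_edge := by
    change ev Γ.T (D.net.curve Γ.i₁ (Γ.breaks _ _) - D.net.curve Γ.i₁ (Γ.breaks _ _)) ≠ 0
    have h := D.net.curve_natCast Γ.i₁ (Γ.m + 1)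
    push_cast at h
    rw [Γ.breaks_shift.1, Γ.breaks_shift.2, D.net.curve_natCast, h]
    exact Γ.T_edge
  w_strand y hy := by
    obtain ⟨y', hy', rfl⟩ := Γ.exists_shift hy
    rw [Γ.curve_shift (Γ.strand_mem hy'), Γ.curve_shift Γ.yb_mem]
    exact Γ.w_strand y' hy'
  half_lt y hy := by
    obtain ⟨y', hy', rfl⟩ := Γ.exists_shift hy
    rw [Γ.curve_shift (Γ.strand_mem hy')]
    exact Γ.half_lt y' hy'
  κ_left := by rw [Γ.vert_left, Γ.vert_mid]; exact Γ.κ_left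
  κ_right := by rw [Γ.vert_right, Γ.vert_mid]; exact Γ.κ_right
  η := Γ.η
  η_pos := Γ.η_pos
  box p := by
    rw [Γ.vert_left, Γ.vert_right, Γ.refinement.coord_system]
    intro h1 h2 h3 h4 h5
    rcases Γ.box _ h1 h2 h3 h4 h5 with ⟨h6, h7⟩ | ⟨h6, h7⟩
    · exact Or.inl ⟨h6, (Γ.base_iff p h6).2 h7⟩
    · obtain ⟨-, -, a3, a4⟩ := Γ.strand_iff p h6
      exact Or.inr ⟨h6, a3.2 h7.1, a4.2 h7.2⟩
  cross r := by
    rw [Γ.vert_left, Γ.vert_right]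
    intro h1 h2
    obtain ⟨y, hy, h3⟩ := Γ.cross r h1 h2
    refine ⟨y + Γ.shift, ⟨by linarith [hy.1], by linarith [hy.2]⟩, ?_⟩
    rw [Γ.curve_shift (Γ.strand_mem (Set.Ioo_subset_Icc_self hy)), h3]
  base_regular p hi hx := by
    rw [Γ.refinement.isMultiple_system]
    exact Γ.base_regular _ hi ((Γ.base_iff p hi).1 hx)
  strand_regular p hi hy := by
    rw [Γ.refinement.isMultiple_system]
    obtain ⟨a1, a2, -, -⟩ := Γ.strand_iff p hi
    exact Γ.strand_regular _ hi ⟨a1.1 hy.1, a2.1 hy.2⟩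

/-- A finger move reduces the number of state circles. -/
theorem exists_card_circle_lt {a b : D.net.Point} (ha : a.1 = Γ.i₀) (ha' : (a.2 : ℝ) = Γ.xa)
    (hb : b.1 = Γ.i₁) (hb' : (b.2 : ℝ) = Γ.yb)
    (hne : circleOf D.Crosses D.PositivePair (a, false) ≠
      circleOf D.Crosses D.PositivePair (b, false))
    {z : Fin D.net.num → ℝ → ℝ} (hz : D.IsHeight z) :
    ∃ (D' : Diagram) (z' : Fin D'.net.num → ℝ → ℝ), D'.IsHeight z' ∧
      AmbientIsotopic (Set.range (D.lift z)) (Set.range (D'.lift z')) ∧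
      Nat.card D'.Circle < Nat.card D.Circle := by
  have h1 : Γ.refinement.point Γ.fingerData.tip = a := by
    refine FingerData.point_ext ha.symm (Eq.trans ?_ ha'.symm)
    have h := Γ.refinement.param_natCast Γ.i₀ (Γ.k + 2)
    change Γ.refinement.param Γ.i₀ (((Γ.k + 1 : ℕ) : ℝ) + 1) = _
    rw [show (((Γ.k + 1 : ℕ) : ℝ) + 1) = ((Γ.k + 2 : ℕ) : ℝ) by push_cast; ring, h]
    exact Γ.breaks_mid
  have h2 : Γ.refinement.point Γ.fingerData.target = b := by
    refine FingerData.point_ext hb.symm (Eq.trans ?_ hb'.symm)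
    exact Γ.param_shift Γ.yb_mem
  have h3 := Γ.fingerData.card_circle_lt (Diagram.circleOf_refine_ne Γ.isAdmissible (by
    change circleOf D.Crosses D.PositivePair (Γ.refinement.point Γ.fingerData.tip, false) ≠
      circleOf D.Crosses D.PositivePair (Γ.refinement.point Γ.fingerData.target, false)
    rw [h1, h2]
    exact hne))
  obtain ⟨z', hz', hiso⟩ := Γ.fingerData.exists_isHeight_diagram
    (Diagram.isHeight_refine Γ.isAdmissible hz)
  rw [Diagram.range_lift_refine] at hiso
  exact ⟨_, z', hz', hiso, h3.trans_le (Diagram.card_circle_refine_le Γ.isAdmissible)⟩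

end FingerSite

end ProjLink

end

/-! ### From a free segment to a finger move -/

noncomputable section

namespace ProjLink

open Filter Topology

theorem ev_neg_left (l V : Fin 3 → ℝ) : ev (-l) V = -ev l V := by
  simp only [ev, Pi.neg_apply]; ring

theorem mem_Ioo_floor {x : ℝ} (hx : 0 ≤ x) (hf : Int.fract x ≠ 0) :
    x ∈ Set.Ioo (⌊x⌋₊ : ℝ) (⌊x⌋₊ + 1) := by
  refine ⟨lt_of_le_of_ne (Nat.floor_le hx) fun h => hf ?_, Nat.lt_floor_add_one x⟩
  rw [← h, Int.fract_natCast]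

theorem PolygonSystem.curve_eq_coord_add {d : ℕ} (F : PolygonSystem d) (p : F.Point) {x : ℝ}
    (hx : x ∈ Set.Icc (⌊(p.2 : ℝ)⌋₊ : ℝ) (⌊(p.2 : ℝ)⌋₊ + 1)) :
    F.curve p.1 x = F.coord p + (x - p.2) • F.edgeVector p.1 p.2 := by
  rw [coord, F.curve_eq_of_mem_Icc hx, F.curve_eq_of_mem_Icc (floor_mem_Icc p.2.2.1), edgeVector]
  module

namespace Diagram

variable (D : Diagram)

/-- Crossing parameters form a finite, hence closed, set. -/
theorem eventually_not_isMultiple {p : D.net.Point} (hp : ¬ D.net.IsMultiple p) :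
    ∀ᶠ x in 𝓝 (p.2 : ℝ), ∀ q : D.net.Point, q.1 = p.1 → (q.2 : ℝ) = x → ¬ D.net.IsMultiple q := by
  have hfin : {x : ℝ | ∃ q : D.net.Point, D.net.IsMultiple q ∧ q.1 = p.1 ∧ (q.2 : ℝ) = x}.Finite := by
    refine (D.finite_multiple.image fun q => (q.2 : ℝ)).subset ?_
    rintro x ⟨q, h1, -, h2⟩
    exact ⟨q, h1, h2⟩
  filter_upwards [hfin.isClosed.compl_mem_nhds (x := (p.2 : ℝ)) (by
    rintro ⟨q, h1, h2, h3⟩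
    exact hp (FingerData.point_ext h2 h3 ▸ h1))] with x hx q h1 h2 h3
  exact hx ⟨q, h3, h1, h2⟩

/-- Away from the end points, the net keeps a distance from a segment that it only meets in
the end points. -/
theorem exists_box {a b : D.net.Point} (hfa : Int.fract (a.2 : ℝ) ≠ 0)
    (hfb : Int.fract (b.2 : ℝ) ≠ 0) {S T : Fin 3 → ℝ} (hδ : S 0 * T 1 - S 1 * T 0 ≠ 0)
    (hseg : ∀ p : D.net.Point, D.net.coord p 2 ≠ 0 → ev T (D.net.coord p) = 0 →
      0 ≤ ev S (D.net.coord p) / D.net.coord p 2 → ev S (D.net.coord p) / D.net.coord p 2 ≤ 1 →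
      p = a ∨ p = b) {ρ σ : ℝ} (hρ : 0 < ρ) (hσ : 0 < σ) :
    ∃ η > 0, ∀ p : D.net.Point, D.net.coord p 2 ≠ 0 →
      -η ≤ ev S (D.net.coord p) / D.net.coord p 2 →
      ev S (D.net.coord p) / D.net.coord p 2 ≤ 1 + η →
      |ev T (D.net.coord p) / D.net.coord p 2| ≤ η →
      (p.1 = a.1 ∧ |(p.2 : ℝ) - a.2| < ρ) ∨ (p.1 = b.1 ∧ |(p.2 : ℝ) - b.2| < σ) := by
  -- For nonzero `V`, this vanishes exactly on representatives of the closed segment. Being free of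
  -- divisions by the weight, it stays continuous across the line at infinity, where a compactness
  -- argument in the affine chart would fail.
  let m : (Fin 3 → ℝ) → ℝ := fun V =>
    |ev T V| + max 0 (-(ev S V * V 2)) + max 0 (|ev S V| - |V 2|)
  have hm : Continuous m := by
    have h1 := continuous_ev T
    have h2 := continuous_ev S
    fun_prop
  have hm0 : ∀ V, 0 ≤ m V := fun V =>
    add_nonneg (add_nonneg (abs_nonneg _) (le_max_left _ _)) (le_max_left _ _)
  have hmp : ∀ p : D.net.Point, p ≠ a → p ≠ b → 0 < m (D.net.coord p) := by
    intro p hpa hpb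
    refine lt_of_le_of_ne (hm0 _) fun h => ?_
    have h1 := abs_nonneg (ev T (D.net.coord p))
    have h2 : 0 ≤ max 0 (-(ev S (D.net.coord p) * D.net.coord p 2)) := le_max_left _ _
    have h3 : 0 ≤ max 0 (|ev S (D.net.coord p)| - |D.net.coord p 2|) := le_max_left _ _
    simp only [m] at h
    have hT : ev T (D.net.coord p) = 0 := abs_eq_zero.1 (by linarith)
    have hS : 0 ≤ ev S (D.net.coord p) * D.net.coord p 2 := by
      have := le_max_right 0 (-(ev S (D.net.coord p) * D.net.coord p 2))
      linarith
    have hSw : |ev S (D.net.coord p)| ≤ |D.net.coord p 2| := by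
      have := le_max_right 0 (|ev S (D.net.coord p)| - |D.net.coord p 2|)
      linarith
    have hw : D.net.coord p 2 ≠ 0 := by
      intro h0
      rw [h0, abs_zero] at hSw
      exact D.net.coord_ne_zero p (vec_eq_zero_of_ev hδ
        (abs_eq_zero.1 (le_antisymm hSw (abs_nonneg _))) hT h0)
    have h4 : 0 ≤ ev S (D.net.coord p) / D.net.coord p 2 := by
      have : ev S (D.net.coord p) / D.net.coord p 2 =
          ev S (D.net.coord p) * D.net.coord p 2 / D.net.coord p 2 ^ 2 := by
        field_simp
      rw [this]
      positivity
    have h5 : ev S (D.net.coord p) / D.net.coord p 2 ≤ 1 := by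
      refine (le_abs_self _).trans ?_
      rw [abs_div, div_le_one (abs_pos.2 hw)]
      exact hSw
    rcases hseg p hw hT h4 h5 with h | h
    · exact hpa h
    · exact hpb h
  -- The compact parameter set left after removing neighbourhoods of `a` and `b`; on it `m` has a
  -- positive lower bound.
  let K : ∀ i : Fin D.net.num, Set ℝ := fun i => Set.Icc (0 : ℝ) (D.net.len i) ∩
    ({x | i = a.1 → ρ ≤ |x - a.2|} ∩ {x | i = b.1 → σ ≤ |x - b.2|})
  have hclosed : ∀ (P : Prop) (c r : ℝ), IsClosed {x : ℝ | P → r ≤ |x - c|} := by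
    intro P c r
    by_cases hP : P
    · simp only [hP, true_imp_iff]
      exact isClosed_le continuous_const (by fun_prop)
    · simp [hP]
  have hK : ∀ i, IsCompact (K i) := fun i =>
    isCompact_Icc.inter_right ((hclosed _ _ _).inter (hclosed _ _ _))
  have hcont : ∀ i, ContinuousOn (fun x => m (D.net.curve i x)) (K i) := fun i =>
    hm.comp_continuousOn ((D.net.continuousOn_curve i _).mono Set.inter_subset_left)
  have hcontw : ∀ i, ContinuousOn (fun x => |D.net.curve i x 2|) (K i) := fun i =>
    ((continuous_apply 2).abs).comp_continuousOn
      ((D.net.continuousOn_curve i _).mono Set.inter_subset_left)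
  have hpos : ∀ i, ∀ x ∈ K i, 0 < m (D.net.curve i x) := by
    rintro i x ⟨hx, hxa, hxb⟩
    rcases hx.2.lt_or_eq with h | h
    · refine hmp ⟨i, x, hx.1, h⟩ ?_ ?_
      · rintro rfl
        have := hxa rfl
        simp at this
        linarith
      · rintro rfl
        have := hxb rfl
        simp at this
        linarith
    · have h1 := hmp (D.net.basePoint i) (by
        rintro rfl
        exact hfa (Int.fract_zero)) (by
        rintro rfl
        exact hfb (Int.fract_zero))
      change 0 < m (D.net.curve i 0) at h1
      have h2 : ((D.net.closing i : ℤ) : ℝ) = 1 ∨ ((D.net.closing i : ℤ) : ℝ) = -1 := by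
        rcases Int.units_eq_one_or (D.net.closing i) with h | h <;> rw [h] <;> simp
      rw [h, D.net.curve_len]
      -- The closed interval includes the duplicate `len i` of the base point, whose representative
      -- differs at most by a sign, and `m` is even.
      have h3 : m (((D.net.closing i : ℤ) : ℝ) • D.net.curve i 0) = m (D.net.curve i 0) := by
        rcases h2 with h2 | h2 <;> rw [h2] <;>
          simp only [m, ev_smul, Pi.smul_apply, smul_eq_mul, one_mul, neg_one_mul, abs_neg,
            neg_mul_neg]
      rw [h3]
      exact h1
  have hev : ∀ᶠ η in 𝓝[>] (0 : ℝ), ∀ i, ∀ x ∈ K i, D.net.curve i x 2 ≠ 0 →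
      -η ≤ ev S (D.net.curve i x) / D.net.curve i x 2 →
      ev S (D.net.curve i x) / D.net.curve i x 2 ≤ 1 + η →
      |ev T (D.net.curve i x) / D.net.curve i x 2| ≤ η → False := by
    rw [eventually_all]
    intro i
    obtain ⟨c, hc, hcm⟩ := (hK i).exists_forall_le' (hcont i) (hpos i)
    obtain ⟨W, hW⟩ := (hK i).bddAbove_image (hcontw i)
    replace hW : ∀ x ∈ K i, |D.net.curve i x 2| ≤ |W| := fun x hx =>
      (hW ⟨x, hx, rfl⟩).trans (le_abs_self W)
    -- In the box of size `η` the three terms of `m` add up to at most `η * (2 * |W| + |W| ^ 2)`,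
    -- which is below the minimum `c` for this choice.
    have hδ0 : 0 < c / (2 * |W| + |W| ^ 2 + 1) := by positivity
    filter_upwards [Ioo_mem_nhdsGT hδ0] with η hη x hx hw h1 h2 h3
    have hη0 : 0 < η := hη.1
    have hη1 := (lt_div_iff₀ (by positivity)).1 hη.2
    have hmx := hcm x hx
    have hWx := hW x hx
    set V := D.net.curve i x
    set W' := |W|
    have hw0 : 0 < |V 2| := abs_pos.2 hw
    have hW' : 0 < W' := hw0.trans_le hWx
    have e1 : |ev T V| ≤ η * W' := by
      rw [abs_div, div_le_iff₀ hw0] at h3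
      exact h3.trans (by gcongr)
    have e2 : max 0 (-(ev S V * V 2)) ≤ η * W' ^ 2 := by
      refine max_le (by positivity) ?_
      have : ev S V * V 2 = ev S V / V 2 * |V 2| ^ 2 := by
        rw [sq_abs]; field_simp
      rw [this]
      have h4 : |V 2| ^ 2 ≤ W' ^ 2 := by gcongr
      nlinarith [sq_nonneg |V 2|]
    have e3 : max 0 (|ev S V| - |V 2|) ≤ η * W' := by
      refine max_le (by positivity) ?_
      have h4 : |ev S V / V 2| ≤ 1 + η := abs_le.2 ⟨by linarith, h2⟩
      rw [abs_div, div_le_iff₀ hw0] at h4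
      nlinarith
    simp only [m] at hmx
    nlinarith
  obtain ⟨η, h1, h2⟩ := (hev.and self_mem_nhdsWithin).exists
  refine ⟨η, h2, fun p hw hs1 hs2 hr => ?_⟩
  by_contra hne
  push Not at hne
  exact h1 p.1 p.2 ⟨Set.Ico_subset_Icc_self p.2.2, hne.1, hne.2⟩ hw hs1 hs2 hr

/-- All requirements on the base and the strand are open conditions that hold at `a` and `b`. The
order of choices matters: the strand radius `ε` and the base radius `ρ` come first, they determine
the box size `η`, and only then is the base narrowed to fit `η` and `τ`. -/
theorem exists_fingerSite_of_pos {a b : D.net.Point} (hfa : Int.fract (a.2 : ℝ) ≠ 0)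
    (hfb : Int.fract (b.2 : ℝ) ≠ 0) (hma : ¬ D.net.IsMultiple a) (hmb : ¬ D.net.IsMultiple b)
    (hwa : D.net.coord a 2 ≠ 0) (hwb : D.net.coord b 2 ≠ 0) {S T : Fin 3 → ℝ}
    (hδ : S 0 * T 1 - S 1 * T 0 ≠ 0)
    (hSa : ev S (D.net.coord a) = 0) (hSe : ev S (D.net.edgeVector a.1 a.2) = 0)
    (hTa : ev T (D.net.coord a) = 0)
    (hTe : 0 < ev T (D.net.edgeVector a.1 a.2) * D.net.coord a 2)
    (hSb : ev S (D.net.coord b) = D.net.coord b 2) (hTb : ev T (D.net.coord b) = 0)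
    (hTeb : ev T (D.net.edgeVector b.1 b.2) ≠ 0)
    (hseg : ∀ p : D.net.Point, D.net.coord p 2 ≠ 0 → ev T (D.net.coord p) = 0 →
      0 ≤ ev S (D.net.coord p) / D.net.coord p 2 → ev S (D.net.coord p) / D.net.coord p 2 ≤ 1 →
      p = a ∨ p = b) :
    ∃ Γ : FingerSite D, a.1 = Γ.i₀ ∧ (a.2 : ℝ) = Γ.xa ∧ b.1 = Γ.i₁ ∧ (b.2 : ℝ) = Γ.yb := by
  have ha := mem_Ioo_floor a.2.2.1 hfa
  have hb := mem_Ioo_floor b.2.2.1 hfb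
  set k := ⌊(a.2 : ℝ)⌋₊ with hk
  set m := ⌊(b.2 : ℝ)⌋₊ with hm
  set A := D.net.coord a with hA
  set B := D.net.coord b with hB
  set E := D.net.edgeVector a.1 a.2 with hE
  set E' := D.net.edgeVector b.1 b.2 with hE'
  have hcA : ∀ {x : ℝ}, x ∈ Set.Icc (k : ℝ) (k + 1) →
      D.net.curve a.1 x = A + (x - a.2) • E := fun hx => D.net.curve_eq_coord_add a hx
  have hcB : ∀ {y : ℝ}, y ∈ Set.Icc (m : ℝ) (m + 1) →
      D.net.curve b.1 y = B + (y - b.2) • E' := fun hx => D.net.curve_eq_coord_add b hx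
  have hcAa : D.net.curve a.1 a.2 = A := rfl
  have hcBb : D.net.curve b.1 b.2 = B := rfl
  have hwa2 : 0 < A 2 * A 2 := mul_self_pos.2 hwa
  have hwb2 : 0 < B 2 * B 2 := mul_self_pos.2 hwb
  -- The slope of the strand: in affine coordinates it runs along `S / w = κ * T / w + 1`.
  let κ := (ev S E' - E' 2) / ev T E'
  -- the strand
  have hevB : ∀ᶠ y in 𝓝 (b.2 : ℝ), y ∈ Set.Ioo (m : ℝ) (m + 1) ∧
      0 < (B + (y - b.2) • E') 2 * B 2 ∧
      1 / 2 < ev S (B + (y - b.2) • E') / (B + (y - b.2) • E') 2 ∧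
      ∀ q : D.net.Point, q.1 = b.1 → (q.2 : ℝ) = y → ¬ D.net.IsMultiple q := by
    refine Filter.Eventually.and (Ioo_mem_nhds hb.1 hb.2) (.and ?_ (.and ?_ (D.eventually_not_isMultiple hmb)))
    · have hc : ContinuousAt (fun y : ℝ => (B + (y - b.2) • E') 2 * B 2) b.2 := by
        simp only [Pi.add_apply, Pi.smul_apply, smul_eq_mul]
        fun_prop
      exact hc.eventually (lt_mem_nhds (by simpa using hwb2))
    · have hc : ContinuousAt (fun y : ℝ => ev S (B + (y - b.2) • E') /
          (B + (y - b.2) • E') 2) b.2 := by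
        simp only [ev_add, ev_smul, Pi.add_apply, Pi.smul_apply, smul_eq_mul]
        refine ContinuousAt.div (by fun_prop) (by fun_prop) (by simpa using hwb)
      refine hc.eventually (lt_mem_nhds ?_)
      simp only [sub_self, zero_smul, add_zero]
      rw [hSb, div_self hwb]
      norm_num
  obtain ⟨ε, hε, hεB⟩ := Metric.eventually_nhds_iff.1 hevB
  have hstrand : ∀ y ∈ Set.Icc (b.2 - ε / 2) (b.2 + ε / 2), y ∈ Set.Ioo (m : ℝ) (m + 1) ∧
      0 < (B + (y - b.2) • E') 2 * B 2 ∧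
      1 / 2 < ev S (B + (y - b.2) • E') / (B + (y - b.2) • E') 2 ∧
      ∀ q : D.net.Point, q.1 = b.1 → (q.2 : ℝ) = y → ¬ D.net.IsMultiple q := by
    intro y hy
    refine hεB ?_
    rw [Real.dist_eq, abs_lt]
    exact ⟨by linarith [hy.1], by linarith [hy.2]⟩
  have hmemB : ∀ {y}, y ∈ Set.Icc (b.2 - ε / 2) (b.2 + ε / 2) → y ∈ Set.Icc (m : ℝ) (m + 1) :=
    fun hy => Set.Ioo_subset_Icc_self (hstrand _ hy).1
  -- the base
  have hevA : ∀ᶠ x in 𝓝 (a.2 : ℝ), x ∈ Set.Ioo (k : ℝ) (k + 1) ∧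
      0 < (A + (x - a.2) • E) 2 * A 2 ∧
      0 < ((A + (x - a.2) • E) 2 + κ * ev T (A + (x - a.2) • E)) * A 2 ∧
      ∀ q : D.net.Point, q.1 = a.1 → (q.2 : ℝ) = x → ¬ D.net.IsMultiple q := by
    refine Filter.Eventually.and (Ioo_mem_nhds ha.1 ha.2) (.and ?_ (.and ?_ (D.eventually_not_isMultiple hma)))
    · have hc : ContinuousAt (fun x : ℝ => (A + (x - a.2) • E) 2 * A 2) a.2 := by
        simp only [Pi.add_apply, Pi.smul_apply, smul_eq_mul]
        fun_prop
      exact hc.eventually (lt_mem_nhds (by simpa using hwa2))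
    · have hc : ContinuousAt (fun x : ℝ => ((A + (x - a.2) • E) 2 +
          κ * ev T (A + (x - a.2) • E)) * A 2) a.2 := by
        simp only [ev_add, ev_smul, Pi.add_apply, Pi.smul_apply, smul_eq_mul]
        fun_prop
      refine hc.eventually (lt_mem_nhds ?_)
      simp only [sub_self, zero_smul, add_zero]
      rw [hTa, mul_zero, add_zero]
      exact hwa2
  obtain ⟨ρ, hρ, hρA⟩ := Metric.eventually_nhds_iff.1 hevA
  simp only [Real.dist_eq] at hρA
  obtain ⟨η, hη, hbox⟩ := D.exists_box hfa hfb hδ hseg hρ (half_pos hε)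
  -- the width of the base
  have hcross : ∀ᶠ r in 𝓝 (0 : ℝ),
      (ev T (B + (-(ε / 2)) • E') - r * (B + (-(ε / 2)) • E') 2) *
        (ev T (B + (ε / 2) • E') - r * (B + (ε / 2) • E') 2) < 0 := by
    have hc : ContinuousAt (fun r : ℝ => (ev T (B + (-(ε / 2)) • E') - r * (B + (-(ε / 2)) • E') 2) *
        (ev T (B + (ε / 2) • E') - r * (B + (ε / 2) • E') 2)) 0 := by fun_prop
    refine hc.eventually (gt_mem_nhds ?_)
    simp only [zero_mul, sub_zero, ev_add, ev_smul, hTb, zero_add]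
    -- At `r = 0` the product is minus this square. So for small `r` the function `ev T - r * w`
    -- still changes sign between the ends of the strand.
    have : 0 < (ε / 2 * ev T E') ^ 2 := by positivity
    nlinarith
  obtain ⟨τ, hτ, hτr⟩ := Metric.eventually_nhds_iff.1 hcross
  simp only [Real.dist_eq, sub_zero] at hτr
  have hwidth : ∀ᶠ x in 𝓝 (a.2 : ℝ),
      |ev T (A + (x - (a.2 : ℝ)) • E) / (A + (x - (a.2 : ℝ)) • E) 2| < min η τ := by
    have hc : ContinuousAt (fun x : ℝ =>
        |ev T (A + (x - (a.2 : ℝ)) • E) / (A + (x - (a.2 : ℝ)) • E) 2|) a.2 := by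
      simp only [ev_add, ev_smul, Pi.add_apply, Pi.smul_apply, smul_eq_mul]
      refine (ContinuousAt.div (by fun_prop) (by fun_prop) (by simpa using hwa)).abs
    refine hc.eventually (gt_mem_nhds ?_)
    simp only [sub_self, zero_smul, add_zero]
    rw [hTa, zero_div, abs_zero]
    exact lt_min hη hτ
  obtain ⟨ω, hω, hωA⟩ := Metric.eventually_nhds_iff.1 hwidth
  simp only [Real.dist_eq] at hωA
  set d := min ρ ω / 2 with hd
  have hd0 : 0 < d := half_pos (lt_min hρ hω)
  have hdρ : d < ρ := (half_lt_self (lt_min hρ hω)).trans_le (min_le_left _ _)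
  have hdω : d < ω := (half_lt_self (lt_min hρ hω)).trans_le (min_le_right _ _)
  have hl : (a.2 : ℝ) - d - a.2 = -d := by ring
  have hr : (a.2 : ℝ) + d - a.2 = d := by ring
  have hAl := hρA (y := a.2 - d) (by rw [hl, abs_neg, abs_of_pos hd0]; exact hdρ)
  have hAr := hρA (y := a.2 + d) (by rw [hr, abs_of_pos hd0]; exact hdρ)
  have hωl := hωA (y := a.2 - d) (by rw [hl, abs_neg, abs_of_pos hd0]; exact hdω)
  have hωr := hωA (y := a.2 + d) (by rw [hr, abs_of_pos hd0]; exact hdω)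
  have hml := Set.Ioo_subset_Icc_self hAl.1
  have hmr := Set.Ioo_subset_Icc_self hAr.1
  have hTx : ∀ t : ℝ, ev T (A + t • E) = t * ev T E := by
    intro t
    rw [ev_add, ev_smul, hTa, zero_add]
  -- By `hTe`, the coordinate `T / w` increases along the base. So bounds on it translate into
  -- bounds on the parameter, as `box` requires.
  have hmono : ∀ {x y : ℝ}, |x - a.2| < ρ → |y - a.2| < ρ →
      ev T (A + (x - a.2) • E) / (A + (x - a.2) • E) 2 ≤
        ev T (A + (y - a.2) • E) / (A + (y - a.2) • E) 2 → x ≤ y := by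
    intro x y hx hy h
    have h1 := (hρA hx).2.1
    have h2 := (hρA hy).2.1
    rw [hTx, hTx] at h
    simp only [Pi.add_apply, Pi.smul_apply, smul_eq_mul] at h h1 h2
    by_contra hlt
    push Not at hlt
    have h3 : 0 < (A 2 + (x - a.2) * E 2) * (A 2 + (y - a.2) * E 2) := by
      have := mul_pos h1 h2
      have e : (A 2 + (x - a.2) * E 2) * A 2 * ((A 2 + (y - a.2) * E 2) * A 2) =
        (A 2 + (x - a.2) * E 2) * (A 2 + (y - a.2) * E 2) * (A 2 * A 2) := by ring
      rw [e] at this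
      exact pos_of_mul_pos_left this hwa2.le
    have h4 : (y - a.2) * ev T E / (A 2 + (y - a.2) * E 2) -
        (x - a.2) * ev T E / (A 2 + (x - a.2) * E 2) =
        (y - x) * (ev T E * A 2) / ((A 2 + (x - a.2) * E 2) * (A 2 + (y - a.2) * E 2)) := by
      have n1 : A 2 + (x - a.2) * E 2 ≠ 0 := left_ne_zero_of_mul h3.ne'
      have n2 : A 2 + (y - a.2) * E 2 ≠ 0 := right_ne_zero_of_mul h3.ne'
      rw [div_sub_div _ _ n2 n1, div_eq_div_iff (mul_ne_zero n2 n1) (mul_ne_zero n1 n2)]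
      ring
    have h5 : (y - x) * (ev T E * A 2) / ((A 2 + (x - a.2) * E 2) * (A 2 + (y - a.2) * E 2)) < 0 :=
      div_neg_of_neg_of_pos (mul_neg_of_neg_of_pos (by linarith) hTe) h3
    linarith
  refine ⟨{ S := S, T := T, det_ne := hδ, i₀ := a.1, k := k, k_lt := D.net.floor_lt_len a
            xl := a.2 - d, xa := a.2, xr := a.2 + d
            k_lt_xl := hAl.1.1, xl_lt := by linarith, lt_xr := by linarith, xr_lt := hAr.1.2
            S_base := fun x hx => by rw [hcA hx, ev_add, ev_smul, hSa, hSe]; ring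
            T_mid := hTa
            w_left := by rw [hcA hml, hcAa]; exact hAl.2.1
            w_right := by rw [hcA hmr, hcAa]; exact hAr.2.1
            T_left := by rw [hcA hml, hcAa, hTx]; nlinarith
            T_right := by rw [hcA hmr, hcAa, hTx]; nlinarith
            i₁ := b.1, m := m, m_lt := D.net.floor_lt_len b
            yl := b.2 - ε / 2, yb := b.2, yr := b.2 + ε / 2
            m_lt_yl := (hstrand _ ⟨le_rfl, by linarith⟩).1.1
            yl_lt := by linarith, lt_yr := by linarith
            yr_lt := (hstrand _ ⟨by linarith, le_rfl⟩).1.2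
            κ := κ
            S_strand := fun y hy => by
              rw [hcB (hmemB hy), ev_add, ev_smul, ev_add, ev_smul, hSb, hTb]
              simp only [κ, Pi.add_apply, Pi.smul_apply, smul_eq_mul]
              field_simp
              ring
            T_yb := hTb
            T_edge := hTeb
            w_strand := fun y hy => by rw [hcB (hmemB hy), hcBb]; exact (hstrand y hy).2.1
            half_lt := fun y hy => by rw [hcB (hmemB hy)]; exact (hstrand y hy).2.2.1
            κ_left := by rw [hcA hml, hcAa]; exact hAl.2.2.1
            κ_right := by rw [hcA hmr, hcAa]; exact hAr.2.2.1
            η := η, η_pos := hη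
            box := ?_
            cross := ?_
            base_regular := fun p hi hx => (hρA (y := p.2) (by
              rw [abs_lt]; exact ⟨by linarith [hx.1], by linarith [hx.2]⟩)).2.2.2 p hi rfl
            strand_regular := fun p hi hy => (hstrand _ hy).2.2.2 p hi rfl },
          rfl, rfl, rfl, rfl⟩
  · intro p hw hs1 hs2 hr1 hr2
    rw [hcA hml] at hr1
    rw [hcA hmr] at hr2
    have h1 : |ev T (D.net.coord p) / D.net.coord p 2| ≤ η := by
      rw [abs_le]
      have h2 := (abs_lt.1 hωl).1
      have h3 := (abs_lt.1 hωr).2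
      have h4 := min_le_left η τ
      exact ⟨by linarith, by linarith⟩
    rcases hbox p hw hs1 hs2 h1 with ⟨hi, hx⟩ | ⟨hi, hy⟩
    · left
      have hxk := Set.Ioo_subset_Icc_self (hρA hx).1
      have hc : D.net.coord p = A + ((p.2 : ℝ) - a.2) • E := by
        rw [← hcA hxk, ← hi]
        rfl
      rw [hc] at hr1 hr2
      exact ⟨hi, hmono (by rw [hl, abs_neg, abs_of_pos hd0]; exact hdρ) hx hr1,
        hmono hx (by rw [hr, abs_of_pos hd0]; exact hdρ) hr2⟩
    · right
      rw [abs_lt] at hy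
      exact ⟨hi, by linarith [hy.1], by linarith [hy.2]⟩
  · intro r hr1 hr2
    rw [hcA hml] at hr1
    rw [hcA hmr] at hr2
    have h1 : |r| < τ := by
      rw [abs_lt]
      have h2 := (abs_lt.1 hωl).1
      have h3 := (abs_lt.1 hωr).2
      have h4 := min_le_right η τ
      exact ⟨by linarith, by linarith⟩
    have h2 := hτr h1
    let f : ℝ → ℝ := fun y => ev T (B + (y - b.2) • E') - r * (B + (y - b.2) • E') 2
    have hf : ContinuousOn f (Set.Icc (b.2 - ε / 2) (b.2 + ε / 2)) := by
      have : Continuous f := by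
        simp only [f, ev_add, ev_smul, Pi.add_apply, Pi.smul_apply, smul_eq_mul]
        fun_prop
      exact this.continuousOn
    have e1 : f (b.2 - ε / 2) = ev T (B + (-(ε / 2)) • E') - r * (B + (-(ε / 2)) • E') 2 := by
      simp only [f]
      rw [show (b.2 : ℝ) - ε / 2 - b.2 = -(ε / 2) by ring]
    have e2 : f (b.2 + ε / 2) = ev T (B + (ε / 2) • E') - r * (B + (ε / 2) • E') 2 := by
      simp only [f]
      rw [show (b.2 : ℝ) + ε / 2 - b.2 = ε / 2 by ring]
    rw [← e1, ← e2] at h2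
    have hle : (b.2 : ℝ) - ε / 2 ≤ b.2 + ε / 2 := by linarith
    obtain ⟨y, hy, hfy⟩ : ∃ y ∈ Set.Ioo (b.2 - ε / 2) (b.2 + ε / 2), f y = 0 := by
      rcases mul_neg_iff.1 h2 with ⟨h3, h4⟩ | ⟨h3, h4⟩
      · exact intermediate_value_Ioo' hle hf ⟨h4, h3⟩
      · exact intermediate_value_Ioo hle hf ⟨h3, h4⟩
    refine ⟨y, hy, ?_⟩
    rw [hcB (hmemB (Set.Ioo_subset_Icc_self hy))]
    exact sub_eq_zero.1 hfy

/-- If the net meets the segment between two points only in its end points, then there is a site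
for a finger move along this segment. -/
theorem exists_fingerSite {a b : D.net.Point} (hfa : Int.fract (a.2 : ℝ) ≠ 0)
    (hfb : Int.fract (b.2 : ℝ) ≠ 0) (hma : ¬ D.net.IsMultiple a) (hmb : ¬ D.net.IsMultiple b)
    (hwa : D.net.coord a 2 ≠ 0) (hwb : D.net.coord b 2 ≠ 0) {S T : Fin 3 → ℝ}
    (hδ : S 0 * T 1 - S 1 * T 0 ≠ 0)
    (hSa : ev S (D.net.coord a) = 0) (hSe : ev S (D.net.edgeVector a.1 a.2) = 0)
    (hTa : ev T (D.net.coord a) = 0) (hTe : ev T (D.net.edgeVector a.1 a.2) ≠ 0)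
    (hSb : ev S (D.net.coord b) = D.net.coord b 2) (hTb : ev T (D.net.coord b) = 0)
    (hTeb : ev T (D.net.edgeVector b.1 b.2) ≠ 0)
    (hseg : ∀ p : D.net.Point, D.net.coord p 2 ≠ 0 → ev T (D.net.coord p) = 0 →
      0 ≤ ev S (D.net.coord p) / D.net.coord p 2 → ev S (D.net.coord p) / D.net.coord p 2 ≤ 1 →
      p = a ∨ p = b) :
    ∃ Γ : FingerSite D, a.1 = Γ.i₀ ∧ (a.2 : ℝ) = Γ.xa ∧ b.1 = Γ.i₁ ∧ (b.2 : ℝ) = Γ.yb := by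
  rcases lt_or_gt_of_ne (mul_ne_zero hTe hwa) with h | h
  -- The sign is only a choice of orientation for the transverse coordinate.
  · refine D.exists_fingerSite_of_pos (T := -T) hfa hfb hma hmb hwa hwb ?_ hSa hSe ?_ ?_ hSb ?_ ?_ ?_
    · simp only [Pi.neg_apply]
      intro h'
      exact hδ (by linarith)
    · rw [ev_neg_left, hTa, neg_zero]
    · rw [ev_neg_left]; linarith
    · rw [ev_neg_left, hTb, neg_zero]
    · rw [ev_neg_left]; exact neg_ne_zero.2 hTeb
    · intro p hw hT
      rw [ev_neg_left, neg_eq_zero] at hT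
      exact hseg p hw hT
  · exact D.exists_fingerSite_of_pos hfa hfb hma hmb hwa hwb hδ hSa hSe hTa h hSb hTb hTeb hseg

end Diagram

end ProjLink

end

noncomputable section

namespace ProjLink

open Matrix

/-! ### Lines in the projective plane -/

theorem ev_cross_left (A B : Fin 3 → ℝ) : ev (A ⨯₃ B) A = 0 := by
  simp only [ev, cross_apply]
  simp
  ring

theorem ev_cross_right (A B : Fin 3 → ℝ) : ev (A ⨯₃ B) B = 0 := by
  simp only [ev, cross_apply]
  simp
  ring

theorem ev_cross_cyclic (A B C : Fin 3 → ℝ) : ev (A ⨯₃ B) C = ev (C ⨯₃ A) B := by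
  simp only [ev, cross_apply]
  simp
  ring

theorem ev_smul_left (c : ℝ) (l V : Fin 3 → ℝ) : ev (c • l) V = c * ev l V := by
  simp only [ev, Pi.smul_apply, smul_eq_mul]; ring

/-- A functional that vanishes on a line is a multiple of the cross product. -/
theorem exists_eq_smul_cross {A B l : Fin 3 → ℝ} (h : LinearIndependent ℝ ![A, B])
    (hA : ev l A = 0) (hB : ev l B = 0) : ∃ c : ℝ, l = c • A ⨯₃ B := by
  have hn := crossProduct_ne_zero_iff_linearIndependent.2 h
  set n := A ⨯₃ B with hnd
  have e0 : n 0 = A 1 * B 2 - A 2 * B 1 := by simp [hnd, cross_apply]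
  have e1 : n 1 = A 2 * B 0 - A 0 * B 2 := by simp [hnd, cross_apply]
  have e2 : n 2 = A 0 * B 1 - A 1 * B 0 := by simp [hnd, cross_apply]
  simp only [ev] at hA hB
  -- Componentwise, `l × (A × B) = 0`, so `l` is parallel to `A × B` and equals its orthogonal
  -- projection onto it.
  have c0 : l 1 * n 2 - l 2 * n 1 = 0 := by
    rw [e1, e2]; linear_combination A 0 * hB - B 0 * hA
  have c1 : l 2 * n 0 - l 0 * n 2 = 0 := by
    rw [e0, e2]; linear_combination A 1 * hB - B 1 * hA
  have c2 : l 0 * n 1 - l 1 * n 0 = 0 := by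
    rw [e0, e1]; linear_combination A 2 * hB - B 2 * hA
  have hnn : n 0 ^ 2 + n 1 ^ 2 + n 2 ^ 2 ≠ 0 := by
    intro h0
    apply hn
    have h1 : n 0 = 0 := by nlinarith [sq_nonneg (n 0), sq_nonneg (n 1), sq_nonneg (n 2)]
    have h2 : n 1 = 0 := by nlinarith [sq_nonneg (n 0), sq_nonneg (n 1), sq_nonneg (n 2)]
    have h3 : n 2 = 0 := by nlinarith [sq_nonneg (n 0), sq_nonneg (n 1), sq_nonneg (n 2)]
    funext k
    fin_cases k
    · exact h1
    · exact h2
    · exact h3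
  refine ⟨(l 0 * n 0 + l 1 * n 1 + l 2 * n 2) / (n 0 ^ 2 + n 1 ^ 2 + n 2 ^ 2), ?_⟩
  funext k
  rw [Pi.smul_apply, smul_eq_mul, div_mul_eq_mul_div, eq_div_iff hnn]
  fin_cases k
  · simp only [Fin.zero_eta]
    linear_combination n 1 * c2 - n 2 * c1
  · simp only [Fin.mk_one]
    linear_combination n 2 * c0 - n 0 * c2
  · simp only [Fin.reduceFinMk]
    linear_combination n 0 * c1 - n 1 * c0

namespace PolygonSystem

variable (F : PolygonSystem 3)

/-- The line of an edge. -/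
def edgeLine (i : Fin F.num) (k : ℕ) : Fin 3 → ℝ := F.vert i k ⨯₃ F.vert i (k + 1)

theorem edgeLine_ne_zero {i : Fin F.num} {k : ℕ} (hk : k < F.len i) : F.edgeLine i k ≠ 0 :=
  crossProduct_ne_zero_iff_linearIndependent.2 (F.nondegenerate i k hk)

theorem ev_coord_eq (l : Fin 3 → ℝ) (p : F.Point) : ev l (F.coord p) =
    ev l (F.vert p.1 ⌊(p.2 : ℝ)⌋₊) + Int.fract (p.2 : ℝ) * ev l (F.edgeVector p.1 p.2) := by
  rw [coord, F.curve_eq_vert_add, ev_add, ev_smul]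

/-- A line that does not contain an edge meets it at most once. -/
theorem subsingleton_zeros (l : Fin 3 → ℝ) (i : Fin F.num) (k : ℕ)
    (h : ¬ (ev l (F.vert i k) = 0 ∧ ev l (F.vert i (k + 1)) = 0)) :
    {x | x ∈ Set.Icc (k : ℝ) (k + 1) ∧ ev l (F.curve i x) = 0}.Subsingleton := by
  rintro x ⟨hx, h1⟩ y ⟨hy, h2⟩
  by_contra hxy
  rw [F.curve_eq_of_mem_Icc hx, ev_add, ev_smul, ev_smul] at h1
  rw [F.curve_eq_of_mem_Icc hy, ev_add, ev_smul, ev_smul] at h2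
  have hxy' : x - y ≠ 0 := sub_ne_zero.2 hxy
  refine h ⟨mul_left_cancel₀ hxy' ?_, mul_left_cancel₀ hxy' ?_⟩
  · linear_combination (-(y - k)) * h1 + (x - k) * h2
  · linear_combination (k + 1 - y) * h1 - (k + 1 - x) * h2

/-- A line that contains no vertex meets the polygons finitely often. -/
theorem finite_zeros (l : Fin 3 → ℝ) (h : ∀ i, ∀ k < F.len i, ev l (F.vert i k) ≠ 0) :
    {p : F.Point | ev l (F.coord p) = 0}.Finite := by
  let f : {p : F.Point | ev l (F.coord p) = 0} → Σ i : Fin F.num, Fin (F.len i) :=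
    fun p => ⟨p.1.1, ⌊(p.1.2 : ℝ)⌋₊, F.floor_lt_len p.1⟩
  refine Set.finite_coe_iff.1 (Finite.of_injective f ?_)
  rintro ⟨⟨i, x⟩, hp⟩ ⟨⟨j, y⟩, hq⟩ hpq
  obtain rfl : i = j := congrArg Sigma.fst hpq
  have hfl : ⌊(x : ℝ)⌋₊ = ⌊(y : ℝ)⌋₊ := by
    have := eq_of_heq (Sigma.mk.inj hpq).2
    exact congrArg Fin.val this
  have hk : ⌊(x : ℝ)⌋₊ < F.len i := F.floor_lt_len ⟨i, x⟩
  have h1 := F.subsingleton_zeros l i ⌊(x : ℝ)⌋₊ (fun h' => h i _ hk h'.1)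
    ⟨floor_mem_Icc x.2.1, hp⟩ ⟨by rw [hfl]; exact floor_mem_Icc y.2.1, hq⟩
  have h2 : x = y := Subtype.ext h1
  subst h2
  rfl

end PolygonSystem

namespace Diagram

variable (D : Diagram)

/-! ### Finding a segment for a finger move -/

/-- On a line in general position that meets the net in points of different colours, there are two
neighbouring points of different colours. -/
theorem exists_fingerSite_of_line {T : Fin 3 → ℝ}
    (hv : ∀ i, ∀ k < D.net.len i, ev T (D.net.vert i k) ≠ 0)
    (hm : ∀ p, D.net.IsMultiple p → ev T (D.net.coord p) ≠ 0) {K : Type*} (χ : D.net.Point → K)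
    {a₀ b₀ : D.net.Point} (hTa₀ : ev T (D.net.coord a₀) = 0) (hTb₀ : ev T (D.net.coord b₀) = 0)
    (hwa₀ : D.net.coord a₀ 2 ≠ 0) (hwb₀ : D.net.coord b₀ 2 ≠ 0) (hχ : χ a₀ ≠ χ b₀) :
    ∃ (a b : D.net.Point) (Γ : FingerSite D), χ a ≠ χ b ∧
      a.1 = Γ.i₀ ∧ (a.2 : ℝ) = Γ.xa ∧ b.1 = Γ.i₁ ∧ (b.2 : ℝ) = Γ.yb := by
  -- The line is not the line at infinity, so its finite part is an affine line with coordinate `θ`.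
  have hT : ¬ (T 0 = 0 ∧ T 1 = 0) := by
    rintro ⟨h0, h1⟩
    have h2 : T 2 = 0 := by
      simp only [ev, h0, h1, zero_mul, zero_add] at hTa₀
      exact (mul_eq_zero.1 hTa₀).resolve_right hwa₀
    refine hv a₀.1 0 (D.net.len_pos _) ?_
    simp [ev, h0, h1, h2]
  let U : Fin 3 → ℝ := ![T 1, -T 0, 0]
  have hUT : U 0 * T 1 - U 1 * T 0 ≠ 0 := by
    have e : U 0 * T 1 - U 1 * T 0 = T 0 ^ 2 + T 1 ^ 2 := by
      simp [U]; ring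
    rw [e]
    intro h
    exact hT ⟨by nlinarith [sq_nonneg (T 0), sq_nonneg (T 1)],
      by nlinarith [sq_nonneg (T 0), sq_nonneg (T 1)]⟩
  let θ : D.net.Point → ℝ := fun p => ev U (D.net.coord p) / D.net.coord p 2
  let H : Set D.net.Point := {p | ev T (D.net.coord p) = 0 ∧ D.net.coord p 2 ≠ 0}
  have hH : H.Finite := (D.net.finite_zeros T hv).subset fun p hp => hp.1
  have hHm : ∀ p ∈ H, ¬ D.net.IsMultiple p := fun p hp h => hm p h hp.1
  have hHe : ∀ p ∈ H, ev T (D.net.edgeVector p.1 p.2) ≠ 0 := by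
    intro p hp h
    have h1 := D.net.ev_coord_eq T p
    rw [hp.1, h, mul_zero, add_zero] at h1
    exact hv _ _ (D.net.floor_lt_len p) h1.symm
  have hHf : ∀ p ∈ H, Int.fract (p.2 : ℝ) ≠ 0 := by
    intro p hp h
    have h1 := D.net.ev_coord_eq T p
    rw [hp.1, h, zero_mul, add_zero] at h1
    exact hv _ _ (D.net.floor_lt_len p) h1.symm
  have hline : ∀ a ∈ H, ∀ b ∈ H, ∀ p ∈ H, (θ b - θ a) • ((D.net.coord p 2)⁻¹ • D.net.coord p -
      (D.net.coord a 2)⁻¹ • D.net.coord a) = (θ p - θ a) • ((D.net.coord b 2)⁻¹ • D.net.coord b -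
      (D.net.coord a 2)⁻¹ • D.net.coord a) := by
    intro a ha b hb p hp
    rw [← sub_eq_zero]
    refine vec_eq_zero_of_ev hUT ?_ ?_ ?_
    · simp only [ev_sub, ev_smul, θ]
      ring
    · simp only [ev_sub, ev_smul, ha.1, hb.1, hp.1]
      ring
    · simp only [Pi.sub_apply, Pi.smul_apply, smul_eq_mul, inv_mul_cancel₀ ha.2,
        inv_mul_cancel₀ hb.2, inv_mul_cancel₀ hp.2]
      ring
  have hinj : ∀ a ∈ H, ∀ b ∈ H, θ a = θ b → a = b := by
    intro a ha b hb hab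
    -- Two points of the net with the same position on the line would form a double point, and the
    -- line avoids those.
    by_contra hne
    refine hHm a ha ⟨b, Ne.symm hne, (D.net.toProj_eq_iff b a).2
      ⟨D.net.coord b 2 / D.net.coord a 2, div_ne_zero hb.2 ha.2, ?_⟩⟩
    have h1 : (D.net.coord b 2)⁻¹ • D.net.coord b - (D.net.coord a 2)⁻¹ • D.net.coord a = 0 := by
      refine vec_eq_zero_of_ev hUT ?_ ?_ ?_
      · simp only [θ] at hab
        simp only [ev_sub, ev_smul]
        rw [inv_mul_eq_div, inv_mul_eq_div, hab, sub_self]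
      · simp only [ev_sub, ev_smul, ha.1, hb.1]
        ring
      · simp only [Pi.sub_apply, Pi.smul_apply, smul_eq_mul, inv_mul_cancel₀ ha.2,
          inv_mul_cancel₀ hb.2, sub_self]
    rw [sub_eq_zero] at h1
    rw [div_eq_mul_inv, mul_smul, ← h1, smul_inv_smul₀ hb.2]
  have hwlog : ∃ a₁ ∈ H, ∃ b₁ ∈ H, χ a₁ ≠ χ b₁ ∧ θ a₁ < θ b₁ := by
    have ha : a₀ ∈ H := ⟨hTa₀, hwa₀⟩
    have hb : b₀ ∈ H := ⟨hTb₀, hwb₀⟩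
    have hne : θ a₀ ≠ θ b₀ := fun h => hχ (congrArg χ (hinj _ ha _ hb h))
    rcases lt_or_gt_of_ne hne with h | h
    · exact ⟨a₀, ha, b₀, hb, hχ, h⟩
    · exact ⟨b₀, hb, a₀, ha, hχ.symm, h⟩
  obtain ⟨a₁, ha₁, b₁, hb₁, hχ₁, hlt⟩ := hwlog
  -- The first point beyond `a₁` with another colour, and then its predecessor: the predecessor
  -- still has the colour of `a₁`, and nothing lies between the two.
  obtain ⟨b, ⟨hb, hb2, hb3⟩, hbmin⟩ := Set.exists_min_image
    {p | p ∈ H ∧ θ a₁ < θ p ∧ χ p ≠ χ a₁} θ (hH.subset fun p hp => hp.1)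
    ⟨b₁, hb₁, hlt, hχ₁.symm⟩
  obtain ⟨a, ⟨ha, ha2, ha3⟩, hamax⟩ := Set.exists_max_image
    {p | p ∈ H ∧ θ a₁ ≤ θ p ∧ θ p < θ b} θ (hH.subset fun p hp => hp.1)
    ⟨a₁, ha₁, le_rfl, hb2⟩
  have hχa : χ a = χ a₁ := by
    rcases ha2.lt_or_eq with h | h
    · by_contra hne
      exact absurd (hbmin a ⟨ha, h, hne⟩) (not_le.2 ha3)
    · rw [hinj _ ha₁ _ ha h]
  have hbetween : ∀ p ∈ H, θ a ≤ θ p → θ p ≤ θ b → p = a ∨ p = b := by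
    intro p hp h1 h2
    rcases h2.lt_or_eq with h | h
    · exact Or.inl (hinj _ hp _ ha (le_antisymm (hamax p ⟨hp, ha2.trans h1, h⟩) h1))
    · exact Or.inr (hinj _ hp _ hb h)
  have hab : a ≠ b := by rintro rfl; exact lt_irrefl _ ha3
  let S' := D.net.coord a ⨯₃ D.net.edgeVector a.1 a.2
  have hS' : S' ≠ 0 := crossProduct_ne_zero_iff_linearIndependent.2
    (D.net.linearIndependent_coord_edgeVector a)
  -- If `b` were on the line of the edge through `a`, that line would be `T`; but `T` crosses this
  -- edge transversally because it contains no vertex. So `S'` can be scaled to be the affine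
  -- coordinate equal to `1` at `b`.
  have hSb : ev S' (D.net.coord b) ≠ 0 := by
    intro h0
    have hli : LinearIndependent ℝ ![D.net.coord a, D.net.coord b] := by
      rw [LinearIndependent.pair_iff' (D.net.coord_ne_zero a)]
      intro c hc
      refine hHm a ha ⟨b, hab.symm, (D.net.toProj_eq_iff b a).2 ⟨c, ?_, hc.symm⟩⟩
      rintro rfl
      rw [zero_smul] at hc
      exact D.net.coord_ne_zero b hc.symm
    obtain ⟨c, hc⟩ := exists_eq_smul_cross hli ha.1 hb.1
    obtain ⟨c', hc'⟩ : ∃ c' : ℝ, S' = c' • D.net.coord a ⨯₃ D.net.coord b :=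
      exists_eq_smul_cross hli (ev_cross_left _ _) h0
    have h1 := ev_cross_right (D.net.coord a) (D.net.edgeVector a.1 a.2)
    have h2 := hHe a ha
    change ev S' _ = 0 at h1
    rw [hc', ev_smul_left] at h1
    rw [hc, ev_smul_left] at h2
    have h3 := (mul_eq_zero.1 h1).resolve_right (right_ne_zero_of_mul h2)
    rw [h3, zero_smul] at hc'
    exact hS' hc'
  let S : Fin 3 → ℝ := (D.net.coord b 2 / ev S' (D.net.coord b)) • S'
  have hSa : ev S (D.net.coord a) = 0 := by
    rw [ev_smul_left, ev_cross_left, mul_zero]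
  have hSe : ev S (D.net.edgeVector a.1 a.2) = 0 := by
    rw [ev_smul_left, ev_cross_right, mul_zero]
  have hSb' : ev S (D.net.coord b) = D.net.coord b 2 := by
    rw [ev_smul_left, div_mul_cancel₀ _ hSb]
  have hδ : S 0 * T 1 - S 1 * T 0 ≠ 0 := by
    set A := D.net.coord a
    set B := D.net.coord b
    set E := D.net.edgeVector a.1 a.2
    have hT1 := ha.1
    have hT2 := hb.1
    -- Multiplicativity of determinants: `S` and `T` are evaluated on the direction of the edge and
    -- on the direction from `a` to `b`. The resulting matrix is antidiagonal, with nonzero entries.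
    have key : (S 0 * T 1 - S 1 * T 0) * ((A 2 * E 0 - E 2 * A 0) * (A 2 * B 1 - B 2 * A 1) -
        (A 2 * E 1 - E 2 * A 1) * (A 2 * B 0 - B 2 * A 0)) = -(A 2 * B 2 * (A 2 * ev T E)) := by
      have s1 : S 0 * (A 2 * E 0 - E 2 * A 0) + S 1 * (A 2 * E 1 - E 2 * A 1) = 0 := by
        simp only [ev] at hSa hSe
        linear_combination A 2 * hSe - E 2 * hSa
      have s2 : T 0 * (A 2 * E 0 - E 2 * A 0) + T 1 * (A 2 * E 1 - E 2 * A 1) = A 2 * ev T E := by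
        change ev T A = 0 at hT1
        simp only [ev] at hT1 ⊢
        linear_combination - E 2 * hT1
      have s3 : S 0 * (A 2 * B 0 - B 2 * A 0) + S 1 * (A 2 * B 1 - B 2 * A 1) = A 2 * B 2 := by
        simp only [ev] at hSa hSb'
        linear_combination A 2 * hSb' - B 2 * hSa
      have s4 : T 0 * (A 2 * B 0 - B 2 * A 0) + T 1 * (A 2 * B 1 - B 2 * A 1) = 0 := by
        change ev T A = 0 at hT1
        change ev T B = 0 at hT2
        simp only [ev] at hT1 hT2
        linear_combination A 2 * hT2 - B 2 * hT1
      rw [← s2, ← s3]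
      linear_combination (T 0 * (A 2 * B 0 - B 2 * A 0) + T 1 * (A 2 * B 1 - B 2 * A 1)) * s1
    intro h0
    rw [h0, zero_mul] at key
    exact mul_ne_zero (mul_ne_zero ha.2 hb.2) (mul_ne_zero ha.2 (hHe a ha)) (by linarith)
  obtain ⟨Γ, h1, h2, h3, h4⟩ := D.exists_fingerSite (hHf a ha) (hHf b hb) (hHm a ha) (hHm b hb)
    ha.2 hb.2 hδ hSa hSe ha.1 (hHe a ha) hSb' hb.1 (hHe b hb) (by
      intro p hw hTp hs0 hs1
      have h1 := congrArg (ev S) (hline a ha b hb p ⟨hTp, hw⟩)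
      simp only [ev_smul, ev_sub, hSa, hSb', mul_zero, sub_zero, inv_mul_cancel₀ hb.2,
        mul_one] at h1
      rw [inv_mul_eq_div] at h1
      have h2 : 0 < θ b - θ a := sub_pos.2 ha3
      refine hbetween p ⟨hTp, hw⟩ ?_ ?_ <;> nlinarith)
  exact ⟨a, b, Γ, by rw [hχa]; exact hb3.symm, h1, h2, h3, h4⟩

end Diagram

end ProjLink

end

/-! ### Points of different state circles in general position -/

noncomputable section

namespace ProjLink

open Matrix

theorem exists_pos_forall_notMem {s : Set ℝ} (hs : s.Finite) (x₀ : ℝ) :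
    ∃ ε > 0, ∀ x, x ≠ x₀ → |x - x₀| < ε → x ∉ s := by
  have h : (s \ {x₀})ᶜ ∈ nhds x₀ := (hs.sdiff (t := {x₀})).isClosed.compl_mem_nhds (by simp)
  obtain ⟨ε, hε, hb⟩ := Metric.mem_nhds_iff.1 h
  refine ⟨ε, hε, fun x hx hd hxs => hb (show x ∈ Metric.ball x₀ ε from ?_) ⟨hxs, hx⟩⟩
  rwa [Metric.mem_ball, Real.dist_eq]

namespace Diagram

variable (D : Diagram)

/-- The circle of the all-A state at a point. -/
def circleAt (p : D.net.Point) : D.Circle := circleOf D.Crosses D.PositivePair (p, false)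

/-- The part `(u, v)` of the edge `k` of the component `i` is regular, and belongs to the state
circle `c`. -/
structure IsStateArc (c : D.Circle) (i : Fin D.net.num) (k : ℕ) (u v : ℝ) : Prop where
  k_lt : k < D.net.len i
  k_le : (k : ℝ) ≤ u
  lt : u < v
  le : v ≤ k + 1
  regular : ∀ p : D.net.Point, p.1 = i → (p.2 : ℝ) ∈ Set.Ioo u v →
    ¬ D.net.IsMultiple p ∧ D.net.coord p 2 ≠ 0 ∧ D.circleAt p = c

/-- Crossings and points at infinity are finite in number; the latter because no vertex is at
infinity. -/
theorem exists_regular_nhds (i : Fin D.net.num) (x₀ : ℝ) :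
    ∃ ε > 0, ∀ p : D.net.Point, p.1 = i → (p.2 : ℝ) ≠ x₀ → |(p.2 : ℝ) - x₀| < ε →
      ¬ D.net.IsMultiple p ∧ D.net.coord p 2 ≠ 0 := by
  have h0 : {p : D.net.Point | ev ![0, 0, 1] (D.net.coord p) = 0}.Finite :=
    D.net.finite_zeros _ fun i k hk => by
      simpa [ev] using D.vert_off_infinity i k hk.le
  have h1 : {p : D.net.Point | D.net.IsMultiple p ∨ D.net.coord p 2 = 0}.Finite := by
    refine (D.finite_multiple.union h0).subset ?_
    rintro p (hp | hp)
    · exact Or.inl hp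
    · exact Or.inr (by simpa [ev] using hp)
  obtain ⟨ε, hε, h2⟩ := exists_pos_forall_notMem (h1.image fun p => (p.2 : ℝ)) x₀
  refine ⟨ε, hε, fun p _ hp hd => ?_⟩
  have h3 := h2 p.2 hp hd
  exact ⟨fun h => h3 ⟨p, Or.inl h, rfl⟩, fun h => h3 ⟨p, Or.inr h, rfl⟩⟩

theorem circleOf_eq_of_between {i : Fin D.net.num} {x y : Set.Ico (0 : ℝ) (D.net.len i)}
    (hxy : x < y) (h : ∀ z : Set.Ico (0 : ℝ) (D.net.len i), x < z → z < y →
      ¬ D.net.IsMultiple ⟨i, z⟩) :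
    circleOf D.Crosses D.PositivePair (⟨i, x⟩, true) = D.circleAt ⟨i, y⟩ :=
  (isColouring_circleOf D.Crosses D.PositivePair).edge.between i x y hxy fun z h1 h2 h3 =>
    h z h1 h2 (D.mem_passages.1 h3)

theorem circleAt_eq_of_not_isMultiple {p : D.net.Point} (hp : ¬ D.net.IsMultiple p) :
    D.circleAt p = circleOf D.Crosses D.PositivePair (p, true) :=
  (isColouring_circleOf D.Crosses D.PositivePair).regular p fun h => hp (D.mem_passages.1 h)

theorem exists_isStateArc_right (p : D.net.Point) : ∃ v,
    D.IsStateArc (circleOf D.Crosses D.PositivePair (p, true)) p.1 ⌊(p.2 : ℝ)⌋₊ p.2 v := by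
  obtain ⟨i, x⟩ := p
  obtain ⟨ε, hε, h⟩ := D.exists_regular_nhds i x
  have hfl := PolygonSystem.floor_mem_Icc x.2.1
  have hlt := Nat.lt_floor_add_one (x : ℝ)
  have key : ∀ y : ℝ, y ∈ Set.Ioo (x : ℝ) (min (x + ε) (⌊(x : ℝ)⌋₊ + 1)) →
      y ≠ x ∧ |y - x| < ε := by
    intro y hy
    have h1 := hy.1
    have h2 := hy.2.trans_le (min_le_left _ _)
    exact ⟨h1.ne', by rw [abs_lt]; constructor <;> linarith⟩
  refine ⟨min (x + ε) (⌊(x : ℝ)⌋₊ + 1), D.net.floor_lt_len ⟨i, x⟩, hfl.1,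
    lt_min (by simp only; linarith) hlt, min_le_right _ _, ?_⟩
  rintro ⟨j, y⟩ hj hy
  obtain rfl : j = i := hj
  obtain ⟨h1, h2⟩ := key y hy
  obtain ⟨h3, h4⟩ := h ⟨j, y⟩ rfl h1 h2
  refine ⟨h3, h4, (D.circleOf_eq_of_between (x := x) (y := y) hy.1 fun z hz hz' => ?_).symm⟩
  obtain ⟨h5, h6⟩ := key z ⟨hz, lt_trans hz' hy.2⟩
  exact (h ⟨j, z⟩ rfl h5 h6).1

/-- The side of a point extends to a short interval next to it. This gives an infinite supply of
regular points on each circle, enough to avoid finitely many bad positions. -/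
theorem exists_isStateArc (c : D.Circle) : ∃ i k u v, D.IsStateArc c i k u v := by
  obtain ⟨⟨p, b⟩, rfl⟩ := circleOf_surjective _ _ c
  cases b with
  | true =>
    obtain ⟨v, hv⟩ := D.exists_isStateArc_right p
    exact ⟨_, _, _, v, hv⟩
  | false =>
    -- At parameter `0` there is no room to the left in the half-open interval; but the base point
    -- is regular, so its other side will do.
    rcases p.2.2.1.eq_or_lt with h0 | h0
    · have hp : ¬ D.net.IsMultiple p := by
        intro h
        refine (D.interior p h).1 ?_
        rw [← h0, Int.fract_zero]
      change ∃ i k u v, D.IsStateArc (D.circleAt p) i k u v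
      rw [D.circleAt_eq_of_not_isMultiple hp]
      obtain ⟨v, hv⟩ := D.exists_isStateArc_right p
      exact ⟨_, _, _, v, hv⟩
    · obtain ⟨i, x⟩ := p
      obtain ⟨ε, hε, h⟩ := D.exists_regular_nhds i x
      simp only at h0
      -- The ceiling instead of the floor: if the point is a vertex, the interval before it lies on
      -- the preceding edge.
      obtain ⟨k, hk⟩ : ∃ k : ℕ, ⌈(x : ℝ)⌉₊ = k + 1 :=
        ⟨⌈(x : ℝ)⌉₊ - 1, by have := Nat.ceil_pos.2 h0; omega⟩
      have h1 : (k : ℝ) < x := Nat.lt_ceil.1 (by omega)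
      have h2 : (x : ℝ) ≤ k + 1 := by
        have := Nat.le_ceil (x : ℝ)
        rw [hk] at this
        exact_mod_cast this
      have key : ∀ y : ℝ, y ∈ Set.Ioo (max ((x : ℝ) - ε) k) x → y ≠ x ∧ |y - x| < ε := by
        intro y hy
        have h3 := hy.2
        have h4 := (le_max_left _ _).trans_lt hy.1
        exact ⟨h3.ne, by rw [abs_lt]; constructor <;> linarith⟩
      refine ⟨i, k, max ((x : ℝ) - ε) k, x, by exact_mod_cast h1.trans x.2.2, le_max_right _ _,
        max_lt (by linarith) h1, h2, ?_⟩
      rintro ⟨j, y⟩ hj hy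
      obtain rfl : j = i := hj
      obtain ⟨h3, h4⟩ := key y hy
      obtain ⟨h5, h6⟩ := h ⟨j, y⟩ rfl h3 h4
      refine ⟨h5, h6, ?_⟩
      rw [D.circleAt_eq_of_not_isMultiple h5]
      refine D.circleOf_eq_of_between (x := y) (y := x) hy.2 fun z hz hz' => ?_
      obtain ⟨h7, h8⟩ := key z ⟨hy.1.trans hz, hz'⟩
      exact (h ⟨j, z⟩ rfl h7 h8).1

namespace IsStateArc

variable {D}
variable {c c' : D.Circle} {i j : Fin D.net.num} {k m : ℕ} {u v u' v' : ℝ}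

theorem lt_len (h : D.IsStateArc c i k u v) {x : ℝ} (hx : x < v) : x < D.net.len i := by
  have h1 : (k : ℝ) + 1 ≤ D.net.len i := by exact_mod_cast h.k_lt
  linarith [h.le]

theorem nonneg (h : D.IsStateArc c i k u v) {x : ℝ} (hx : u < x) : 0 ≤ x :=
  (Nat.cast_nonneg k).trans (h.k_le.trans hx.le)

/-- The point of a state arc with a given parameter. -/
def point (h : D.IsStateArc c i k u v) {x : ℝ} (hx : x ∈ Set.Ioo u v) : D.net.Point :=
  ⟨i, x, h.nonneg hx.1, h.lt_len hx.2⟩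

theorem mem_Icc (h : D.IsStateArc c i k u v) {x : ℝ} (hx : x ∈ Set.Ioo u v) :
    x ∈ Set.Icc (k : ℝ) (k + 1) := ⟨h.k_le.trans hx.1.le, hx.2.le.trans h.le⟩

/-- Two state arcs on different lines that belong to different circles. -/
theorem exists_fingerSite (h : D.IsStateArc c i k u v) (h' : D.IsStateArc c' j m u' v')
    (hne : c ≠ c') (hline : ¬ (ev (D.net.edgeLine j m) (D.net.vert i k) = 0 ∧
      ev (D.net.edgeLine j m) (D.net.vert i (k + 1)) = 0)) :
    ∃ (a b : D.net.Point) (Γ : FingerSite D), D.circleAt a ≠ D.circleAt b ∧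
      a.1 = Γ.i₀ ∧ (a.2 : ℝ) = Γ.xa ∧ b.1 = Γ.i₁ ∧ (b.2 : ℝ) = Γ.yb := by
  -- The line through the two points must miss these vectors. The first point is chosen off `Q` and
  -- off the line of the other edge, so each line joining it to a point of `Q` meets that edge at
  -- most once; the second point avoids those lines.
  let Q : Set (Fin 3 → ℝ) := (⋃ i : Fin D.net.num, D.net.vert i '' Set.Iic (D.net.len i)) ∪
    D.net.coord '' {p | D.net.IsMultiple p}
  have hQ : Q.Finite := (Set.finite_iUnion fun i => (Set.finite_Iic _).image _).union
    (D.finite_multiple.image _)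
  have hQ0 : ∀ q ∈ Q, q ≠ 0 := by
    rintro q (hq | ⟨p, -, rfl⟩)
    · obtain ⟨i, k, hk, rfl⟩ := Set.mem_iUnion.1 hq
      intro h0
      exact D.vert_off_infinity i k hk (congrFun h0 2)
    · exact D.net.coord_ne_zero p
  -- the first point
  have hbad : ({x | x ∈ Set.Icc (k : ℝ) (k + 1) ∧ ev (D.net.edgeLine j m) (D.net.curve i x) = 0} ∪
      ⋃ q ∈ Q, {x | x ∈ Set.Icc (k : ℝ) (k + 1) ∧ ∃ r : ℝ, r • q = D.net.curve i x}).Finite := by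
    refine (D.net.subsingleton_zeros _ i k hline).finite.union
      (hQ.biUnion fun q hq => Set.Subsingleton.finite ?_)
    rintro x ⟨hx, r, hr⟩ y ⟨hy, s, hs⟩
    have hs0 : s ≠ 0 := by
      rintro rfl
      rw [zero_smul] at hs
      have := D.net.linearIndependent_curve h.k_lt hy
        (y := if y = k then k + 1 else k) (by split_ifs <;> constructor <;> simp) (by
          split_ifs with h1
          · rw [h1]; simp
          · exact h1)
      exact this.ne_zero 0 hs.symm
    refine D.net.eq_of_curve_eq_smul h.k_lt hx hy (c := r / s) ?_
    rw [← hr, ← hs, smul_smul, div_mul_cancel₀ _ hs0]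
  obtain ⟨x, hx, hxbad⟩ := (Set.Ioo_infinite h.lt).exists_notMem_finite hbad
  have hxI := h.mem_Icc hx
  simp only [Set.mem_union, Set.mem_iUnion, Set.mem_ofPred_eq, hxI, true_and, not_or,
    not_exists] at hxbad
  obtain ⟨hx1, hx2⟩ := hxbad
  set A := D.net.curve i x with hA
  have hl0 : ∀ q ∈ Q, q ⨯₃ A ≠ 0 := by
    intro q hq
    rw [crossProduct_ne_zero_iff_linearIndependent, LinearIndependent.pair_iff' (hQ0 q hq)]
    exact fun r hr => hx2 q hq r hr
  -- the second point
  have hbad' : (⋃ q ∈ Q, {y | y ∈ Set.Icc (m : ℝ) (m + 1) ∧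
      ev (q ⨯₃ A) (D.net.curve j y) = 0}).Finite := by
    refine hQ.biUnion fun q hq => (D.net.subsingleton_zeros _ j m ?_).finite
    rintro ⟨h1, h2⟩
    obtain ⟨r, hr⟩ := exists_eq_smul_cross (D.net.nondegenerate j m h'.k_lt) h1 h2
    have h3 := ev_cross_right q A
    rw [hr, ev_smul_left] at h3
    rcases mul_eq_zero.1 h3 with h4 | h4
    · rw [h4, zero_smul] at hr
      exact hl0 q hq hr
    · exact hx1 h4
  obtain ⟨y, hy, hybad⟩ := (Set.Ioo_infinite h'.lt).exists_notMem_finite hbad'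
  have hyI := h'.mem_Icc hy
  simp only [Set.mem_iUnion, Set.mem_ofPred_eq, hyI, true_and, not_exists] at hybad
  have hTQ : ∀ q ∈ Q, ev (A ⨯₃ D.net.curve j y) q ≠ 0 := by
    intro q hq
    rw [ev_cross_cyclic]
    exact hybad q hq
  obtain ⟨-, hwa, hca⟩ := h.regular (h.point hx) rfl hx
  obtain ⟨-, hwb, hcb⟩ := h'.regular (h'.point hy) rfl hy
  exact D.exists_fingerSite_of_line (T := A ⨯₃ D.net.curve j y)
    (fun i k hk => hTQ _ (Or.inl (Set.mem_iUnion.2 ⟨i, k, hk.le, rfl⟩)))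
    (fun p hp => hTQ _ (Or.inr ⟨p, hp, rfl⟩)) D.circleAt (a₀ := h.point hx) (b₀ := h'.point hy)
    (ev_cross_left _ _) (ev_cross_right _ _) hwa hwb (by rw [hca, hcb]; exact hne)

end IsStateArc

/-! ### Nets on a line -/

theorem curve_mem_line {n : Fin 3 → ℝ}
    (hn : ∀ i, ∀ k < D.net.len i, ev n (D.net.vert i k) = 0 ∧ ev n (D.net.vert i (k + 1)) = 0)
    (p : D.net.Point) : ev n (D.net.coord p) = 0 ∧ ev n (D.net.edgeVector p.1 p.2) = 0 := by
  obtain ⟨h1, h2⟩ := hn p.1 _ (D.net.floor_lt_len p)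
  have h3 : ev n (D.net.edgeVector p.1 p.2) = 0 := by
    rw [PolygonSystem.edgeVector, ev_sub, h1, h2, sub_zero]
  exact ⟨by rw [D.net.ev_coord_eq, h1, h3, mul_zero, add_zero], h3⟩

/-- All velocities along a line are parallel, so a transversal crossing is impossible. -/
theorem not_isMultiple_of_line {n : Fin 3 → ℝ} (hn0 : ¬ (n 0 = 0 ∧ n 1 = 0))
    (hn : ∀ i, ∀ k < D.net.len i, ev n (D.net.vert i k) = 0 ∧ ev n (D.net.vert i (k + 1)) = 0)
    (p : D.net.Point) : ¬ D.net.IsMultiple p := by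
  rintro ⟨q, hqp, h⟩
  have h1 := D.transversal q p hqp h
  have h2 := D.net.ev_velocity n p
  have h3 := D.net.ev_velocity n q
  obtain ⟨a1, a2⟩ := D.curve_mem_line hn p
  obtain ⟨b1, b2⟩ := D.curve_mem_line hn q
  rw [a1, a2, zero_mul, zero_mul, sub_zero, zero_div] at h2
  rw [b1, b2, zero_mul, zero_mul, sub_zero, zero_div] at h3
  refine hn0 ⟨?_, ?_⟩
  · refine (mul_eq_zero.1 (?_ : det₂ (D.net.velocity q) (D.net.velocity p) * n 0 = 0)).resolve_left h1
    simp only [det₂]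
    linear_combination (D.net.velocity p).2 * h3 - (D.net.velocity q).2 * h2
  · refine (mul_eq_zero.1 (?_ : det₂ (D.net.velocity q) (D.net.velocity p) * n 1 = 0)).resolve_left h1
    simp only [det₂]
    linear_combination (D.net.velocity q).1 * h2 - (D.net.velocity p).1 * h3

/-- A net on a line has only one component. -/
theorem fst_eq_of_line {n : Fin 3 → ℝ} (hn0 : ¬ (n 0 = 0 ∧ n 1 = 0))
    (hn : ∀ i, ∀ k < D.net.len i, ev n (D.net.vert i k) = 0 ∧ ev n (D.net.vert i (k + 1)) = 0)
    (p q : D.net.Point) (hw : D.net.coord q 2 ≠ 0) : p.1 = q.1 := by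
  by_contra hpq
  have hinj : ∀ p q : D.net.Point, D.net.toProj p = D.net.toProj q → p = q := by
    intro p q h
    by_contra hne
    exact D.not_isMultiple_of_line hn0 hn q ⟨p, hne, h⟩
  let t : Fin 3 → ℝ := ![n 1, -n 0, 0]
  have hnt : n 0 * t 1 - n 1 * t 0 ≠ 0 := by
    have e : n 0 * t 1 - n 1 * t 0 = -(n 0 ^ 2 + n 1 ^ 2) := by
      simp [t]; ring
    rw [e]
    intro h
    exact hn0 ⟨by nlinarith [sq_nonneg (n 0), sq_nonneg (n 1)],
      by nlinarith [sq_nonneg (n 0), sq_nonneg (n 1)]⟩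
  obtain ⟨i, x₀⟩ := p
  set Q := D.net.coord q with hQ
  have hnQ : ev n Q = 0 := (D.curve_mem_line hn q).1
  -- On the line, `f` vanishes only at the point `q`. If component `i` misses `q`, then `w / f` is
  -- an injective continuous real function on it, and a circle admits none.
  let f : (Fin 3 → ℝ) → ℝ := fun V => ev t V * Q 2 - V 2 * ev t Q
  have hfc : Continuous f := by
    have := continuous_ev t
    fun_prop
  have hfs : ∀ (c : ℝ) V, f (c • V) = c * f V := by
    intro c V
    simp only [f, ev_smul, Pi.smul_apply, smul_eq_mul]
    ring
  have hf0 : ∀ p : D.net.Point, p.1 = i → f (D.net.coord p) ≠ 0 := by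
    intro p hp h0
    have h1 : D.net.coord p - (D.net.coord p 2 / Q 2) • Q = 0 := by
      refine vec_eq_zero_of_ev hnt ?_ ?_ ?_
      · rw [ev_sub, ev_smul, hnQ, (D.curve_mem_line hn p).1, mul_zero, sub_zero]
      · rw [ev_sub, ev_smul, sub_eq_zero, div_mul_eq_mul_div, eq_div_iff hw]
        exact sub_eq_zero.1 h0
      · rw [Pi.sub_apply, Pi.smul_apply, smul_eq_mul, div_mul_cancel₀ _ hw, sub_self]
    rw [sub_eq_zero] at h1
    have h2 := hinj p q ((D.net.toProj_eq_iff p q).2 ⟨_, ?_, h1⟩)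
    · exact hpq (hp.symm.trans (congrArg Sigma.fst h2))
    · intro h3
      rw [h3, zero_smul] at h1
      exact D.net.coord_ne_zero p h1
  have hlen : (0 : ℝ) < D.net.len i := by exact_mod_cast D.net.len_pos i
  let h : ℝ → ℝ := fun x => D.net.curve i x 2 / f (D.net.curve i x)
  have hfx : ∀ x ∈ Set.Icc (0 : ℝ) (D.net.len i), f (D.net.curve i x) ≠ 0 := by
    intro x hx
    rcases hx.2.lt_or_eq with h1 | h1
    · exact hf0 ⟨i, x, hx.1, h1⟩ rfl
    · rw [h1, D.net.curve_len, hfs]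
      exact mul_ne_zero (D.net.closing_ne_zero i) (hf0 (D.net.basePoint i) rfl)
  have hcont : ContinuousOn h (Set.Icc (0 : ℝ) (D.net.len i)) := by
    have hc := D.net.continuousOn_curve i (D.net.len i)
    exact ((continuous_apply 2).comp_continuousOn hc).div (hfc.comp_continuousOn hc) hfx
  have h0len : h (D.net.len i) = h 0 := by
    simp only [h]
    rw [D.net.curve_len, hfs, Pi.smul_apply, smul_eq_mul,
      mul_div_mul_left _ _ (D.net.closing_ne_zero i)]
  have hinjh : ∀ x ∈ Set.Ico (0 : ℝ) (D.net.len i), ∀ y ∈ Set.Ico (0 : ℝ) (D.net.len i),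
      h x = h y → x = y := by
    intro x hx y hy hxy
    have fx := hfx x ⟨hx.1, hx.2.le⟩
    have fy := hfx y ⟨hy.1, hy.2.le⟩
    have nx := (D.curve_mem_line hn ⟨i, x, hx⟩).1
    have ny := (D.curve_mem_line hn ⟨i, y, hy⟩).1
    change ev n (D.net.curve i x) = 0 at nx
    change ev n (D.net.curve i y) = 0 at ny
    have hxy' : D.net.curve i x 2 * f (D.net.curve i y) = D.net.curve i y 2 * f (D.net.curve i x) :=
      (div_eq_div_iff fx fy).1 hxy
    have h1 : D.net.curve i x - (f (D.net.curve i x) / f (D.net.curve i y)) • D.net.curve i y = 0 := by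
      refine vec_eq_zero_of_ev hnt ?_ ?_ ?_
      · rw [ev_sub, ev_smul, nx, ny, mul_zero, sub_zero]
      · rw [ev_sub, ev_smul, sub_eq_zero, div_mul_eq_mul_div, eq_div_iff fy]
        refine mul_right_cancel₀ hw ?_
        simp only [f] at hxy' ⊢
        linear_combination ev t Q * hxy'
      · rw [Pi.sub_apply, Pi.smul_apply, smul_eq_mul, sub_eq_zero, div_mul_eq_mul_div,
          eq_div_iff fy]
        linarith
    have h2 := hinj ⟨i, x, hx⟩ ⟨i, y, hy⟩ ((D.net.toProj_eq_iff _ _).2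
      ⟨_, div_ne_zero fx fy, sub_eq_zero.1 h1⟩)
    exact congrArg Subtype.val (eq_of_heq (Sigma.mk.inj h2).2)
  set N : ℝ := (D.net.len i : ℝ)
  have hN : N / 2 ∈ Set.Ico 0 N := ⟨by linarith, by linarith⟩
  -- The value halfway between these two is taken on both halves of the circle. Injectivity would
  -- force both parameters to be `N / 2`, where the value is a different one.
  have hne : h 0 ≠ h (N / 2) := by
    intro h1
    have := hinjh 0 ⟨le_rfl, hlen⟩ _ hN h1
    linarith
  have hmid1 : (h 0 + h (N / 2)) / 2 ∈ Set.uIcc (h 0) (h (N / 2)) := by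
    rw [Set.mem_uIcc]
    rcases le_total (h 0) (h (N / 2)) with h1 | h1
    · exact Or.inl ⟨by linarith, by linarith⟩
    · exact Or.inr ⟨by linarith, by linarith⟩
  have hmid2 : (h 0 + h (N / 2)) / 2 ∈ Set.uIcc (h (N / 2)) (h N) := by
    rw [h0len, Set.uIcc_comm]
    exact hmid1
  have hu1 : Set.uIcc 0 (N / 2) = Set.Icc 0 (N / 2) := Set.uIcc_of_le hN.1
  have hu2 : Set.uIcc (N / 2) N = Set.Icc (N / 2) N := Set.uIcc_of_le hN.2.le
  obtain ⟨x, hx, hhx⟩ := intermediate_value_uIcc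
    (hcont.mono (by rw [hu1]; exact Set.Icc_subset_Icc_right hN.2.le)) hmid1
  obtain ⟨y, hy, hhy⟩ := intermediate_value_uIcc
    (hcont.mono (by rw [hu2]; exact Set.Icc_subset_Icc_left hN.1)) hmid2
  rw [hu1] at hx
  rw [hu2] at hy
  have hyN : y < N := by
    refine lt_of_le_of_ne hy.2 ?_
    rintro rfl
    rw [h0len] at hhy
    exact hne (by linarith)
  have hxy := hinjh x ⟨hx.1, hx.2.trans_lt hN.2⟩ y ⟨hN.1.trans hy.1, hyN⟩ (hhx.trans hhy.symm)
  have hxm : x = N / 2 := le_antisymm hx.2 (hxy ▸ hy.1)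
  rw [hxm] at hhx
  exact hne (by linarith)

/-- If the all-A state has several circles, then there is a site for a finger move between
different circles. -/
theorem exists_fingerSite_of_not_subsingleton (hD : ¬ Subsingleton D.Circle) :
    ∃ (a b : D.net.Point) (Γ : FingerSite D), D.circleAt a ≠ D.circleAt b ∧
      a.1 = Γ.i₀ ∧ (a.2 : ℝ) = Γ.xa ∧ b.1 = Γ.i₁ ∧ (b.2 : ℝ) = Γ.yb := by
  by_contra hno
  have key : ∀ {c c' i k u v j m u' v'}, D.IsStateArc c i k u v → D.IsStateArc c' j m u' v' →
      c ≠ c' → ev (D.net.edgeLine j m) (D.net.vert i k) = 0 ∧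
        ev (D.net.edgeLine j m) (D.net.vert i (k + 1)) = 0 := by
    intro c c' i k u v j m u' v' h h' hne
    by_contra hline
    exact hno (h.exists_fingerSite h' hne hline)
  rw [not_subsingleton_iff_nontrivial] at hD
  obtain ⟨c, c', hne⟩ := exists_pair_ne D.Circle
  obtain ⟨i, k, u, v, hc⟩ := D.exists_isStateArc c
  obtain ⟨j, m, u', v', hc'⟩ := D.exists_isStateArc c'
  set n := D.net.edgeLine i k with hn
  -- Otherwise all edges lie on one line: the initial arc of an edge has a circle different from `c`
  -- or from `c'`, hence lies on the line of the corresponding arc, and these two lines coincide.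
  have hnv : ∀ i, ∀ k < D.net.len i, ev n (D.net.vert i k) = 0 ∧ ev n (D.net.vert i (k + 1)) = 0 := by
    intro l r hr
    have hr' : (r : ℝ) < D.net.len l := by exact_mod_cast hr
    obtain ⟨w, hw⟩ := D.exists_isStateArc_right ⟨l, r, Nat.cast_nonneg r, hr'⟩
    simp only [Nat.floor_natCast] at hw
    by_cases h : circleOf D.Crosses D.PositivePair (⟨l, r, Nat.cast_nonneg r, hr'⟩, true) = c
    · have h1 := key hw hc' (by rw [h]; exact hne)
      obtain ⟨h2, h3⟩ := key hc' hc hne.symm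
      obtain ⟨s, hs⟩ := exists_eq_smul_cross (D.net.nondegenerate j m hc'.k_lt) h2 h3
      rw [← hn] at hs
      rw [hs, ev_smul_left, ev_smul_left]
      change s * ev (D.net.edgeLine j m) _ = 0 ∧ s * ev (D.net.edgeLine j m) _ = 0
      rw [h1.1, h1.2, mul_zero]
      exact ⟨rfl, rfl⟩
    · exact key hw hc h
  have hn0 : ¬ (n 0 = 0 ∧ n 1 = 0) := by
    rintro ⟨h0, h1⟩
    have h2 := (hnv i k hc.k_lt).1
    simp only [ev, h0, h1, zero_mul, zero_add] at h2
    have h3 := (mul_eq_zero.1 h2).resolve_right (D.vert_off_infinity i k hc.k_lt.le)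
    refine D.net.edgeLine_ne_zero hc.k_lt (funext fun l => ?_)
    fin_cases l
    · exact h0
    · exact h1
    · exact h3
  have hx : (u + v) / 2 ∈ Set.Ioo u v := ⟨by linarith [hc.lt], by linarith [hc.lt]⟩
  have hy : (u' + v') / 2 ∈ Set.Ioo u' v' := ⟨by linarith [hc'.lt], by linarith [hc'.lt]⟩
  obtain ⟨-, -, h1⟩ := hc.regular (hc.point hx) rfl hx
  obtain ⟨-, hw, h2⟩ := hc'.regular (hc'.point hy) rfl hy
  have hij := D.fst_eq_of_line hn0 hnv (hc.point hx) (hc'.point hy) hw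
  have hnm := D.not_isMultiple_of_line hn0 hnv
  have hconst : ∀ {i : Fin D.net.num} (x y : Set.Ico (0 : ℝ) (D.net.len i)), x < y →
      D.circleAt ⟨i, x⟩ = D.circleAt ⟨i, y⟩ := by
    intro i x y hxy
    rw [D.circleAt_eq_of_not_isMultiple (hnm _)]
    exact D.circleOf_eq_of_between hxy fun z _ _ => hnm _
  have hconst' : ∀ p q : D.net.Point, p.1 = q.1 → D.circleAt p = D.circleAt q := by
    rintro ⟨i, x⟩ ⟨j, y⟩ hpq
    obtain rfl : i = j := hpq
    rcases lt_trichotomy x y with h | rfl | h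
    · exact hconst x y h
    · rfl
    · exact (hconst y x h).symm
  exact hne (h1.symm.trans ((hconst' _ _ hij).trans h2))

/-- A diagram whose all-A state has several circles can be replaced by a diagram of the same link
whose all-A state has fewer circles. -/
theorem exists_card_circle_lt (hD : ¬ Subsingleton D.Circle) {z : Fin D.net.num → ℝ → ℝ}
    (hz : D.IsHeight z) : ∃ (D' : Diagram) (z' : Fin D'.net.num → ℝ → ℝ), D'.IsHeight z' ∧
      AmbientIsotopic (Set.range (D.lift z)) (Set.range (D'.lift z')) ∧
      Nat.card D'.Circle < Nat.card D.Circle := by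
  obtain ⟨a, b, Γ, hne, h1, h2, h3, h4⟩ := D.exists_fingerSite_of_not_subsingleton hD
  exact Γ.exists_card_circle_lt h1 h2 h3 h4 hne hz

/-- A link with a diagram has a diagram whose all-A ribbon graph has exactly one vertex. -/
theorem exists_card_vertex_eq_one {L : Set RP3} (hL : L.Nonempty) (hD : D.IsDiagramOf L) :
    ∃ D' : Diagram, D'.IsDiagramOf L ∧ Nat.card D'.allA.Vertex = 1 := by
  generalize hN : Nat.card D.Circle = N
  induction N using Nat.strong_induction_on generalizing D with
  | _ N ih =>
    obtain ⟨z, hz, hiso⟩ := hD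
    -- This case allows zero circles too; it is non-emptiness of the link that supplies a point of
    -- the net.
    by_cases h : Subsingleton D.Circle
    · refine ⟨D, ⟨z, hz, hiso⟩, D.card_vertex_eq_one h ?_⟩
      obtain ⟨_, p, -⟩ := hiso.nonempty hL
      exact ⟨p⟩
    · obtain ⟨D', z', hz', hiso', hlt⟩ := D.exists_card_circle_lt h hz
      exact ih _ (hN ▸ hlt) D' ⟨z', hz', hiso'.symm.trans hiso⟩ rfl

end Diagram

end ProjLink

end

noncomputable section

namespace ProjLink

/-! ### Generic vectors -/

/-- A function on a vector space that is polynomial on each line. -/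
def PolyOnLines {E : Type*} [AddCommGroup E] [Module ℝ E] (f : E → ℝ) : Prop :=
  ∀ a b, ∃ P : Polynomial ℝ, ∀ t : ℝ, f (a + t • b) = P.eval t

namespace PolyOnLines

variable {E : Type*} [AddCommGroup E] [Module ℝ E] {f g : E → ℝ}

theorem linear (l : E →ₗ[ℝ] ℝ) : PolyOnLines fun x => l x := fun a b =>
  ⟨.C (l a) + .C (l b) * .X, fun t => by simp; ring⟩

theorem sub (hf : PolyOnLines f) (hg : PolyOnLines g) : PolyOnLines fun x => f x - g x := by
  intro a b
  obtain ⟨P, hP⟩ := hf a b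
  obtain ⟨Q, hQ⟩ := hg a b
  exact ⟨P - Q, fun t => by simp [hP, hQ]⟩

theorem mul (hf : PolyOnLines f) (hg : PolyOnLines g) : PolyOnLines fun x => f x * g x := by
  intro a b
  obtain ⟨P, hP⟩ := hf a b
  obtain ⟨Q, hQ⟩ := hg a b
  exact ⟨P * Q, fun t => by simp [hP, hQ]⟩

theorem det₂_left (κ : E →ₗ[ℝ] ℝ × ℝ) (v : ℝ × ℝ) : PolyOnLines fun x => det₂ (κ x) v := by
  refine fun a b => ⟨Polynomial.C (det₂ (κ a) v) + Polynomial.X * Polynomial.C (det₂ (κ b) v),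
    fun t => ?_⟩
  simp [det₂]
  ring

/-- Finitely many nonzero functions that are polynomial on lines have a common non-zero. -/
theorem exists_forall_ne_zero {S : Set (E → ℝ)} (hS : S.Finite) (hf : ∀ f ∈ S, PolyOnLines f)
    (h : ∀ f ∈ S, ∃ x, f x ≠ 0) : ∃ c, ∀ f ∈ S, f c ≠ 0 := by
  induction S, hS using Set.Finite.induction_on with
  | empty => exact ⟨0, by simp⟩
  | @insert f S _ hS ih =>
    obtain ⟨c, hc⟩ := ih (fun g hg => hf g (Or.inr hg)) fun g hg => h g (Or.inr hg)
    obtain ⟨x, hx⟩ := h f (Or.inl rfl)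
    -- On the line from `c` to `x`, each old function is nonzero at `t = 0` and the new one at `t =
    -- 1`, so all restrict to nonzero polynomials.
    have hfin : (⋃ g ∈ insert f S, {t : ℝ | g (c + t • (x - c)) = 0}).Finite := by
      refine (hS.insert f).biUnion fun g hg => ?_
      obtain ⟨P, hP⟩ := hf g hg c (x - c)
      have hP0 : P ≠ 0 := by
        rintro rfl
        simp only [Polynomial.eval_zero] at hP
        rcases hg with rfl | hg
        · exact hx (by simpa using hP 1)
        · exact hc g hg (by simpa using hP 0)
      refine (Polynomial.finite_setOfPred_isRoot hP0).subset fun t ht => ?_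
      change P.eval t = 0
      rw [← hP]
      exact ht
    obtain ⟨t, ht⟩ := hfin.exists_notMem
    refine ⟨c + t • (x - c), fun g hg h0 => ht ?_⟩
    simp only [Set.mem_iUnion]
    exact ⟨g, hg, h0⟩

end PolyOnLines

/-- The projection along a plane of a four-dimensional space. -/
theorem exists_surjective_of_linearIndependent {a b : Fin 4 → ℝ}
    (h : LinearIndependent ℝ ![a, b]) :
    ∃ κ : (Fin 4 → ℝ) →ₗ[ℝ] ℝ × ℝ, Function.Surjective κ ∧ κ a = 0 ∧ κ b = 0 := by
  let W := Submodule.span ℝ (Set.range ![a, b])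
  have hW : Module.finrank ℝ W = 2 := by simpa using finrank_span_eq_card h
  have hQ : Module.finrank ℝ ((Fin 4 → ℝ) ⧸ W) = Module.finrank ℝ (ℝ × ℝ) := by
    have := W.finrank_quotient_add_finrank
    simp [hW] at this ⊢
    omega
  let e := LinearEquiv.ofFinrankEq _ _ hQ
  have hmem : ∀ k, (![a, b] k) ∈ W := fun k => Submodule.subset_span ⟨k, rfl⟩
  refine ⟨e.toLinearMap ∘ₗ W.mkQ, e.surjective.comp W.mkQ_surjective, ?_, ?_⟩
  · have : W.mkQ a = 0 := by simpa using hmem 0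
    simp [this]
  · have : W.mkQ b = 0 := by simpa using hmem 1
    simp [this]

theorem det₂_smul_left (s : ℝ) (u v : ℝ × ℝ) : det₂ (s • u) v = s * det₂ u v := by
  simp [det₂]; ring

theorem det₂_smul_right (s : ℝ) (u v : ℝ × ℝ) : det₂ u (s • v) = s * det₂ u v := by
  simp [det₂]; ring

theorem det₂_add_left (u u' v : ℝ × ℝ) : det₂ (u + u') v = det₂ u v + det₂ u' v := by
  simp [det₂]; ring

theorem det₂_add_right (u v v' : ℝ × ℝ) : det₂ u (v + v') = det₂ u v + det₂ u v' := by
  simp [det₂]; ring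

theorem det₂_self (u : ℝ × ℝ) : det₂ u u = 0 := by
  simp [det₂]; ring

theorem exists_det₂_ne_zero {v : ℝ × ℝ} (hv : v ≠ 0) : ∃ u, det₂ u v ≠ 0 := by
  refine ⟨(v.2, -v.1), fun h => hv ?_⟩
  simp only [det₂] at h
  ext <;> simp <;> nlinarith [sq_nonneg v.1, sq_nonneg v.2]

theorem exists_combination {u v : ℝ × ℝ} (h : det₂ u v ≠ 0) (w : ℝ × ℝ) :
    ∃ s t : ℝ, s • u + t • v = w := by
  refine ⟨det₂ w v / det₂ u v, det₂ u w / det₂ u v, ?_⟩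
  ext <;> simp only [Prod.fst_add, Prod.snd_add, Prod.smul_fst, Prod.smul_snd, smul_eq_mul] <;>
    field_simp <;> simp only [det₂] <;> ring

namespace PolygonSystem

variable {d : ℕ}

/-- The edges of a polygon system. -/
abbrev Edge (F : PolygonSystem d) : Type := Σ i : Fin F.num, Fin (F.len i)

variable (F : PolygonSystem d)

/-- The first end point of an edge. -/
def tail (E : F.Edge) : Fin d → ℝ := F.vert E.1 E.2

/-- The second end point of an edge. -/
def head (E : F.Edge) : Fin d → ℝ := F.vert E.1 (E.2 + 1)

/-- The edge that contains a point. -/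
def edge (p : F.Point) : F.Edge := ⟨p.1, ⌊(p.2 : ℝ)⌋₊, F.floor_lt_len p⟩

theorem coord_eq (p : F.Point) : F.coord p =
    (1 - Int.fract (p.2 : ℝ)) • F.tail (F.edge p) + Int.fract (p.2 : ℝ) • F.head (F.edge p) := rfl

theorem edgeVector_eq (p : F.Point) :
    F.edgeVector p.1 p.2 = F.head (F.edge p) - F.tail (F.edge p) := rfl

theorem eq_of_edge_eq {p q : F.Point} (h : F.edge p = F.edge q)
    (hf : Int.fract (p.2 : ℝ) = Int.fract (q.2 : ℝ)) : p = q := by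
  obtain ⟨i, x, hx⟩ := p
  obtain ⟨j, y, hy⟩ := q
  obtain rfl : i = j := congrArg Sigma.fst h
  have hk : ⌊x⌋₊ = ⌊y⌋₊ := by
    simpa [edge] using h
  have : x = y := by
    have h1 := Int.floor_add_fract x
    have h2 := Int.floor_add_fract y
    rw [← natCast_floor_eq_intCast_floor hx.1, hk] at h1
    rw [← natCast_floor_eq_intCast_floor hy.1] at h2
    simp only at hf
    linarith
  subst this
  rfl

end PolygonSystem

namespace PolygonSystem

/-- A direction of projection `c` is generic for a polygon system, where `κ E` is the projection
along the plane of the edge `E`. -/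
structure IsGeneric (F : PolygonSystem 4) (κ : F.Edge → (Fin 4 → ℝ) →ₗ[ℝ] ℝ × ℝ)
    (c : Fin 4 → ℝ) : Prop where
  κ_tail : ∀ E, κ E (F.tail E) = 0
  κ_head : ∀ E, κ E (F.head E) = 0
  three : c 3 ≠ 0
  -- Stronger than `κ E c ≠ 0`, but a single linear condition; it puts `c` outside the plane of each
  -- edge.
  fst : ∀ E, (κ E c).1 ≠ 0
  tail : ∀ E E', κ E (F.tail E') ≠ 0 → det₂ (κ E c) (κ E (F.tail E')) ≠ 0
  head : ∀ E E', κ E (F.head E') ≠ 0 → det₂ (κ E c) (κ E (F.head E')) ≠ 0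
  -- This excludes triple points: a point of `E₃` aligned with points of both `E₁` and `E₂` would
  -- solve a linear system with this determinant.
  triple : ∀ E₁ E₂ E₃, det₂ (κ E₂ (F.tail E₁)) (κ E₂ (F.head E₁)) ≠ 0 →
    det₂ (κ E₁ (F.tail E₃)) (κ E₁ (F.head E₃)) ≠ 0 →
    det₂ (κ E₂ (F.tail E₃)) (κ E₂ (F.head E₃)) ≠ 0 →
    det₂ (κ E₁ c) (κ E₁ (F.tail E₃)) * det₂ (κ E₂ c) (κ E₂ (F.head E₃)) -
      det₂ (κ E₁ c) (κ E₁ (F.head E₃)) * det₂ (κ E₂ c) (κ E₂ (F.tail E₃)) ≠ 0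

/-- Each condition is the nonvanishing of a function that is polynomial on lines, and there are
finitely many. It remains to find, for each, one vector where it does not vanish. -/
theorem exists_isGeneric (F : PolygonSystem 4) : ∃ κ c, F.IsGeneric κ c := by
  have h : ∀ E : F.Edge, ∃ κ : (Fin 4 → ℝ) →ₗ[ℝ] ℝ × ℝ, Function.Surjective κ ∧
      κ (F.tail E) = 0 ∧ κ (F.head E) = 0 := fun E =>
    exists_surjective_of_linearIndependent (F.nondegenerate E.1 E.2 E.2.2)
  choose κ hκ ht hh using h
  let S₀ : Set ((Fin 4 → ℝ) → ℝ) := {fun c => c 3}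
  let S₁ : Set ((Fin 4 → ℝ) → ℝ) := Set.range fun E c => (κ E c).1
  let S₂ : Set ((Fin 4 → ℝ) → ℝ) :=
    (fun p : F.Edge × F.Edge => fun c => det₂ (κ p.1 c) (κ p.1 (F.tail p.2))) ''
      {p | κ p.1 (F.tail p.2) ≠ 0}
  let S₃ : Set ((Fin 4 → ℝ) → ℝ) :=
    (fun p : F.Edge × F.Edge => fun c => det₂ (κ p.1 c) (κ p.1 (F.head p.2))) ''
      {p | κ p.1 (F.head p.2) ≠ 0}
  let S₄ : Set ((Fin 4 → ℝ) → ℝ) :=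
    (fun p : F.Edge × F.Edge × F.Edge => fun c =>
      det₂ (κ p.1 c) (κ p.1 (F.tail p.2.2)) * det₂ (κ p.2.1 c) (κ p.2.1 (F.head p.2.2)) -
      det₂ (κ p.1 c) (κ p.1 (F.head p.2.2)) * det₂ (κ p.2.1 c) (κ p.2.1 (F.tail p.2.2))) ''
      {p | det₂ (κ p.2.1 (F.tail p.1)) (κ p.2.1 (F.head p.1)) ≠ 0 ∧
        det₂ (κ p.1 (F.tail p.2.2)) (κ p.1 (F.head p.2.2)) ≠ 0 ∧
        det₂ (κ p.2.1 (F.tail p.2.2)) (κ p.2.1 (F.head p.2.2)) ≠ 0}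
  have hfin : (S₀ ∪ (S₁ ∪ (S₂ ∪ (S₃ ∪ S₄)))).Finite :=
    (Set.finite_singleton _).union <| (Set.finite_range _).union <|
      ((Set.toFinite _).image _).union <| ((Set.toFinite _).image _).union <|
      (Set.toFinite _).image _
  have hpoly : ∀ f ∈ S₀ ∪ (S₁ ∪ (S₂ ∪ (S₃ ∪ S₄))), PolyOnLines f := by
    rintro f (rfl | ⟨E, rfl⟩ | ⟨p, -, rfl⟩ | ⟨p, -, rfl⟩ | ⟨p, -, rfl⟩)
    · exact .linear (LinearMap.proj (R := ℝ) (φ := fun _ : Fin 4 => ℝ) 3)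
    · exact .linear (LinearMap.fst ℝ ℝ ℝ ∘ₗ κ E)
    · exact .det₂_left _ _
    · exact .det₂_left _ _
    · exact .sub (.mul (.det₂_left _ _) (.det₂_left _ _)) (.mul (.det₂_left _ _) (.det₂_left _ _))
  have hne : ∀ f ∈ S₀ ∪ (S₁ ∪ (S₂ ∪ (S₃ ∪ S₄))), ∃ x, f x ≠ 0 := by
    rintro f (rfl | ⟨E, rfl⟩ | ⟨p, hp, rfl⟩ | ⟨p, hp, rfl⟩ | ⟨⟨E₁, E₂, E₃⟩, ⟨h1, h2, h3⟩, rfl⟩)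
    · exact ⟨fun _ => 1, one_ne_zero⟩
    · obtain ⟨x, hx⟩ := hκ E (1, 0)
      exact ⟨x, by simp [hx]⟩
    · obtain ⟨u, hu⟩ := exists_det₂_ne_zero hp
      obtain ⟨x, rfl⟩ := hκ p.1 u
      exact ⟨x, hu⟩
    · obtain ⟨u, hu⟩ := exists_det₂_ne_zero hp
      obtain ⟨x, rfl⟩ := hκ p.1 u
      exact ⟨x, hu⟩
    -- The planes of `E₁` and `E₂` are complementary, so a vector can look like the tail of `E₃`
    -- modulo the first and like its head modulo the second. This kills one product and keeps the
    -- other.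
    · obtain ⟨s, t, hst⟩ := exists_combination h1 (κ E₂ (F.head E₃) - κ E₂ (F.tail E₃))
      refine ⟨F.tail E₃ + (s • F.tail E₁ + t • F.head E₁), ?_⟩
      have e1 : κ E₁ (F.tail E₃ + (s • F.tail E₁ + t • F.head E₁)) = κ E₁ (F.tail E₃) := by
        simp [ht, hh]
      have e2 : κ E₂ (F.tail E₃ + (s • F.tail E₁ + t • F.head E₁)) = κ E₂ (F.head E₃) := by
        rw [map_add, map_add, map_smul, map_smul, hst]
        abel
      simp only [e1, e2, det₂_self, zero_mul, zero_sub, neg_ne_zero]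
      rw [det₂_swap (κ E₂ (F.tail E₃))]
      exact mul_ne_zero h2 (neg_ne_zero.2 h3)
  obtain ⟨c, hc⟩ := PolyOnLines.exists_forall_ne_zero hfin hpoly hne
  refine ⟨κ, c, ht, hh, hc _ (Or.inl rfl), fun E => hc _ (Or.inr (Or.inl ⟨E, rfl⟩)),
    fun E E' h => hc _ (Or.inr (Or.inr (Or.inl ⟨(E, E'), h, rfl⟩))),
    fun E E' h => hc _ (Or.inr (Or.inr (Or.inr (Or.inl ⟨(E, E'), h, rfl⟩)))),
    fun E₁ E₂ E₃ h1 h2 h3 =>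
      hc _ (Or.inr (Or.inr (Or.inr (Or.inr ⟨(E₁, E₂, E₃), ⟨h1, h2, h3⟩, rfl⟩))))⟩

/-- The points of the line of `p` that are projected to the line of `q`, along `c`. -/
def Aligned (F : PolygonSystem 4) (c : Fin 4 → ℝ) (p q : F.Point) : Prop :=
  ∃ r s : ℝ, r ≠ 0 ∧ F.coord p = r • F.coord q + s • c

theorem Aligned.symm {F : PolygonSystem 4} {c : Fin 4 → ℝ} {p q : F.Point}
    (h : F.Aligned c p q) : F.Aligned c q p := by
  obtain ⟨r, s, hr, h⟩ := h
  refine ⟨r⁻¹, -(r⁻¹ * s), inv_ne_zero hr, ?_⟩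
  rw [h, smul_add, smul_smul, inv_mul_cancel₀ hr]
  module

theorem Aligned.trans {F : PolygonSystem 4} {c : Fin 4 → ℝ} {p q q' : F.Point}
    (h : F.Aligned c p q) (h' : F.Aligned c q q') : F.Aligned c p q' := by
  obtain ⟨r, s, hr, h⟩ := h
  obtain ⟨r', s', hr', h'⟩ := h'
  refine ⟨r * r', r * s' + s, mul_ne_zero hr hr', ?_⟩
  rw [h, h']
  module

theorem det₂_combination (u v : ℝ × ℝ) (a b a' b' : ℝ) :
    det₂ (a • u + b • v) (a' • u + b' • v) = (a * b' - b * a') * det₂ u v := by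
  simp [det₂]; ring

namespace IsGeneric

variable {F : PolygonSystem 4} {κ : F.Edge → (Fin 4 → ℝ) →ₗ[ℝ] ℝ × ℝ} {c : Fin 4 → ℝ}

theorem ne_zero (H : F.IsGeneric κ c) (E : F.Edge) : κ E c ≠ 0 := fun h => H.fst E (by simp [h])

theorem κ_coord_self (H : F.IsGeneric κ c) (p : F.Point) : κ (F.edge p) (F.coord p) = 0 := by
  simp [F.coord_eq, H.κ_tail, H.κ_head]

theorem κ_edgeVector_self (H : F.IsGeneric κ c) (p : F.Point) :
    κ (F.edge p) (F.edgeVector p.1 p.2) = 0 := by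
  simp [F.edgeVector_eq, H.κ_tail, H.κ_head]

/-- Modulo the plane of the edge of `q`, alignment says that `p` is parallel to `c`. The factor is
nonzero because the link has no self-intersections. -/
theorem exists_κ_coord (H : F.IsGeneric κ c) (hF : Function.Injective F.toProj) {p q : F.Point}
    (hpq : p ≠ q) (h : F.Aligned c p q) :
    ∃ s : ℝ, s ≠ 0 ∧ κ (F.edge q) (F.coord p) = s • κ (F.edge q) c := by
  obtain ⟨r, s, hr, h⟩ := h
  refine ⟨s, ?_, by simp [h, H.κ_coord_self]⟩
  rintro rfl
  exact hpq (hF ((F.toProj_eq_iff p q).2 ⟨r, hr, by simpa using h⟩))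

theorem fract_ne_zero (H : F.IsGeneric κ c) (hF : Function.Injective F.toProj) {p q : F.Point}
    (hpq : p ≠ q) (h : F.Aligned c p q) : Int.fract (p.2 : ℝ) ≠ 0 := by
  intro hf
  obtain ⟨s, hs, h⟩ := H.exists_κ_coord hF hpq h
  have hp : F.coord p = F.tail (F.edge p) := by simp [F.coord_eq, hf]
  rw [hp] at h
  have h0 : κ (F.edge q) (F.tail (F.edge p)) ≠ 0 := by
    rw [h]
    exact smul_ne_zero hs (H.ne_zero _)
  apply H.tail _ _ h0
  rw [h, det₂_smul_right, det₂_self, mul_zero]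

/-- Edges that cross in the projection have complementary planes. Otherwise the image of the edge of
`p` modulo that of `q` would be one line, containing `κ c`, and a vertex with nonzero image would
violate genericity. -/
theorem det₂_ne_zero (H : F.IsGeneric κ c) (hF : Function.Injective F.toProj) {p q : F.Point}
    (hpq : p ≠ q) (h : F.Aligned c p q) :
    det₂ (κ (F.edge q) (F.tail (F.edge p))) (κ (F.edge q) (F.head (F.edge p))) ≠ 0 := by
  obtain ⟨s, hs, h⟩ := H.exists_κ_coord hF hpq h
  intro h0
  rw [F.coord_eq, map_add, map_smul, map_smul] at h
  by_cases ht : κ (F.edge q) (F.tail (F.edge p)) = 0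
  · by_cases hh : κ (F.edge q) (F.head (F.edge p)) = 0
    · rw [ht, hh] at h
      simp only [smul_zero, add_zero] at h
      exact smul_ne_zero hs (H.ne_zero _) h.symm
    · refine mul_ne_zero hs (H.head _ _ hh) ?_
      rw [← det₂_smul_left, ← h, ht, smul_zero, zero_add, det₂_smul_left, det₂_self, mul_zero]
  · refine mul_ne_zero hs (H.tail _ _ ht) ?_
    rw [← det₂_smul_left, ← h, det₂_add_left, det₂_smul_left, det₂_smul_left, det₂_self,
      det₂_swap (κ (F.edge q) (F.tail (F.edge p))), h0]
    ring

/-- The linear form of transversality: reduction modulo the plane of the edge of `q` removes the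
second term, and pairing with the image of `p` removes the right-hand side. -/
theorem eq_zero_of_combination (H : F.IsGeneric κ c) (hF : Function.Injective F.toProj)
    {p q : F.Point} (hpq : p ≠ q) (h : F.Aligned c p q) {α β x y t : ℝ}
    (he : α • (F.edgeVector p.1 p.2 - x • F.coord p) + β • (F.edgeVector q.1 q.2 - y • F.coord q) =
      t • c) : α = 0 := by
  obtain ⟨s, hs, h'⟩ := H.exists_κ_coord hF hpq h
  have h1 := congrArg (κ (F.edge q)) he
  rw [map_add, map_smul, map_smul, map_sub, map_sub, map_smul, map_smul, map_smul,
    H.κ_coord_self, H.κ_edgeVector_self, smul_zero, sub_zero, smul_zero, add_zero] at h1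
  have h2 : det₂ (κ (F.edge q) (F.coord p)) (κ (F.edge q) (F.edgeVector p.1 p.2)) =
      det₂ (κ (F.edge q) (F.tail (F.edge p))) (κ (F.edge q) (F.head (F.edge p))) := by
    have e1 : κ (F.edge q) (F.edgeVector p.1 p.2) = (-1 : ℝ) • κ (F.edge q) (F.tail (F.edge p)) +
        (1 : ℝ) • κ (F.edge q) (F.head (F.edge p)) := by
      rw [F.edgeVector_eq, map_sub]
      module
    rw [e1, F.coord_eq, map_add, map_smul, map_smul, det₂_combination]
    ring
  have h3 : det₂ (κ (F.edge q) (F.coord p)) (κ (F.edge q) c) = 0 := by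
    rw [h', det₂_smul_left, det₂_self, mul_zero]
  have h4 := congrArg (det₂ (κ (F.edge q) (F.coord p))) h1
  rw [det₂_smul_right, det₂_smul_right, h3, sub_eq_add_neg, ← neg_smul, det₂_add_right,
    det₂_smul_right, det₂_self, h2] at h4
  simpa [H.det₂_ne_zero hF hpq h] using h4

theorem eq_of_edge_eq (H : F.IsGeneric κ c) (hF : Function.Injective F.toProj)
    {p q p' q' : F.Point} (hpq : p ≠ q) (h : F.Aligned c p q) (hpq' : p' ≠ q')
    (h' : F.Aligned c p' q') (hp : F.edge p = F.edge p') (hq : F.edge q = F.edge q') : p = p' := by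
  obtain ⟨s, hs, h1⟩ := H.exists_κ_coord hF hpq h
  obtain ⟨s', hs', h2⟩ := H.exists_κ_coord hF hpq' h'
  have h3 : det₂ (κ (F.edge q) (F.coord p)) (κ (F.edge q) (F.coord p')) = 0 := by
    rw [h1, hq, h2, det₂_smul_left, det₂_smul_right, det₂_self, mul_zero, mul_zero]
  rw [F.coord_eq, F.coord_eq, ← hp, map_add, map_add, map_smul, map_smul, map_smul, map_smul,
    det₂_combination] at h3
  apply F.eq_of_edge_eq hp
  have h4 := (mul_eq_zero.1 h3).resolve_right (H.det₂_ne_zero hF hpq h)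
  linarith

/-- The weights `1 - fract` and `fract` of `p` on its edge solve two homogeneous equations whose
determinant is the one in `triple`; but their sum is `1`. -/
theorem not_triple (H : F.IsGeneric κ c) (hF : Function.Injective F.toProj) {p q q' : F.Point}
    (hq : q ≠ p) (hq' : q' ≠ p) (h : F.Aligned c q p) (h' : F.Aligned c q' p) : q = q' := by
  by_contra hne
  obtain ⟨s, hs, h1⟩ := H.exists_κ_coord hF hq.symm h.symm
  obtain ⟨s', hs', h2⟩ := H.exists_κ_coord hF hq'.symm h'.symm
  have h3 := H.triple (F.edge q) (F.edge q') (F.edge p)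
    (H.det₂_ne_zero hF hne (h.trans h'.symm)) (H.det₂_ne_zero hF hq.symm h.symm)
    (H.det₂_ne_zero hF hq'.symm h'.symm)
  have h4 : ∀ E (s : ℝ), κ E (F.coord p) = s • κ E c →
      (1 - Int.fract (p.2 : ℝ)) * det₂ (κ E c) (κ E (F.tail (F.edge p))) +
        Int.fract (p.2 : ℝ) * det₂ (κ E c) (κ E (F.head (F.edge p))) = 0 := by
    intro E s h
    have h5 := congrArg (det₂ (κ E c)) h
    rwa [F.coord_eq, map_add, map_smul, map_smul, det₂_add_right, det₂_smul_right,
      det₂_smul_right, det₂_smul_right, det₂_self, mul_zero] at h5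
  have h5 := h4 _ _ h1
  have h6 := h4 _ _ h2
  apply h3
  linear_combination (det₂ (κ (F.edge q') c) (κ (F.edge q') (F.head (F.edge p))) -
    det₂ (κ (F.edge q') c) (κ (F.edge q') (F.tail (F.edge p)))) * h5 -
    (det₂ (κ (F.edge q) c) (κ (F.edge q) (F.head (F.edge p))) -
    det₂ (κ (F.edge q) c) (κ (F.edge q) (F.tail (F.edge p)))) * h6

/-- A crossing is determined by its pair of edges, and there are finitely many pairs. -/
theorem finite_aligned (H : F.IsGeneric κ c) (hF : Function.Injective F.toProj) :
    {p | ∃ q, q ≠ p ∧ F.Aligned c q p}.Finite := by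
  choose! o ho using fun (p : F.Point) (h : ∃ q, q ≠ p ∧ F.Aligned c q p) => h
  refine Set.Finite.of_injOn (f := fun p => (F.edge p, F.edge (o p))) (t := Set.univ)
    (fun _ _ => Set.mem_univ _) ?_ Set.finite_univ
  intro p hp p' hp' he
  exact H.eq_of_edge_eq hF (ho p hp).1.symm (ho p hp).2.symm (ho p' hp').1.symm (ho p' hp').2.symm
    (congrArg Prod.fst he) (congrArg Prod.snd he)

end IsGeneric

end PolygonSystem

end ProjLink

end

noncomputable section

namespace ProjLink

/-! ### Diagrams of polygonal links -/

/-- The projection of `ℝ⁴` to `ℝ³` along `c`, followed by a shear that depends on `s`. -/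
def projAlong (c : Fin 4 → ℝ) (s : ℝ) : (Fin 4 → ℝ) →ₗ[ℝ] (Fin 3 → ℝ) where
  toFun V := ![V 0 - c 0 / c 3 * V 3, V 1 - c 1 / c 3 * V 3,
    V 2 - c 2 / c 3 * V 3 + s * (V 0 - c 0 / c 3 * V 3) + s ^ 2 * (V 1 - c 1 / c 3 * V 3)]
  map_add' V W := by
    ext k
    fin_cases k <;> simp <;> ring
  map_smul' t V := by
    ext k
    fin_cases k <;> simp <;> ring

theorem projAlong_self {c : Fin 4 → ℝ} (hc : c 3 ≠ 0) (s : ℝ) : projAlong c s c = 0 := by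
  ext k
  fin_cases k <;> simp [projAlong, hc]

theorem exists_eq_smul_of_projAlong_eq_zero {c : Fin 4 → ℝ} (hc : c 3 ≠ 0) {s : ℝ}
    {V : Fin 4 → ℝ} (h : projAlong c s V = 0) : ∃ t : ℝ, V = t • c := by
  have h0 : V 0 - c 0 / c 3 * V 3 = 0 := congrFun h 0
  have h1 : V 1 - c 1 / c 3 * V 3 = 0 := congrFun h 1
  have h2 : V 2 - c 2 / c 3 * V 3 + s * (V 0 - c 0 / c 3 * V 3) +
    s ^ 2 * (V 1 - c 1 / c 3 * V 3) = 0 := congrFun h 2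
  rw [h0, h1, mul_zero, mul_zero, add_zero, add_zero] at h2
  refine ⟨V 3 / c 3, funext fun k => ?_⟩
  fin_cases k <;> simp
  · linear_combination h0
  · linear_combination h1
  · linear_combination h2
  · field_simp

/-- Chooses the line at infinity: the weight is a quadratic polynomial in `s` whose coefficients are
the coordinates of the projected vector, so it is nonzero unless `V` is projected to zero. -/
theorem exists_projAlong_two_ne_zero {c : Fin 4 → ℝ} (hc : c 3 ≠ 0) {N : Set (Fin 4 → ℝ)}
    (hN : N.Finite) (h : ∀ V ∈ N, ∀ t : ℝ, V ≠ t • c) :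
    ∃ s, ∀ V ∈ N, projAlong c s V 2 ≠ 0 := by
  obtain ⟨s, hs⟩ := PolyOnLines.exists_forall_ne_zero
    (S := (fun V s => projAlong c s V 2) '' N) (hN.image _) (by
      rintro _ ⟨V, -, rfl⟩ a b
      refine ⟨.C (V 2 - c 2 / c 3 * V 3) +
        (.C a + .X * .C b) * .C (V 0 - c 0 / c 3 * V 3) +
        (.C a + .X * .C b) ^ 2 * .C (V 1 - c 1 / c 3 * V 3), fun t => ?_⟩
      simp [projAlong]
      ring) (by
      rintro _ ⟨V, hV, rfl⟩
      by_contra! h0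
      have e : ∀ s, V 2 - c 2 / c 3 * V 3 + s * (V 0 - c 0 / c 3 * V 3) +
        s ^ 2 * (V 1 - c 1 / c 3 * V 3) = 0 := h0
      have e0 := e 0
      have e1 := e 1
      have e2 := e (-1)
      obtain ⟨t, ht⟩ := exists_eq_smul_of_projAlong_eq_zero hc (s := 0) (V := V) (by
        ext k
        fin_cases k
        · change V 0 - c 0 / c 3 * V 3 = 0
          linear_combination (e1 - e2) / 2
        · change V 1 - c 1 / c 3 * V 3 = 0
          linear_combination (e1 + e2) / 2 - e0
        · exact e0)
      exact h V hV t ht)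
  exact ⟨s, fun V hV => hs _ ⟨V, hV, rfl⟩⟩

namespace PolygonSystem

variable {F : PolygonSystem 4} {κ : F.Edge → (Fin 4 → ℝ) →ₗ[ℝ] ℝ × ℝ} {c : Fin 4 → ℝ}

theorem IsGeneric.eq_zero_of_κ_eq_zero (H : F.IsGeneric κ c) {E : F.Edge} {V : Fin 4 → ℝ}
    (hV : κ E V = 0) {t : ℝ} (h : V = t • c) : V = 0 := by
  rw [h, map_smul] at hV
  rw [h, (smul_eq_zero.1 hV).resolve_right (H.ne_zero E), zero_smul]

theorem tail_ne_zero (F : PolygonSystem 4) (E : F.Edge) : F.tail E ≠ 0 :=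
  (F.nondegenerate E.1 E.2 E.2.2).ne_zero 0

theorem IsGeneric.linearIndependent (H : F.IsGeneric κ c) (s : ℝ) (i : Fin F.num) (k : ℕ)
    (hk : k < F.len i) :
    LinearIndependent ℝ ![projAlong c s (F.vert i k), projAlong c s (F.vert i (k + 1))] := by
  rw [LinearIndependent.pair_iff]
  intro a b h
  rw [← map_smul, ← map_smul, ← map_add] at h
  obtain ⟨t, ht⟩ := exists_eq_smul_of_projAlong_eq_zero H.three h
  refine LinearIndependent.pair_iff.1 (F.nondegenerate i k hk) a b
    (H.eq_zero_of_κ_eq_zero (E := ⟨i, k, hk⟩) ?_ ht)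
  have h1 : κ ⟨i, k, hk⟩ (F.vert i k) = 0 := H.κ_tail ⟨i, k, hk⟩
  have h2 : κ ⟨i, k, hk⟩ (F.vert i (k + 1)) = 0 := H.κ_head ⟨i, k, hk⟩
  simp [h1, h2]

/-- The projection of a polygonal link along a generic direction. -/
abbrev IsGeneric.net (H : F.IsGeneric κ c) (s : ℝ) : PolygonSystem 3 :=
  F.map (projAlong c s) (H.linearIndependent s)

namespace IsGeneric

variable (H : F.IsGeneric κ c) (s : ℝ)

theorem coord_net (p : F.Point) : (H.net s).coord p = projAlong c s (F.coord p) := by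
  simp [coord, curve]

theorem edgeVector_net (i : Fin F.num) (x : ℝ) :
    (H.net s).edgeVector i x = projAlong c s (F.edgeVector i x) := by
  simp [edgeVector]

theorem toProj_net_eq_iff (p q : F.Point) :
    (H.net s).toProj p = (H.net s).toProj q ↔ F.Aligned c p q := by
  rw [toProj_eq_iff]
  simp only [H.coord_net s]
  constructor
  · rintro ⟨r, hr, h⟩
    obtain ⟨t, ht⟩ := exists_eq_smul_of_projAlong_eq_zero H.three (s := s)
      (V := F.coord p - r • F.coord q) (by rw [map_sub, map_smul, h, sub_self])
    exact ⟨r, t, hr, by rw [← ht]; abel⟩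
  · rintro ⟨r, t, hr, h⟩
    exact ⟨r, hr, by rw [h, map_add, map_smul, map_smul, projAlong_self H.three]; simp⟩

theorem isMultiple_net_iff (p : F.Point) :
    (H.net s).IsMultiple p ↔ ∃ q, q ≠ p ∧ F.Aligned c q p := by
  simp only [IsMultiple, ← H.toProj_net_eq_iff s]

theorem exists_height_ne_zero (hF : Function.Injective F.toProj) :
    ∃ s, (∀ i, ∀ k ≤ F.len i, (H.net s).vert i k 2 ≠ 0) ∧
      ∀ p, (H.net s).IsMultiple p → (H.net s).coord p 2 ≠ 0 := by
  obtain ⟨s, hs⟩ := exists_projAlong_two_ne_zero H.three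
    (N := Set.range F.tail ∪ F.coord '' {p | ∃ q, q ≠ p ∧ F.Aligned c q p})
    ((Set.finite_range _).union ((H.finite_aligned hF).image _)) (by
      rintro V (⟨E, rfl⟩ | ⟨p, -, rfl⟩) t ht
      · exact F.tail_ne_zero E (H.eq_zero_of_κ_eq_zero (H.κ_tail E) ht)
      · exact F.coord_ne_zero p (H.eq_zero_of_κ_eq_zero (H.κ_coord_self p) ht))
  have hv : ∀ i, ∀ k < F.len i, (H.net s).vert i k 2 ≠ 0 := fun i k hk =>
    hs _ (Or.inl ⟨⟨i, k, hk⟩, rfl⟩)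
  refine ⟨s, fun i k hk => ?_, fun p hp => ?_⟩
  · rcases hk.lt_or_eq with h | rfl
    · exact hv i k h
    · rw [(H.net s).closed i]
      exact mul_ne_zero (F.closing_ne_zero i) (hv i 0 (F.len_pos i))
  · rw [H.coord_net s p]
    exact hs _ (Or.inr ⟨p, (H.isMultiple_net_iff s p).1 hp, rfl⟩)

/-- A linear relation between the affine velocities lifts to `ℝ⁴` up to a multiple of `c`, which is
the situation of `eq_zero_of_combination`. -/
theorem eq_zero_of_velocity (hF : Function.Injective F.toProj) {p q : F.Point} (hpq : p ≠ q)
    (h : F.Aligned c p q) (hp : (H.net s).coord p 2 ≠ 0) (hq : (H.net s).coord q 2 ≠ 0) {α β : ℝ}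
    (h1 : α * ((H.net s).velocity p).1 + β * ((H.net s).velocity q).1 = 0)
    (h2 : α * ((H.net s).velocity p).2 + β * ((H.net s).velocity q).2 = 0) : α = 0 := by
  simp only [velocity, edgeVector_net, coord_net] at h1 h2 hp hq
  set P := projAlong c s (F.coord p) with hP
  set Q := projAlong c s (F.coord q) with hQ
  set e := projAlong c s (F.edgeVector p.1 p.2) with he
  set e' := projAlong c s (F.edgeVector q.1 q.2) with he'
  obtain ⟨t, ht⟩ := exists_eq_smul_of_projAlong_eq_zero H.three (s := s)
    (V := (α / P 2) • (F.edgeVector p.1 p.2 - (e 2 / P 2) • F.coord p) +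
      (β / Q 2) • (F.edgeVector q.1 q.2 - (e' 2 / Q 2) • F.coord q)) (by
    rw [map_add, map_smul, map_smul, map_sub, map_sub, map_smul, map_smul, ← hP, ← hQ, ← he, ← he']
    ext k
    fin_cases k
    · simp
      rw [← h1]
      field_simp
    · simp
      rw [← h2]
      field_simp
    · simp [hp, hq])
  have := H.eq_zero_of_combination hF hpq h ht
  exact (div_eq_zero_iff.1 this).resolve_right hp

theorem det₂_velocity_ne_zero (hF : Function.Injective F.toProj) {p q : F.Point} (hpq : p ≠ q)
    (h : F.Aligned c p q) (hp : (H.net s).coord p 2 ≠ 0) (hq : (H.net s).coord q 2 ≠ 0) :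
    det₂ ((H.net s).velocity p) ((H.net s).velocity q) ≠ 0 := by
  intro h0
  rw [det₂] at h0
  have h1 : ((H.net s).velocity q).1 = 0 := H.eq_zero_of_velocity s hF hpq h hp hq
    (β := -((H.net s).velocity p).1) (by ring) (by linear_combination -h0)
  have h2 : ((H.net s).velocity q).2 = 0 := H.eq_zero_of_velocity s hF hpq h hp hq
    (β := -((H.net s).velocity p).2) (by linear_combination h0) (by ring)
  exact one_ne_zero (H.eq_zero_of_velocity s hF hpq.symm h.symm hq hp (α := 1) (β := 0)
    (by rw [h1]; ring) (by rw [h2]; ring))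

/-- The height of a point over the projective plane. -/
def height (p : F.Point) : ℝ := F.coord p 3 / (H.net s).coord p 2

/-- Aligned representatives differ by a multiple of `c`, nonzero as the link is embedded; this
changes the last coordinate because `c 3 ≠ 0`. -/
theorem height_ne (hF : Function.Injective F.toProj) {p q : F.Point} (hpq : p ≠ q)
    (h : F.Aligned c p q) (hq : (H.net s).coord q 2 ≠ 0) : H.height s p ≠ H.height s q := by
  obtain ⟨r, t, hr, h⟩ := h
  have ht : t ≠ 0 := by
    rintro rfl
    exact hpq (hF ((F.toProj_eq_iff p q).2 ⟨r, hr, by simpa using h⟩))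
  have h1 : (H.net s).coord p = r • (H.net s).coord q := by
    rw [H.coord_net s, H.coord_net s, h, map_add, map_smul, map_smul, projAlong_self H.three]
    simp
  simp only [height, h1, h, Pi.add_apply, Pi.smul_apply, smul_eq_mul]
  rw [Ne, div_eq_div_iff (mul_ne_zero hr hq) hq]
  intro h2
  refine mul_ne_zero (mul_ne_zero ht H.three) hq ?_
  linear_combination h2

/-- The diagram of a polygonal link that is given by a generic projection. -/
abbrev diagram (hF : Function.Injective F.toProj)
    (hv : ∀ i, ∀ k ≤ F.len i, (H.net s).vert i k 2 ≠ 0)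
    (hm : ∀ p, (H.net s).IsMultiple p → (H.net s).coord p 2 ≠ 0) : Diagram where
  net := H.net s
  vert_off_infinity := hv
  finite_multiple := (H.finite_aligned hF).subset fun p hp => (H.isMultiple_net_iff s p).1 hp
  interior p hp := by
    obtain ⟨q, hq, h⟩ := (H.isMultiple_net_iff s p).1 hp
    exact ⟨H.fract_ne_zero hF hq.symm h.symm, hm p hp⟩
  transversal p q hpq h := H.det₂_velocity_ne_zero s hF hpq ((H.toProj_net_eq_iff s p q).1 h)
    (hm p ⟨q, hpq.symm, h.symm⟩) (hm q ⟨p, hpq, h⟩)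
  double p q r hq hr h h' := H.not_triple hF hq hr ((H.toProj_net_eq_iff s q p).1 h)
    ((H.toProj_net_eq_iff s r p).1 h')
  isOver p := ∃ q, q ≠ p ∧ (H.net s).toProj q = (H.net s).toProj p ∧ H.height s q < H.height s p
  isOver_iff p q hpq h := by
    have hne := H.height_ne s hF hpq ((H.toProj_net_eq_iff s p q).1 h) (hm q ⟨p, hpq, h⟩)
    constructor
    · rintro ⟨r, hr, hrp, hlt⟩ ⟨r', hr', hrq, hlt'⟩
      obtain rfl : r = q := H.not_triple hF hr hpq.symm ((H.toProj_net_eq_iff s r p).1 hrp)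
        ((H.toProj_net_eq_iff s q p).1 h.symm)
      obtain rfl : r' = p := H.not_triple hF hr' hpq ((H.toProj_net_eq_iff s r' r).1 hrq)
        ((H.toProj_net_eq_iff s p r).1 h)
      exact lt_asymm hlt hlt'
    · intro h'
      refine ⟨q, hpq.symm, h.symm, hne.symm.lt_of_le (not_lt.1 fun hlt => h' ⟨p, hpq, h, hlt⟩)⟩

theorem isDiagramOf_diagram (hF : Function.Injective F.toProj)
    (hv : ∀ i, ∀ k ≤ F.len i, (H.net s).vert i k 2 ≠ 0)
    (hm : ∀ p, (H.net s).IsMultiple p → (H.net s).coord p 2 ≠ 0) :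
    (H.diagram s hF hv hm).IsDiagramOf (Set.range F.toProj) := by
  refine ⟨fun i x => F.curve i x 3, ⟨fun i => ?_, fun i => ?_, ?_⟩, AmbientIsotopic.symm ?_⟩
  · exact (continuous_apply 3).comp_continuousOn (F.continuousOn_curve i (F.len i))
  · simp [F.curve_len]
  · rintro p q hpq h ⟨r, hr, hrp, hlt⟩
    obtain rfl : r = q := H.not_triple hF hr hpq.symm ((H.toProj_net_eq_iff s r p).1 hrp)
        ((H.toProj_net_eq_iff s q p).1 h.symm)
    exact hlt
  -- The first shear turns the direction `c` into the vertical one and the second adjusts the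
  -- weight. Both keep the last coordinate, so the result is exactly the lift with that coordinate
  -- as height.
  · let u : Fin 4 → ℝ := ![c 0 / c 3, c 1 / c 3, c 2 / c 3, 0]
    let v : Fin 4 → ℝ := ![0, 0, 1, 0]
    let R : F.Point → Fin 4 → ℝ := fun p => F.coord p + (-F.coord p 3) • u
    let D := H.diagram s hF hv hm
    have hRD : ∀ p, D.liftCoord (fun i x => F.curve i x 3) p =
        R p + (s * R p 0 + s ^ 2 * R p 1) • v := by
      intro p
      have hp := H.coord_net s p
      ext k
      fin_cases k
      · change (H.net s).coord p 0 = _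
        rw [hp]
        simp [R, u, v, projAlong, Matrix.vecHead, Matrix.vecTail]
        ring
      · change (H.net s).coord p 1 = _
        rw [hp]
        simp [R, u, v, projAlong, Matrix.vecHead, Matrix.vecTail]
        ring
      · change (H.net s).coord p 2 = _
        rw [hp]
        simp [R, u, v, projAlong, Matrix.vecHead, Matrix.vecTail]
        ring
      · change F.coord p 3 = _
        simp [R, u, v, Matrix.vecHead, Matrix.vecTail]
    have hR : ∀ p, R p ≠ 0 := fun p h =>
      D.liftCoord_ne_zero (fun i x => F.curve i x 3) p (by rw [hRD, h]; simp)
    have h1 := ambientIsotopic_shear u (fun V => -V 3) (by fun_prop) (fun t V => by simp)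
      (by simp [u]) (fun V x y hxy => by simpa [u] using hxy) F.coord R F.coord_ne_zero hR
      fun p => rfl
    have h2 := ambientIsotopic_shear v (fun V => s * V 0 + s ^ 2 * V 1) (by fun_prop)
      (fun t V => by simp; ring) (by simp [v]) (fun V x y hxy => by simpa [v] using hxy) R
      (D.liftCoord fun i x => F.curve i x 3) hR (D.liftCoord_ne_zero _) hRD
    exact h1.trans h2

end IsGeneric

end PolygonSystem

theorem IsPolygonalLink.exists_isDiagramOf {P : Set RP3} (hP : IsPolygonalLink P) :
    ∃ D : Diagram, D.IsDiagramOf P := by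
  obtain ⟨F, hF, rfl⟩ := hP
  obtain ⟨κ, c, H⟩ := F.exists_isGeneric
  obtain ⟨s, hv, hm⟩ := H.exists_height_ne_zero hF
  exact ⟨H.diagram s hF hv hm, H.isDiagramOf_diagram s hF hv hm⟩

theorem IsLink.exists_isDiagramOf {L : Set RP3} (hL : IsLink L) : ∃ D : Diagram, D.IsDiagramOf L := by
  obtain ⟨P, hP, hPL⟩ := hL
  obtain ⟨D, z, hz, h⟩ := hP.exists_isDiagramOf
  exact ⟨D, z, hz, h.trans hPL⟩

end ProjLink

end

/-- Every non-empty link in real projective 3-space has a diagram whose all-A ribbon graph has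
exactly one vertex. -/
theorem mainTheorem4 (L : Set ProjLink.RP3) (hL : ProjLink.IsLink L) (hne : L.Nonempty) :
    ∃ D : ProjLink.Diagram, D.IsDiagramOf L ∧ Nat.card D.allA.Vertex = 1 := by
  obtain ⟨D, hD⟩ := hL.exists_isDiagramOf
  exact D.exists_card_vertex_eq_one hne hD
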